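/- Write $\mathbf T=\mathbf R/\mathbf Z$, let $\omega_h$ be $\mathbf T\times\mathbf R$ or $\mathbf T^2$, with points $x_h=(x,y)$ (for $\mathbf T^2$, $y\in(-\frac12,\frac12)$ represents $\mathbf T$), and let $\omega=\omega_h\times(0,1)$. For $u=(u_h,u_3)$ put $u_h^\perp=(-u_2,u_1)$. **Assumptions on the wind stress.** $\sigma=(\sigma_1,\sigma_2)\in H^2(\omega_h)$, and for some constant $|\sigma|,|\partial_x\sigma|\le \mathrm{const}\cdot y^2$, $|\partial_y\sigma|\le \mathrm{const}\cdot|y|$ on $\omega_h$, and $\int_{\mathbf T}\sigma_1(x,y)\,dx=0$ for all $y$. If $\omega_h=\mathbf T\times\mathbf R$, moreover $\sigma\in W^{2,\infty}(\omega_h)$. If $\omega_h=\mathbf T^2$, moreover $\sigma=0$ for $|y|>\frac12-d$, for some $d>0$. **Assumptions on the Coriolis factor** $b=b(y)$. If $\omega_h=\mathbf T\times\mathbf R$: $b$ is $C^1$ with $b''\in L^\infty(\mathbf R)$; $b(y)\neq0$ for $y\ne0$; $|b|$ is bounded below by a positive constant on $\{|y|\ge1\}$; $c^{-1}\le b'\le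 c$ on $\mathbf R$ for some $c>0$; $b(y)\sim\beta y$ as $y\to0$ for some $\beta>0$. If $\omega_h=\mathbf T^2$: $b$ is bounded and measurable; for every $a\in(0,\frac12)$, $b\in W^{2,\infty}(-a,a)$ and $c_a^{-1}\le b'\le c_a$ on $[-a,a]$ for some $c_a>0$; $b(y)\ne0$ for $y\neq0$; $|b|$ is bounded below by a positive constant on $\{|y|\ge\frac14\}$; $b(y)\sim\beta y$ as $y\to0$ for some $\beta>0$ ($b$ may jump at $y=\frac12$). **Conclusion.** There is a constant $C$, depending only on $b$ (on $b$ and $d$ if $\omega_h=\mathbf T^2$), with the following property. For every such $\sigma$ and all horizontal viscosities $\nu_h=\nu_h(\varepsilon)>0$ with $\nu_h=o(\varepsilon)$ as $\varepsilon\to0^+$, there are, for all small $\varepsilon>0$, fields $u^{BL},u^{int}\in H^1(\omega)^3$ and a pressure $p^{stat}\in H^1(\omega)$ such that $u^{stat}=u^{BL}+u^{int}$ is divergence free, satisfies the boundary conditions $$\partial_zu^{stat}_h=0,\ u_3^{stat}=0\ \text{ at } z=0,\qquad \partial_zu_h^{stat}=\varepsilon^{-2}\sigma,\ u_3^{stat}=0\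 \text{ at } z=1$$ in the sense of $L^2(\omega_h)$ traces (the trace of $g$ at $z=1$ is $s$ if $\frac1h\int_{1-h}^1\|g(\cdot,z)-s\|_{L^2(\omega_h)}^2dz\to0$ as $h\to0^+$, and similarly at $z=0$), and satisfies in the sense of distributions on $\omega$ (this is the rescaled rotating-fluid system with $\eta=\nu_z=\varepsilon$, $\gamma=\varepsilon^{-2}$) $$\tfrac1\varepsilon b\,(u_h^{stat})^\perp+\nabla_hp^{stat}-\varepsilon\partial_{zz}u_h^{stat}-\nu_h\Delta_hu_h^{stat}=r_h^1+r_h^2,$$ $$\tfrac1{\varepsilon^2}\partial_zp^{stat}-\varepsilon\partial_{zz}u_3^{stat}-\nu_h\Delta_hu_3^{stat}=r_3^1+r_3^2,$$ where, as $\varepsilon\to0$, $r_h^1=o(1)$ and $r_3^1=o(\varepsilon^{-1})$ in $L^2(\omega)$, and $r_h^2=o(\sqrt{\nu_h})$ and $r_3^2=o(\varepsilon^{-1}\sqrt{\nu_h})$ in $L^2([0,1],H^{-1}(\omega_h))$. The term $u^{BL}$ is located in a boundary layer of size $\varepsilon$ near $z=1$: for every $\kappa>0$ there is $M$ such that for all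 small $\varepsilon$ its restriction to $\{z<1-M\varepsilon\}$ satisfies $\|u_h^{BL}\|_{L^2}\le\kappa\varepsilon^{-1/2}$ and $\|u_3^{BL}\|_{L^2}\le\kappa\varepsilon^{1/2}$. The term $u^{int}$ is interior: for every $M$, $\|u^{int}\|_{L^2(\{z>1-M\varepsilon\})}\to0$ as $\varepsilon\to0$. Finally, for all small $\varepsilon$ (how small may depend on $\sigma$ and $\nu_h$), $$\|u^{int}\|_{L^2(\omega)}\le C\|\sigma\|_{H^2(\omega_h)},\qquad \|u_h^{BL}\|_{L^2(\omega)}\le \frac{C}{\sqrt\varepsilon}\|\sigma\|_{H^1(\omega_h)},\qquad \|u_3^{BL}\|_{L^2(\omega)}\le C\|\sigma\|_{H^1(\omega_h)}.$$ -/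

import Mathlib

open MeasureTheory Filter Topology Asymptotics
open scoped NNReal ENNReal ContDiff

/-- Points `(x, y)` of the (unrolled) horizontal domain. -/
abbrev HPt : Type := ℝ × ℝ

/-- Points `(x, y, z)` of the (unrolled) fluid domain. -/
abbrev Pt : Type := ℝ × ℝ × ℝ

/-- The two horizontal domains, with `𝕋 = ℝ / ℤ`: the channel `𝕋 × ℝ` and the torus `𝕋 × 𝕋`. -/
inductive HDom : Type
  | channel
  | torus

/-- Range of the latitude `y`: the line, or the fundamental interval `(-1/2, 1/2)` of `𝕋`. -/
def HDom.yRange : HDom → Set ℝ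
  | .channel => Set.univ
  | .torus => Set.Ioo (-(1 / 2)) (1 / 2)

/-- Fundamental domain of `ω_h`. Functions on `ω_h` are represented by their restriction to it
(up to null sets); periodicity is expressed by the periodic test functions below. -/
def HDom.hBox (D : HDom) : Set HPt := {q | q.1 ∈ Set.Ioo (0 : ℝ) 1 ∧ q.2 ∈ D.yRange}

/-- Fundamental domain of `ω = ω_h × (0, 1)`. -/
def HDom.box (D : HDom) : Set Pt :=
  {p | p.1 ∈ Set.Ioo (0 : ℝ) 1 ∧ p.2.1 ∈ D.yRange ∧ p.2.2 ∈ Set.Ioo (0 : ℝ) 1}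

/-- Lebesgue measure on `ω_h`. -/
noncomputable def HDom.hVol (D : HDom) : Measure HPt := volume.restrict D.hBox

/-- Lebesgue measure on `ω`. -/
noncomputable def HDom.vol (D : HDom) : Measure Pt := volume.restrict D.box

/-- Lebesgue measure on the part of `ω` where `z` belongs to `S`. -/
noncomputable def HDom.volSlab (D : HDom) (S : Set ℝ) : Measure Pt :=
  volume.restrict {p | p ∈ D.box ∧ p.2.2 ∈ S}

/-- The coordinate directions `x, y` of the horizontal domain. -/
def hDir : Fin 2 → HPt := ![(1, 0), (0, 1)]

/-- The coordinate directions `x, y, z`. -/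
def dir : Fin 3 → Pt := ![(1, 0, 0), (0, 1, 0), (0, 0, 1)]

/-- Classical partial derivative in the direction `v` (used on smooth functions only). -/
noncomputable def pd {E : Type*} [NormedAddCommGroup E] [NormedSpace ℝ E] (v : E) (φ : E → ℝ) :
    E → ℝ :=
  fun p => fderiv ℝ φ p v

/-- Test functions on `ω_h`: the elements of `C_c^∞(ω_h)`, as periodic functions of the
unrolled variables. -/
structure IsHTest (D : HDom) (φ : HPt → ℝ) : Prop where
  smooth : ContDiff ℝ ∞ φ
  periodic_x : ∀ x y, φ (x + 1, y) = φ (x, y)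
  lateral : match D with
    | .channel => ∃ R : ℝ, ∀ x y, R < |y| → φ (x, y) = 0
    | .torus => ∀ x y, φ (x, y + 1) = φ (x, y)

/-- Test functions on `ω`: the elements of `C_c^∞(ω)`, as periodic functions of the
unrolled variables. -/
structure IsTest (D : HDom) (φ : Pt → ℝ) : Prop where
  smooth : ContDiff ℝ ∞ φ
  periodic_x : ∀ x y z, φ (x + 1, y, z) = φ (x, y, z)
  lateral : match D with
    | .channel => ∃ R : ℝ, ∀ x y z, R < |y| → φ (x, y, z) = 0
    | .torus => ∀ x y z, φ (x, y + 1, z) = φ (x, y, z)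
  vertical : ∃ a : ℝ, 0 < a ∧ ∀ x y z, (z < a ∨ 1 - a < z) → φ (x, y, z) = 0

/-- The vector space `C_c^∞(ω)`. -/
def testSpace (D : HDom) : Submodule ℝ (Pt → ℝ) where
  carrier := {φ | IsTest D φ}
  zero_mem' := by
    refine ⟨contDiff_const, fun _ _ _ => rfl, ?_, ⟨1, one_pos, fun _ _ _ _ => rfl⟩⟩
    cases D
    · exact ⟨0, fun _ _ _ _ => rfl⟩
    · exact fun _ _ _ => rfl
  add_mem' := by
    rintro f g ⟨hf, hfx, hfl, a, ha, hfa⟩ ⟨hg, hgx, hgl, b, hb, hgb⟩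
    refine ⟨hf.add hg, fun x y z => by simp [hfx, hgx], ?_, min a b, lt_min ha hb, ?_⟩
    · cases D
      · obtain ⟨R, hR⟩ := hfl
        obtain ⟨S, hS⟩ := hgl
        refine ⟨max R S, fun x y z h => ?_⟩
        simp [hR x y z (lt_of_le_of_lt (le_max_left _ _) h),
          hS x y z (lt_of_le_of_lt (le_max_right _ _) h)]
      · intro x y z
        have h1 := hfl x y z
        have h2 := hgl x y z
        simp [h1, h2]
    · intro x y z h
      have h1 : f (x, y, z) = 0 := hfa x y z (h.imp (fun h => lt_of_lt_of_le h (min_le_left _ _))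
        (fun h => by linarith [min_le_left a b]))
      have h2 : g (x, y, z) = 0 := hgb x y z (h.imp (fun h => lt_of_lt_of_le h (min_le_right _ _))
        (fun h => by linarith [min_le_right a b]))
      simp [h1, h2]
  smul_mem' := by
    rintro c f ⟨hf, hfx, hfl, a, ha, hfa⟩
    refine ⟨hf.const_smul c, fun x y z => by simp [hfx], ?_, a, ha, fun x y z h => ?_⟩
    · cases D
      · obtain ⟨R, hR⟩ := hfl
        exact ⟨R, fun x y z h => by simp [hR x y z h]⟩
      · intro x y z
        have h1 := hfl x y z
        simp [h1]
    · simp [hfa x y z h]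

/-- `g` is the weak derivative of `f` on `ω_h` in the `k`-th horizontal direction. -/
def IsHWeakDeriv (D : HDom) (k : Fin 2) (f g : HPt → ℝ) : Prop :=
  ∀ φ : HPt → ℝ, IsHTest D φ →
    ∫ q, f q * pd (hDir k) φ q ∂D.hVol = -∫ q, g q * φ q ∂D.hVol

/-- `g` is the weak derivative of `f` on `ω` in the `k`-th direction. -/
def IsWeakDeriv (D : HDom) (k : Fin 3) (f g : Pt → ℝ) : Prop :=
  ∀ φ ∈ testSpace D, ∫ p, f p * pd (dir k) φ p ∂D.vol = -∫ p, g p * φ p ∂D.vol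

/-- `f ∈ H²(ω_h)`, with first weak derivatives `df k = ∂_k f` and second weak derivatives
`ddf k l = ∂_l ∂_k f` (they are unique up to null sets). -/
structure IsH2 (D : HDom) (f : HPt → ℝ) (df : Fin 2 → HPt → ℝ)
    (ddf : Fin 2 → Fin 2 → HPt → ℝ) : Prop where
  memLp : MemLp f 2 D.hVol
  memLp_d : ∀ k, MemLp (df k) 2 D.hVol
  memLp_dd : ∀ k l, MemLp (ddf k l) 2 D.hVol
  weak_d : ∀ k, IsHWeakDeriv D k f (df k)
  weak_dd : ∀ k l, IsHWeakDeriv D l (df k) (ddf k l)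

/-- `f ∈ H¹(ω)`. -/
def MemH1 (D : HDom) (f : Pt → ℝ) : Prop :=
  MemLp f 2 D.vol ∧ ∀ k, ∃ g : Pt → ℝ, MemLp g 2 D.vol ∧ IsWeakDeriv D k f g

/-- `L²` norm of a vector field, given by its finite family of components. -/
noncomputable def l2norm {E ι : Type*} [MeasurableSpace E] [Fintype ι] (μ : Measure E)
    (f : ι → E → ℝ) : ℝ≥0∞ :=
  (∑ i, eLpNorm (f i) 2 μ ^ 2) ^ (1 / 2 : ℝ)

/-- `‖σ‖_{H¹(ω_h)}`. -/
noncomputable def normH1 (D : HDom) (σ : Fin 2 → HPt → ℝ) (dσ : Fin 2 → Fin 2 → HPt → ℝ) :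
    ℝ≥0∞ :=
  (∑ i, eLpNorm (σ i) 2 D.hVol ^ 2 + ∑ i, ∑ k, eLpNorm (dσ i k) 2 D.hVol ^ 2) ^ (1 / 2 : ℝ)

/-- `‖σ‖_{H²(ω_h)}`. -/
noncomputable def normH2 (D : HDom) (σ : Fin 2 → HPt → ℝ) (dσ : Fin 2 → Fin 2 → HPt → ℝ)
    (ddσ : Fin 2 → Fin 2 → Fin 2 → HPt → ℝ) : ℝ≥0∞ :=
  (∑ i, eLpNorm (σ i) 2 D.hVol ^ 2 + ∑ i, ∑ k, eLpNorm (dσ i k) 2 D.hVol ^ 2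
    + ∑ i, ∑ k, ∑ l, eLpNorm (ddσ i k l) 2 D.hVol ^ 2) ^ (1 / 2 : ℝ)

/-- Norm of `φ` in `L²([0,1], H¹(ω_h))`. -/
noncomputable def normL2H1 (D : HDom) (φ : Pt → ℝ) : ℝ≥0∞ :=
  l2norm D.vol ![φ, pd (dir 0) φ, pd (dir 1) φ]

/-- Norm of a distribution on `ω` in `L²([0,1], H⁻¹(ω_h))`, the dual of `L²([0,1], H¹(ω_h))`, in
which the test functions are dense (the value is `∞` if the distribution is not in that space). -/
noncomputable def normL2HNeg1 (D : HDom) (T : testSpace D →ₗ[ℝ] ℝ) : ℝ≥0∞ :=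
  ⨆ φ : testSpace D, ENNReal.ofReal |T φ| / normL2H1 D (φ : Pt → ℝ)

/-- The trace of `g` on the surface `z = 1` exists in `L²` and equals `s`:
`h⁻¹ ∫_{1-h}^1 ‖g(·, z) - s‖²_{L²(ω_h)} dz → 0` as `h → 0⁺`. -/
def HasTraceTop (D : HDom) (g : Pt → ℝ) (s : HPt → ℝ) : Prop :=
  Tendsto (fun h : ℝ => ENNReal.ofReal h⁻¹ *
      ∫⁻ p, ‖g p - s (p.1, p.2.1)‖ₑ ^ 2 ∂D.volSlab (Set.Ioo (1 - h) 1))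
    (𝓝[>] 0) (𝓝 0)

/-- The trace of `g` on the bottom `z = 0` exists in `L²` and equals `s`. -/
def HasTraceBottom (D : HDom) (g : Pt → ℝ) (s : HPt → ℝ) : Prop :=
  Tendsto (fun h : ℝ => ENNReal.ofReal h⁻¹ *
      ∫⁻ p, ‖g p - s (p.1, p.2.1)‖ₑ ^ 2 ∂D.volSlab (Set.Ioo 0 h))
    (𝓝[>] 0) (𝓝 0)

/-- `div u = 0` in the sense of distributions. -/
def IsDivFree (D : HDom) (u : Fin 3 → Pt → ℝ) : Prop :=
  ∀ φ ∈ testSpace D, ∫ p, ∑ j, u j p * pd (dir j) φ p ∂D.vol = 0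

/-- Bottom and surface conditions: `∂_z u_h = 0`, `u_3 = 0` at `z = 0`, and
`∂_z u_h = γ σ`, `u_3 = 0` at `z = 1`. -/
structure BoundaryConditions (D : HDom) (γ : ℝ) (σ : Fin 2 → HPt → ℝ)
    (u : Fin 3 → Pt → ℝ) : Prop where
  horizontal : ∀ i : Fin 2, ∃ g : Pt → ℝ, MemLp g 2 D.vol ∧ IsWeakDeriv D 2 (u i.castSucc) g ∧
    HasTraceBottom D g 0 ∧ HasTraceTop D g (fun q => γ * σ i q)
  vertical_bottom : HasTraceBottom D (u 2) 0
  vertical_top : HasTraceTop D (u 2) 0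

/-- The field `e₃ ∧ u = (-u₂, u₁, 0)`. -/
def rot3 (u : Fin 3 → Pt → ℝ) : Fin 3 → Pt → ℝ := ![-(u 1), u 0, 0]

/-- The stationary rescaled rotating fluid equations with source `r¹ + r²`,
`ε⁻¹ b(y) e₃ ∧ u + (∇_h p, η⁻² ∂_z p) - ν_h Δ_h u - ν_z ∂_zz u = r¹ + r²`,
in the sense of distributions; `r¹` is a function and `r²` a distribution. -/
def IsStationarySolution (D : HDom) (ε η νh νz : ℝ) (b : ℝ → ℝ) (u : Fin 3 → Pt → ℝ)
    (p : Pt → ℝ) (r₁ : Fin 3 → Pt → ℝ) (r₂ : Fin 3 → testSpace D →ₗ[ℝ] ℝ) : Prop :=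
  ∀ i : Fin 3, ∀ φ : testSpace D,
    ∫ q, (1 / ε * b q.2.1 * rot3 u i q * (φ : Pt → ℝ) q
      - (![1, 1, 1 / η ^ 2] : Fin 3 → ℝ) i * p q * pd (dir i) (φ : Pt → ℝ) q
      - νh * u i q * (pd (dir 0) (pd (dir 0) (φ : Pt → ℝ)) q
          + pd (dir 1) (pd (dir 1) (φ : Pt → ℝ)) q)
      - νz * u i q * pd (dir 2) (pd (dir 2) (φ : Pt → ℝ)) q) ∂D.vol
    = ∫ q, r₁ i q * (φ : Pt → ℝ) q ∂D.vol + r₂ i φ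

/-- The wind stress: `σ ∈ H²(ω_h)` (with its derivatives), vanishing quadratically at `y = 0`,
with zero zonal mean of its first component. -/
structure IsWindStress (D : HDom) (σ : Fin 2 → HPt → ℝ) (dσ : Fin 2 → Fin 2 → HPt → ℝ)
    (ddσ : Fin 2 → Fin 2 → Fin 2 → HPt → ℝ) : Prop where
  isH2 : ∀ i, IsH2 D (σ i) (dσ i) (ddσ i)
  quadratic : ∃ C : ℝ, ∀ i, ∀ᵐ q ∂D.hVol,
    |σ i q| ≤ C * q.2 ^ 2 ∧ |dσ i 0 q| ≤ C * q.2 ^ 2 ∧ |dσ i 1 q| ≤ C * |q.2|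
  zonal_mean : ∀ᵐ y ∂(volume.restrict D.yRange), ∫ x in Set.Ioo (0 : ℝ) 1, σ 0 (x, y) = 0

/-- `σ ∈ W^{2,∞}(ω_h)`. -/
def IsW2Infty (D : HDom) (σ : Fin 2 → HPt → ℝ) (dσ : Fin 2 → Fin 2 → HPt → ℝ)
    (ddσ : Fin 2 → Fin 2 → Fin 2 → HPt → ℝ) : Prop :=
  ∀ i, MemLp (σ i) ∞ D.hVol ∧ (∀ k, MemLp (dσ i k) ∞ D.hVol) ∧
    ∀ k l, MemLp (ddσ i k l) ∞ D.hVol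

/-- Coriolis factors on `𝕋 × ℝ`: `b` has a bounded second derivative (that is, `b'` is Lipschitz),
`b ≠ 0` away from `y = 0` and uniformly so for `|y| ≥ 1`, `c⁻¹ ≤ b' ≤ c`, `b(y) ~ β y`. -/
structure IsCoriolisChannel (b : ℝ → ℝ) : Prop where
  differentiable : Differentiable ℝ b
  lipschitz_deriv : ∃ L : ℝ≥0, LipschitzWith L (deriv b)
  ne_zero : ∀ y, y ≠ 0 → b y ≠ 0
  away : ∃ C : ℝ, 0 < C ∧ ∀ y, 1 ≤ |y| → C ≤ |b y|
  deriv_bounds : ∃ c : ℝ, 0 < c ∧ ∀ y, c⁻¹ ≤ deriv b y ∧ deriv b y ≤ c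
  equivalent : ∃ β : ℝ, 0 < β ∧ b ~[𝓝 0] fun y => β * y

/-- Coriolis factors on `𝕋 × 𝕋`, given on `(-1/2, 1/2)`: as on the channel, but the bounds on the
first two derivatives hold on compact sets that stay away from `y = ±1/2`, where `b` may be
discontinuous. -/
structure IsCoriolisTorus (b : ℝ → ℝ) : Prop where
  measurable : Measurable b
  bounded : ∃ B : ℝ, ∀ y ∈ Set.Ioo (-(1 / 2) : ℝ) (1 / 2), |b y| ≤ B
  differentiable : DifferentiableOn ℝ b (Set.Ioo (-(1 / 2)) (1 / 2))
  lipschitz_deriv : ∀ a ∈ Set.Ioo (0 : ℝ) (1 / 2), ∃ L : ℝ≥0,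
    LipschitzOnWith L (deriv b) (Set.Icc (-a) a)
  ne_zero : ∀ y ∈ Set.Ioo (-(1 / 2) : ℝ) (1 / 2), y ≠ 0 → b y ≠ 0
  away : ∃ C : ℝ, 0 < C ∧ ∀ y ∈ Set.Ioo (-(1 / 2) : ℝ) (1 / 2), 1 / 4 ≤ |y| → C ≤ |b y|
  deriv_bounds : ∀ a ∈ Set.Ioo (0 : ℝ) (1 / 2), ∃ c : ℝ, 0 < c ∧
    ∀ y ∈ Set.Icc (-a) a, c⁻¹ ≤ deriv b y ∧ deriv b y ≤ c
  equivalent : ∃ β : ℝ, 0 < β ∧ b ~[𝓝 0] fun y => β * y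

/-- A family `u^BL` (indexed by `ε → 0`) located in a layer of size `ε` below `z = 1`, with
horizontal amplitude of order `ε⁻¹` and vertical amplitude of order `1`: the rescaled profiles
`ε U_h` and `U_3`, `U(x_h, ζ) = u^BL(x_h, 1 - ε ζ)`, have a uniformly small `L²` norm on
`{ζ > M}` when `M` is large. In the variable `z`, `L²` norms are multiplied by `√ε`. -/
def IsSurfaceLayer (D : HDom) (uBL : ℝ → Fin 3 → Pt → ℝ) : Prop :=
  ∀ κ : ℝ, 0 < κ → ∃ M : ℝ, ∀ᶠ ε : ℝ in 𝓝[>] 0,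
    l2norm (D.volSlab (Set.Iio (1 - M * ε))) ![uBL ε 0, uBL ε 1] ≤ ENNReal.ofReal (κ / √ε) ∧
    eLpNorm (uBL ε 2) 2 (D.volSlab (Set.Iio (1 - M * ε))) ≤ ENNReal.ofReal (κ * √ε)

/-- A family `u^int` (indexed by `ε → 0`) without boundary layer of size `ε` at the surface. -/
def IsInterior (D : HDom) (uint : ℝ → Fin 3 → Pt → ℝ) : Prop :=
  ∀ M : ℝ, Tendsto (fun ε : ℝ => l2norm (D.volSlab (Set.Ioi (1 - M * ε))) (uint ε))
    (𝓝[>] 0) (𝓝 0)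

/-- `u^stat = u^BL + u^int`, with pressure `p`, is a family of approximate stationary solutions
(with `η = ν_z = ε`, `γ = ε⁻²`) with remainders `r¹`, `r²` of the prescribed sizes, and `u^BL`,
`u^int` satisfy the stated estimates with the constant `C`. -/
structure IsApproxStationary (D : HDom) (b : ℝ → ℝ) (σ : Fin 2 → HPt → ℝ)
    (dσ : Fin 2 → Fin 2 → HPt → ℝ) (ddσ : Fin 2 → Fin 2 → Fin 2 → HPt → ℝ) (νh : ℝ → ℝ) (C : ℝ≥0)
    (uBL uint : ℝ → Fin 3 → Pt → ℝ) (p : ℝ → Pt → ℝ) (r₁ : ℝ → Fin 3 → Pt → ℝ)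
    (r₂ : ℝ → Fin 3 → testSpace D →ₗ[ℝ] ℝ) : Prop where
  memH1 : ∀ᶠ ε : ℝ in 𝓝[>] 0,
    (∀ i, MemH1 D (uBL ε i)) ∧ (∀ i, MemH1 D (uint ε i)) ∧ MemH1 D (p ε)
  divFree : ∀ᶠ ε : ℝ in 𝓝[>] 0, IsDivFree D (uBL ε + uint ε)
  boundary : ∀ᶠ ε : ℝ in 𝓝[>] 0, BoundaryConditions D (1 / ε ^ 2) σ (uBL ε + uint ε)
  equation : ∀ᶠ ε : ℝ in 𝓝[>] 0,
    IsStationarySolution D ε ε (νh ε) ε b (uBL ε + uint ε) (p ε) (r₁ ε) (r₂ ε)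
  memL2_r₁ : ∀ᶠ ε : ℝ in 𝓝[>] 0, ∀ i, MemLp (r₁ ε i) 2 D.vol
  small_r₁_h : Tendsto (fun ε => l2norm D.vol ![r₁ ε 0, r₁ ε 1]) (𝓝[>] 0) (𝓝 0)
  small_r₁_3 : Tendsto (fun ε => ENNReal.ofReal ε * eLpNorm (r₁ ε 2) 2 D.vol) (𝓝[>] 0) (𝓝 0)
  small_r₂_h : ∀ i : Fin 2, Tendsto
    (fun ε => ENNReal.ofReal (1 / √(νh ε)) * normL2HNeg1 D (r₂ ε i.castSucc)) (𝓝[>] 0) (𝓝 0)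
  small_r₂_3 : Tendsto
    (fun ε => ENNReal.ofReal (ε / √(νh ε)) * normL2HNeg1 D (r₂ ε 2)) (𝓝[>] 0) (𝓝 0)
  layer : IsSurfaceLayer D uBL
  interior : IsInterior D uint
  bound_int : ∀ᶠ ε : ℝ in 𝓝[>] 0, l2norm D.vol (uint ε) ≤ C * normH2 D σ dσ ddσ
  bound_BL_h : ∀ᶠ ε : ℝ in 𝓝[>] 0,
    l2norm D.vol ![uBL ε 0, uBL ε 1] ≤ ENNReal.ofReal (C / √ε) * normH1 D σ dσ
  bound_BL_3 : ∀ᶠ ε : ℝ in 𝓝[>] 0, eLpNorm (uBL ε 2) 2 D.vol ≤ C * normH1 D σ dσ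

open Set (Ioo Icc Ioi Iio Ioc univ indicator Ioo_subset_Icc_self indicator_of_mem indicator_of_notMem)
open ENNReal (ofReal ofReal_mul ofReal_le_ofReal ofReal_pow ofReal_add)
open Complex (I sinh cosh norm_I)
open Real (sqrt_nonneg)

noncomputable section

/-- Lebesgue measure on the horizontal channel. -/
local notation "hΩ" => HDom.channel.hVol
/-- Lebesgue measure on the channel. -/
local notation "vΩ" => HDom.channel.vol
local notation "𝕀" => Set.Ioo (0 : ℝ) 1
/-- Horizontal vector fields, and the families of their first and second derivatives. -/
local notation "VF₁" => Fin 2 → HPt → ℝ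
local notation "VF₂" => Fin 2 → Fin 2 → HPt → ℝ
local notation "VF₃" => Fin 2 → Fin 2 → Fin 2 → HPt → ℝ
/-- Velocity fields on the fluid domain, and the families of their derivatives. -/
local notation "UF₁" => Fin 3 → Pt → ℝ
local notation "UF₂" => Fin 3 → Fin 3 → Pt → ℝ

/-! ### Directional derivatives -/

lemma hasDerivAt_pd_zero {φ : Pt → ℝ} (hφ : Differentiable ℝ φ) (x y z : ℝ) :
    HasDerivAt (fun t => φ (t, y, z)) (pd (dir 0) φ (x, y, z)) x := by
  have h1 : HasDerivAt (fun t : ℝ => ((t, y, z) : Pt)) (1, 0, 0) x :=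
    (hasDerivAt_id x).prodMk (hasDerivAt_const x (y, z))
  exact (hφ (x, y, z)).hasFDerivAt.comp_hasDerivAt x h1

lemma hasDerivAt_pd_one {φ : Pt → ℝ} (hφ : Differentiable ℝ φ) (x y z : ℝ) :
    HasDerivAt (fun t => φ (x, t, z)) (pd (dir 1) φ (x, y, z)) y := by
  have h1 : HasDerivAt (fun t : ℝ => ((x, t, z) : Pt)) (0, 1, 0) y :=
    (hasDerivAt_const y x).prodMk ((hasDerivAt_id y).prodMk (hasDerivAt_const y z))
  exact (hφ (x, y, z)).hasFDerivAt.comp_hasDerivAt y h1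

lemma hasDerivAt_pd_two {φ : Pt → ℝ} (hφ : Differentiable ℝ φ) (x y z : ℝ) :
    HasDerivAt (fun t => φ (x, y, t)) (pd (dir 2) φ (x, y, z)) z := by
  have h1 : HasDerivAt (fun t : ℝ => ((x, y, t) : Pt)) (0, 0, 1) z :=
    (hasDerivAt_const z x).prodMk ((hasDerivAt_const z y).prodMk (hasDerivAt_id z))
  exact (hφ (x, y, z)).hasFDerivAt.comp_hasDerivAt z h1

lemma hasDerivAt_hpd_zero {φ : HPt → ℝ} (hφ : Differentiable ℝ φ) (x y : ℝ) :
    HasDerivAt (fun t => φ (t, y)) (pd (hDir 0) φ (x, y)) x := by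
  have h1 : HasDerivAt (fun t : ℝ => ((t, y) : HPt)) (1, 0) x :=
    (hasDerivAt_id x).prodMk (hasDerivAt_const x y)
  exact (hφ (x, y)).hasFDerivAt.comp_hasDerivAt x h1

lemma hasDerivAt_hpd_one {φ : HPt → ℝ} (hφ : Differentiable ℝ φ) (x y : ℝ) :
    HasDerivAt (fun t => φ (x, t)) (pd (hDir 1) φ (x, y)) y := by
  have h1 : HasDerivAt (fun t : ℝ => ((x, t) : HPt)) (0, 1) y :=
    (hasDerivAt_const y x).prodMk (hasDerivAt_id y)
  exact (hφ (x, y)).hasFDerivAt.comp_hasDerivAt y h1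

lemma contDiff_pd {E : Type*} [NormedAddCommGroup E] [NormedSpace ℝ E] {φ : E → ℝ}
    (hφ : ContDiff ℝ ∞ φ) (v : E) : ContDiff ℝ ∞ (pd v φ) := by
  unfold pd
  exact (hφ.fderiv_right (m := ∞) (by simp)).clm_apply contDiff_const

lemma pd_comm {E : Type*} [NormedAddCommGroup E] [NormedSpace ℝ E] {φ : E → ℝ}
    (hφ : ContDiff ℝ ∞ φ) (v w : E) : pd v (pd w φ) = pd w (pd v φ) := by
  funext p
  have hd : DifferentiableAt ℝ (fderiv ℝ φ) p :=
    ((hφ.fderiv_right (m := ∞) (by simp)).differentiable (by simp)) p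
  have hs : IsSymmSndFDerivAt ℝ φ p :=
    (hφ.contDiffAt).isSymmSndFDerivAt (by
      simp only [minSmoothness_of_isRCLikeNormedField]
      exact ENat.LEInfty.out)
  have h : ∀ a b : E, pd a (pd b φ) p = fderiv ℝ (fderiv ℝ φ) p a b := by
    intro a b
    unfold pd
    rw [fderiv_clm_apply hd (differentiableAt_const b)]
    simp
  rw [h, h]
  exact hs v w

/-! ### Test functions -/

lemma IsTest.pd {D : HDom} {φ : Pt → ℝ} (h : IsTest D φ) (k : Fin 3) :
    IsTest D (pd (dir k) φ) := by
  have tr : ∀ a : Pt, (∀ p, φ (p + a) = φ p) → ∀ p, _root_.pd (dir k) φ (p + a) =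
      _root_.pd (dir k) φ p := by
    intro a ha p
    unfold _root_.pd
    have : (fun q => φ (q + a)) = φ := funext ha
    rw [← fderiv_comp_add_right, this]
  have loc : ∀ U : Set Pt, IsOpen U → (∀ p ∈ U, φ p = 0) → ∀ p ∈ U,
      _root_.pd (dir k) φ p = 0 := by
    intro U hU h0 p hp
    unfold _root_.pd
    have : φ =ᶠ[𝓝 p] fun _ => 0 := by
      filter_upwards [hU.mem_nhds hp] with q hq using h0 q hq
    rw [this.fderiv_eq]; simp
  refine ⟨contDiff_pd h.smooth _, fun x y z => ?_, ?_, ?_⟩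
  · simpa using tr (1, 0, 0) (fun p => by
        have := h.periodic_x p.1 p.2.1 p.2.2
        rwa [show p + (1, 0, 0) = (p.1 + 1, p.2.1, p.2.2) by ext <;> simp]) (x, y, z)
  · have := h.lateral
    cases D
    · obtain ⟨R, hR⟩ := this
      refine ⟨R, fun x y z hy => loc {p | R < |p.2.1|} ?_ (fun p hp => hR p.1 p.2.1 p.2.2 hp) _ hy⟩
      exact isOpen_lt continuous_const (by fun_prop)
    · intro x y z
      simpa using tr (0, 1, 0) (fun p => by
        have := this p.1 p.2.1 p.2.2
        rwa [show p + (0, 1, 0) = (p.1, p.2.1 + 1, p.2.2) by ext <;> simp]) (x, y, z)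
  · obtain ⟨a, ha, h0⟩ := h.vertical
    refine ⟨a, ha, fun x y z hz => loc {p | p.2.2 < a ∨ 1 - a < p.2.2} ?_
      (fun p hp => h0 p.1 p.2.1 p.2.2 hp) _ hz⟩
    have hc : Continuous fun p : Pt => p.2.2 := by fun_prop
    exact (isOpen_lt hc continuous_const).union (isOpen_lt continuous_const hc)

lemma IsHTest.pd {D : HDom} {φ : HPt → ℝ} (h : IsHTest D φ) (k : Fin 2) :
    IsHTest D (pd (hDir k) φ) := by
  have tr : ∀ a : HPt, (∀ p, φ (p + a) = φ p) → ∀ p, _root_.pd (hDir k) φ (p + a) =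
      _root_.pd (hDir k) φ p := by
    intro a ha p
    unfold _root_.pd
    have : (fun q => φ (q + a)) = φ := funext ha
    rw [← fderiv_comp_add_right, this]
  have loc : ∀ U : Set HPt, IsOpen U → (∀ p ∈ U, φ p = 0) → ∀ p ∈ U,
      _root_.pd (hDir k) φ p = 0 := by
    intro U hU h0 p hp
    unfold _root_.pd
    have : φ =ᶠ[𝓝 p] fun _ => 0 := by
      filter_upwards [hU.mem_nhds hp] with q hq using h0 q hq
    rw [this.fderiv_eq]; simp
  refine ⟨contDiff_pd h.smooth _, fun x y => ?_, ?_⟩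
  · simpa using tr (1, 0) (fun p => by
        have := h.periodic_x p.1 p.2
        rwa [show p + (1, 0) = (p.1 + 1, p.2) by ext <;> simp]) (x, y)
  · have := h.lateral
    cases D
    · obtain ⟨R, hR⟩ := this
      refine ⟨R, fun x y hy => loc {p | R < |p.2|} ?_ (fun p hp => hR p.1 p.2 hp) _ hy⟩
      exact isOpen_lt continuous_const (by fun_prop)
    · intro x y
      simpa using tr (0, 1) (fun p => by
        have := this p.1 p.2
        rwa [show p + (0, 1) = (p.1, p.2 + 1) by ext <;> simp]) (x, y)

lemma IsTest.slice {D : HDom} {φ : Pt → ℝ} (h : IsTest D φ) (z : ℝ) :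
    IsHTest D (fun q => φ (q.1, q.2, z)) := by
  refine ⟨h.smooth.comp (by fun_prop), fun x y => h.periodic_x x y z, ?_⟩
  have := h.lateral
  cases D
  · obtain ⟨R, hR⟩ := this
    exact ⟨R, fun x y hy => hR x y z hy⟩
  · exact fun x y => this x y z

lemma IsTest.differentiable {D : HDom} {φ : Pt → ℝ} (h : IsTest D φ) : Differentiable ℝ φ :=
  h.smooth.differentiable (by simp)

lemma IsHTest.differentiable {D : HDom} {φ : HPt → ℝ} (h : IsHTest D φ) : Differentiable ℝ φ :=
  h.smooth.differentiable (by simp)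

/-- A continuous function with support bounded in the latitude is bounded on the box. -/
lemma IsTest.exists_bound {D : HDom} {φ : Pt → ℝ} (h : IsTest D φ) :
    ∃ R C : ℝ, (∀ p ∈ D.box, R < |p.2.1| → φ p = 0) ∧ ∀ p ∈ D.box, |φ p| ≤ C := by
  have key : ∃ R : ℝ, ∀ p ∈ D.box, R < |p.2.1| → φ p = 0 := by
    have := h.lateral
    cases D
    · obtain ⟨R, hR⟩ := this
      exact ⟨R, fun p _ hp => hR p.1 p.2.1 p.2.2 hp⟩
    · refine ⟨1 / 2, fun p hp hp' => absurd hp' (not_lt.2 ?_)⟩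
      exact abs_le.2 ⟨hp.2.1.1.le, hp.2.1.2.le⟩
  obtain ⟨R, hR⟩ := key
  have hc : IsCompact (Icc (0 : ℝ) 1 ×ˢ Icc (-R) R ×ˢ Icc (0 : ℝ) 1) :=
    isCompact_Icc.prod (isCompact_Icc.prod isCompact_Icc)
  obtain ⟨C, hC⟩ := hc.exists_bound_of_continuousOn h.smooth.continuous.continuousOn
  refine ⟨R, max C 0, hR, fun p hp => ?_⟩
  by_cases hy : |p.2.1| ≤ R
  · refine (hC p ⟨Ioo_subset_Icc_self hp.1, abs_le.1 hy, Ioo_subset_Icc_self hp.2.2⟩).trans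
      (le_max_left _ _)
  · rw [hR p hp (not_le.1 hy)]; simp

/-! ### Product structure of the measures -/

lemma measurableSet_hBox (D : HDom) : MeasurableSet D.hBox := by
  have : MeasurableSet D.yRange := by
    cases D
    · exact MeasurableSet.univ
    · exact measurableSet_Ioo
  exact measurableSet_Ioo.prod this

lemma measurePreserving_slab (A : Set HPt) (B : Set ℝ) :
    MeasurePreserving (MeasurableEquiv.prodAssoc : (ℝ × ℝ) × ℝ ≃ᵐ ℝ × ℝ × ℝ)
      ((volume.restrict A).prod (volume.restrict B))
      (volume.restrict {p : Pt | (p.1, p.2.1) ∈ A ∧ p.2.2 ∈ B}) := by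
  rw [Measure.prod_restrict]
  have h := (volume_preserving_prodAssoc (α₁ := ℝ) (β₁ := ℝ) (γ₁ := ℝ)).restrict_preimage_emb
    MeasurableEquiv.prodAssoc.measurableEmbedding {p : Pt | (p.1, p.2.1) ∈ A ∧ p.2.2 ∈ B}
  exact h

lemma volSlab_eq (D : HDom) (S : Set ℝ) :
    D.volSlab S = volume.restrict
      {p : Pt | (p.1, p.2.1) ∈ D.hBox ∧ p.2.2 ∈ 𝕀 ∩ S} := by
  unfold HDom.volSlab HDom.box HDom.hBox
  congr 1
  ext p
  simp only [Set.mem_ofPred_eq, Set.mem_inter_iff]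
  tauto

lemma vol_eq (D : HDom) :
    D.vol = volume.restrict {p : Pt | (p.1, p.2.1) ∈ D.hBox ∧ p.2.2 ∈ 𝕀} := by
  unfold HDom.vol HDom.box HDom.hBox
  congr 1
  ext p
  simp only [Set.mem_ofPred_eq]
  tauto

lemma measurePreserving_vol (D : HDom) :
    MeasurePreserving (MeasurableEquiv.prodAssoc : (ℝ × ℝ) × ℝ ≃ᵐ ℝ × ℝ × ℝ)
      (D.hVol.prod (volume.restrict 𝕀)) D.vol := by
  rw [vol_eq]; exact measurePreserving_slab _ _

lemma measurePreserving_volSlab (D : HDom) (S : Set ℝ) :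
    MeasurePreserving (MeasurableEquiv.prodAssoc : (ℝ × ℝ) × ℝ ≃ᵐ ℝ × ℝ × ℝ)
      (D.hVol.prod (volume.restrict (𝕀 ∩ S))) (D.volSlab S) := by
  rw [volSlab_eq]; exact measurePreserving_slab _ _

lemma measurableSet_box (D : HDom) : MeasurableSet D.box := by
  have : D.box = (MeasurableEquiv.prodAssoc : (ℝ × ℝ) × ℝ ≃ᵐ ℝ × ℝ × ℝ).symm ⁻¹'
      (D.hBox ×ˢ 𝕀) := by
    ext p
    simp [HDom.box, HDom.hBox, MeasurableEquiv.prodAssoc]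
    tauto
  rw [this]
  exact (MeasurableEquiv.measurable _) ((measurableSet_hBox D).prod measurableSet_Ioo)

instance (D : HDom) : SigmaFinite D.hVol := by unfold HDom.hVol; infer_instance

/-! ### Local integrability -/

/-- Integrability on the parts of `ω` where the latitude is bounded. -/
def LocInt (D : HDom) (F : Pt → ℝ) : Prop :=
  ∀ R : ℝ, IntegrableOn F {p | p ∈ D.box ∧ |p.2.1| ≤ R}

lemma measurableSet_boxR (D : HDom) (R : ℝ) : MeasurableSet {p : Pt | p ∈ D.box ∧ |p.2.1| ≤ R} :=
  by
  have hc : Measurable fun p : Pt => |p.2.1| := by fun_prop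
  exact (measurableSet_box D).inter (measurableSet_le hc measurable_const)

lemma volume_boxR_lt_top (D : HDom) (R : ℝ) : volume {p : Pt | p ∈ D.box ∧ |p.2.1| ≤ R} < ⊤ := by
  refine (measure_mono (t := Icc (0 : ℝ) 1 ×ˢ Icc (-R) R ×ˢ Icc (0 : ℝ) 1) ?_).trans_lt
    (isCompact_Icc.prod (isCompact_Icc.prod isCompact_Icc)).measure_lt_top
  rintro p ⟨hp, hy⟩
  exact ⟨Ioo_subset_Icc_self hp.1, abs_le.1 hy, Ioo_subset_Icc_self hp.2.2⟩

lemma MeasureTheory.MemLp.locInt {D : HDom} {F : Pt → ℝ} (h : MemLp F 2 D.vol) : LocInt D F := by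
  intro R
  have h2 : MemLp F 2 (volume.restrict {p : Pt | p ∈ D.box ∧ |p.2.1| ≤ R}) :=
    h.mono_measure (Measure.restrict_mono (fun p hp => hp.1) le_rfl)
  have : IsFiniteMeasure (volume.restrict {p : Pt | p ∈ D.box ∧ |p.2.1| ≤ R}) :=
    ⟨by simpa using volume_boxR_lt_top D R⟩
  exact h2.integrable (by norm_num)

lemma LocInt.add {D : HDom} {F G : Pt → ℝ} (hF : LocInt D F) (hG : LocInt D G) :
    LocInt D (fun p => F p + G p) := fun R => (hF R).add (hG R)

lemma LocInt.sub {D : HDom} {F G : Pt → ℝ} (hF : LocInt D F) (hG : LocInt D G) :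
    LocInt D (fun p => F p - G p) := fun R => (hF R).sub (hG R)

lemma LocInt.const_mul {D : HDom} {F : Pt → ℝ} (hF : LocInt D F) (c : ℝ) :
    LocInt D (fun p => c * F p) := fun R => (hF R).const_mul c

lemma LocInt.neg {D : HDom} {F : Pt → ℝ} (hF : LocInt D F) :
    LocInt D (fun p => - F p) := fun R => (hF R).neg

lemma LocInt.bdd_mul {D : HDom} {F k : Pt → ℝ} (hF : LocInt D F) (hk : Measurable k)
    (hb : ∀ R : ℝ, ∃ C : ℝ, ∀ p ∈ D.box, |p.2.1| ≤ R → |k p| ≤ C) :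
    LocInt D (fun p => k p * F p) := by
  intro R
  obtain ⟨C, hC⟩ := hb R
  refine Integrable.bdd_mul (c := C) (hF R) hk.aestronglyMeasurable ?_
  filter_upwards [ae_restrict_mem (measurableSet_boxR D R)] with p hp using hC p hp.1 hp.2

lemma LocInt.integrable_mul {D : HDom} {F φ : Pt → ℝ} (hF : LocInt D F) (hφ : IsTest D φ) :
    Integrable (fun p => F p * φ p) D.vol := by
  obtain ⟨R, C, hR, hC⟩ := hφ.exists_bound
  have h1 : IntegrableOn (fun p => F p * φ p) {p | p ∈ D.box ∧ |p.2.1| ≤ R} := by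
    refine Integrable.mul_bdd (c := C) (hF R) hφ.smooth.continuous.aestronglyMeasurable ?_
    filter_upwards [ae_restrict_mem (measurableSet_boxR D R)] with p hp using hC p hp.1
  refine IntegrableOn.of_forall_sdiff_eq_zero h1 (measurableSet_box D) ?_
  rintro p ⟨hp, hp'⟩
  have : R < |p.2.1| := by
    by_contra hlt
    exact hp' ⟨hp, not_lt.1 hlt⟩
  rw [hR p hp this, mul_zero]

lemma IsWeakDeriv.add {D : HDom} {k : Fin 3} {F G F' G' : Pt → ℝ} (hF : LocInt D F)
    (hG : LocInt D G) (hF' : LocInt D F') (hG' : LocInt D G') (h : IsWeakDeriv D k F F')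
    (h' : IsWeakDeriv D k G G') :
    IsWeakDeriv D k (fun p => F p + G p) (fun p => F' p + G' p) := by
  intro φ hφ
  have hφ' : IsTest D φ := hφ
  simp only [add_mul]
  rw [integral_add (hF.integrable_mul (hφ'.pd k)) (hG.integrable_mul (hφ'.pd k)),
    integral_add (hF'.integrable_mul hφ') (hG'.integrable_mul hφ'), h φ hφ, h' φ hφ]
  ring

lemma IsWeakDeriv.const_mul {D : HDom} {k : Fin 3} {F F' : Pt → ℝ} (h : IsWeakDeriv D k F F')
    (c : ℝ) : IsWeakDeriv D k (fun p => c * F p) (fun p => c * F' p) := by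
  intro φ hφ
  simp only [mul_assoc, integral_const_mul]
  rw [h φ hφ]; ring

lemma IsWeakDeriv.sub {D : HDom} {k : Fin 3} {F G F' G' : Pt → ℝ} (hF : LocInt D F)
    (hG : LocInt D G) (hF' : LocInt D F') (hG' : LocInt D G') (h : IsWeakDeriv D k F F')
    (h' : IsWeakDeriv D k G G') :
    IsWeakDeriv D k (fun p => F p - G p) (fun p => F' p - G' p) := by
  have := h.add hF (hG.const_mul (-1)) hF' (hG'.const_mul (-1)) (h'.const_mul (-1))
  simpa [sub_eq_add_neg] using this

/-! ### Products of horizontal functions with smooth functions of `(y, z)` -/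

lemma integrable_comp_vol {D : HDom} {F : Pt → ℝ} (hF : Integrable F D.vol) :
    Integrable (fun w : HPt × ℝ => F (w.1.1, w.1.2, w.2))
      (D.hVol.prod (volume.restrict 𝕀)) :=
  (measurePreserving_vol D).integrable_comp_of_integrable hF

lemma integral_vol_eq {D : HDom} {F : Pt → ℝ} (hF : Integrable F D.vol) :
    ∫ p, F p ∂D.vol = ∫ z in 𝕀, ∫ q, F (q.1, q.2, z) ∂D.hVol := by
  rw [← (measurePreserving_vol D).integral_comp']
  exact integral_prod_symm _ (integrable_comp_vol hF)

lemma integral_vol_eq' {D : HDom} {F : Pt → ℝ} (hF : Integrable F D.vol) :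
    ∫ p, F p ∂D.vol = ∫ q, (∫ z in 𝕀, F (q.1, q.2, z)) ∂D.hVol := by
  rw [← (measurePreserving_vol D).integral_comp']
  exact integral_prod _ (integrable_comp_vol hF)

lemma measurableSet_hBoxR (D : HDom) (R : ℝ) :
    MeasurableSet {q : HPt | q ∈ D.hBox ∧ |q.2| ≤ R} := by
  have hc : Measurable fun q : HPt => |q.2| := by fun_prop
  exact (measurableSet_hBox D).inter (measurableSet_le hc measurable_const)

lemma volume_hBoxR_lt_top (D : HDom) (R : ℝ) :
    volume {q : HPt | q ∈ D.hBox ∧ |q.2| ≤ R} < ⊤ := by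
  refine (measure_mono (t := Icc (0 : ℝ) 1 ×ˢ Icc (-R) R) ?_).trans_lt
    (isCompact_Icc.prod isCompact_Icc).measure_lt_top
  rintro q ⟨hq, hy⟩
  exact ⟨Ioo_subset_Icc_self hq.1, abs_le.1 hy⟩

lemma MeasureTheory.MemLp.integrableOn_hBoxR {D : HDom} {f : HPt → ℝ} (hf : MemLp f 2 D.hVol)
    (R : ℝ) : IntegrableOn f {q | q ∈ D.hBox ∧ |q.2| ≤ R} := by
  have h2 : MemLp f 2 (volume.restrict {q : HPt | q ∈ D.hBox ∧ |q.2| ≤ R}) :=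
    hf.mono_measure (Measure.restrict_mono (fun p hp => hp.1) le_rfl)
  have : IsFiniteMeasure (volume.restrict {q : HPt | q ∈ D.hBox ∧ |q.2| ≤ R}) :=
    ⟨by simpa using volume_hBoxR_lt_top D R⟩
  exact h2.integrable (by norm_num)

lemma locInt_proj {D : HDom} {f : HPt → ℝ} (hf : MemLp f 2 D.hVol) :
    LocInt D (fun p => f (p.1, p.2.1)) := by
  intro R
  have h1 : Integrable (fun w : HPt × ℝ => f w.1)
      ((volume.restrict {q : HPt | q ∈ D.hBox ∧ |q.2| ≤ R}).prod
        (volume.restrict 𝕀)) :=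
    (hf.integrableOn_hBoxR R).comp_fst _
  have h2 := ((measurePreserving_slab {q : HPt | q ∈ D.hBox ∧ |q.2| ≤ R}
    𝕀).integrable_comp_emb (MeasurableEquiv.measurableEmbedding _)
      (g := fun p : Pt => f (p.1, p.2.1))).1 h1
  have h3 : {p : Pt | (p.1, p.2.1) ∈ {q : HPt | q ∈ D.hBox ∧ |q.2| ≤ R} ∧
      p.2.2 ∈ 𝕀} = {p | p ∈ D.box ∧ |p.2.1| ≤ R} := by
    ext p
    simp only [Set.mem_ofPred_eq, HDom.box, HDom.hBox]
    tauto
  rwa [h3] at h2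

lemma locally_bounded_of_continuous (D : HDom) {k : ℝ → ℝ → ℝ} (hk : Continuous ↿k) (R : ℝ) :
    ∃ C : ℝ, ∀ p ∈ D.box, |p.2.1| ≤ R → |k p.2.1 p.2.2| ≤ C := by
  obtain ⟨C, hC⟩ := (isCompact_Icc.prod isCompact_Icc : IsCompact (Icc (-R) R ×ˢ
    Icc (0 : ℝ) 1)).exists_bound_of_continuousOn hk.continuousOn
  exact ⟨C, fun p hp hy => hC (p.2.1, p.2.2) ⟨abs_le.1 hy, Ioo_subset_Icc_self hp.2.2⟩⟩

lemma locInt_mul {D : HDom} {f : HPt → ℝ} (hf : MemLp f 2 D.hVol) {k : ℝ → ℝ → ℝ}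
    (hk : Continuous ↿k) : LocInt D (fun p => f (p.1, p.2.1) * k p.2.1 p.2.2) := by
  have := (locInt_proj hf).bdd_mul (k := fun p => k p.2.1 p.2.2)
    ((hk.comp (by fun_prop : Continuous fun p : Pt => (p.2.1, p.2.2))).measurable)
    (locally_bounded_of_continuous D hk)
  simpa only [mul_comm] using this

lemma IsHTest.mul_lat {φ : HPt → ℝ} (h : IsHTest .channel φ) {a : ℝ → ℝ}
    (ha : ContDiff ℝ ∞ a) : IsHTest .channel (fun q => a q.2 * φ q) := by
  refine ⟨(ha.comp contDiff_snd).mul h.smooth, fun x y => by simp [h.periodic_x x y], ?_⟩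
  obtain ⟨R, hR⟩ := h.lateral
  exact ⟨R, fun x y hy => by simp [hR x y hy]⟩

lemma isWeakDeriv_mul_zero {f g : HPt → ℝ} (hf : MemLp f 2 hΩ)
    (hg : MemLp g 2 hΩ) (h : IsHWeakDeriv .channel 0 f g) {k : ℝ → ℝ → ℝ}
    (hk : Continuous ↿k) (hky : ∀ z, ContDiff ℝ ∞ (fun y => k y z)) :
    IsWeakDeriv .channel 0 (fun p => f (p.1, p.2.1) * k p.2.1 p.2.2)
      (fun p => g (p.1, p.2.1) * k p.2.1 p.2.2) := by
  intro φ hφ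
  have hφ' : IsTest .channel φ := hφ
  rw [integral_vol_eq ((locInt_mul hf hk).integrable_mul (hφ'.pd 0)),
    integral_vol_eq ((locInt_mul hg hk).integrable_mul hφ'), ← integral_neg]
  refine integral_congr_ae (Eventually.of_forall fun z => ?_)
  have h1 := h _ ((hφ'.slice z).mul_lat (hky z))
  simp only
  have h2 : ∀ q : HPt, pd (hDir 0) (fun q : HPt => k q.2 z * φ (q.1, q.2, z)) q =
      k q.2 z * pd (dir 0) φ (q.1, q.2, z) := by
    intro q
    have := (hasDerivAt_pd_zero hφ'.differentiable q.1 q.2 z).const_mul (k q.2 z)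
    exact (hasDerivAt_hpd_zero ((hφ'.slice z).mul_lat (hky z)).differentiable q.1 q.2).unique this
  simp only [h2, ← mul_assoc] at h1
  exact h1

lemma isWeakDeriv_mul_one {f g : HPt → ℝ} (hf : MemLp f 2 hΩ)
    (hg : MemLp g 2 hΩ) (h : IsHWeakDeriv .channel 1 f g) {k k' : ℝ → ℝ → ℝ}
    (hk : Continuous ↿k) (hky : ∀ z, ContDiff ℝ ∞ (fun y => k y z)) (hk' : Continuous ↿k')
    (hd : ∀ y z, HasDerivAt (fun y => k y z) (k' y z) y) :
    IsWeakDeriv .channel 1 (fun p => f (p.1, p.2.1) * k p.2.1 p.2.2)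
      (fun p => g (p.1, p.2.1) * k p.2.1 p.2.2 + f (p.1, p.2.1) * k' p.2.1 p.2.2) := by
  intro φ hφ
  have hφ' : IsTest .channel φ := hφ
  have i1 := (locInt_mul hf hk).integrable_mul (hφ'.pd 1)
  have i2 := (locInt_mul hg hk).integrable_mul hφ'
  have i3 := (locInt_mul hf hk').integrable_mul hφ'
  simp only [add_mul]
  rw [integral_add i2 i3, neg_add, eq_comm, ← sub_eq_add_neg, sub_eq_iff_eq_add,
    ← integral_add i1 i3, integral_vol_eq i2,
    integral_vol_eq (F := fun p => f (p.1, p.2.1) * k p.2.1 p.2.2 * pd (dir 1) φ p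
      + f (p.1, p.2.1) * k' p.2.1 p.2.2 * φ p) (i1.add i3), ← integral_neg]
  refine integral_congr_ae (Eventually.of_forall fun z => ?_)
  have h1 := h _ ((hφ'.slice z).mul_lat (hky z))
  have h2 : ∀ q : HPt, pd (hDir 1) (fun q : HPt => k q.2 z * φ (q.1, q.2, z)) q =
      k' q.2 z * φ (q.1, q.2, z) + k q.2 z * pd (dir 1) φ (q.1, q.2, z) := by
    intro q
    have := (hd q.2 z).mul (hasDerivAt_pd_one hφ'.differentiable q.1 q.2 z)
    exact (hasDerivAt_hpd_one ((hφ'.slice z).mul_lat (hky z)).differentiable q.1 q.2).unique this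
  simp only [h2] at h1
  simp only
  rw [eq_comm]
  refine Eq.trans (integral_congr_ae (Eventually.of_forall fun q => ?_)) (h1.trans ?_)
  · ring
  · congr 1
    exact integral_congr_ae (Eventually.of_forall fun q => by ring)

lemma integral_slice_deriv {D : HDom} {φ : Pt → ℝ} (hφ : IsTest D φ) {k k' : ℝ → ℝ}
    (hk' : Continuous k') (hd : ∀ z, HasDerivAt k (k' z) z) (x y : ℝ) :
    ∫ z in 𝕀, k z * pd (dir 2) φ (x, y, z) =
      -∫ z in 𝕀, k' z * φ (x, y, z) := by
  obtain ⟨a, ha, h0⟩ := hφ.vertical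
  rw [← integral_Ioc_eq_integral_Ioo, ← integral_Ioc_eq_integral_Ioo,
    ← intervalIntegral.integral_of_le zero_le_one, ← intervalIntegral.integral_of_le zero_le_one]
  have hc : Continuous fun z => pd (dir 2) φ (x, y, z) :=
    (contDiff_pd hφ.smooth _).continuous.comp (by fun_prop)
  rw [intervalIntegral.integral_mul_deriv_eq_deriv_mul (u := k) (v := fun z => φ (x, y, z))
    (fun z _ => hd z) (fun z _ => hasDerivAt_pd_two hφ.differentiable x y z)
    (hk'.intervalIntegrable _ _) (hc.intervalIntegrable _ _)]
  simp [h0 x y 0 (Or.inl ha), h0 x y 1 (Or.inr (by linarith))]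

lemma isWeakDeriv_mul_two {D : HDom} {f : HPt → ℝ} (hf : MemLp f 2 D.hVol)
    {k k' : ℝ → ℝ → ℝ} (hk : Continuous ↿k) (hk' : Continuous ↿k')
    (hd : ∀ y z, HasDerivAt (fun z => k y z) (k' y z) z) :
    IsWeakDeriv D 2 (fun p => f (p.1, p.2.1) * k p.2.1 p.2.2)
      (fun p => f (p.1, p.2.1) * k' p.2.1 p.2.2) := by
  intro φ hφ
  have hφ' : IsTest D φ := hφ
  rw [integral_vol_eq' ((locInt_mul hf hk).integrable_mul (hφ'.pd 2)),
    integral_vol_eq' ((locInt_mul hf hk').integrable_mul hφ'), ← integral_neg]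
  refine integral_congr_ae (Eventually.of_forall fun q => ?_)
  simp only [mul_assoc, integral_const_mul]
  rw [integral_slice_deriv hφ' (hk'.comp (by fun_prop : Continuous fun z : ℝ => (q.2, z)))
    (fun z => hd q.2 z), mul_neg]
  rfl

/-! ### Complex coefficients -/

/-- `g` is the weak derivative of the complex function `f` on the channel. -/
def HWeakC (k : Fin 2) (f g : HPt → ℂ) : Prop :=
  IsHWeakDeriv .channel k (fun q => (f q).re) (fun q => (g q).re) ∧
    IsHWeakDeriv .channel k (fun q => (f q).im) (fun q => (g q).im)

lemma MeasureTheory.MemLp.re' {μ : Measure HPt} {f : HPt → ℂ} (hf : MemLp f 2 μ) :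
    MemLp (fun q => (f q).re) 2 μ := hf.re

lemma MeasureTheory.MemLp.im' {μ : Measure HPt} {f : HPt → ℂ} (hf : MemLp f 2 μ) :
    MemLp (fun q => (f q).im) 2 μ := hf.im

lemma locInt_re_mul {D : HDom} {f : HPt → ℂ} (hf : MemLp f 2 D.hVol) {k : ℝ → ℝ → ℂ}
    (hk : Continuous ↿k) : LocInt D (fun p => (f (p.1, p.2.1) * k p.2.1 p.2.2).re) := by
  have h1 := locInt_mul (k := fun y z => (k y z).re) hf.re' (Complex.continuous_re.comp hk)
  have h2 := locInt_mul (k := fun y z => (k y z).im) hf.im' (Complex.continuous_im.comp hk)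
  simpa only [Complex.mul_re] using h1.sub h2

lemma HasDerivAt.complex_re {k : ℝ → ℂ} {k' : ℂ} {t : ℝ} (h : HasDerivAt k k' t) :
    HasDerivAt (fun s => (k s).re) k'.re t :=
  Complex.reCLM.hasFDerivAt.comp_hasDerivAt t h

lemma HasDerivAt.complex_im {k : ℝ → ℂ} {k' : ℂ} {t : ℝ} (h : HasDerivAt k k' t) :
    HasDerivAt (fun s => (k s).im) k'.im t :=
  Complex.imCLM.hasFDerivAt.comp_hasDerivAt t h

lemma ContDiff.complex_re {k : ℝ → ℂ} (h : ContDiff ℝ ∞ k) : ContDiff ℝ ∞ fun s => (k s).re :=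
  Complex.reCLM.contDiff.comp h

lemma ContDiff.complex_im {k : ℝ → ℂ} (h : ContDiff ℝ ∞ k) : ContDiff ℝ ∞ fun s => (k s).im :=
  Complex.imCLM.contDiff.comp h

lemma isWeakDeriv_re_mul_zero {f g : HPt → ℂ} (hf : MemLp f 2 hΩ)
    (hg : MemLp g 2 hΩ) (h : HWeakC 0 f g) {k : ℝ → ℝ → ℂ}
    (hk : Continuous ↿k) (hky : ∀ z, ContDiff ℝ ∞ (fun y => k y z)) :
    IsWeakDeriv .channel 0 (fun p => (f (p.1, p.2.1) * k p.2.1 p.2.2).re)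
      (fun p => (g (p.1, p.2.1) * k p.2.1 p.2.2).re) := by
  have hr : Continuous ↿(fun y z => (k y z).re) := Complex.continuous_re.comp hk
  have hi : Continuous ↿(fun y z => (k y z).im) := Complex.continuous_im.comp hk
  simp only [Complex.mul_re]
  exact (isWeakDeriv_mul_zero hf.re' hg.re' h.1 hr fun z => (hky z).complex_re).sub
    (locInt_mul hf.re' hr) (locInt_mul hf.im' hi) (locInt_mul hg.re' hr) (locInt_mul hg.im' hi)
    (isWeakDeriv_mul_zero hf.im' hg.im' h.2 hi fun z => (hky z).complex_im)

lemma isWeakDeriv_re_mul_one {f g : HPt → ℂ} (hf : MemLp f 2 hΩ)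
    (hg : MemLp g 2 hΩ) (h : HWeakC 1 f g) {k k' : ℝ → ℝ → ℂ}
    (hk : Continuous ↿k) (hky : ∀ z, ContDiff ℝ ∞ (fun y => k y z)) (hk' : Continuous ↿k')
    (hd : ∀ y z, HasDerivAt (fun y => k y z) (k' y z) y) :
    IsWeakDeriv .channel 1 (fun p => (f (p.1, p.2.1) * k p.2.1 p.2.2).re)
      (fun p => (g (p.1, p.2.1) * k p.2.1 p.2.2).re
        + (f (p.1, p.2.1) * k' p.2.1 p.2.2).re) := by
  have hr : Continuous ↿(fun y z => (k y z).re) := Complex.continuous_re.comp hk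
  have hi : Continuous ↿(fun y z => (k y z).im) := Complex.continuous_im.comp hk
  have hr' : Continuous ↿(fun y z => (k' y z).re) := Complex.continuous_re.comp hk'
  have hi' : Continuous ↿(fun y z => (k' y z).im) := Complex.continuous_im.comp hk'
  simp only [Complex.mul_re]
  have := (isWeakDeriv_mul_one hf.re' hg.re' h.1 hr (fun z => (hky z).complex_re) hr'
      fun y z => (hd y z).complex_re).sub
    (locInt_mul hf.re' hr) (locInt_mul hf.im' hi)
    ((locInt_mul hg.re' hr).add (locInt_mul hf.re' hr'))
    ((locInt_mul hg.im' hi).add (locInt_mul hf.im' hi'))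
    (isWeakDeriv_mul_one hf.im' hg.im' h.2 hi (fun z => (hky z).complex_im) hi'
      fun y z => (hd y z).complex_im)
  convert this using 2
  ring

lemma isWeakDeriv_re_mul_two {D : HDom} {f : HPt → ℂ} (hf : MemLp f 2 D.hVol)
    {k k' : ℝ → ℝ → ℂ} (hk : Continuous ↿k) (hk' : Continuous ↿k')
    (hd : ∀ y z, HasDerivAt (fun z => k y z) (k' y z) z) :
    IsWeakDeriv D 2 (fun p => (f (p.1, p.2.1) * k p.2.1 p.2.2).re)
      (fun p => (f (p.1, p.2.1) * k' p.2.1 p.2.2).re) := by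
  have hr : Continuous ↿(fun y z => (k y z).re) := Complex.continuous_re.comp hk
  have hi : Continuous ↿(fun y z => (k y z).im) := Complex.continuous_im.comp hk
  have hr' : Continuous ↿(fun y z => (k' y z).re) := Complex.continuous_re.comp hk'
  have hi' : Continuous ↿(fun y z => (k' y z).im) := Complex.continuous_im.comp hk'
  simp only [Complex.mul_re]
  exact (isWeakDeriv_mul_two hf.re' hr hr' fun y z => (hd y z).complex_re).sub
    (locInt_mul hf.re' hr) (locInt_mul hf.im' hi)
    (locInt_mul hf.re' hr') (locInt_mul hf.im' hi')
    (isWeakDeriv_mul_two hf.im' hi hi' fun y z => (hd y z).complex_im)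

/-! ### Cauchy-Schwarz and `L²` norms -/

lemma eLpNorm_two_sq {E F : Type*} [MeasurableSpace E] [NormedAddCommGroup F] (f : E → F)
    (μ : Measure E) : eLpNorm f 2 μ ^ 2 = ∫⁻ x, ‖f x‖ₑ ^ 2 ∂μ := by
  have := eLpNorm_nnreal_pow_eq_lintegral (f := f) (μ := μ) (p := 2) (by norm_num)
  simpa using this

lemma lintegral_mul_sq_le {E : Type*} [MeasurableSpace E] {μ : Measure E} {f g : E → ℝ≥0∞}
    (hf : AEMeasurable f μ) (hg : AEMeasurable g μ) :
    (∫⁻ x, f x * g x ∂μ) ^ 2 ≤ (∫⁻ x, f x ^ 2 ∂μ) * ∫⁻ x, g x ^ 2 ∂μ := by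
  have h := ENNReal.lintegral_mul_le_Lp_mul_Lq μ (Real.HolderConjugate.two_two) hf hg
  simp only [Pi.mul_apply, ENNReal.rpow_two] at h
  calc (∫⁻ x, f x * g x ∂μ) ^ 2
      ≤ ((∫⁻ x, f x ^ 2 ∂μ) ^ (1 / 2 : ℝ) * (∫⁻ x, g x ^ 2 ∂μ) ^ (1 / 2 : ℝ)) ^ 2 := by gcongr
    _ = _ := by
      rw [mul_pow, ← ENNReal.rpow_natCast, ← ENNReal.rpow_mul, ← ENNReal.rpow_natCast,
        ← ENNReal.rpow_mul]
      norm_num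

lemma eLpNorm_le_of_sq_le {E F E' F' : Type*} [MeasurableSpace E] [NormedAddCommGroup F]
    [MeasurableSpace E'] [NormedAddCommGroup F'] {f : E → F} {g : E' → F'} {μ : Measure E}
    {ν : Measure E'} {c : ℝ≥0∞}
    (h : ∫⁻ x, ‖f x‖ₑ ^ 2 ∂μ ≤ c ^ 2 * ∫⁻ x, ‖g x‖ₑ ^ 2 ∂ν) :
    eLpNorm f 2 μ ≤ c * eLpNorm g 2 ν := by
  rw [← eLpNorm_two_sq, ← eLpNorm_two_sq, ← mul_pow] at h
  exact (ENNReal.pow_right_strictMono two_ne_zero).le_iff_le.1 h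

/-! ### Periodic square integrable functions on the channel -/

/-- Measurable functions on the plane, `1`-periodic in `x` and square integrable on the channel. -/
structure HGood (f : HPt → ℝ) : Prop where
  meas : Measurable f
  per : ∀ x y, f (x + 1, y) = f (x, y)
  memLp : MemLp f 2 hΩ

lemma channel_hVol_eq :
    hΩ = (volume.restrict 𝕀).prod (volume : Measure ℝ) := by
  have h := Measure.prod_restrict (μ := (volume : Measure ℝ)) (ν := (volume : Measure ℝ))
    𝕀 univ
  rw [Measure.restrict_univ] at h
  rw [h]
  rfl

lemma measurePreserving_fract_add (a : ℝ) :
    MeasurePreserving (fun x => Int.fract (x + a)) (volume.restrict 𝕀)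
      (volume.restrict 𝕀) := by
  have hm : Measurable fun x : ℝ => Int.fract (x + a) := by fun_prop
  refine ⟨hm, Measure.ext fun s hs => ?_⟩
  rw [Measure.map_apply hm hs, ← lintegral_indicator_one hs, ← lintegral_indicator_one (hm hs)]
  have e1 : ∀ g : ℝ → ℝ≥0∞, ∫⁻ x in 𝕀, g x = ∫⁻ x in Ioc (0 : ℝ) (0 + 1), g x :=
    fun g => by rw [zero_add, restrict_Ioo_eq_restrict_Ioc]
  have hper : ∀ (g : AddSubgroup.zmultiples (1 : ℝ)) (x : ℝ),
      s.indicator (1 : ℝ → ℝ≥0∞) (Int.fract (g +ᵥ x)) = s.indicator 1 (Int.fract x) := by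
    rintro ⟨_, n, rfl⟩ x
    simp [AddSubgroup.vadd_def]
  calc ∫⁻ x in 𝕀, ((fun x => Int.fract (x + a)) ⁻¹' s).indicator 1 x
      = ∫⁻ x in Ioc (0 : ℝ) (0 + 1), s.indicator 1 (Int.fract (x + a)) := by
        rw [e1]; rfl
    _ = ∫⁻ x in Ioc a (a + 1), s.indicator 1 (Int.fract x) := by
        have h := (measurePreserving_add_right (volume : Measure ℝ) a).setLIntegral_comp_preimage_emb
          (measurableEmbedding_addRight a) (fun x => s.indicator (1 : ℝ → ℝ≥0∞) (Int.fract x))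
          (Ioc a (a + 1))
        rw [← h]
        congr 2
        ext x
        simp [add_comm]
    _ = ∫⁻ x in Ioc (0 : ℝ) (0 + 1), s.indicator 1 (Int.fract x) :=
        (isAddFundamentalDomain_Ioc one_pos a).setLIntegral_eq (isAddFundamentalDomain_Ioc one_pos 0)
          _ hper
    _ = ∫⁻ x in 𝕀, s.indicator 1 x := by
        rw [← e1]
        refine setLIntegral_congr_fun measurableSet_Ioo fun x hx => ?_
        rw [Int.fract_eq_self.2 ⟨hx.1.le, hx.2⟩]

/-- Translation of the channel, represented on the fundamental domain. -/
def wrap (a q : HPt) : HPt := (Int.fract (q.1 + a.1), q.2 + a.2)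

lemma measurePreserving_wrap (a : HPt) :
    MeasurePreserving (wrap a) hΩ hΩ := by
  rw [channel_hVol_eq]
  exact (measurePreserving_fract_add a.1).prod (measurePreserving_add_right volume a.2)

lemma periodic_wrap {G : HPt → ℝ} (hG : ∀ x y, G (x + 1, y) = G (x, y)) (a q : HPt) :
    G (wrap a q) = G (q + a) := by
  have h : Function.Periodic (fun x => G (x, q.2 + a.2)) 1 := fun x => hG x _
  have := h.sub_zsmul_eq (x := q.1 + a.1) ⌊q.1 + a.1⌋
  simp only [zsmul_eq_mul, mul_one] at this
  rw [show q + a = (q.1 + a.1, q.2 + a.2) from rfl, ← this]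
  rfl

lemma integral_translate {G : HPt → ℝ} (hm : Measurable G)
    (hG : ∀ x y, G (x + 1, y) = G (x, y)) (a : HPt) :
    ∫ q, G (q + a) ∂hΩ = ∫ q, G q ∂hΩ := by
  simp only [← periodic_wrap hG a]
  rw [← (measurePreserving_wrap a).map_eq]
  conv_rhs => rw [integral_map (measurePreserving_wrap a).aemeasurable
    hm.aestronglyMeasurable]
  rw [(measurePreserving_wrap a).map_eq]

lemma HGood.lintegral_translate {f : HPt → ℝ} (hf : HGood f) (a : HPt) :
    ∫⁻ q, ‖f (q + a)‖ₑ ^ 2 ∂hΩ = ∫⁻ q, ‖f q‖ₑ ^ 2 ∂hΩ := by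
  simp only [← periodic_wrap hf.per a]
  exact (measurePreserving_wrap a).lintegral_comp (f := fun q => ‖f q‖ₑ ^ 2)
    (hf.meas.enorm.pow_const 2)

lemma HGood.translate {f : HPt → ℝ} (hf : HGood f) (a : HPt) : HGood (fun q => f (q + a)) := by
  refine ⟨hf.meas.comp (by fun_prop), fun x y => ?_, ?_⟩
  · have := hf.per (x + a.1) (y + a.2)
    rw [show ((x + 1, y) : HPt) + a = (x + a.1 + 1, y + a.2) by ext <;> simp; ring,
      show ((x, y) : HPt) + a = (x + a.1, y + a.2) by ext <;> simp]
    exact this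
  · have := hf.memLp.comp_measurePreserving (measurePreserving_wrap a)
    exact this.congr_norm (hf.meas.comp (by fun_prop)).aestronglyMeasurable
      (Eventually.of_forall fun q => by simp [periodic_wrap hf.per a q])

lemma HGood.eLpNorm_translate {f : HPt → ℝ} (hf : HGood f) (a : HPt) :
    eLpNorm (fun q => f (q + a)) 2 hΩ = eLpNorm f 2 hΩ := by
  have := hf.lintegral_translate a
  rw [← eLpNorm_two_sq, ← eLpNorm_two_sq] at this
  exact (ENNReal.pow_right_strictMono two_ne_zero).injective this

lemma HGood.add {f g : HPt → ℝ} (hf : HGood f) (hg : HGood g) : HGood (fun q => f q + g q) :=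
  ⟨hf.meas.add hg.meas, fun x y => by rw [hf.per, hg.per], hf.memLp.add hg.memLp⟩

lemma HGood.sub {f g : HPt → ℝ} (hf : HGood f) (hg : HGood g) : HGood (fun q => f q - g q) :=
  ⟨hf.meas.sub hg.meas, fun x y => by rw [hf.per, hg.per], hf.memLp.sub hg.memLp⟩

lemma HGood.const_mul {f : HPt → ℝ} (hf : HGood f) (c : ℝ) : HGood (fun q => c * f q) :=
  ⟨hf.meas.const_mul c, fun x y => by rw [hf.per], hf.memLp.const_mul c⟩

lemma HGood.lat_mul {f : HPt → ℝ} (hf : HGood f) {a : ℝ → ℝ} (ha : Measurable a) {C : ℝ}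
    (hC : ∀ y, |a y| ≤ C) : HGood (fun q => a q.2 * f q) := by
  have hm : Measurable fun q : HPt => a q.2 * f q := (ha.comp measurable_snd).mul hf.meas
  refine ⟨hm, fun x y => by simp [hf.per], ?_⟩
  refine (hf.memLp.const_mul C).of_le hm.aestronglyMeasurable (Eventually.of_forall fun q => ?_)
  simp only [norm_mul, Real.norm_eq_abs]
  exact mul_le_mul_of_nonneg_right ((hC _).trans (le_abs_self C)) (abs_nonneg _)

/-! ### Averages of translates -/

/-- The average `∫₀¹ w(s) f(q + v(s)) ds` of translates of `f`. -/
def avg (w : ℝ → ℝ) (v : ℝ → HPt) (f : HPt → ℝ) (q : HPt) : ℝ :=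
  ∫ s in 𝕀, w s * f (q + v s)

lemma measurable_translates {f : HPt → ℝ} (hf : Measurable f) {w : ℝ → ℝ} {v : ℝ → HPt}
    (hw : Continuous w) (hv : Continuous v) :
    Measurable fun r : HPt × ℝ => w r.2 * f (r.1 + v r.2) :=
  (hw.measurable.comp measurable_snd).mul
    (hf.comp (measurable_fst.add (hv.measurable.comp measurable_snd)))

lemma lintegral_avg_le {f : HPt → ℝ} (hf : HGood f) {w : ℝ → ℝ} {v : ℝ → HPt}
    (hw : Continuous w) (hv : Continuous v) {W : ℝ≥0∞} (hW : ∀ s ∈ 𝕀, ‖w s‖ₑ ≤ W) :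
    ∫⁻ q, ‖avg w v f q‖ₑ ^ 2 ∂hΩ ≤
      W ^ 2 * ∫⁻ q, ‖f q‖ₑ ^ 2 ∂hΩ := by
  have hm := measurable_translates hf.meas hw hv
  have h1 : ∀ q, ‖avg w v f q‖ₑ ^ 2 ≤
      W ^ 2 * ∫⁻ s in 𝕀, ‖f (q + v s)‖ₑ ^ 2 := by
    intro q
    have h2 : ‖avg w v f q‖ₑ ≤ ∫⁻ s in 𝕀, ‖f (q + v s)‖ₑ * W := by
      refine (enorm_integral_le_lintegral_enorm _).trans
        (setLIntegral_mono' measurableSet_Ioo fun s hs => ?_)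
      rw [enorm_mul, mul_comm]
      gcongr
      exact hW s hs
    have hmq : Measurable fun s => ‖f (q + v s)‖ₑ :=
      (hf.meas.comp (measurable_const.add hv.measurable)).enorm
    calc ‖avg w v f q‖ₑ ^ 2 ≤ (∫⁻ s in 𝕀, ‖f (q + v s)‖ₑ * W) ^ 2 := by gcongr
      _ ≤ (∫⁻ s in 𝕀, ‖f (q + v s)‖ₑ ^ 2) * ∫⁻ s in 𝕀, W ^ 2 :=
        lintegral_mul_sq_le hmq.aemeasurable aemeasurable_const
      _ = _ := by simp [mul_comm]
  have hmp : Measurable fun r : HPt × ℝ => ‖f (r.1 + v r.2)‖ₑ ^ 2 :=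
    ((hf.meas.comp (measurable_fst.add (hv.measurable.comp measurable_snd))).enorm).pow_const 2
  calc _ ≤ ∫⁻ q, W ^ 2 * (∫⁻ s in 𝕀, ‖f (q + v s)‖ₑ ^ 2) ∂hΩ :=
        lintegral_mono h1
    _ = W ^ 2 * ∫⁻ s in 𝕀, ∫⁻ q, ‖f (q + v s)‖ₑ ^ 2 ∂hΩ := by
        rw [lintegral_const_mul _ hmp.lintegral_prod_right', lintegral_lintegral_swap hmp.aemeasurable]
    _ = _ := by simp [hf.lintegral_translate]

lemma eLpNorm_avg_le {f : HPt → ℝ} (hf : HGood f) {w : ℝ → ℝ} {v : ℝ → HPt}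
    (hw : Continuous w) (hv : Continuous v) {W : ℝ≥0∞} (hW : ∀ s ∈ 𝕀, ‖w s‖ₑ ≤ W) :
    eLpNorm (avg w v f) 2 hΩ ≤ W * eLpNorm f 2 hΩ :=
  eLpNorm_le_of_sq_le (lintegral_avg_le hf hw hv hW)

lemma exists_enorm_bound {w : ℝ → ℝ} (hw : Continuous w) :
    ∃ C : ℝ≥0, ∀ s ∈ 𝕀, ‖w s‖ₑ ≤ C := by
  obtain ⟨C, hC⟩ := (isCompact_Icc : IsCompact (Icc (0 : ℝ) 1)).exists_bound_of_continuousOn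
    hw.continuousOn
  refine ⟨C.toNNReal, fun s hs => ?_⟩
  rw [← ofReal_norm]
  exact ofReal_le_ofReal (hC s (Ioo_subset_Icc_self hs))

lemma HGood.avg {f : HPt → ℝ} (hf : HGood f) {w : ℝ → ℝ} {v : ℝ → HPt}
    (hw : Continuous w) (hv : Continuous v) : HGood (avg w v f) := by
  have hm : Measurable (_root_.avg w v f) :=
    (measurable_translates hf.meas hw hv).stronglyMeasurable.integral_prod_right.measurable
  refine ⟨hm, fun x y => ?_, hm.aestronglyMeasurable, ?_⟩
  · unfold _root_.avg
    congr 1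
    funext s
    have := (hf.translate (v s)).per x y
    rw [this]
  · obtain ⟨C, hC⟩ := exists_enorm_bound hw
    exact (eLpNorm_avg_le hf hw hv hC).trans_lt (ENNReal.mul_lt_top (by simp) hf.memLp.2)

lemma IsHTest.hGood {χ : HPt → ℝ} (h : IsHTest .channel χ) : HGood χ := by
  refine ⟨h.smooth.continuous.measurable, h.periodic_x,
    h.smooth.continuous.aestronglyMeasurable, ?_⟩
  obtain ⟨R, hR⟩ := h.lateral
  obtain ⟨C, hC⟩ := (isCompact_Icc.prod isCompact_Icc : IsCompact (Icc (0 : ℝ) 1 ×ˢ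
    Icc (-R) R)).exists_bound_of_continuousOn h.smooth.continuous.continuousOn
  have h1 : MemLp ({q : HPt | q ∈ HDom.channel.hBox ∧ |q.2| ≤ R}.indicator fun _ => C) 2
      hΩ := by
    refine memLp_indicator_const 2 (measurableSet_hBoxR _ R) C (Or.inr ?_)
    refine ((Measure.restrict_apply_le _ _).trans_lt (volume_hBoxR_lt_top _ R)).ne
  refine (eLpNorm_mono_ae ?_).trans_lt h1.2
  filter_upwards [ae_restrict_mem (measurableSet_hBox _)] with q hq
  by_cases hy : |q.2| ≤ R
  · rw [indicator_of_mem (show q ∈ {q : HPt | q ∈ HDom.channel.hBox ∧ |q.2| ≤ R} from ⟨hq, hy⟩)]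
    exact (hC q ⟨Ioo_subset_Icc_self hq.1, abs_le.1 hy⟩).trans (le_abs_self C)
  · rw [show χ q = 0 from hR q.1 q.2 (not_le.1 hy)]; simp

lemma integral_avg_mul {f χ : HPt → ℝ} (hf : HGood f) (hχ : HGood χ) {w : ℝ → ℝ} {v : ℝ → HPt}
    (hw : Continuous w) (hv : Continuous v) :
    ∫ q, avg w v f q * χ q ∂hΩ =
        ∫ s in 𝕀, w s * ∫ q, f q * χ (q - v s) ∂hΩ ∧
      ∫ q, avg w v f q * χ q ∂hΩ =
        ∫ q, f q * avg w (fun s => - v s) χ q ∂hΩ := by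
  have obs : ∀ {f χ : HPt → ℝ}, HGood f → HGood χ → ∀ {v : ℝ → HPt}, Continuous v →
      Integrable (fun r : HPt × ℝ => w r.2 * f (r.1 + v r.2) * χ r.1)
      (HDom.channel.hVol.prod (volume.restrict 𝕀)) := by
    intro f χ hf hχ v hv
    have hm := measurable_translates hf.meas hw hv
    have m1 : MemLp (fun r : HPt × ℝ => w r.2 * f (r.1 + v r.2)) 2
        (HDom.channel.hVol.prod (volume.restrict 𝕀)) := by
      refine ⟨hm.aestronglyMeasurable, ?_⟩
      obtain ⟨C, hC⟩ := exists_enorm_bound hw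
      have : eLpNorm (fun r : HPt × ℝ => w r.2 * f (r.1 + v r.2)) 2
        (HDom.channel.hVol.prod (volume.restrict 𝕀)) ≤
          C * eLpNorm f 2 hΩ := by
        refine eLpNorm_le_of_sq_le ?_
        rw [lintegral_prod_symm _ (hm.enorm.pow_const 2).aemeasurable]
        refine (setLIntegral_mono' (g := fun _ => (C : ℝ≥0∞) ^ 2 *
          ∫⁻ q, ‖f q‖ₑ ^ 2 ∂hΩ) measurableSet_Ioo fun s hs => ?_).trans (by simp)
        rw [← hf.lintegral_translate (v s), ← lintegral_const_mul']
        · refine lintegral_mono fun q => ?_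
          simp only [enorm_mul, mul_pow]
          gcongr
          exact hC s hs
        · simp
      exact this.trans_lt (ENNReal.mul_lt_top (by simp) hf.memLp.2)
    have m2 : MemLp (fun r : HPt × ℝ => χ r.1) 2
        (HDom.channel.hVol.prod (volume.restrict 𝕀)) := hχ.memLp.comp_fst _
    exact m1.integrable_mul m2
  have i1 := obs hf hχ hv
  have i2 := obs hχ hf hv.neg
  have tr : ∀ s, ∫ q, f (q + v s) * χ q ∂hΩ =
      ∫ q, f q * χ (q - v s) ∂hΩ := by
    intro s
    have := integral_translate (G := fun q => f q * χ (q - v s))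
      (hf.meas.mul (hχ.meas.comp (by fun_prop))) (fun x y => by
        have := (hχ.translate (-v s)).per x y
        simp only [← sub_eq_add_neg] at this
        rw [hf.per, this]) (v s)
    simpa using this
  have e1 : ∫ q, avg w v f q * χ q ∂hΩ =
      ∫ s in 𝕀, w s * ∫ q, f q * χ (q - v s) ∂hΩ := by
    unfold avg
    simp only [← integral_mul_const]
    rw [integral_integral_swap i1]
    simp only [mul_assoc, integral_const_mul, tr]
  refine ⟨e1, e1.trans ?_⟩
  unfold avg
  simp only [← integral_const_mul (f _)]
  have : ∀ q s, f q * (w s * χ (q + -v s)) = w s * χ (q + -v s) * f q := fun q s => by ring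
  simp only [this]
  rw [integral_integral_swap i2]
  refine integral_congr_ae (Eventually.of_forall fun s => ?_)
  simp only [← integral_const_mul]
  exact integral_congr_ae (Eventually.of_forall fun q => by
    simp only [sub_eq_add_neg]
    ring)

lemma IsHTest.translate {χ : HPt → ℝ} (h : IsHTest .channel χ) (a : HPt) :
    IsHTest .channel (fun q => χ (q - a)) := by
  refine ⟨h.smooth.comp (by fun_prop), fun x y => ?_, ?_⟩
  · have := h.periodic_x (x - a.1) (y - a.2)
    rw [show ((x + 1, y) : HPt) - a = (x - a.1 + 1, y - a.2) by ext <;> simp; ring,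
      show ((x, y) : HPt) - a = (x - a.1, y - a.2) by ext <;> simp]
    exact this
  · obtain ⟨R, hR⟩ := h.lateral
    refine ⟨R + |a.2|, fun x y hy => hR _ _ ?_⟩
    have : |y| ≤ |y - a.2| + |a.2| := by simpa using abs_add_le (y - a.2) a.2
    simp only
    linarith

lemma IsHWeakDeriv.avg {f g : HPt → ℝ} (hf : HGood f) (hg : HGood g) {k : Fin 2}
    (h : IsHWeakDeriv .channel k f g) {w : ℝ → ℝ} {v : ℝ → HPt}
    (hw : Continuous w) (hv : Continuous v) :
    IsHWeakDeriv .channel k (_root_.avg w v f) (_root_.avg w v g) := by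
  intro φ hφ
  rw [(integral_avg_mul hf (hφ.pd k).hGood hw hv).1, (integral_avg_mul hg hφ.hGood hw hv).1,
    ← integral_neg]
  refine integral_congr_ae (Eventually.of_forall fun s => ?_)
  have h1 := h _ (hφ.translate (v s))
  have h2 : ∀ q, pd (hDir k) (fun q => φ (q - v s)) q = pd (hDir k) φ (q - v s) := by
    intro q
    unfold pd
    simp only [sub_eq_add_neg, fderiv_comp_add_right]
  simp only [h2] at h1
  simp only [h1]
  ring

lemma HGood.integrable_mul {f g : HPt → ℝ} (hf : HGood f) (hg : HGood g) :
    Integrable (fun q => f q * g q) hΩ := hf.memLp.integrable_mul hg.memLp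

/-! ### Zonal primitive and latitude averages -/

/-- Primitive in `x` of a function with zero zonal mean. -/
def xPrim (f : HPt → ℝ) : HPt → ℝ := avg (fun s => s) (fun s => (s, 0)) f

/-- Average over latitudes at distance at most `δ`. -/
def yAvg (δ : ℝ) (f : HPt → ℝ) : HPt → ℝ :=
  avg (fun _ => 1) (fun s => (0, δ * (2 * s - 1))) f

/-- The kernel average for which `yAvg δ f = f + δ² yRem δ (∂_yy f)`. -/
def yRem (δ : ℝ) (f : HPt → ℝ) : HPt → ℝ := fun q =>
  avg (fun s => (1 - s) ^ 2 / 4) (fun s => (0, δ * s)) f q +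
    avg (fun s => (1 - s) ^ 2 / 4) (fun s => (0, -(δ * s))) f q

/-- The centred difference quotient in latitude. -/
def yQuot (δ : ℝ) (f : HPt → ℝ) : HPt → ℝ := fun q =>
  (2 * δ)⁻¹ * (f (q + (0, δ)) - f (q + (0, -δ)))

lemma HGood.xPrim {f : HPt → ℝ} (hf : HGood f) : HGood (xPrim f) :=
  hf.avg (by fun_prop) (by fun_prop)

lemma HGood.yAvg {f : HPt → ℝ} (hf : HGood f) (δ : ℝ) : HGood (yAvg δ f) :=
  hf.avg (by fun_prop) (by fun_prop)

lemma HGood.yRem {f : HPt → ℝ} (hf : HGood f) (δ : ℝ) : HGood (yRem δ f) :=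
  (hf.avg (by fun_prop) (by fun_prop)).add (hf.avg (by fun_prop) (by fun_prop))

lemma HGood.yQuot {f : HPt → ℝ} (hf : HGood f) (δ : ℝ) : HGood (yQuot δ f) :=
  ((hf.translate _).sub (hf.translate _)).const_mul _

lemma eLpNorm_xPrim_le {f : HPt → ℝ} (hf : HGood f) :
    eLpNorm (xPrim f) 2 hΩ ≤ eLpNorm f 2 hΩ := by
  have := eLpNorm_avg_le (W := 1) hf (w := fun s => s) (v := fun s => (s, 0))
    (by fun_prop) (by fun_prop) (fun s hs => by
      rw [← ofReal_norm, Real.norm_of_nonneg hs.1.le]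
      exact ENNReal.ofReal_le_of_le_toReal (by simpa using hs.2.le))
  simpa [xPrim] using this

lemma eLpNorm_yAvg_le {f : HPt → ℝ} (hf : HGood f) (δ : ℝ) :
    eLpNorm (yAvg δ f) 2 hΩ ≤ eLpNorm f 2 hΩ := by
  have := eLpNorm_avg_le (W := 1) hf (w := fun _ => 1) (v := fun s => (0, δ * (2 * s - 1)))
    (by fun_prop) (by fun_prop) (fun s _ => by simp)
  simpa [yAvg] using this

lemma eLpNorm_yRem_le {f : HPt → ℝ} (hf : HGood f) (δ : ℝ) :
    eLpNorm (yRem δ f) 2 hΩ ≤ 2 * eLpNorm f 2 hΩ := by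
  have hw : ∀ s ∈ 𝕀, ‖(1 - s) ^ 2 / 4‖ₑ ≤ (1 : ℝ≥0) := fun s hs => by
    rw [← ofReal_norm, Real.norm_of_nonneg (by positivity)]
    refine ENNReal.ofReal_le_of_le_toReal ?_
    simp only [ENNReal.coe_one, ENNReal.toReal_one]
    nlinarith [hs.1, hs.2]
  have h1 := eLpNorm_avg_le hf (w := fun s => (1 - s) ^ 2 / 4) (v := fun s => (0, δ * s))
    (by fun_prop) (by fun_prop) hw
  have h2 := eLpNorm_avg_le hf (w := fun s => (1 - s) ^ 2 / 4) (v := fun s => (0, -(δ * s)))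
    (by fun_prop) (by fun_prop) hw
  refine (eLpNorm_add_le (hf.avg (by fun_prop) (by fun_prop)).meas.aestronglyMeasurable
    (hf.avg (by fun_prop) (by fun_prop)).meas.aestronglyMeasurable (by norm_num)).trans ?_
  rw [two_mul]
  simpa using add_le_add h1 h2

lemma eLpNorm_yQuot_le {f : HPt → ℝ} (hf : HGood f) {δ : ℝ} (hδ : 0 < δ) :
    eLpNorm (yQuot δ f) 2 hΩ ≤
      ofReal δ⁻¹ * eLpNorm f 2 hΩ := by
  unfold yQuot
  rw [show (fun q => (2 * δ)⁻¹ * (f (q + (0, δ)) - f (q + (0, -δ)))) =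
    (2 * δ)⁻¹ • fun q => (f (q + (0, δ)) - f (q + (0, -δ))) from rfl, eLpNorm_const_smul]
  have h1 := eLpNorm_sub_le (p := 2) (hf.translate (0, δ)).meas.aestronglyMeasurable
    (hf.translate (0, -δ)).meas.aestronglyMeasurable (μ := hΩ) (by norm_num)
  rw [hf.eLpNorm_translate, hf.eLpNorm_translate, ← two_mul] at h1
  calc _ ≤ ‖(2 * δ)⁻¹‖ₑ * (2 * eLpNorm f 2 hΩ) := by gcongr; exact h1
    _ = _ := by
      rw [← mul_assoc, ← ofReal_norm, Real.norm_of_nonneg (by positivity),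
        show (2 : ℝ≥0∞) = ofReal 2 by simp, ← ofReal_mul (by positivity)]
      congr 2
      field_simp

/-- `f` vanishes at latitudes of modulus larger than `a`. -/
def LatSupp (a : ℝ) (f : HPt → ℝ) : Prop := ∀ q : HPt, a < |q.2| → f q = 0

lemma LatSupp.avg {f : HPt → ℝ} {a : ℝ} (h : LatSupp a f) {w : ℝ → ℝ} {v : ℝ → HPt} {δ : ℝ}
    (hv : ∀ s ∈ 𝕀, |(v s).2| ≤ δ) : LatSupp (a + δ) (avg w v f) := by
  intro q hq
  unfold _root_.avg
  refine (setIntegral_congr_fun (g := fun _ => 0) measurableSet_Ioo fun s hs => ?_).trans (by simp)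
  have : |q.2| ≤ |(q + v s).2| + |(v s).2| := by
    have := abs_sub_abs_le_abs_sub q.2 (-(v s).2)
    rw [abs_neg, sub_neg_eq_add] at this
    simp only [Prod.snd_add]; linarith
  rw [h _ (by linarith [hv s hs]), mul_zero]

lemma LatSupp.xPrim {f : HPt → ℝ} {a : ℝ} (h : LatSupp a f) : LatSupp a (xPrim f) := by
  have := h.avg (w := fun s => s) (v := fun s => (s, 0)) (δ := 0) (by simp)
  rwa [add_zero] at this

lemma LatSupp.yAvg {f : HPt → ℝ} {a δ : ℝ} (h : LatSupp a f) (hδ : 0 ≤ δ) :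
    LatSupp (a + δ) (yAvg δ f) := by
  refine h.avg fun s hs => ?_
  simp only
  rw [abs_mul, abs_of_nonneg hδ]
  have : |2 * s - 1| ≤ 1 := abs_le.2 ⟨by linarith [hs.1], by linarith [hs.2]⟩
  nlinarith

lemma LatSupp.yRem {f : HPt → ℝ} {a δ : ℝ} (h : LatSupp a f) (hδ : 0 ≤ δ) :
    LatSupp (a + δ) (yRem δ f) := by
  have h1 : ∀ s ∈ 𝕀, |δ * s| ≤ δ := fun s hs => by
    rw [abs_of_nonneg (mul_nonneg hδ hs.1.le)]
    nlinarith [hs.2]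
  intro q hq
  unfold _root_.yRem
  rw [h.avg (v := fun s => (0, δ * s)) h1 q hq,
    h.avg (v := fun s => (0, -(δ * s))) (by simpa using h1) q hq, add_zero]

lemma LatSupp.yQuot {f : HPt → ℝ} {a δ : ℝ} (h : LatSupp a f) (hδ : 0 ≤ δ) :
    LatSupp (a + δ) (yQuot δ f) := by
  intro q hq
  have h1 : a < |q.2 + δ| := by
    have := abs_sub_abs_le_abs_sub q.2 (-δ)
    rw [abs_neg, sub_neg_eq_add, abs_of_nonneg hδ] at this
    linarith
  have h2 : a < |q.2 + -δ| := by
    have := abs_sub_abs_le_abs_sub q.2 δ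
    rw [abs_of_nonneg hδ] at this
    rw [← sub_eq_add_neg]; linarith
  unfold _root_.yQuot
  rw [h _ (by simpa using h1), h _ (by simpa using h2)]; simp

lemma integral_Ioo_eq_interval (g : ℝ → ℝ) :
    ∫ s in 𝕀, g s = ∫ s in (0 : ℝ)..1, g s := by
  rw [← integral_Ioc_eq_integral_Ioo, intervalIntegral.integral_of_le zero_le_one]

lemma isHWeakDeriv_xPrim {f : HPt → ℝ} (hf : HGood f)
    (h0 : ∀ᵐ y, ∫ x in 𝕀, f (x, y) = 0) :
    IsHWeakDeriv .channel 0 (xPrim f) f := by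
  intro φ hφ
  have hg : HGood (avg (fun _ => 1) (fun s => -((s, 0) : HPt)) φ) :=
    hφ.hGood.avg (by fun_prop) (by fun_prop)
  have key : ∀ q : HPt, avg (fun s => s) (fun s => -((s, 0) : HPt)) (pd (hDir 0) φ) q =
      avg (fun _ => 1) (fun s => -((s, 0) : HPt)) φ q - φ q := by
    rintro ⟨x, y⟩
    unfold avg
    rw [integral_Ioo_eq_interval, integral_Ioo_eq_interval]
    have hd : ∀ s, HasDerivAt (fun s => φ (x - s, y)) (-pd (hDir 0) φ (x - s, y)) s := by
      intro s
      have := (hasDerivAt_hpd_zero hφ.differentiable (x - s) y).comp_const_sub x s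
      exact this
    have hc : Continuous fun s => -pd (hDir 0) φ (x - s, y) :=
      ((contDiff_pd hφ.smooth _).continuous.comp (by fun_prop)).neg
    have := intervalIntegral.integral_mul_deriv_eq_deriv_mul (a := 0) (b := 1) (u := fun s => s)
      (fun s _ => hasDerivAt_id s) (fun s _ => hd s) (intervalIntegrable_const)
      (hc.intervalIntegrable _ _)
    have hp : φ (x - 1, y) = φ (x, y) := by simpa using (hφ.periodic_x (x - 1) y).symm
    simp only [mul_neg, intervalIntegral.integral_neg, one_mul, zero_mul, sub_zero] at this
    have e : ∀ s, ((x, y) : HPt) + -(s, 0) = (x - s, y) := fun s => by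
      ext <;> simp [sub_eq_add_neg]
    simp only [e, one_mul]
    linarith
  have hy : ∀ q : HPt, avg (fun _ => 1) (fun s => -((s, 0) : HPt)) φ q =
      ∫ s in (0 : ℝ)..1, φ (s, q.2) := by
    rintro ⟨x, y⟩
    unfold avg
    rw [integral_Ioo_eq_interval]
    have e : ∀ s, ((x, y) : HPt) + -(s, 0) = (x - s, y) := fun s => by
      ext <;> simp [sub_eq_add_neg]
    simp only [e, one_mul]
    rw [intervalIntegral.integral_comp_sub_left (fun s => φ (s, y)) x]
    have hper : Function.Periodic (fun s => φ (s, y)) 1 := fun s => hφ.periodic_x s y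
    have := hper.intervalIntegral_add_eq (x - 1) 0
    simpa using this
  have hz : ∫ q, f q * avg (fun _ => 1) (fun s => -((s, 0) : HPt)) φ q ∂hΩ = 0 := by
    have hi := hf.memLp.integrable_mul hg.memLp
    rw [channel_hVol_eq] at hi ⊢
    have := integral_prod_symm _ hi
    simp only [Pi.mul_apply] at this
    rw [this]
    simp only [hy, integral_mul_const]
    refine (integral_congr_ae (g := fun _ => 0) ?_).trans (by simp)
    filter_upwards [h0] with y hy0
    rw [hy0, zero_mul]
  unfold xPrim
  rw [(integral_avg_mul hf (hφ.pd 0).hGood (by fun_prop) (by fun_prop)).2]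
  simp only [key, mul_sub]
  rw [integral_sub (hf.integrable_mul hg) (hf.integrable_mul hφ.hGood), hz,
    zero_sub]

lemma isHWeakDeriv_yAvg {f : HPt → ℝ} (hf : HGood f) {δ : ℝ} (hδ : 0 < δ) :
    IsHWeakDeriv .channel 1 (yAvg δ f) (yQuot δ f) := by
  intro φ hφ
  have key : ∀ q : HPt, avg (fun _ => 1) (fun s => -((0, δ * (2 * s - 1)) : HPt))
      (pd (hDir 1) φ) q = (2 * δ)⁻¹ * (φ (q - (0, -δ)) - φ (q - (0, δ))) := by
    rintro ⟨x, y⟩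
    unfold avg
    rw [integral_Ioo_eq_interval]
    have hd : ∀ s, HasDerivAt (fun s => -(2 * δ)⁻¹ * φ (x, y - δ * (2 * s - 1)))
        (pd (hDir 1) φ (x, y - δ * (2 * s - 1))) s := by
      intro s
      have h1 : HasDerivAt (fun s : ℝ => y - δ * (2 * s - 1)) (-(δ * 2)) s := by
        have := (((hasDerivAt_id s).const_mul 2).sub_const 1).const_mul δ |>.const_sub y
        simpa using this
      have := ((hasDerivAt_hpd_one hφ.differentiable x (y - δ * (2 * s - 1))).comp s h1).const_mul
        (-(2 * δ)⁻¹)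
      refine this.congr_deriv ?_
      rw [mul_neg, ← neg_mul, mul_comm, ← mul_assoc]
      have h2 : δ * 2 * (2 * δ)⁻¹ = 1 := by field_simp
      linear_combination pd (hDir 1) φ (x, y - δ * (2 * s - 1)) * h2
    have hc : Continuous fun s => pd (hDir 1) φ (x, y - δ * (2 * s - 1)) :=
      (contDiff_pd hφ.smooth _).continuous.comp (by fun_prop)
    have := intervalIntegral.integral_eq_sub_of_hasDerivAt (a := 0) (b := 1) (fun s _ => hd s)
      (hc.intervalIntegrable _ _)
    have e : ∀ s, ((x, y) : HPt) + -(0, δ * (2 * s - 1)) = (x, y - δ * (2 * s - 1)) := fun s => by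
      ext <;> simp [sub_eq_add_neg]
    simp only [e, one_mul, this]
    have e1 : ((x, y) : HPt) - (0, -δ) = (x, y + δ) := by ext <;> simp
    have e2 : ((x, y) : HPt) - (0, δ) = (x, y - δ) := by ext <;> simp
    rw [e1, e2]
    norm_num
    ring
  unfold yAvg
  rw [(integral_avg_mul hf (hφ.pd 1).hGood (by fun_prop) (by fun_prop)).2]
  simp only [key]
  have tr : ∀ a : HPt, ∫ q, f q * φ (q - a) ∂hΩ =
      ∫ q, f (q + a) * φ q ∂hΩ := by
    intro a
    have := integral_translate (G := fun q => f q * φ (q - a))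
      (hf.meas.mul ((hφ.translate a).hGood.meas)) (fun x y => by
        rw [hf.per, (hφ.translate a).hGood.per]) a
    simpa using this.symm
  have it : ∀ a : HPt, Integrable (fun q => f q * φ (q - a)) hΩ := fun a =>
    hf.memLp.integrable_mul (hφ.translate a).hGood.memLp
  have it' : ∀ a : HPt, Integrable (fun q => f (q + a) * φ q) hΩ := fun a =>
    (hf.translate a).memLp.integrable_mul hφ.hGood.memLp
  have e1 : ∀ q, f q * ((2 * δ)⁻¹ * (φ (q - (0, -δ)) - φ (q - (0, δ)))) =
      (2 * δ)⁻¹ * (f q * φ (q - (0, -δ)) - f q * φ (q - (0, δ))) := fun q => by ring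
  have e2 : ∀ q, yQuot δ f q * φ q =
      (2 * δ)⁻¹ * (f (q + (0, δ)) * φ q - f (q + (0, -δ)) * φ q) := fun q => by
    unfold yQuot; ring
  simp only [e1, e2, integral_const_mul]
  rw [integral_sub (it _) (it _), integral_sub (it' _) (it' _), tr, tr]
  ring

lemma average_sub_eq_kernel {g g' g'' : ℝ → ℝ} (h1 : ∀ t, HasDerivAt g (g' t) t)
    (h2 : ∀ t, HasDerivAt g' (g'' t) t) (hc : Continuous g'') :
    ∫ s in (0 : ℝ)..1, g (1 - 2 * s) = g 0 +
      ((∫ s in (0 : ℝ)..1, (1 - s) ^ 2 / 4 * g'' (-s)) +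
        ∫ s in (0 : ℝ)..1, (1 - s) ^ 2 / 4 * g'' s) := by
  have half : ∀ {g g' g'' : ℝ → ℝ}, (∀ t, HasDerivAt g (g' t) t) →
      (∀ t, HasDerivAt g' (g'' t) t) → Continuous g'' →
      ∫ s in (0 : ℝ)..1, (1 - s) ^ 2 / 4 * g'' s =
        -g' 0 / 4 - g 0 / 2 + 1 / 2 * ∫ s in (0 : ℝ)..1, g s := by
    intro g g' g'' h1 h2 hc
    have c1 : Continuous g' := continuous_iff_continuousAt.2 fun t => (h2 t).continuousAt
    have d1 : ∀ s : ℝ, HasDerivAt (fun s : ℝ => (1 - s) ^ 2 / 4) (-(1 - s) / 2) s := fun s => by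
      have := (((hasDerivAt_id s).const_sub 1).pow 2).div_const 4
      refine this.congr_deriv ?_
      simp only [id]; ring
    have d2 : ∀ s : ℝ, HasDerivAt (fun s : ℝ => -(1 - s) / 2) (1 / 2) s := fun s => by
      have := ((hasDerivAt_id s).const_sub 1).neg.div_const 2
      refine this.congr_deriv ?_
      norm_num
    rw [intervalIntegral.integral_mul_deriv_eq_deriv_mul (fun s _ => d1 s) (fun s _ => h2 s)
      ((by fun_prop : Continuous fun s : ℝ => -(1 - s) / 2).intervalIntegrable _ _)
      (hc.intervalIntegrable _ _),
      intervalIntegral.integral_mul_deriv_eq_deriv_mul (fun s _ => d2 s) (fun s _ => h1 s)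
      (intervalIntegrable_const) (c1.intervalIntegrable _ _), intervalIntegral.integral_const_mul]
    ring
  have c0 : Continuous g := continuous_iff_continuousAt.2 fun t => (h1 t).continuousAt
  have e1 := half h1 h2 hc
  have e2 := half (g := fun t => g (-t)) (g' := fun t => -g' (-t)) (g'' := fun t => g'' (-t))
    (fun t => ((h1 (-t)).comp t (hasDerivAt_neg t)).congr_deriv (by ring))
    (fun t => ((h2 (-t)).comp t (hasDerivAt_neg t)).neg.congr_deriv (by ring)) (hc.comp continuous_neg)
  rw [e1, e2]
  have e3 : ∫ s in (0 : ℝ)..1, g (-s) = ∫ s in (-1 : ℝ)..0, g s := by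
    rw [intervalIntegral.integral_comp_neg]; simp
  have e4 : ∫ s in (0 : ℝ)..1, g (1 - 2 * s) = 1 / 2 * ∫ s in (-1 : ℝ)..1, g s := by
    rw [intervalIntegral.integral_comp_sub_mul _ two_ne_zero]; norm_num
  rw [e3, e4, ← intervalIntegral.integral_add_adjacent_intervals (b := 0)
    (c0.intervalIntegrable _ _) (c0.intervalIntegrable _ _)]
  simp
  ring

lemma integral_yAvg_mul {f fy fyy : HPt → ℝ} (hf : HGood f) (hfy : HGood fy) (hfyy : HGood fyy)
    (h1 : IsHWeakDeriv .channel 1 f fy) (h2 : IsHWeakDeriv .channel 1 fy fyy) (δ : ℝ)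
    {φ : HPt → ℝ} (hφ : IsHTest .channel φ) :
    ∫ q, yAvg δ f q * φ q ∂hΩ =
      ∫ q, (f q + δ ^ 2 * yRem δ fyy q) * φ q ∂hΩ := by
  set κ : ℝ → ℝ := fun s => (1 - s) ^ 2 / 4 with hκ
  have cκ : Continuous κ := by fun_prop
  have c1 : Continuous fun s : ℝ => ((0, δ * s) : HPt) := by fun_prop
  have c2 : Continuous fun s : ℝ => ((0, -(δ * s)) : HPt) := by fun_prop
  have key : ∀ q : HPt, avg (fun _ => 1) (fun s => -((0, δ * (2 * s - 1)) : HPt)) φ q =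
      φ q + δ ^ 2 * (avg κ (fun s => -((0, δ * s) : HPt)) (pd (hDir 1) (pd (hDir 1) φ)) q +
        avg κ (fun s => -((0, -(δ * s)) : HPt)) (pd (hDir 1) (pd (hDir 1) φ)) q) := by
    rintro ⟨x, y⟩
    unfold avg
    simp only [integral_Ioo_eq_interval]
    have d : ∀ {χ : HPt → ℝ}, IsHTest .channel χ → ∀ t : ℝ,
        HasDerivAt (fun t => χ (x, y + δ * t)) (δ * pd (hDir 1) χ (x, y + δ * t)) t := by
      intro χ hχ t
      have h1 : HasDerivAt (fun s : ℝ => y + δ * s) δ t := by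
        simpa using ((hasDerivAt_id t).const_mul δ).const_add y
      have := (hasDerivAt_hpd_one hχ.differentiable x (y + δ * t)).comp t h1
      rw [mul_comm]
      exact this
    have hc : Continuous fun t => δ * (δ * pd (hDir 1) (pd (hDir 1) φ) (x, y + δ * t)) :=
      continuous_const.mul (continuous_const.mul
        (((hφ.pd 1).pd 1).smooth.continuous.comp (by fun_prop)))
    have := average_sub_eq_kernel (d hφ) (fun t => ((d (hφ.pd 1)) t).const_mul δ) hc
    have e : ∀ s, ((x, y) : HPt) + -(0, δ * (2 * s - 1)) = (x, y + δ * (1 - 2 * s)) := fun s => by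
      ext <;> simp; ring
    have e1 : ∀ s, ((x, y) : HPt) + -(0, δ * s) = (x, y + δ * (-s)) := fun s => by
      ext <;> simp
    have e2 : ∀ s, ((x, y) : HPt) + -(0, -(δ * s)) = (x, y + δ * s) := fun s => by
      ext <;> simp
    simp only [e, e1, e2, one_mul, this, mul_zero, add_zero]
    rw [mul_add, ← intervalIntegral.integral_const_mul, ← intervalIntegral.integral_const_mul]
    congr 2
    · exact intervalIntegral.integral_congr fun s _ => by simp only [hκ]; ring
    · exact intervalIntegral.integral_congr fun s _ => by simp only [hκ]; ring
  have wk : ∀ {v : ℝ → HPt}, Continuous v →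
      ∫ q, f q * avg κ (fun s => -(v s)) (pd (hDir 1) (pd (hDir 1) φ)) q ∂hΩ =
        ∫ q, avg κ v fyy q * φ q ∂hΩ := by
    intro v hv
    rw [← (integral_avg_mul hf ((hφ.pd 1).pd 1).hGood cκ hv).2,
      h1.avg hf hfy cκ hv _ (hφ.pd 1), h2.avg hfy hfyy cκ hv _ hφ, neg_neg]
  unfold yAvg
  rw [(integral_avg_mul hf hφ.hGood (by fun_prop) (by fun_prop)).2]
  have p2 := ((hφ.pd 1).pd 1).hGood
  have i0 := hf.integrable_mul hφ.hGood
  have i1 := (hf.integrable_mul (p2.avg cκ c1.neg)).const_mul (δ ^ 2)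
  have i2 := (hf.integrable_mul (p2.avg cκ c2.neg)).const_mul (δ ^ 2)
  have i3 := ((hfyy.avg cκ c1).integrable_mul hφ.hGood).const_mul (δ ^ 2)
  have i4 := ((hfyy.avg cκ c2).integrable_mul hφ.hGood).const_mul (δ ^ 2)
  have k1 := integral_add i0 (i1.add i2)
  have k2 := integral_add i1 i2
  have k3 := integral_add i0 (i3.add i4)
  have k4 := integral_add i3 i4
  simp only [Pi.add_apply, Pi.neg_def, integral_const_mul] at k1 k2 k3 k4
  rw [k2, wk c1, wk c2, ← k4] at k1
  rw [← k1] at k3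
  refine Eq.trans (integral_congr_ae (Eventually.of_forall fun q => ?_)) (k3.symm.trans
    (integral_congr_ae (Eventually.of_forall fun q => ?_)))
  · simp only [key]; ring
  · simp only [yRem]; ring

/-! ### Functions tested by periodic test functions -/

lemma contDiff_comp_fract {φ : HPt → ℝ} (hφ : ContDiff ℝ ∞ φ) {κ : ℝ} (hκ : 0 < κ)
    (h0 : ∀ x y, (x < κ ∨ 1 - κ < x) → φ (x, y) = 0) :
    ContDiff ℝ ∞ fun q : HPt => φ (Int.fract q.1, q.2) := by
  refine contDiff_iff_contDiffAt.2 fun q => ?_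
  rcases (Int.fract_nonneg q.1).eq_or_lt with h | h
  · have hn : q.1 = (⌊q.1⌋ : ℝ) := by
      have := Int.self_sub_floor q.1
      linarith
    have hev : (fun q : HPt => φ (Int.fract q.1, q.2)) =ᶠ[𝓝 q] fun _ => 0 := by
      have hU : {r : HPt | |r.1 - q.1| < min κ (1 / 2)} ∈ 𝓝 q := by
        refine (isOpen_lt (by fun_prop) continuous_const).mem_nhds ?_
        simpa using hκ
      filter_upwards [hU] with r hr
      have hr' : |r.1 - q.1| < min κ (1 / 2) := hr
      obtain ⟨h1, h2⟩ := lt_min_iff.1 hr'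
      refine h0 _ _ ?_
      rcases le_or_gt q.1 r.1 with hle | hlt
      · left
        have hf : ⌊r.1⌋ = ⌊q.1⌋ := by
          rw [Int.floor_eq_iff]
          constructor
          · linarith
          · linarith [(abs_lt.1 h2).2]
        rw [← Int.self_sub_floor, hf]
        linarith [(abs_lt.1 h1).2]
      · right
        have hf : ⌊r.1⌋ = ⌊q.1⌋ - 1 := by
          rw [Int.floor_eq_iff]
          push_cast
          constructor
          · linarith [(abs_lt.1 h2).1]
          · linarith
        rw [← Int.self_sub_floor, hf]
        push_cast
        linarith [(abs_lt.1 h1).1]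
    exact contDiffAt_const.congr_of_eventuallyEq hev
  · have hev : (fun q : HPt => φ (Int.fract q.1, q.2)) =ᶠ[𝓝 q]
        fun r => φ (r.1 - ⌊q.1⌋, r.2) := by
      have h1 : (⌊q.1⌋ : ℝ) < q.1 := by
        have := Int.self_sub_floor q.1
        linarith
      have hU : {r : HPt | (⌊q.1⌋ : ℝ) < r.1 ∧ r.1 < ⌊q.1⌋ + 1} ∈ 𝓝 q := by
        exact ((isOpen_lt continuous_const continuous_fst).inter
          (isOpen_lt continuous_fst continuous_const)).mem_nhds ⟨h1, Int.lt_floor_add_one q.1⟩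
      filter_upwards [hU] with r hr
      have hf : ⌊r.1⌋ = ⌊q.1⌋ := Int.floor_eq_iff.2 ⟨hr.1.le, hr.2⟩
      rw [← Int.self_sub_floor, hf]
    refine ContDiffAt.congr_of_eventuallyEq ?_ hev
    exact (hφ.comp (by fun_prop : ContDiff ℝ ∞ fun r : HPt =>
      ((r.1 - ⌊q.1⌋, r.2) : HPt))).contDiffAt

lemma IsCompact.exists_margin {K : Set ℝ} (hK : IsCompact K) {u v : ℝ} (hs : K ⊆ Ioo u v) :
    ∃ κ > 0, ∀ t ∈ K, u + κ < t ∧ t < v - κ := by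
  obtain ⟨κ, hκ, hth⟩ := hK.exists_thickening_subset_open isOpen_Ioo hs
  refine ⟨κ / 2, half_pos hκ, fun t ht => ?_⟩
  have m := fun x (h : dist x t < κ) => hth (Metric.mem_thickening_iff.2 ⟨t, ht, h⟩)
  have e : |κ| / 2 < κ := by rw [abs_of_pos hκ]; linarith
  have m1 := m (t - κ / 2) (by simpa [Real.dist_eq] using e)
  have m2 := m (t + κ / 2) (by simpa [Real.dist_eq] using e)
  exact ⟨by linarith [m1.1], by linarith [m2.2]⟩

lemma ae_eq_zero_of_forall_integral_comp_fract {U : Set HPt} (hU : IsOpen U)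
    (hUb : U ⊆ HDom.channel.hBox) {F : HPt → ℝ} (hF : MemLp F 2 (volume.restrict U))
    (h : ∀ φ : HPt → ℝ, HasCompactSupport φ → tsupport φ ⊆ U →
      IsHTest .channel (fun q => φ (Int.fract q.1, q.2)) →
      ∫ q in U, F q * φ (Int.fract q.1, q.2) = 0) :
    ∀ᵐ q ∂volume.restrict U, F q = 0 := by
  have hloc : LocallyIntegrableOn F U volume :=
    locallyIntegrableOn_of_locallyIntegrable_restrict (hF.locallyIntegrable (by norm_num))
  refine (ae_restrict_iff' hU.measurableSet).2
    (hU.ae_eq_zero_of_integral_contDiff_smul_eq_zero hloc ?_)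
  intro φ hφ hc hsub
  have hK : IsCompact (Prod.fst '' tsupport φ) := hc.isCompact.image continuous_fst
  have hKs : Prod.fst '' tsupport φ ⊆ 𝕀 := by
    rintro _ ⟨q, hq, rfl⟩
    exact (hUb (hsub hq)).1
  obtain ⟨κ, hκ, hm⟩ := hK.exists_margin hKs
  have h0 : ∀ x y, (x < κ ∨ 1 - κ < x) → φ (x, y) = 0 := fun x y hx => by
    by_contra hne
    have := hm x ⟨(x, y), subset_tsupport _ hne, rfl⟩
    rcases hx with hx | hx <;> linarith
  have hKy : IsCompact (Prod.snd '' tsupport φ) := hc.isCompact.image continuous_snd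
  obtain ⟨R, hR⟩ := hKy.isBounded.exists_norm_le
  have ht : IsHTest .channel fun q : HPt => φ (Int.fract q.1, q.2) := by
    refine ⟨contDiff_comp_fract hφ hκ h0, fun x y => by simp, R, fun x y hy => ?_⟩
    by_contra hne
    have := hR y ⟨_, subset_tsupport _ hne, rfl⟩
    rw [Real.norm_eq_abs] at this
    linarith
  have e : ∫ q, φ q • F q = ∫ q in U, φ q • F q := by
    refine (setIntegral_eq_integral_of_forall_compl_eq_zero fun q hq => ?_).symm
    rw [image_eq_zero_of_notMem_tsupport fun hm => hq (hsub hm), zero_smul]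
  rw [e, ← h _ hc hsub ht]
  refine setIntegral_congr_fun hU.measurableSet fun q hq => ?_
  simp only [smul_eq_mul]
  rw [Int.fract_eq_self.2 ⟨(hUb hq).1.1.le, (hUb hq).1.2⟩, mul_comm]

lemma isOpen_hBox (D : HDom) : IsOpen D.hBox := by
  refine isOpen_Ioo.prod (?_ : IsOpen D.yRange)
  cases D
  · exact isOpen_univ
  · exact isOpen_Ioo

lemma ae_eq_zero_of_forall_integral_isHTest {F : HPt → ℝ} (hF : HGood F)
    (h : ∀ φ, IsHTest .channel φ → ∫ q, F q * φ q ∂hΩ = 0) :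
    ∀ᵐ q ∂hΩ, F q = 0 :=
  ae_eq_zero_of_forall_integral_comp_fract (isOpen_hBox _) subset_rfl hF.memLp
    fun _ _ _ => h _

/-! ### Hardy's inequality -/

lemma ae_sub_translate_eq {f g : HPt → ℝ} (hf : HGood f) (hg : HGood g)
    (h : IsHWeakDeriv .channel 1 f g) (t : ℝ) :
    ∀ᵐ q ∂hΩ, f q - f (q + (0, -t)) =
      t * avg (fun _ => 1) (fun s => (0, -(t * s))) g q := by
  have cv : Continuous fun s : ℝ => ((0, -(t * s)) : HPt) := by fun_prop
  have hG : HGood (avg (fun _ => 1) (fun s => (0, -(t * s))) g) := hg.avg (by fun_prop) cv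
  have hT := hf.translate (0, -t)
  have := ae_eq_zero_of_forall_integral_isHTest ((hf.sub hT).sub (hG.const_mul t)) ?_
  · filter_upwards [this] with q hq using sub_eq_zero.1 hq
  intro φ hφ
  have key : ∀ q : HPt, φ (q - (0, -t)) = φ q +
      t * avg (fun _ => 1) (fun s => -((0, -(t * s)) : HPt)) (pd (hDir 1) φ) q := by
    rintro ⟨x, y⟩
    unfold avg
    rw [integral_Ioo_eq_interval]
    have hd : ∀ s, HasDerivAt (fun s => φ (x, y + t * s)) (t * pd (hDir 1) φ (x, y + t * s)) s := by
      intro s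
      have h1 : HasDerivAt (fun s : ℝ => y + t * s) t s := by
        simpa using ((hasDerivAt_id s).const_mul t).const_add y
      have := (hasDerivAt_hpd_one hφ.differentiable x (y + t * s)).comp s h1
      rw [mul_comm]
      exact this
    have hc : Continuous fun s => t * pd (hDir 1) φ (x, y + t * s) :=
      continuous_const.mul ((contDiff_pd hφ.smooth _).continuous.comp (by fun_prop))
    have := intervalIntegral.integral_eq_sub_of_hasDerivAt (a := 0) (b := 1) (fun s _ => hd s)
      (hc.intervalIntegrable _ _)
    have e : ∀ s, ((x, y) : HPt) + -(0, -(t * s)) = (x, y + t * s) := fun s => by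
      ext <;> simp
    have e1 : ((x, y) : HPt) - (0, -t) = (x, y + t) := by ext <;> simp
    simp only [e, e1, one_mul, ← intervalIntegral.integral_const_mul, this]
    simp
  have wk : ∫ q, f q * avg (fun _ => 1) (fun s => -((0, -(t * s)) : HPt)) (pd (hDir 1) φ) q
      ∂hΩ = -∫ q, avg (fun _ => 1) (fun s => (0, -(t * s))) g q * φ q
        ∂hΩ := by
    rw [← (integral_avg_mul hf (hφ.pd 1).hGood (by fun_prop) cv).2,
      h.avg hf hg (by fun_prop) cv _ hφ]
  have tr : ∫ q, f (q + (0, -t)) * φ q ∂hΩ =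
      ∫ q, f q * φ (q - (0, -t)) ∂hΩ := by
    have := integral_translate (G := fun q => f q * φ (q - (0, -t)))
      (hf.meas.mul ((hφ.translate _).hGood.meas)) (fun x y => by
        rw [hf.per, (hφ.translate _).hGood.per]) (0, -t)
    simpa using this
  have i1 := hf.integrable_mul hφ.hGood
  have i2 := hT.integrable_mul hφ.hGood
  have i3 := (hG.integrable_mul hφ.hGood).const_mul t
  have i4 := (hf.integrable_mul ((hφ.pd 1).hGood.avg (w := fun _ => 1) (by fun_prop)
    cv.neg)).const_mul t
  have k1 := integral_sub (i1.sub i2) i3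
  have k2 := integral_sub i1 i2
  have k3 := integral_add i1 i4
  simp only [Pi.sub_apply, Pi.neg_def, integral_const_mul] at k1 k2 k3
  rw [k2, tr] at k1
  have k4 : ∫ q, f q * φ (q - (0, -t)) ∂hΩ =
      ∫ q, f q * φ q ∂hΩ + t * ∫ q, f q *
        avg (fun _ => 1) (fun s => -((0, -(t * s)) : HPt)) (pd (hDir 1) φ) q
        ∂hΩ := by
    rw [← k3]
    exact integral_congr_ae (Eventually.of_forall fun q => by simp only [key]; ring)
  rw [k4, wk] at k1
  refine Eq.trans (integral_congr_ae (Eventually.of_forall fun q => ?_)) (k1.trans (by ring))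
  simp only; ring

/-- The average of `G` over the segment joining the equator to `q`. -/
def segAvg (G : HPt → ℝ≥0∞) (q : HPt) : ℝ≥0∞ :=
  ∫⁻ θ in 𝕀, G (q.1, θ * q.2)

lemma ae_enorm_le_segAvg {f g : HPt → ℝ} (hf : HGood f) (hg : HGood g)
    (h : IsHWeakDeriv .channel 1 f g) {C : ℝ} (hC : ∀ q : HPt, |q.2| ≤ 1 → |f q| ≤ C * |q.2|) :
    ∀ᵐ q ∂hΩ, ‖f q‖ₑ ≤ ‖q.2‖ₑ * segAvg (fun q => ‖g q‖ₑ) q := by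
  have hm1 : Measurable fun r : HPt × ℝ =>
      r.2 * avg (fun _ => 1) (fun s => (0, -(r.2 * s))) g r.1 := by
    refine measurable_snd.mul ?_
    have : Measurable fun w : (HPt × ℝ) × ℝ => (1 : ℝ) * g (w.1.1 + (0, -(w.1.2 * w.2))) :=
      (hg.meas.comp (by fun_prop)).const_mul 1
    exact this.stronglyMeasurable.integral_prod_right.measurable
  have hm2 : Measurable fun r : HPt × ℝ => f r.1 - f (r.1 + (0, -r.2)) :=
    (hf.meas.comp measurable_fst).sub (hf.meas.comp (by fun_prop))
  have h1 : ∀ᵐ r ∂((volume : Measure ℝ).prod hΩ), f r.2 - f (r.2 + (0, -r.1)) =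
      r.1 * avg (fun _ => 1) (fun s => (0, -(r.1 * s))) g r.2 := by
    refine (Measure.ae_prod_iff_ae_ae ?_).2 (Eventually.of_forall fun t =>
      ae_sub_translate_eq hf hg h t)
    exact measurableSet_eq_fun (hm2.comp measurable_swap) (hm1.comp measurable_swap)
  have h2 : ∀ᵐ q ∂hΩ, ∀ᵐ t ∂(volume : Measure ℝ), f q - f (q + (0, -t)) =
      t * avg (fun _ => 1) (fun s => (0, -(t * s))) g q := by
    have : ∀ᵐ r ∂(HDom.channel.hVol.prod (volume : Measure ℝ)), f r.1 - f (r.1 + (0, -r.2)) =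
      r.2 * avg (fun _ => 1) (fun s => (0, -(r.2 * s))) g r.1 :=
      (Measure.measurePreserving_swap (μ := hΩ)
        (ν := (volume : Measure ℝ))).quasiMeasurePreserving.ae h1
    exact Measure.ae_ae_of_ae_prod this
  have h3 : ∀ᵐ q ∂hΩ, LocallyIntegrable (fun t => g (q.1, t)) volume := by
    have hfin : ∫⁻ q, ‖g q‖ₑ ^ 2 ∂hΩ ≠ ⊤ := by
      rw [← eLpNorm_two_sq]
      exact (ENNReal.pow_lt_top hg.memLp.2).ne
    rw [channel_hVol_eq] at hfin ⊢
    rw [lintegral_prod _ (hg.meas.enorm.pow_const 2).aemeasurable] at hfin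
    have := ae_lt_top' ((hg.meas.enorm.pow_const 2).lintegral_prod_right').aemeasurable hfin
    have h4 : ∀ᵐ x ∂(volume.restrict 𝕀),
        LocallyIntegrable (fun t => g (x, t)) volume := by
      filter_upwards [this] with x hx
      have : MemLp (fun t => g (x, t)) 2 volume := by
        refine ⟨(hg.meas.comp (by fun_prop)).aestronglyMeasurable, ?_⟩
        rw [← eLpNorm_two_sq] at hx
        by_contra htop
        rw [not_lt, top_le_iff] at htop
        simp [htop] at hx
      exact this.locallyIntegrable (by norm_num)
    exact Measure.quasiMeasurePreserving_fst.ae h4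
  filter_upwards [h2, h3] with q hq hloc
  have hii : ∀ a b, IntervalIntegrable (fun t => g (q.1, t)) volume a b := fun a b =>
    (hloc.integrableOn_isCompact isCompact_uIcc).intervalIntegrable
  have hI : ∀ t, t * avg (fun _ => 1) (fun s => (0, -(t * s))) g q =
      ∫ r in (q.2 - t)..q.2, g (q.1, r) := by
    intro t
    unfold avg
    rw [integral_Ioo_eq_interval]
    have e : ∀ s, q + (0, -(t * s)) = (q.1, q.2 - t * s) := fun s => by
      ext <;> simp [sub_eq_add_neg]
    simp only [e, one_mul]
    have := intervalIntegral.smul_integral_comp_sub_mul (fun r => g (q.1, r)) t q.2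
      (a := 0) (b := 1)
    simpa using this
  have hlim : f q = ∫ r in (0 : ℝ)..q.2, g (q.1, r) := by
    have hd := Measure.dense_of_ae hq
    have hne : (𝓝[{t : ℝ | f q - f (q + (0, -t)) =
        t * avg (fun _ => 1) (fun s => (0, -(t * s))) g q}] q.2).NeBot :=
      mem_closure_iff_nhdsWithin_neBot.1 (hd q.2)
    have l1 : Tendsto (fun t => f (q + (0, -t))) (𝓝 q.2) (𝓝 0) := by
      have l2 : Tendsto (fun t : ℝ => C * |q.2 - t|) (𝓝 q.2) (𝓝 0) := by
        have : Continuous fun t : ℝ => C * |q.2 - t| := by fun_prop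
        simpa using this.tendsto q.2
      refine squeeze_zero_norm' ?_ l2
      have : ∀ᶠ t in 𝓝 q.2, |q.2 - t| < 1 := by
        have : Continuous fun t : ℝ => |q.2 - t| := by fun_prop
        exact (isOpen_lt this continuous_const).mem_nhds (by simp)
      filter_upwards [this] with t ht
      have := hC (q + (0, -t)) (by simpa [sub_eq_add_neg] using ht.le)
      simpa [sub_eq_add_neg] using this
    have l3 : Tendsto (fun t => ∫ r in (q.2 - t)..q.2, g (q.1, r)) (𝓝 q.2)
        (𝓝 (∫ r in (0 : ℝ)..q.2, g (q.1, r))) := by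
      have c := (intervalIntegral.continuous_primitive hii q.2).neg.comp
        (by fun_prop : Continuous fun t : ℝ => q.2 - t)
      have := c.tendsto q.2
      simp only [Function.comp_def, Pi.neg_apply, sub_self] at this
      rw [intervalIntegral.integral_symm q.2 0]
      refine this.congr fun t => ?_
      rw [intervalIntegral.integral_symm (q.2 - t) q.2, neg_neg]
    have l4 : Tendsto (fun t => f q - f (q + (0, -t))) (𝓝[{t : ℝ | f q - f (q + (0, -t)) =
        t * avg (fun _ => 1) (fun s => (0, -(t * s))) g q}] q.2)
        (𝓝 (∫ r in (0 : ℝ)..q.2, g (q.1, r))) := by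
      refine (l3.mono_left nhdsWithin_le_nhds).congr' ?_
      filter_upwards [self_mem_nhdsWithin] with t ht
      rw [← hI t]
      exact ht.symm
    have l5 : Tendsto (fun t => f q - f (q + (0, -t))) (𝓝[{t : ℝ | f q - f (q + (0, -t)) =
        t * avg (fun _ => 1) (fun s => (0, -(t * s))) g q}] q.2) (𝓝 (f q - 0)) :=
      (tendsto_const_nhds.sub l1).mono_left nhdsWithin_le_nhds
    have := tendsto_nhds_unique l5 l4
    rwa [sub_zero] at this
  have hs : f q = q.2 * ∫ θ in (0 : ℝ)..1, g (q.1, θ * q.2) := by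
    rw [hlim]
    have := intervalIntegral.smul_integral_comp_mul_right (fun r => g (q.1, r)) q.2
      (a := 0) (b := 1)
    simpa using this.symm
  rw [hs, enorm_mul, ← integral_Ioo_eq_interval]
  gcongr
  exact enorm_integral_le_lintegral_enorm _

lemma lintegral_comp_mul_left_real {G : ℝ → ℝ≥0∞} (hG : Measurable G) {θ : ℝ} (hθ : 0 < θ) :
    ∫⁻ y, G (θ * y) = ofReal θ⁻¹ * ∫⁻ y, G y := by
  have := Real.map_volume_mul_left hθ.ne'
  rw [← lintegral_map (f := G) hG (measurable_const_mul θ), this, lintegral_smul_measure,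
    abs_of_pos (inv_pos.2 hθ)]
  rfl

lemma lintegral_rpow_neg_half :
    ∫⁻ θ in 𝕀, ofReal (θ ^ (-(1 / 2) : ℝ)) = 2 := by
  rw [← ofReal_integral_eq_lintegral_ofReal]
  · rw [integral_Ioo_eq_interval, integral_rpow (Or.inl (by norm_num))]
    norm_num
  · have := intervalIntegral.intervalIntegrable_rpow' (a := 0) (b := 1)
      (r := -(1 / 2)) (by norm_num)
    rw [intervalIntegrable_iff_integrableOn_Ioc_of_le zero_le_one] at this
    exact this.mono_set Set.Ioo_subset_Ioc_self
  · filter_upwards [ae_restrict_mem measurableSet_Ioo] with θ hθ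
    exact Real.rpow_nonneg hθ.1.le _

lemma lintegral_segAvg_sq_le {G : HPt → ℝ≥0∞} (hG : Measurable G) :
    ∫⁻ q, segAvg G q ^ 2 ∂hΩ ≤ 2 ^ 2 * ∫⁻ q, G q ^ 2 ∂hΩ := by
  have mθ : Measurable fun w : HPt × ℝ => G (w.1.1, w.2 * w.1.2) := hG.comp (by fun_prop)
  have r1 : ∀ q, segAvg G q ^ 2 ≤ 2 * ∫⁻ θ in 𝕀,
      ofReal (θ ^ (1 / 2 : ℝ)) * G (q.1, θ * q.2) ^ 2 := by
    intro q
    have e : segAvg G q = ∫⁻ θ in 𝕀, ofReal (θ ^ (-(1 / 4) : ℝ)) *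
        (ofReal (θ ^ (1 / 4 : ℝ)) * G (q.1, θ * q.2)) := by
      refine setLIntegral_congr_fun measurableSet_Ioo fun θ hθ => ?_
      rw [← mul_assoc, ← ofReal_mul (Real.rpow_nonneg hθ.1.le _), ← Real.rpow_add hθ.1]
      norm_num
    rw [e]
    refine (lintegral_mul_sq_le (by fun_prop) ?_).trans (le_of_eq ?_)
    · exact (by fun_prop : Measurable fun θ : ℝ => ofReal (θ ^ (1 / 4 : ℝ))).mul
        (hG.comp (by fun_prop)) |>.aemeasurable
    · congr 1
      · rw [← lintegral_rpow_neg_half]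
        refine setLIntegral_congr_fun measurableSet_Ioo fun θ hθ => ?_
        rw [← ofReal_pow (Real.rpow_nonneg hθ.1.le _), ← Real.rpow_natCast,
          ← Real.rpow_mul hθ.1.le]
        norm_num
      · refine setLIntegral_congr_fun measurableSet_Ioo fun θ hθ => ?_
        rw [mul_pow, ← ofReal_pow (Real.rpow_nonneg hθ.1.le _), ← Real.rpow_natCast,
          ← Real.rpow_mul hθ.1.le]
        norm_num
  have mw : Measurable fun w : HPt × ℝ =>
      ofReal (w.2 ^ (1 / 2 : ℝ)) * G (w.1.1, w.2 * w.1.2) ^ 2 :=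
    (by fun_prop : Measurable fun w : HPt × ℝ => ofReal (w.2 ^ (1 / 2 : ℝ))).mul
      (mθ.pow_const 2)
  have sc : ∀ θ ∈ 𝕀, ∫⁻ q, G (q.1, θ * q.2) ^ 2 ∂hΩ =
      ofReal θ⁻¹ * ∫⁻ q, G q ^ 2 ∂hΩ := by
    intro θ hθ
    rw [channel_hVol_eq, lintegral_prod _ (by
      exact ((hG.comp (by fun_prop : Measurable fun q : HPt => ((q.1, θ * q.2) : HPt))).pow_const
        2).aemeasurable), lintegral_prod _ (hG.pow_const 2).aemeasurable,
      ← lintegral_const_mul _ (hG.pow_const 2).lintegral_prod_right']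
    refine lintegral_congr fun x => ?_
    exact lintegral_comp_mul_left_real (G := fun y => G (x, y) ^ 2)
      ((hG.comp (by fun_prop)).pow_const 2) hθ.1
  calc _ ≤ ∫⁻ q, 2 * (∫⁻ θ in 𝕀,
      ofReal (θ ^ (1 / 2 : ℝ)) * G (q.1, θ * q.2) ^ 2) ∂hΩ :=
        lintegral_mono r1
    _ = 2 * ∫⁻ θ in 𝕀, ∫⁻ q,
      ofReal (θ ^ (1 / 2 : ℝ)) * G (q.1, θ * q.2) ^ 2 ∂hΩ := by
        rw [lintegral_const_mul _ mw.lintegral_prod_right', lintegral_lintegral_swap mw.aemeasurable]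
    _ = 2 * ∫⁻ θ in 𝕀, ofReal (θ ^ (-(1 / 2) : ℝ)) *
        ∫⁻ q, G q ^ 2 ∂hΩ := by
        congr 1
        refine setLIntegral_congr_fun measurableSet_Ioo fun θ hθ => ?_
        rw [lintegral_const_mul' _ _ (by simp), sc θ hθ, ← mul_assoc,
          ← ofReal_mul (Real.rpow_nonneg hθ.1.le _)]
        congr 2
        rw [← Real.rpow_neg_one, ← Real.rpow_add hθ.1]
        norm_num
    _ = _ := by
        rw [lintegral_mul_const _ (by fun_prop), lintegral_rpow_neg_half, ← mul_assoc, sq]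

lemma hardy {f g : HPt → ℝ} (hf : HGood f) (hg : HGood g)
    (h : IsHWeakDeriv .channel 1 f g) {C : ℝ} (hC : ∀ q : HPt, |q.2| ≤ 1 → |f q| ≤ C * |q.2|) :
    eLpNorm (fun q => f q / q.2) 2 hΩ ≤ 2 * eLpNorm g 2 hΩ := by
  refine eLpNorm_le_of_sq_le (le_trans (lintegral_mono_ae ?_)
    (lintegral_segAvg_sq_le hg.meas.enorm))
  filter_upwards [ae_enorm_le_segAvg hf hg h hC] with q hq
  gcongr
  rcases eq_or_ne q.2 0 with h0 | h0
  · simp [h0]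
  · rw [div_eq_mul_inv, enorm_mul, enorm_inv h0, ← div_eq_mul_inv]
    exact ENNReal.div_le_of_le_mul' hq

lemma hardy_sq {f g : HPt → ℝ} (hf : HGood f) (hg : HGood g)
    (h : IsHWeakDeriv .channel 1 f g) {C : ℝ} (hC : ∀ q : HPt, |q.2| ≤ 1 → |f q| ≤ C * |q.2|) :
    eLpNorm (fun q => f q / q.2 ^ 2) 2 hΩ ≤
      2 * eLpNorm (fun q => g q / q.2) 2 hΩ := by
  have hm : Measurable fun q : HPt => ‖g q / q.2‖ₑ := (hg.meas.div measurable_snd).enorm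
  refine eLpNorm_le_of_sq_le (le_trans (lintegral_mono_ae ?_) (lintegral_segAvg_sq_le hm))
  filter_upwards [ae_enorm_le_segAvg hf hg h hC] with q hq
  gcongr
  rcases eq_or_ne q.2 0 with h0 | h0
  · simp [h0]
  · have e : f q / q.2 ^ 2 = f q * (q.2)⁻¹ * (q.2)⁻¹ := by field_simp
    rw [e, enorm_mul, enorm_mul]
    calc ‖f q‖ₑ * ‖(q.2)⁻¹‖ₑ * ‖(q.2)⁻¹‖ₑ
        ≤ segAvg (fun q => ‖g q‖ₑ) q * ‖(q.2)⁻¹‖ₑ := by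
          gcongr
          rw [enorm_inv h0, ← div_eq_mul_inv]
          exact ENNReal.div_le_of_le_mul' hq
      _ = ∫⁻ θ in 𝕀, ‖g (q.1, θ * q.2)‖ₑ * ‖(q.2)⁻¹‖ₑ := by
          rw [segAvg, lintegral_mul_const']
          simp
      _ ≤ _ := by
          refine setLIntegral_mono' measurableSet_Ioo fun θ hθ => ?_
          simp only
          rw [div_eq_mul_inv, enorm_mul, mul_inv, enorm_mul]
          gcongr
          refine le_mul_of_one_le_left zero_le ?_
          rw [← ofReal_norm, Real.norm_of_nonneg (inv_nonneg.2 hθ.1.le)]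
          exact ENNReal.one_le_ofReal.2 ((one_le_inv₀ hθ.1).2 hθ.2.le)

/-! ### The Ekman profile as a holomorphic function of the Coriolis parameter -/

/-- The principal square root. -/
def rt (β : ℂ) : ℂ := Complex.exp (Complex.log β / 2)

/-- The profile `sinh(√β z / ε) / sinh(√β / ε)`. -/
def profQ (ε : ℝ) (β : ℂ) (z : ℝ) : ℂ :=
  sinh (rt β / ε * z) / sinh (rt β / ε)

/-- The profile of the transport, `profQ / β`. -/
def profK (ε : ℝ) (β : ℂ) (z : ℝ) : ℂ := profQ ε β z / β

/-- The profile of the horizontal velocity, the derivative of `profK` with respect to `z`. -/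
def profM (ε : ℝ) (β : ℂ) (z : ℝ) : ℂ :=
  cosh (rt β / ε * z) / (ε * rt β * sinh (rt β / ε))

lemma rt_mul_self {β : ℂ} (hβ : β ≠ 0) : rt β * rt β = β := by
  unfold rt
  rw [← Complex.exp_add, add_halves, Complex.exp_log hβ]

lemma rt_ne_zero (β : ℂ) : rt β ≠ 0 := Complex.exp_ne_zero _

lemma norm_rt {β : ℂ} (hβ : β ≠ 0) : ‖rt β‖ = √‖β‖ := by
  have := congrArg norm (rt_mul_self hβ)
  rw [norm_mul] at this
  rw [← this, Real.sqrt_mul_self (norm_nonneg _)]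

lemma rt_re_nonneg (β : ℂ) : 0 ≤ (rt β).re := by
  unfold rt
  rw [Complex.exp_re]
  refine mul_nonneg (Real.exp_pos _).le (Real.cos_nonneg_of_neg_pi_div_two_le_of_le ?_ ?_)
  · have := Complex.neg_pi_lt_arg β
    rw [Complex.div_ofNat_im, Complex.log_im]; linarith
  · have := Complex.arg_le_pi β
    rw [Complex.div_ofNat_im, Complex.log_im]; linarith

lemma two_mul_rt_re_sq {β : ℂ} (hβ : β ≠ 0) : 2 * (rt β).re ^ 2 = ‖β‖ + β.re := by
  have h1 := congrArg Complex.re (rt_mul_self hβ)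
  have h2 : ‖rt β‖ ^ 2 = ‖β‖ := by rw [norm_rt hβ, Real.sq_sqrt (norm_nonneg _)]
  rw [Complex.sq_norm, Complex.normSq_apply] at h2
  rw [Complex.mul_re] at h1
  nlinarith

lemma norm_sinh_le {μ : ℂ} (h0 : 0 ≤ μ.re) {z : ℝ} (hz : 0 ≤ z) :
    ‖sinh (μ * z)‖ ≤ Real.exp (μ.re * z) ∧ ‖cosh (μ * z)‖ ≤ Real.exp (μ.re * z) := by
  have h1 : ‖Complex.exp (μ * z)‖ = Real.exp (μ.re * z) := by
    rw [Complex.norm_exp]; simp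
  have h2 : ‖Complex.exp (-(μ * z))‖ ≤ Real.exp (μ.re * z) := by
    rw [Complex.norm_exp]
    refine Real.exp_le_exp.2 ?_
    simp
    nlinarith [mul_nonneg h0 hz]
  constructor
  · rw [sinh, norm_div, Complex.norm_ofNat, div_le_iff₀ two_pos]
    refine (norm_sub_le _ _).trans ?_
    linarith
  · rw [cosh, norm_div, Complex.norm_ofNat, div_le_iff₀ two_pos]
    refine (norm_add_le _ _).trans ?_
    linarith

lemma le_norm_sinh (μ : ℂ) : (Real.exp μ.re - Real.exp (-μ.re)) / 2 ≤ ‖sinh μ‖ := by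
  rw [sinh, norm_div, Complex.norm_ofNat]
  have := norm_sub_norm_le (Complex.exp μ) (Complex.exp (-μ))
  rw [Complex.norm_exp, Complex.norm_exp, Complex.neg_re] at this
  linarith

lemma sinh_ne_zero_of_re_pos {μ : ℂ} (h : 0 < μ.re) : sinh μ ≠ 0 := by
  intro h0
  have := le_norm_sinh μ
  rw [h0, norm_zero] at this
  have := Real.exp_lt_exp.2 (by linarith : -μ.re < μ.re)
  linarith

lemma exp_div_four_le_norm_sinh {μ : ℂ} (h : 1 ≤ μ.re) : Real.exp μ.re / 4 ≤ ‖sinh μ‖ := by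
  refine le_trans ?_ (le_norm_sinh μ)
  have h1 : 2 ≤ Real.exp μ.re := by linarith [Real.add_one_le_exp μ.re]
  have h2 : Real.exp (-μ.re) ≤ 1 := Real.exp_le_one_iff.2 (by linarith)
  linarith

lemma norm_div_sinh_le {μ : ℂ} (h : 1 ≤ μ.re) {z a : ℝ} (hz : z ∈ Icc (0 : ℝ) 1)
    (ha : a ≤ μ.re) :
    ‖sinh (μ * z)‖ / ‖sinh μ‖ ≤ 4 * Real.exp (-(a * (1 - z))) ∧
      ‖cosh (μ * z)‖ / ‖sinh μ‖ ≤ 4 * Real.exp (-(a * (1 - z))) := by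
  have h1 := norm_sinh_le (by linarith : 0 ≤ μ.re) hz.1
  have h2 := exp_div_four_le_norm_sinh h
  have hpos : 0 < ‖sinh μ‖ := lt_of_lt_of_le (by positivity) h2
  have h3 : Real.exp (μ.re * z) ≤ 4 * Real.exp (-(a * (1 - z))) * ‖sinh μ‖ := by
    calc Real.exp (μ.re * z) = 4 * Real.exp (-(μ.re * (1 - z))) * (Real.exp μ.re / 4) := by
          rw [mul_assoc, mul_div_assoc', ← Real.exp_add]
          ring_nf
      _ ≤ 4 * Real.exp (-(a * (1 - z))) * ‖sinh μ‖ := by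
          gcongr
          linarith [hz.2]
  exact ⟨(div_le_iff₀ hpos).2 (h1.1.trans h3), (div_le_iff₀ hpos).2 (h1.2.trans h3)⟩

/-- The sector in which the profiles are holomorphic and decay. -/
def sector : Set ℂ := {β | β ≠ 0 ∧ -‖β‖ / 3 ≤ β.re}

lemma rt_re_sq_ge {β : ℂ} (h : β ∈ sector) : ‖β‖ / 3 ≤ (rt β).re ^ 2 := by
  have := two_mul_rt_re_sq h.1
  have h2 : -‖β‖ / 3 ≤ β.re := h.2
  linarith

lemma rt_re_pos {β : ℂ} (h : β ∈ sector) : 0 < (rt β).re := by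
  refine (rt_re_nonneg β).lt_of_ne fun h0 => ?_
  have := rt_re_sq_ge h
  rw [← h0] at this
  have := norm_pos_iff.2 h.1
  linarith

lemma sector_subset_slitPlane {β : ℂ} (h : β ∈ sector) : β ∈ Complex.slitPlane := by
  by_contra hn
  rw [Complex.mem_slitPlane_iff, not_or, not_lt, not_not] at hn
  have h1 : ‖β‖ = -β.re := by
    rw [← Complex.re_add_im β, hn.2]
    simp [abs_of_nonpos hn.1]
  have h2 : -‖β‖ / 3 ≤ β.re := h.2
  have := norm_pos_iff.2 h.1
  linarith

lemma sinh_rt_ne_zero {ε : ℝ} (hε : 0 < ε) {β : ℂ} (h : β ∈ sector) :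
    sinh (rt β / ε) ≠ 0 := by
  refine sinh_ne_zero_of_re_pos ?_
  rw [Complex.div_ofReal_re]
  exact div_pos (rt_re_pos h) hε

lemma differentiableAt_rt {β : ℂ} (h : β ∈ sector) : DifferentiableAt ℂ rt β :=
  ((differentiableAt_id.clog (sector_subset_slitPlane h)).div_const 2).cexp

lemma differentiableAt_profQ {ε : ℝ} (hε : 0 < ε) (z : ℝ) {β : ℂ} (h : β ∈ sector) :
    DifferentiableAt ℂ (fun β => profQ ε β z) β :=
  (((differentiableAt_rt h).div_const _).mul_const _).csinh.div
    ((differentiableAt_rt h).div_const _).csinh (sinh_rt_ne_zero hε h)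

lemma differentiableAt_profK {ε : ℝ} (hε : 0 < ε) (z : ℝ) {β : ℂ} (h : β ∈ sector) :
    DifferentiableAt ℂ (fun β => profK ε β z) β :=
  (differentiableAt_profQ hε z h).div differentiableAt_id h.1

lemma differentiableAt_profM {ε : ℝ} (hε : 0 < ε) (z : ℝ) {β : ℂ} (h : β ∈ sector) :
    DifferentiableAt ℂ (fun β => profM ε β z) β :=
  (((differentiableAt_rt h).div_const _).mul_const _).ccosh.div
    (((differentiableAt_rt h).const_mul _).mul ((differentiableAt_rt h).div_const _).csinh)
    (mul_ne_zero (mul_ne_zero (by exact_mod_cast hε.ne') (rt_ne_zero β)) (sinh_rt_ne_zero hε h))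

/-- The decay factor of the profiles. -/
def decay (ε : ℝ) (β : ℂ) (z : ℝ) : ℝ := Real.exp (-(√‖β‖ / (2 * ε) * (1 - z)))

lemma closedBall_subset_sector {β : ℂ} (h0 : β ≠ 0) (hre : 0 ≤ β.re) {w : ℂ}
    (hw : w ∈ Metric.closedBall β (‖β‖ / 4)) : w ∈ sector ∧ 3 / 4 * ‖β‖ ≤ ‖w‖ := by
  rw [mem_closedBall_iff_norm] at hw
  have hp := norm_pos_iff.2 h0
  have h1 : 3 / 4 * ‖β‖ ≤ ‖w‖ := by
    have := norm_sub_norm_le β w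
    rw [norm_sub_rev] at this
    linarith
  refine ⟨⟨norm_pos_iff.1 (by linarith), ?_⟩, h1⟩
  have := (Complex.abs_re_le_norm (w - β)).trans hw
  rw [Complex.sub_re] at this
  have := (abs_le.1 this).1
  linarith

lemma norm_prof_le_of_mem_closedBall {ε : ℝ} (hε : 0 < ε) {β : ℂ} (hre : 0 ≤ β.re)
    (hβ : 4 * ε ^ 2 ≤ ‖β‖) {z : ℝ} (hz : z ∈ Icc (0 : ℝ) 1) {w : ℂ}
    (hw : w ∈ Metric.closedBall β (‖β‖ / 4)) :
    ‖profQ ε w z‖ ≤ 4 * decay ε β z ∧ ‖profK ε w z‖ ≤ 6 * decay ε β z / ‖β‖ ∧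
      ‖profM ε w z‖ ≤ 5 * decay ε β z / (ε * √‖β‖) := by
  have hp : 0 < ‖β‖ := lt_of_lt_of_le (by positivity) hβ
  have h0 := norm_pos_iff.1 hp
  obtain ⟨hs, hn⟩ := closedBall_subset_sector h0 hre hw
  have ha : √‖β‖ / 2 ≤ (rt w).re := by
    refine abs_le_of_sq_le_sq' ?_ (rt_re_pos hs).le |>.2
    have := rt_re_sq_ge hs
    rw [div_pow, Real.sq_sqrt hp.le]
    linarith
  have hb : 2 * ε ≤ √‖β‖ := Real.le_sqrt_of_sq_le (by nlinarith)
  have hμ : √‖β‖ / (2 * ε) ≤ (rt w / ε).re := by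
    rw [Complex.div_ofReal_re, ← div_div]
    gcongr
  have h1 : 1 ≤ √‖β‖ / (2 * ε) := (one_le_div (by positivity)).2 hb
  have hD := norm_div_sinh_le (h1.trans hμ) hz hμ
  have hQ : ‖profQ ε w z‖ ≤ 4 * decay ε β z := by
    unfold profQ
    rw [norm_div]
    exact hD.1
  have hd : 0 < decay ε β z := Real.exp_pos _
  refine ⟨hQ, ?_, ?_⟩
  · unfold profK
    rw [norm_div, div_le_div_iff₀ (by linarith) hp]
    nlinarith [mul_le_mul_of_nonneg_left hn hd.le, mul_le_mul_of_nonneg_right hQ hp.le]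
  · unfold profM
    have hr : 4 / 5 * √‖β‖ ≤ ‖rt w‖ := by
      rw [norm_rt hs.1]
      refine Real.le_sqrt_of_sq_le ?_
      rw [mul_pow, Real.sq_sqrt hp.le]
      linarith
    have hsq : 0 < √‖β‖ := Real.sqrt_pos.2 hp
    rw [norm_div, norm_mul, norm_mul, Complex.norm_real, Real.norm_of_nonneg hε.le, mul_comm (ε * _),
      ← div_div, div_le_div_iff₀ (by nlinarith) (by positivity)]
    have := hD.2
    unfold decay at hd ⊢
    calc _ ≤ 4 * Real.exp (-(√‖β‖ / (2 * ε) * (1 - z))) * (ε * √‖β‖) := by gcongr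
      _ = 5 * Real.exp (-(√‖β‖ / (2 * ε) * (1 - z))) * (ε * (4 / 5 * √‖β‖)) := by ring
      _ ≤ _ := by gcongr

lemma norm_derivs_le_of_closedBall {f : ℂ → ℂ} {β : ℂ} (h0 : β ≠ 0) (hre : 0 ≤ β.re)
    (hf : ∀ w ∈ sector, DifferentiableAt ℂ f w) {B : ℝ}
    (hB : ∀ w ∈ Metric.closedBall β (‖β‖ / 4), ‖f w‖ ≤ B) :
    ‖deriv f β‖ ≤ 4 * B / ‖β‖ ∧ ‖deriv (deriv f) β‖ ≤ 32 * B / ‖β‖ ^ 2 := by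
  have hp := norm_pos_iff.2 h0
  have hd : DiffContOnCl ℂ f (Metric.ball β (‖β‖ / 4)) := by
    refine DifferentiableOn.diffContOnCl fun w hw => ?_
    rw [closure_ball _ (by positivity)] at hw
    exact (hf w (closedBall_subset_sector h0 hre hw).1).differentiableWithinAt
  have hB' : ∀ w ∈ Metric.sphere β (‖β‖ / 4), ‖f w‖ ≤ B := fun w hw =>
    hB w (Metric.sphere_subset_closedBall hw)
  have h1 := Complex.norm_iteratedDeriv_le_of_forall_mem_sphere_norm_le 1 (by positivity) hd hB'
  have h2 := Complex.norm_iteratedDeriv_le_of_forall_mem_sphere_norm_le 2 (by positivity) hd hB'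
  rw [iteratedDeriv_one] at h1
  rw [iteratedDeriv_succ, iteratedDeriv_one] at h2
  constructor
  · refine h1.trans (le_of_eq ?_)
    simp
    field_simp
  · refine h2.trans (le_of_eq ?_)
    simp
    field_simp
    ring

lemma profQ_one {ε : ℝ} (hε : 0 < ε) {β : ℂ} (h : β ∈ sector) : profQ ε β 1 = 1 := by
  unfold profQ
  rw [Complex.ofReal_one, mul_one, div_self (sinh_rt_ne_zero hε h)]

lemma profQ_zero (ε : ℝ) (β : ℂ) : profQ ε β 0 = 0 := by simp [profQ]

lemma hasDerivAt_profK {ε : ℝ} (hε : 0 < ε) {β : ℂ} (h : β ∈ sector) (z : ℝ) :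
    HasDerivAt (fun z : ℝ => profK ε β z) (profM ε β z) z := by
  unfold profK profQ profM
  have h1 : HasDerivAt (fun z : ℝ => rt β / ε * (z : ℂ)) (rt β / ε) z := by
    simpa using ((hasDerivAt_id (z : ℂ)).const_mul (rt β / ε)).comp_ofReal
  have := (((Complex.hasDerivAt_sinh _).comp z h1).div_const (sinh (rt β / ε))).div_const β
  refine this.congr_deriv ?_
  have e := rt_mul_self h.1
  have hr := rt_ne_zero β
  have hs := sinh_rt_ne_zero hε h
  have hε' : (ε : ℂ) ≠ 0 := by exact_mod_cast hε.ne'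
  have hβ := h.1
  rw [div_div, div_eq_div_iff (mul_ne_zero hs hβ) (mul_ne_zero (mul_ne_zero hε' hr) hs)]
  field_simp
  linear_combination (cosh (rt β * z / ε)) * e

lemma hasDerivAt_profM {ε : ℝ} (hε : 0 < ε) {β : ℂ} (h : β ∈ sector) (z : ℝ) :
    HasDerivAt (fun z : ℝ => profM ε β z) (profQ ε β z / ε ^ 2) z := by
  unfold profQ profM
  have h1 : HasDerivAt (fun z : ℝ => rt β / ε * (z : ℂ)) (rt β / ε) z := by
    simpa using ((hasDerivAt_id (z : ℂ)).const_mul (rt β / ε)).comp_ofReal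
  have := ((Complex.hasDerivAt_cosh _).comp z h1).div_const (ε * rt β * sinh (rt β / ε))
  refine this.congr_deriv ?_
  have hr := rt_ne_zero β
  have hs := sinh_rt_ne_zero hε h
  have hε' : (ε : ℂ) ≠ 0 := by exact_mod_cast hε.ne'
  field_simp

lemma hasDerivAt_profQ {ε : ℝ} (hε : 0 < ε) {β : ℂ} (h : β ∈ sector) (z : ℝ) :
    HasDerivAt (fun z : ℝ => profQ ε β z) (β * profM ε β z) z := by
  have := (hasDerivAt_profK hε h z).const_mul β
  refine this.congr_of_eventuallyEq (Eventually.of_forall fun z => ?_)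
  exact (mul_div_cancel₀ (profQ ε β z) h.1).symm

lemma mem_sector_of_re_pos {β : ℂ} (h : 0 < β.re) : β ∈ sector :=
  ⟨fun h0 => by simp [h0] at h, by have := norm_nonneg β; linarith⟩

/-! ### Smooth functions of `(y, z)` -/

lemma contDiff_rt_comp {E : Type*} [NormedAddCommGroup E] [NormedSpace ℝ E] {b : E → ℂ}
    (hb : ContDiff ℝ ∞ b) (hs : ∀ y, b y ∈ sector) : ContDiff ℝ ∞ fun y => rt (b y) := by
  have h1 : ContDiff ℝ ∞ fun y => Complex.log (b y) := contDiff_iff_contDiffAt.2 fun y =>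
    ((Complex.contDiffAt_log (sector_subset_slitPlane (hs y))).restrict_scalars ℝ).comp y
      hb.contDiffAt
  exact (h1.div_const 2).cexp

lemma ContDiff.div_complex {E : Type*} [NormedAddCommGroup E] [NormedSpace ℝ E] {f g : E → ℂ}
    (hf : ContDiff ℝ ∞ f) (hg : ContDiff ℝ ∞ g) (h0 : ∀ w, g w ≠ 0) :
    ContDiff ℝ ∞ fun w => f w / g w := by
  simp only [div_eq_mul_inv]
  exact hf.mul (hg.inv h0)

lemma contDiff_prof {ε : ℝ} (hε : 0 < ε) {b : ℝ → ℂ} (hb : ContDiff ℝ ∞ b)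
    (hs : ∀ y, b y ∈ sector) :
    ContDiff ℝ ∞ ↿(fun y z => profQ ε (b y) z) ∧ ContDiff ℝ ∞ ↿(fun y z => profK ε (b y) z) ∧
      ContDiff ℝ ∞ ↿(fun y z => profM ε (b y) z) := by
  have hb' : ContDiff ℝ ∞ fun w : ℝ × ℝ => b w.1 := hb.comp contDiff_fst
  have hr := contDiff_rt_comp hb' (fun w => hs w.1)
  have hz : ContDiff ℝ ∞ fun w : ℝ × ℝ => (w.2 : ℂ) := Complex.ofRealCLM.contDiff.comp contDiff_snd
  have h1 : ContDiff ℝ ∞ fun w : ℝ × ℝ => rt (b w.1) / ε := hr.div_const _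
  have h2 : ContDiff ℝ ∞ fun w : ℝ × ℝ => sinh (rt (b w.1) / ε) :=
    (Complex.contDiff_sinh.restrict_scalars ℝ).comp h1
  have h3 : ContDiff ℝ ∞ fun w : ℝ × ℝ => sinh (rt (b w.1) / ε * w.2) :=
    (Complex.contDiff_sinh.restrict_scalars ℝ).comp (h1.mul hz)
  have h4 : ContDiff ℝ ∞ fun w : ℝ × ℝ => cosh (rt (b w.1) / ε * w.2) :=
    (Complex.contDiff_cosh.restrict_scalars ℝ).comp (h1.mul hz)
  have hQ : ContDiff ℝ ∞ fun w : ℝ × ℝ => profQ ε (b w.1) w.2 :=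
    ContDiff.div_complex h3 h2 fun w : ℝ × ℝ => sinh_rt_ne_zero hε (hs w.1)
  have hK : ContDiff ℝ ∞ fun w : ℝ × ℝ => profK ε (b w.1) w.2 :=
    ContDiff.div_complex hQ hb' fun w : ℝ × ℝ => (hs w.1).1
  have hM : ContDiff ℝ ∞ fun w : ℝ × ℝ => profM ε (b w.1) w.2 :=
    ContDiff.div_complex h4 ((contDiff_const.mul hr).mul h2) fun w : ℝ × ℝ =>
      mul_ne_zero (mul_ne_zero (by exact_mod_cast hε.ne') (rt_ne_zero _))
        (sinh_rt_ne_zero hε (hs w.1))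
  exact ⟨hQ, hK, hM⟩

/-- The partial derivative in `y`. -/
def dY (k : ℝ → ℝ → ℂ) : ℝ → ℝ → ℂ := fun y z => deriv (fun y => k y z) y

lemma hasDerivAt_fst_of_contDiff {k : ℝ → ℝ → ℂ} (hk : ContDiff ℝ ∞ ↿k) (y z : ℝ) :
    HasDerivAt (fun y => k y z) (fderiv ℝ ↿k (y, z) (1, 0)) y := by
  have h1 : HasDerivAt (fun t : ℝ => (t, z)) (1, 0) y :=
    (hasDerivAt_id y).prodMk (hasDerivAt_const y z)
  exact (hk.differentiable (by simp) (y, z)).hasFDerivAt.comp_hasDerivAt y h1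

lemma hasDerivAt_snd_of_contDiff {k : ℝ → ℝ → ℂ} (hk : ContDiff ℝ ∞ ↿k) (y z : ℝ) :
    HasDerivAt (fun z => k y z) (fderiv ℝ ↿k (y, z) (0, 1)) z := by
  have h1 : HasDerivAt (fun t : ℝ => (y, t)) (0, 1) z :=
    (hasDerivAt_const z y).prodMk (hasDerivAt_id z)
  exact (hk.differentiable (by simp) (y, z)).hasFDerivAt.comp_hasDerivAt z h1

lemma hasDerivAt_dY {k : ℝ → ℝ → ℂ} (hk : ContDiff ℝ ∞ ↿k) (y z : ℝ) :
    HasDerivAt (fun y => k y z) (dY k y z) y :=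
  (hasDerivAt_fst_of_contDiff hk y z).differentiableAt.hasDerivAt

lemma contDiff_dY {k : ℝ → ℝ → ℂ} (hk : ContDiff ℝ ∞ ↿k) : ContDiff ℝ ∞ ↿(dY k) := by
  have : (↿(dY k) : ℝ × ℝ → ℂ) = fun w => fderiv ℝ ↿k w (1, 0) :=
    funext fun w => (hasDerivAt_fst_of_contDiff hk w.1 w.2).deriv
  rw [this]
  exact (hk.fderiv_right (m := ∞) (by simp)).clm_apply contDiff_const

lemma contDiff_slice {k : ℝ → ℝ → ℂ} (hk : ContDiff ℝ ∞ ↿k) (z : ℝ) :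
    ContDiff ℝ ∞ fun y => k y z :=
  hk.comp (by fun_prop : ContDiff ℝ ∞ fun y : ℝ => (y, z))

lemma hasDerivAt_dY_snd {k k' : ℝ → ℝ → ℂ} (hk : ContDiff ℝ ∞ ↿k)
    (hd : ∀ y z, HasDerivAt (fun z => k y z) (k' y z) z) (y z : ℝ) :
    HasDerivAt (fun z => dY k y z) (dY k' y z) z := by
  have e1 : (↿(dY k) : ℝ × ℝ → ℂ) = fun w => fderiv ℝ ↿k w (1, 0) :=
    funext fun w => (hasDerivAt_fst_of_contDiff hk w.1 w.2).deriv
  have e2 : (↿k' : ℝ × ℝ → ℂ) = fun w => fderiv ℝ ↿k w (0, 1) :=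
    funext fun w => (hd w.1 w.2).unique (hasDerivAt_snd_of_contDiff hk w.1 w.2)
  have hk' : ContDiff ℝ ∞ (↿k' : ℝ × ℝ → ℂ) := by
    rw [e2]
    exact (hk.fderiv_right (m := ∞) (by simp)).clm_apply contDiff_const
  have h1 := hasDerivAt_snd_of_contDiff (contDiff_dY hk) y z
  refine h1.congr_deriv ?_
  have h2 := (hasDerivAt_fst_of_contDiff hk' y z).deriv
  have hdf : DifferentiableAt ℝ (fderiv ℝ (↿k : ℝ × ℝ → ℂ)) (y, z) :=
    ((hk.fderiv_right (m := ∞) (by simp)).differentiable (by simp)) _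
  have hs : IsSymmSndFDerivAt ℝ (↿k : ℝ × ℝ → ℂ) (y, z) :=
    (hk.contDiffAt).isSymmSndFDerivAt (by
      simp only [minSmoothness_of_isRCLikeNormedField]
      exact ENat.LEInfty.out)
  have h : ∀ a b : ℝ × ℝ, fderiv ℝ (fun w => fderiv ℝ (↿k : ℝ × ℝ → ℂ) w b) (y, z) a =
      fderiv ℝ (fderiv ℝ (↿k : ℝ × ℝ → ℂ)) (y, z) a b := by
    intro a b
    rw [fderiv_clm_apply hdf (differentiableAt_const b)]
    simp
  change _ = deriv (fun y => k' y z) y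
  rw [h2, e1, e2, h, h]
  exact hs _ _

/-! ### Regularised Coriolis factors -/

/-- A Coriolis factor on the line that vanishes at the equator, with `c⁻¹ ≤ b' ≤ c` and
`b'` Lipschitz with constant `L`. -/
structure CoreB (b : ℝ → ℝ) (c L : ℝ) : Prop where
  two_le : 2 ≤ c
  nonneg : 0 ≤ L
  diff : Differentiable ℝ b
  zero : b 0 = 0
  le_deriv : ∀ y, c⁻¹ ≤ deriv b y
  deriv_le : ∀ y, deriv b y ≤ c
  lip : ∀ y y', |deriv b y - deriv b y'| ≤ L * |y - y'|

/-- A fixed smooth even mollifier supported in `[-1, 1]`. -/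
def bumpFn : ℝ → ℝ :=
  (⟨1 / 2, 1, by norm_num, by norm_num⟩ : ContDiffBump (0 : ℝ)).normed volume

lemma bumpFn_contDiff : ContDiff ℝ ∞ bumpFn := ContDiffBump.contDiff_normed _
lemma bumpFn_nonneg (t : ℝ) : 0 ≤ bumpFn t := ContDiffBump.nonneg_normed _ _
lemma bumpFn_integral : ∫ t, bumpFn t = 1 := ContDiffBump.integral_normed _
lemma bumpFn_neg (t : ℝ) : bumpFn (-t) = bumpFn t := by
  unfold bumpFn
  exact ContDiffBump.normed_neg _ t
lemma bumpFn_compact : HasCompactSupport bumpFn := ContDiffBump.hasCompactSupport_normed _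
lemma bumpFn_eq_zero {t : ℝ} (h : 1 ≤ |t|) : bumpFn t = 0 := by
  by_contra hne
  have : t ∈ Function.support bumpFn := hne
  unfold bumpFn at this
  rw [ContDiffBump.support_normed_eq] at this
  have := mem_ball_zero_iff.1 this
  rw [Real.norm_eq_abs] at this
  change |t| < 1 at this
  linarith

/-- The mollifier at scale `δ`. -/
def bumpAt (δ t : ℝ) : ℝ := δ⁻¹ * bumpFn (δ⁻¹ * t)

lemma bumpAt_contDiff (δ : ℝ) : ContDiff ℝ ∞ (bumpAt δ) :=
  contDiff_const.mul (bumpFn_contDiff.comp (by fun_prop))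

lemma bumpAt_nonneg {δ : ℝ} (hδ : 0 < δ) (t : ℝ) : 0 ≤ bumpAt δ t :=
  mul_nonneg (inv_nonneg.2 hδ.le) (bumpFn_nonneg _)

lemma bumpAt_integral {δ : ℝ} (hδ : 0 < δ) : ∫ t, bumpAt δ t = 1 := by
  unfold bumpAt
  rw [integral_const_mul, Measure.integral_comp_mul_left bumpFn, bumpFn_integral, inv_inv,
    abs_of_pos hδ]
  simp [hδ.ne']

lemma bumpAt_compact {δ : ℝ} (hδ : 0 < δ) : HasCompactSupport (bumpAt δ) := by
  have : HasCompactSupport fun t => bumpFn (δ⁻¹ * t) :=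
    bumpFn_compact.comp_homeomorph (Homeomorph.mulLeft₀ δ⁻¹ (inv_ne_zero hδ.ne'))
  exact this.mul_left

lemma bumpAt_eq_zero {δ : ℝ} (hδ : 0 < δ) {t : ℝ} (h : δ ≤ |t|) : bumpAt δ t = 0 := by
  unfold bumpAt
  rw [bumpFn_eq_zero, mul_zero]
  rw [abs_mul, abs_of_pos (inv_pos.2 hδ), inv_mul_eq_div, one_le_div hδ]
  exact h

lemma bumpAt_neg (δ t : ℝ) : bumpAt δ (-t) = bumpAt δ t := by
  unfold bumpAt
  rw [mul_neg, bumpFn_neg]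

lemma deriv_bumpAt_integral {δ : ℝ} (hδ : 0 < δ) :
    ∫ t, |deriv (bumpAt δ) t| = δ⁻¹ * ∫ t, |deriv bumpFn t| := by
  have h1 : ∀ t, deriv (bumpAt δ) t = δ⁻¹ * (δ⁻¹ * deriv bumpFn (δ⁻¹ * t)) := by
    intro t
    have h2 : HasDerivAt (fun t : ℝ => δ⁻¹ * t) δ⁻¹ t := by
      simpa using (hasDerivAt_id t).const_mul δ⁻¹
    have h3 := ((bumpFn_contDiff.differentiable (by simp) (δ⁻¹ * t)).hasDerivAt.comp t h2).const_mul
      δ⁻¹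
    rw [mul_comm δ⁻¹ (deriv _ _)]
    exact h3.deriv
  have h4 : ∀ t, |deriv (bumpAt δ) t| = δ⁻¹ * (δ⁻¹ * |deriv bumpFn (δ⁻¹ * t)|) := by
    intro t
    rw [h1, abs_mul, abs_mul, abs_of_pos (inv_pos.2 hδ)]
  simp only [h4, integral_const_mul]
  rw [Measure.integral_comp_mul_left (fun t => |deriv bumpFn t|), inv_inv, abs_of_pos hδ, smul_eq_mul]
  field_simp

/-- The mollification `∫ ψ(t) h(y - t) dt`. -/
def moll (ψ h : ℝ → ℝ) (y : ℝ) : ℝ := ∫ t, ψ t * h (y - t)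

lemma moll_contDiff {ψ h : ℝ → ℝ} (hψ : ContDiff ℝ ∞ ψ) (hc : HasCompactSupport ψ)
    (hh : Continuous h) : ContDiff ℝ ∞ (moll ψ h) :=
  hc.contDiff_convolution_left (ContinuousLinearMap.mul ℝ ℝ) hψ hh.locallyIntegrable

lemma deriv_moll_left {ψ h : ℝ → ℝ} (hψ : ContDiff ℝ ∞ ψ) (hc : HasCompactSupport ψ)
    (hh : Continuous h) : deriv (moll ψ h) = moll (deriv ψ) h :=
  funext fun y => (hc.hasDerivAt_convolution_left (ContinuousLinearMap.mul ℝ ℝ)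
    (hψ.of_le (by simp)) hh.locallyIntegrable y).deriv

lemma moll_integrable {ψ h : ℝ → ℝ} (hψ : Continuous ψ) (hc : HasCompactSupport ψ)
    (hh : Continuous h) (y : ℝ) : Integrable fun t => ψ t * h (y - t) :=
  (hψ.mul (hh.comp (by fun_prop))).integrable_of_hasCompactSupport hc.mul_right

lemma moll_lip {ψ h : ℝ → ℝ} (hψ : Continuous ψ) (hc : HasCompactSupport ψ)
    (hh : Continuous h) {L : ℝ} (hL : ∀ y y', |h y - h y'| ≤ L * |y - y'|) (y y' : ℝ) :
    |moll ψ h y - moll ψ h y'| ≤ (∫ t, |ψ t|) * L * |y - y'| := by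
  unfold moll
  rw [← integral_sub (moll_integrable hψ hc hh y) (moll_integrable hψ hc hh y'), mul_assoc,
    ← integral_mul_const]
  have hi : Integrable fun t => |ψ t| := (hψ.integrable_of_hasCompactSupport hc).abs
  rw [← Real.norm_eq_abs]
  refine norm_integral_le_of_norm_le (hi.mul_const (L * |y - y'|))
    (Eventually.of_forall fun t => ?_)
  rw [← mul_sub, norm_mul, Real.norm_eq_abs, Real.norm_eq_abs]
  have := hL (y - t) (y' - t)
  rw [sub_sub_sub_cancel_right] at this
  gcongr

lemma abs_deriv_le_of_lip {h : ℝ → ℝ} {L : ℝ} (h0 : 0 ≤ L)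
    (hL : ∀ y y', |h y - h y'| ≤ L * |y - y'|) (y : ℝ) : |deriv h y| ≤ L := by
  have : LipschitzWith L.toNNReal h := LipschitzWith.of_dist_le_mul fun a b => by
    rw [Real.dist_eq, Real.dist_eq, Real.coe_toNNReal _ h0]
    exact hL a b
  have := norm_deriv_le_of_lipschitz this (x₀ := y)
  rwa [Real.coe_toNNReal _ h0] at this

lemma CoreB.continuous_deriv {b : ℝ → ℝ} {c L : ℝ} (hb : CoreB b c L) : Continuous (deriv b) := by
  have : LipschitzWith L.toNNReal (deriv b) := LipschitzWith.of_dist_le_mul fun y y' => by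
    rw [Real.dist_eq, Real.dist_eq, Real.coe_toNNReal _ hb.nonneg]
    exact hb.lip y y'
  exact this.continuous

lemma CoreB.abs_sub_linear_le {b : ℝ → ℝ} {c L : ℝ} (hb : CoreB b c L) (y t : ℝ) :
    |b (y - t) - b y + t * deriv b y| ≤ L * t ^ 2 := by
  have h : ∀ s, HasDerivAt (fun s => b s - s * deriv b y) (deriv b s - deriv b y) s := fun s => by
    exact ((hb.diff s).hasDerivAt.sub ((hasDerivAt_id s).mul_const (deriv b y))).congr_deriv
      (by rw [one_mul])
  have := Convex.norm_image_sub_le_of_norm_hasDerivWithin_le (s := Set.uIcc y (y - t))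
    (C := L * |t|) (fun s _ => (h s).hasDerivWithinAt) (fun s hs => ?_) (convex_uIcc _ _)
    Set.left_mem_uIcc Set.right_mem_uIcc
  · rw [Real.norm_eq_abs, Real.norm_eq_abs] at this
    rw [show b (y - t) - b y + t * deriv b y =
      b (y - t) - (y - t) * deriv b y - (b y - y * deriv b y) by ring]
    refine this.trans (le_of_eq ?_)
    rw [show y - t - y = -t by ring, abs_neg, mul_assoc, abs_mul_abs_self, sq]
  · rw [Real.norm_eq_abs]
    refine (hb.lip s y).trans (mul_le_mul_of_nonneg_left ?_ hb.nonneg)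
    have := Set.abs_sub_left_of_mem_uIcc hs
    rw [abs_sub_comm]
    simpa [abs_sub_comm] using this

lemma CoreB.hasDerivAt_moll {b : ℝ → ℝ} {c L : ℝ} (hb : CoreB b c L) {ψ : ℝ → ℝ}
    (hψ : Continuous ψ) (hc : HasCompactSupport ψ) (y : ℝ) :
    HasDerivAt (moll ψ b) (moll ψ (deriv b) y) y := by
  have hbound : ∀ s, |deriv b s| ≤ c := fun s => abs_le.2
    ⟨by have := hb.le_deriv s; have := hb.two_le; have : 0 < c⁻¹ := inv_pos.2 (by linarith)
        linarith, hb.deriv_le s⟩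
  refine (hasDerivAt_integral_of_dominated_loc_of_deriv_le (F := fun y t => ψ t * b (y - t))
    (F' := fun y t => ψ t * deriv b (y - t)) (bound := fun t => |ψ t| * c) univ_mem
    (Eventually.of_forall fun s =>
      (moll_integrable hψ hc hb.diff.continuous s).aestronglyMeasurable)
    (moll_integrable hψ hc hb.diff.continuous y)
    (moll_integrable hψ hc hb.continuous_deriv y).aestronglyMeasurable
    (Eventually.of_forall fun t s _ => ?_)
    ((hψ.integrable_of_hasCompactSupport hc).abs.mul_const c)
    (Eventually.of_forall fun t s _ => ?_)).2
  · rw [norm_mul, Real.norm_eq_abs, Real.norm_eq_abs]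
    gcongr
    exact hbound _
  · have := ((hb.diff (s - t)).hasDerivAt.comp_sub_const s t).const_mul (ψ t)
    exact this

/-- Smooth Coriolis factors close to `b` at scale `δ`. -/
structure Smoothed (b g : ℝ → ℝ) (c L C₀ δ : ℝ) : Prop where
  contDiff : ContDiff ℝ ∞ g
  zero : g 0 = 0
  le_deriv : ∀ y, c⁻¹ ≤ deriv g y
  deriv_le : ∀ y, deriv g y ≤ c
  deriv2 : ∀ y, |deriv (deriv g) y| ≤ L
  deriv3 : ∀ y, |deriv (deriv (deriv g)) y| ≤ C₀ * L / δ
  close : ∀ y, |g y - b y| ≤ 2 * L * δ ^ 2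

lemma CoreB.exists_smoothed {b : ℝ → ℝ} {c L : ℝ} (hb : CoreB b c L) {δ : ℝ} (hδ : 0 < δ) :
    ∃ g, Smoothed b g c L (∫ t, |deriv bumpFn t|) δ := by
  set ψ := bumpAt δ
  have cψ : ContDiff ℝ ∞ ψ := bumpAt_contDiff δ
  have sψ : HasCompactSupport ψ := bumpAt_compact hδ
  have cψ' : ContDiff ℝ ∞ (deriv ψ) := by
    have := (contDiff_infty_iff_deriv.1 cψ).2
    exact this
  have iψ : Integrable ψ := cψ.continuous.integrable_of_hasCompactSupport sψ
  have hcont := hb.diff.continuous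
  have d1 : deriv (moll ψ b) = moll ψ (deriv b) :=
    funext fun y => (hb.hasDerivAt_moll cψ.continuous sψ y).deriv
  have d2 : deriv (moll ψ (deriv b)) = moll (deriv ψ) (deriv b) :=
    deriv_moll_left cψ sψ hb.continuous_deriv
  have n1 : ∫ t, |ψ t| = 1 := by
    simp only [ψ, abs_of_nonneg (bumpAt_nonneg hδ _)]
    exact bumpAt_integral hδ
  have hconst : ∀ a : ℝ, ∫ t, ψ t * a = a := fun a => by
    rw [integral_mul_const, bumpAt_integral hδ, one_mul]
  have hclose : ∀ y, |moll ψ b y - b y| ≤ L * δ ^ 2 := by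
    intro y
    have i1 := moll_integrable cψ.continuous sψ hcont y
    have i3 : Integrable fun t => ψ t * (t * deriv b y) :=
      (cψ.continuous.mul (by fun_prop)).integrable_of_hasCompactSupport sψ.mul_right
    have odd : ∫ t, ψ t * (t * deriv b y) = 0 := by
      have := integral_neg_eq_self (fun t => ψ t * (t * deriv b y)) volume
      simp only [ψ, bumpAt_neg, neg_mul, mul_neg, integral_neg] at this
      simp only [ψ]
      linarith
    have e : moll ψ b y - b y = ∫ t, ψ t * (b (y - t) - b y + t * deriv b y) := by
      have k1 := integral_sub i1 (iψ.mul_const (b y))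
      have k2 := integral_add (i1.sub (iψ.mul_const (b y))) i3
      simp only [Pi.sub_apply, hconst] at k1 k2
      rw [k1, odd, add_zero] at k2
      refine k2.symm.trans (integral_congr_ae (Eventually.of_forall fun t => ?_))
      simp only; ring
    rw [e]
    have hb2 : ∀ t, ‖ψ t * (b (y - t) - b y + t * deriv b y)‖ ≤ ψ t * (L * δ ^ 2) := by
      intro t
      rw [norm_mul, Real.norm_of_nonneg (bumpAt_nonneg hδ t), Real.norm_eq_abs]
      rcases le_or_gt δ |t| with h | h
      · simp [ψ, bumpAt_eq_zero hδ h]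
      · refine mul_le_mul_of_nonneg_left ((hb.abs_sub_linear_le y t).trans ?_) (bumpAt_nonneg hδ t)
        refine mul_le_mul_of_nonneg_left ?_ hb.nonneg
        rw [← sq_abs]
        gcongr
    have := norm_integral_le_of_norm_le (iψ.mul_const (L * δ ^ 2)) (Eventually.of_forall hb2)
    rwa [hconst, Real.norm_eq_abs] at this
  have dg : deriv (fun y => moll ψ b y - moll ψ b 0) = moll ψ (deriv b) := by
    funext y
    rw [deriv_sub_const]
    exact congrFun d1 y
  refine ⟨fun y => moll ψ b y - moll ψ b 0, (moll_contDiff cψ sψ hcont).sub contDiff_const,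
    sub_self _, fun y => ?_, fun y => ?_, fun y => ?_, fun y => ?_, fun y => ?_⟩
  · rw [dg, ← hconst c⁻¹]
    exact integral_mono (iψ.mul_const _) (moll_integrable cψ.continuous sψ hb.continuous_deriv y)
      fun t => mul_le_mul_of_nonneg_left (hb.le_deriv _) (bumpAt_nonneg hδ t)
  · rw [dg, ← hconst c]
    exact integral_mono (moll_integrable cψ.continuous sψ hb.continuous_deriv y) (iψ.mul_const _)
      fun t => mul_le_mul_of_nonneg_left (hb.deriv_le _) (bumpAt_nonneg hδ t)
  · rw [dg]
    refine abs_deriv_le_of_lip hb.nonneg (fun a a' => ?_) y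
    have := moll_lip cψ.continuous sψ hb.continuous_deriv hb.lip a a'
    rwa [n1, one_mul] at this
  · rw [dg, d2, mul_div_right_comm]
    have h1 : ∫ t, |deriv ψ t| = (∫ t, |deriv bumpFn t|) / δ := by
      rw [deriv_bumpAt_integral hδ, inv_mul_eq_div]
    rw [← h1]
    exact abs_deriv_le_of_lip (mul_nonneg (integral_nonneg fun t => abs_nonneg _) hb.nonneg)
      (moll_lip cψ'.continuous sψ.deriv hb.continuous_deriv hb.lip) y
  · have h1 := hclose y
    have h2 := hclose 0
    rw [hb.zero, sub_zero] at h2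
    have := abs_sub (moll ψ b y - b y) (moll ψ b 0)
    rw [show moll ψ b y - moll ψ b 0 - b y = moll ψ b y - b y - moll ψ b 0 by ring]
    linarith

lemma abs_ge_of_deriv_ge {g : ℝ → ℝ} {c : ℝ} (_hc : 0 < c) (hd : Differentiable ℝ g)
    (h0 : g 0 = 0) (h1 : ∀ y, c⁻¹ ≤ deriv g y) (y : ℝ) : |y| / c ≤ |g y| := by
  have hm : Monotone fun y => g y - c⁻¹ * y := by
    refine monotone_of_deriv_nonneg (hd.sub (by fun_prop)) fun y => ?_
    have : HasDerivAt (fun y => g y - c⁻¹ * y) (deriv g y - c⁻¹) y := by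
      exact ((hd y).hasDerivAt.sub ((hasDerivAt_id y).const_mul c⁻¹)).congr_deriv (by rw [mul_one])
    rw [this.deriv]
    linarith [h1 y]
  rcases le_total 0 y with h | h
  · have := hm h
    simp only [h0, mul_zero, sub_zero] at this
    rw [abs_of_nonneg h, div_eq_inv_mul]
    exact (by linarith : c⁻¹ * y ≤ g y).trans (le_abs_self _)
  · have := hm h
    simp only [h0, mul_zero, sub_zero] at this
    rw [abs_of_nonpos h, div_eq_inv_mul]
    exact (by linarith : c⁻¹ * -y ≤ -g y).trans (neg_le_abs _)

/-! ### The complex Coriolis parameter -/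

/-- The friction that regularises the profile at the equator. -/
def fric (ε y : ℝ) : ℝ := ε ^ 3 / (ε ^ 2 + y ^ 2)

/-- The regularised complex Coriolis parameter. -/
def cor (ε : ℝ) (g : ℝ → ℝ) (y : ℝ) : ℂ := fric ε y + g y * I

lemma fric_pos {ε : ℝ} (hε : 0 < ε) (y : ℝ) : 0 < fric ε y := by unfold fric; positivity

lemma fric_mul_sq_le {ε : ℝ} (hε : 0 < ε) (y : ℝ) : fric ε y * y ^ 2 ≤ ε ^ 3 := by
  unfold fric
  rw [div_mul_eq_mul_div, div_le_iff₀ (by positivity)]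
  nlinarith [pow_pos hε 3, pow_pos hε 5]

lemma cor_re (ε : ℝ) (g : ℝ → ℝ) (y : ℝ) : (cor ε g y).re = fric ε y := by simp [cor]

lemma cor_im (ε : ℝ) (g : ℝ → ℝ) (y : ℝ) : (cor ε g y).im = g y := by simp [cor]

/-- The first derivative of `fric`. -/
def fric₁ (ε y : ℝ) : ℝ := -(2 * y * ε ^ 3) / (ε ^ 2 + y ^ 2) ^ 2

/-- The second derivative of `fric`. -/
def fric₂ (ε y : ℝ) : ℝ := ε ^ 3 * (6 * y ^ 2 - 2 * ε ^ 2) / (ε ^ 2 + y ^ 2) ^ 3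

lemma hasDerivAt_fric {ε : ℝ} (hε : 0 < ε) (y : ℝ) : HasDerivAt (fric ε) (fric₁ ε y) y := by
  have h0 : ε ^ 2 + y ^ 2 ≠ 0 := by positivity
  have h1 : HasDerivAt (fun y : ℝ => ε ^ 2 + y ^ 2) (2 * y) y := by
    simpa using (hasDerivAt_pow 2 y).const_add (ε ^ 2)
  have := (hasDerivAt_const y (ε ^ 3)).div h1 h0
  refine this.congr_deriv ?_
  unfold fric₁
  ring

lemma hasDerivAt_fric₁ {ε : ℝ} (hε : 0 < ε) (y : ℝ) : HasDerivAt (fric₁ ε) (fric₂ ε y) y := by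
  have h0 : ε ^ 2 + y ^ 2 ≠ 0 := by positivity
  have h1 : HasDerivAt (fun y : ℝ => (ε ^ 2 + y ^ 2) ^ 2) (2 * (ε ^ 2 + y ^ 2) * (2 * y)) y := by
    have : HasDerivAt (fun y : ℝ => ε ^ 2 + y ^ 2) (2 * y) y := by
      simpa using (hasDerivAt_pow 2 y).const_add (ε ^ 2)
    exact (this.pow 2).congr_deriv (by push_cast; ring)
  have h2 : HasDerivAt (fun y : ℝ => -(2 * y * ε ^ 3)) (-(2 * ε ^ 3)) y := by
    exact (((hasDerivAt_id y).const_mul 2).mul_const (ε ^ 3)).neg.congr_deriv (by ring)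
  have := h2.div h1 (pow_ne_zero 2 h0)
  refine this.congr_deriv ?_
  unfold fric₂
  field_simp
  ring

lemma abs_fric₁_le {ε : ℝ} (hε : 0 < ε) (y : ℝ) : |fric₁ ε y| ≤ 1 := by
  unfold fric₁
  rw [abs_div, abs_neg, abs_of_pos (show 0 < (ε ^ 2 + y ^ 2) ^ 2 by positivity),
    div_le_one (by positivity), abs_mul, abs_mul, abs_of_pos (pow_pos hε 3), abs_two]
  have h1 : 2 * |y| * ε ≤ ε ^ 2 + y ^ 2 := by nlinarith [sq_nonneg (|y| - ε), sq_abs y]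
  calc 2 * |y| * ε ^ 3 = 2 * |y| * ε * ε ^ 2 := by ring
    _ ≤ (ε ^ 2 + y ^ 2) * (ε ^ 2 + y ^ 2) := by gcongr; nlinarith
    _ = _ := by ring

lemma abs_fric₂_le {ε : ℝ} (hε : 0 < ε) (y : ℝ) : |fric₂ ε y| ≤ 6 / ε := by
  unfold fric₂
  rw [abs_div, abs_of_pos (show 0 < (ε ^ 2 + y ^ 2) ^ 3 by positivity),
    div_le_div_iff₀ (by positivity) hε, abs_mul, abs_of_pos (pow_pos hε 3)]
  have h1 : |6 * y ^ 2 - 2 * ε ^ 2| ≤ 6 * (ε ^ 2 + y ^ 2) :=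
    abs_le.2 ⟨by nlinarith [sq_nonneg y, sq_nonneg ε], by nlinarith [sq_nonneg y, sq_nonneg ε]⟩
  calc ε ^ 3 * |6 * y ^ 2 - 2 * ε ^ 2| * ε ≤ ε ^ 3 * (6 * (ε ^ 2 + y ^ 2)) * ε := by gcongr
    _ = 6 * (ε ^ 2 * ε ^ 2 * (ε ^ 2 + y ^ 2)) := by ring
    _ ≤ 6 * ((ε ^ 2 + y ^ 2) * (ε ^ 2 + y ^ 2) * (ε ^ 2 + y ^ 2)) := by
        have : ε ^ 2 ≤ ε ^ 2 + y ^ 2 := by nlinarith [sq_nonneg y]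
        gcongr
    _ = _ := by ring

lemma contDiff_fric {ε : ℝ} (hε : 0 < ε) : ContDiff ℝ ∞ (fric ε) :=
  ContDiff.div contDiff_const (by fun_prop) fun y => by positivity

section Cor

variable {b g : ℝ → ℝ} {c L C₀ δ ε : ℝ}

lemma Smoothed.contDiff_cor (hg : Smoothed b g c L C₀ δ) (hε : 0 < ε) :
    ContDiff ℝ ∞ (cor ε g) :=
  (Complex.ofRealCLM.contDiff.comp (contDiff_fric hε)).add
    ((Complex.ofRealCLM.contDiff.comp hg.contDiff).mul contDiff_const)

lemma Smoothed.hasDerivAt_cor (hg : Smoothed b g c L C₀ δ) (hε : 0 < ε) (y : ℝ) :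
    HasDerivAt (cor ε g) (fric₁ ε y + deriv g y * I) y :=
  (hasDerivAt_fric hε y).ofReal_comp.add
    (((hg.contDiff.differentiable (by simp) y).hasDerivAt.ofReal_comp).mul_const _)

lemma Smoothed.contDiff_deriv (hg : Smoothed b g c L C₀ δ) : ContDiff ℝ ∞ (deriv g) :=
  (contDiff_infty_iff_deriv.1 hg.contDiff).2

lemma Smoothed.contDiff_deriv2 (hg : Smoothed b g c L C₀ δ) : ContDiff ℝ ∞ (deriv (deriv g)) :=
  (contDiff_infty_iff_deriv.1 hg.contDiff_deriv).2

lemma Smoothed.hasDerivAt_cor' (hg : Smoothed b g c L C₀ δ) (hε : 0 < ε) (y : ℝ) :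
    HasDerivAt (fun y => (fric₁ ε y + deriv g y * I : ℂ))
      (fric₂ ε y + deriv (deriv g) y * I) y :=
  (hasDerivAt_fric₁ hε y).ofReal_comp.add
    (((hg.contDiff_deriv.differentiable (by simp) y).hasDerivAt.ofReal_comp).mul_const _)

lemma Smoothed.abs_deriv_le (hg : Smoothed b g c L C₀ δ) (hc : 2 ≤ c) (y : ℝ) :
    |deriv g y| ≤ c :=
  abs_le.2 ⟨by
    have := hg.le_deriv y
    have : 0 < c⁻¹ := inv_pos.2 (by linarith)
    linarith, hg.deriv_le y⟩

lemma norm_add_mul_I_le (a d : ℝ) : ‖(a + d * I : ℂ)‖ ≤ |a| + |d| := by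
  refine (norm_add_le _ _).trans ?_
  simp

lemma Smoothed.lat_le_norm_cor (hg : Smoothed b g c L C₀ δ) (hc : 2 ≤ c) (y : ℝ) :
    |y| / c ≤ ‖cor ε g y‖ := by
  refine (abs_ge_of_deriv_ge (by linarith) (hg.contDiff.differentiable (by simp)) hg.zero
    hg.le_deriv y).trans ?_
  have := Complex.abs_im_le_norm (cor ε g y)
  rwa [cor_im] at this

lemma Smoothed.eps_le_norm_cor (hg : Smoothed b g c L C₀ δ) (hc : 2 ≤ c) (hε : 0 < ε) (y : ℝ) :
    ε / c ≤ ‖cor ε g y‖ := by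
  rcases le_or_gt ε |y| with h | h
  · exact (by gcongr : ε / c ≤ |y| / c).trans (hg.lat_le_norm_cor hc y)
  · have := Complex.abs_re_le_norm (cor ε g y)
    rw [cor_re, abs_of_pos (fric_pos hε y)] at this
    refine le_trans ?_ this
    unfold fric
    rw [div_le_div_iff₀ (by linarith) (by positivity)]
    have h2 : y ^ 2 ≤ ε ^ 2 := by rw [← sq_abs y]; gcongr
    nlinarith [pow_pos hε 3, mul_le_mul_of_nonneg_left h2 hε.le]

lemma Smoothed.norm_cor_pos (hg : Smoothed b g c L C₀ δ) (hc : 2 ≤ c) (hε : 0 < ε) (y : ℝ) :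
    0 < ‖cor ε g y‖ := lt_of_lt_of_le (by positivity) (hg.eps_le_norm_cor hc hε y)

lemma cor_mem_sector (hε : 0 < ε) (g : ℝ → ℝ) (y : ℝ) : cor ε g y ∈ sector :=
  mem_sector_of_re_pos (by rw [cor_re]; exact fric_pos hε y)

end Cor

/-! ### Bounds on the profiles along the Coriolis parameter -/

lemma differentiableAt_deriv_of_sector {f : ℂ → ℂ} (hf : ∀ w ∈ sector, DifferentiableAt ℂ f w)
    {β : ℂ} (h0 : β ≠ 0) (hre : 0 ≤ β.re) : DifferentiableAt ℂ (deriv f) β := by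
  have hp := norm_pos_iff.2 h0
  have h1 : DifferentiableOn ℂ f (Metric.ball β (‖β‖ / 4)) := fun w hw =>
    (hf w (closedBall_subset_sector h0 hre (Metric.ball_subset_closedBall hw)).1).differentiableWithinAt
  exact (h1.deriv Metric.isOpen_ball).differentiableAt
    (Metric.isOpen_ball.mem_nhds (Metric.mem_ball_self (by positivity)))

lemma norm_deriv_comp_le {f : ℂ → ℂ} (hf : ∀ w ∈ sector, DifferentiableAt ℂ f w)
    {β β' β'' : ℝ → ℂ} (hβ : ∀ y, HasDerivAt β (β' y) y) (hβ' : ∀ y, HasDerivAt β' (β'' y) y)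
    (hre : ∀ y, 0 < (β y).re) (y : ℝ) {B : ℝ}
    (hB : ∀ w ∈ Metric.closedBall (β y) (‖β y‖ / 4), ‖f w‖ ≤ B) :
    ‖deriv (fun y => f (β y)) y‖ ≤ 4 * B / ‖β y‖ * ‖β' y‖ ∧
      ‖deriv (deriv fun y => f (β y)) y‖ ≤
        32 * B / ‖β y‖ ^ 2 * ‖β' y‖ ^ 2 + 4 * B / ‖β y‖ * ‖β'' y‖ := by
  have h0 : ∀ y, β y ≠ 0 := fun y h => by have := hre y; simp [h] at this
  have e1 : deriv (fun y => f (β y)) = fun y => deriv f (β y) * β' y := funext fun y =>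
    ((hf _ (mem_sector_of_re_pos (hre y))).hasDerivAt.comp y (hβ y)).deriv
  have e2 : deriv (fun y => deriv f (β y) * β' y) y =
      deriv (deriv f) (β y) * β' y * β' y + deriv f (β y) * β'' y :=
    (((differentiableAt_deriv_of_sector hf (h0 y) (hre y).le).hasDerivAt.comp y (hβ y)).mul
      (hβ' y)).deriv
  obtain ⟨b1, b2⟩ := norm_derivs_le_of_closedBall (h0 y) (hre y).le hf hB
  rw [e1, e2]
  constructor
  · rw [norm_mul]
    gcongr
  · refine (norm_add_le _ _).trans ?_
    rw [norm_mul, norm_mul, norm_mul, mul_assoc, ← sq]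
    gcongr

/-- The profile of the vertical velocity. -/
def kerK (ε : ℝ) (g : ℝ → ℝ) (y z : ℝ) : ℂ := profK ε (cor ε g y) z
/-- The profile of the horizontal velocity. -/
def kerM (ε : ℝ) (g : ℝ → ℝ) (y z : ℝ) : ℂ := profM ε (cor ε g y) z
/-- The profile of the vertical derivative of the horizontal velocity, up to scaling. -/
def kerQ (ε : ℝ) (g : ℝ → ℝ) (y z : ℝ) : ℂ := profQ ε (cor ε g y) z

/-- The constant in the bounds of the profiles. -/
def kerB (c L : ℝ) : ℝ := 192 * c * (1 + c) ^ 2 + 24 * (L + 6)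

/-- Pointwise bounds on the profiles and their derivatives. -/
structure KerBounds (ε : ℝ) (g : ℝ → ℝ) (B y z : ℝ) : Prop where
  K : ‖kerK ε g y z‖ ≤ B * decay ε (cor ε g y) z / ‖cor ε g y‖
  dK : ‖dY (kerK ε g) y z‖ ≤ B * decay ε (cor ε g y) z / ‖cor ε g y‖ ^ 2
  ddK : ‖dY (dY (kerK ε g)) y z‖ ≤ B * decay ε (cor ε g y) z / (ε * ‖cor ε g y‖ ^ 2)
  M : ‖kerM ε g y z‖ ≤ B * decay ε (cor ε g y) z / (ε * √‖cor ε g y‖)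
  dM : ‖dY (kerM ε g) y z‖ ≤ B * decay ε (cor ε g y) z / (ε * ‖cor ε g y‖ * √‖cor ε g y‖)
  Q : ‖kerQ ε g y z‖ ≤ B * decay ε (cor ε g y) z
  dQ : ‖dY (kerQ ε g) y z‖ ≤ B * decay ε (cor ε g y) z / ‖cor ε g y‖

section

variable {b g : ℝ → ℝ} {c L C₀ δ ε : ℝ}

lemma Smoothed.kerBounds (hg : Smoothed b g c L C₀ δ) (hc : 2 ≤ c) (hL : 0 ≤ L) (hε : 0 < ε)
    (hεc : ε ≤ 1 / (4 * c)) (y : ℝ) {z : ℝ} (hz : z ∈ Icc (0 : ℝ) 1) :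
    KerBounds ε g (kerB c L) y z := by
  have hre : ∀ y, 0 < (cor ε g y).re := fun y => by rw [cor_re]; exact fric_pos hε y
  set N := ‖cor ε g y‖ with hN
  have hNp : 0 < N := hg.norm_cor_pos hc hε y
  have hNε : ε / c ≤ N := hg.eps_le_norm_cor hc hε y
  have hc0 : 0 < c := by linarith
  rw [le_div_iff₀ (by positivity)] at hεc
  have hε1 : ε ≤ 1 := by nlinarith
  have h4 : 4 * ε ^ 2 ≤ N := by
    refine le_trans ?_ hNε
    rw [le_div_iff₀ hc0]
    nlinarith
  set d := decay ε (cor ε g y) z with hd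
  have hdp : 0 < d := Real.exp_pos _
  have hball := fun w hw => norm_prof_le_of_mem_closedBall hε (hre y).le h4 hz (w := w) hw
  have hself := hball _ (Metric.mem_closedBall_self (by positivity))
  have b1 : ‖(fric₁ ε y + deriv g y * I : ℂ)‖ ≤ 1 + c :=
    (norm_add_mul_I_le _ _).trans (add_le_add (abs_fric₁_le hε y) (hg.abs_deriv_le hc y))
  have b2 : ‖(fric₂ ε y + deriv (deriv g) y * I : ℂ)‖ ≤ (L + 6) / ε := by
    refine (norm_add_mul_I_le _ _).trans ((add_le_add (abs_fric₂_le hε y) (hg.deriv2 y)).trans ?_)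
    rw [div_add' _ _ _ hε.ne']
    refine div_le_div_of_nonneg_right ?_ hε.le
    nlinarith
  have dK := norm_deriv_comp_le (fun w hw => differentiableAt_profK hε z hw)
    (hg.hasDerivAt_cor hε) (hg.hasDerivAt_cor' hε) hre y (fun w hw => (hball w hw).2.1)
  have dM := norm_deriv_comp_le (fun w hw => differentiableAt_profM hε z hw)
    (hg.hasDerivAt_cor hε) (hg.hasDerivAt_cor' hε) hre y (fun w hw => (hball w hw).2.2)
  have dQ := norm_deriv_comp_le (fun w hw => differentiableAt_profQ hε z hw)
    (hg.hasDerivAt_cor hε) (hg.hasDerivAt_cor' hε) hre y (fun w hw => (hball w hw).1)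
  rw [← hN, ← hd] at hself dK dM dQ
  have hB1 : 24 * (1 + c) ≤ kerB c L := by
    unfold kerB
    nlinarith [mul_pos hc0 hc0, pow_pos hc0 3]
  have hB0 : 6 ≤ kerB c L := by linarith
  have hs : 0 < √N := Real.sqrt_pos.2 hNp
  have hBp : 0 ≤ kerB c L := by linarith
  refine ⟨hself.2.1.trans ?_, dK.1.trans ?_, dK.2.trans ?_, hself.2.2.trans ?_, dM.1.trans ?_,
    hself.1.trans ?_, dQ.1.trans ?_⟩
  · gcongr
  · calc _ ≤ 4 * (6 * d / N) / N * (1 + c) := by gcongr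
      _ = 24 * (1 + c) * d / N ^ 2 := by field_simp; ring
      _ ≤ _ := by gcongr
  · calc _ ≤ 32 * (6 * d / N) / N ^ 2 * (1 + c) ^ 2 + 4 * (6 * d / N) / N * ((L + 6) / ε) := by gcongr
      _ = (192 * (1 + c) ^ 2 * (ε / N) + 24 * (L + 6)) * d / (ε * N ^ 2) := by field_simp; ring
      _ ≤ (192 * (1 + c) ^ 2 * c + 24 * (L + 6)) * d / (ε * N ^ 2) := by
          gcongr
          rw [div_le_iff₀ hc0] at hNε
          rw [div_le_iff₀ hNp]
          linarith
      _ = _ := by unfold kerB; ring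
  · gcongr
    linarith
  · calc _ ≤ 4 * (5 * d / (ε * √N)) / N * (1 + c) := by gcongr
      _ = 20 * (1 + c) * d / (ε * N * √N) := by field_simp; ring
      _ ≤ _ := by gcongr; linarith
  · gcongr
    linarith
  · calc _ ≤ 4 * (4 * d) / N * (1 + c) := by gcongr
      _ = 16 * (1 + c) * d / N := by ring
      _ ≤ _ := by gcongr; linarith

lemma Smoothed.contDiff_ker (hg : Smoothed b g c L C₀ δ) (hε : 0 < ε) :
    ContDiff ℝ ∞ ↿(kerQ ε g) ∧ ContDiff ℝ ∞ ↿(kerK ε g) ∧ ContDiff ℝ ∞ ↿(kerM ε g) :=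
  contDiff_prof hε (hg.contDiff_cor hε) (cor_mem_sector hε g)

lemma hasDerivAt_kerK (hε : 0 < ε) (g : ℝ → ℝ) (y z : ℝ) :
    HasDerivAt (fun z => kerK ε g y z) (kerM ε g y z) z :=
  hasDerivAt_profK hε (cor_mem_sector hε g y) z

lemma hasDerivAt_kerM (hε : 0 < ε) (g : ℝ → ℝ) (y z : ℝ) :
    HasDerivAt (fun z => kerM ε g y z) (kerQ ε g y z / ε ^ 2) z :=
  hasDerivAt_profM hε (cor_mem_sector hε g y) z

lemma hasDerivAt_kerQ (hε : 0 < ε) (g : ℝ → ℝ) (y z : ℝ) :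
    HasDerivAt (fun z => kerQ ε g y z) (cor ε g y * kerM ε g y z) z :=
  hasDerivAt_profQ hε (cor_mem_sector hε g y) z

lemma kerQ_one (hε : 0 < ε) (g : ℝ → ℝ) (y : ℝ) : kerQ ε g y 1 = 1 :=
  profQ_one hε (cor_mem_sector hε g y)

lemma kerQ_zero (ε : ℝ) (g : ℝ → ℝ) (y : ℝ) : kerQ ε g y 0 = 0 := profQ_zero _ _

lemma kerK_one (hε : 0 < ε) (g : ℝ → ℝ) (y : ℝ) : kerK ε g y 1 = 1 / cor ε g y := by
  rw [← kerQ_one hε g y]; rfl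

lemma kerK_zero (ε : ℝ) (g : ℝ → ℝ) (y : ℝ) : kerK ε g y 0 = 0 := by
  unfold kerK profK
  rw [profQ_zero, zero_div]

lemma dY_kerK_zero (ε : ℝ) (g : ℝ → ℝ) (y : ℝ) : dY (kerK ε g) y 0 = 0 := by
  unfold dY
  simp only [kerK_zero]
  exact deriv_const _ _

lemma decay_one (ε : ℝ) (β : ℂ) : decay ε β 1 = 1 := by simp [decay]

end

/-! ### `L²` norms of fields on `ω` -/

lemma lintegral_volSlab_le (D : HDom) (S : Set ℝ) (F : Pt → ℝ≥0∞) :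
    ∫⁻ p, F p ∂D.volSlab S ≤
      ∫⁻ q, (∫⁻ z in 𝕀 ∩ S, F (q.1, q.2, z)) ∂D.hVol := by
  rw [← (measurePreserving_volSlab D S).lintegral_comp_emb
    (MeasurableEquiv.measurableEmbedding _) F]
  exact lintegral_prod_le _

lemma vol_eq_volSlab (D : HDom) : D.vol = D.volSlab (Iio 1) := by
  unfold HDom.vol HDom.volSlab
  congr 1
  ext p
  exact ⟨fun h => ⟨h, h.2.2.2⟩, fun h => h.1⟩

lemma lintegral_decay_le {ε : ℝ} (hε : 0 < ε) {β : ℂ} (hβ : 0 < ‖β‖) {M : ℝ} :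
    ∫⁻ z in 𝕀 ∩ Iio (1 - M * ε), ofReal (decay ε β z ^ 2) ≤
      ofReal (ε / √‖β‖ * Real.exp (-(M * √‖β‖))) := by
  have hs : 0 < √‖β‖ := Real.sqrt_pos.2 hβ
  have ha : 0 < √‖β‖ / ε := by positivity
  have e : ∀ z, decay ε β z ^ 2 = Real.exp (-(√‖β‖ / ε)) * Real.exp (√‖β‖ / ε * z) := fun z => by
    unfold decay
    rw [← Real.exp_nat_mul, ← Real.exp_add]
    congr 1
    field_simp
    push_cast
    ring
  have hi : IntegrableOn (fun z => Real.exp (-(√‖β‖ / ε)) * Real.exp (√‖β‖ / ε * z))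
      (Set.Iic (1 - M * ε)) := (integrableOn_exp_mul_Iic ha _).const_mul _
  calc _ ≤ ∫⁻ z in Set.Iic (1 - M * ε), ofReal (decay ε β z ^ 2) :=
        lintegral_mono_set (Set.inter_subset_right.trans Set.Iio_subset_Iic_self)
    _ = ofReal (∫ z in Set.Iic (1 - M * ε),
          Real.exp (-(√‖β‖ / ε)) * Real.exp (√‖β‖ / ε * z)) := by
        simp only [e]
        rw [ofReal_integral_eq_lintegral_ofReal hi
          (Eventually.of_forall fun z => by positivity)]
    _ = _ := by
        rw [integral_const_mul, integral_exp_mul_Iic ha, mul_div_assoc', ← Real.exp_add]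
        congr 1
        rw [show -(√‖β‖ / ε) + √‖β‖ / ε * (1 - M * ε) = -(M * √‖β‖) by field_simp; ring]
        field_simp

lemma sq_eLpNorm_slab_le (D : HDom) {f : Pt → ℝ} {ε : ℝ} (hε : 0 < ε) {β : ℝ → ℂ}
    (hβ : ∀ y, 0 < ‖β y‖) {G : HPt → ℝ} {M : ℝ}
    (h : ∀ q : HPt, ∀ z ∈ 𝕀, |f (q.1, q.2, z)| ≤ G q * decay ε (β q.2) z) :
    eLpNorm f 2 (D.volSlab (Iio (1 - M * ε))) ^ 2 ≤
      ∫⁻ q, ofReal (G q ^ 2 * (ε / √‖β q.2‖ * Real.exp (-(M * √‖β q.2‖)))) ∂D.hVol := by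
  rw [eLpNorm_two_sq]
  refine (lintegral_volSlab_le _ _ _).trans (lintegral_mono fun q => ?_)
  calc _ ≤ ∫⁻ z in 𝕀 ∩ Iio (1 - M * ε),
        ofReal (G q ^ 2) * ofReal (decay ε (β q.2) z ^ 2) := by
        refine setLIntegral_mono' (measurableSet_Ioo.inter measurableSet_Iio) fun z hz => ?_
        rw [← ofReal_mul (sq_nonneg _), ← mul_pow, ← ofReal_norm, Real.norm_eq_abs,
          ← ofReal_pow (abs_nonneg _)]
        exact ofReal_le_ofReal (pow_le_pow_left₀ (abs_nonneg _) (h q z hz.1) 2)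
    _ ≤ _ := by
        rw [lintegral_const_mul' _ _ ENNReal.ofReal_ne_top, ofReal_mul (sq_nonneg _)]
        gcongr
        exact lintegral_decay_le hε (hβ _)

lemma lintegral_ofReal_sq_le {D : HDom} {E : HPt → ℝ} {W : HPt → ℝ} {A : ℝ} (hA : 0 ≤ A)
    (h : ∀ q, W q ≤ A * E q ^ 2) :
    ∫⁻ q, ofReal (W q) ∂D.hVol ≤ ofReal A * eLpNorm E 2 D.hVol ^ 2 := by
  rw [eLpNorm_two_sq, ← lintegral_const_mul' _ _ ENNReal.ofReal_ne_top]
  refine lintegral_mono fun q => ?_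
  rw [← ofReal_norm, ← ofReal_pow (norm_nonneg _), ← ofReal_mul hA,
    Real.norm_eq_abs, sq_abs]
  exact ofReal_le_ofReal (h q)

lemma eLpNorm_le_of_sq_le_mul {x y : ℝ≥0∞} {A : ℝ}
    (h : x ^ 2 ≤ ofReal A * y ^ 2) : x ≤ ofReal (√A) * y := by
  refine (ENNReal.pow_le_pow_left_iff two_ne_zero).1 ?_
  rcases le_total 0 A with hA | hA
  · rwa [mul_pow, ← ofReal_pow (sqrt_nonneg _), Real.sq_sqrt hA]
  · rw [ENNReal.ofReal_of_nonpos hA, zero_mul] at h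
    exact h.trans zero_le

lemma eLpNorm_vol_le_of_decay (D : HDom) {f : Pt → ℝ} {ε : ℝ} (hε : 0 < ε) {β : ℝ → ℂ}
    (hβ : ∀ y, 0 < ‖β y‖) {G E : HPt → ℝ}
    (h : ∀ q : HPt, ∀ z ∈ 𝕀, |f (q.1, q.2, z)| ≤ G q * decay ε (β q.2) z)
    {A : ℝ} (hA : 0 ≤ A) (hG : ∀ q, G q ^ 2 * (ε / √‖β q.2‖) ≤ A * E q ^ 2) :
    eLpNorm f 2 D.vol ≤ ofReal (√A) * eLpNorm E 2 D.hVol := by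
  refine eLpNorm_le_of_sq_le_mul ?_
  have := sq_eLpNorm_slab_le D hε hβ h (M := 0)
  simp only [zero_mul, sub_zero, neg_zero, Real.exp_zero, mul_one] at this
  rw [vol_eq_volSlab]
  exact this.trans (lintegral_ofReal_sq_le hA hG)

lemma eLpNorm_slab_le_of_decay (D : HDom) {f : Pt → ℝ} {ε : ℝ} (hε : 0 < ε) {β : ℝ → ℂ}
    (hβ : ∀ y, 0 < ‖β y‖) {G E : HPt → ℝ} {M : ℝ}
    (h : ∀ q : HPt, ∀ z ∈ 𝕀, |f (q.1, q.2, z)| ≤ G q * decay ε (β q.2) z)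
    {A : ℝ} (hA : 0 ≤ A)
    (hG : ∀ q, G q ^ 2 * (ε / √‖β q.2‖ * Real.exp (-(M * √‖β q.2‖))) ≤ A * E q ^ 2) :
    eLpNorm f 2 (D.volSlab (Iio (1 - M * ε))) ≤ ofReal (√A) * eLpNorm E 2 D.hVol :=
  eLpNorm_le_of_sq_le_mul ((sq_eLpNorm_slab_le D hε hβ h).trans (lintegral_ofReal_sq_le hA hG))

lemma eLpNorm_volSlab_le (D : HDom) {f : Pt → ℝ} {E : HPt → ℝ} (S : Set ℝ)
    (h : ∀ q : HPt, ∀ z ∈ 𝕀, |f (q.1, q.2, z)| ≤ |E q|) :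
    eLpNorm f 2 (D.volSlab S) ^ 2 ≤ volume (𝕀 ∩ S) * eLpNorm E 2 D.hVol ^ 2 := by
  rw [eLpNorm_two_sq, eLpNorm_two_sq]
  have hV : volume (𝕀 ∩ S) ≠ ⊤ :=
    ((measure_mono Set.inter_subset_left).trans_lt (by simp)).ne
  rw [← lintegral_const_mul' _ _ hV]
  refine (lintegral_volSlab_le _ _ _).trans (lintegral_mono fun q => ?_)
  have hm : ∀ᵐ z ∂volume.restrict (𝕀 ∩ S), z ∈ 𝕀 :=
    ae_restrict_of_ae_restrict_of_subset Set.inter_subset_left (ae_restrict_mem measurableSet_Ioo)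
  calc _ ≤ ∫⁻ z in 𝕀 ∩ S, ‖E q‖ₑ ^ 2 := by
        refine lintegral_mono_ae (hm.mono fun z hz => ?_)
        gcongr
        rw [← ofReal_norm, ← ofReal_norm]
        exact ofReal_le_ofReal (h q z hz)
    _ = _ := by rw [setLIntegral_const, mul_comm]

lemma eLpNorm_vol_le (D : HDom) {f : Pt → ℝ} {E : HPt → ℝ} {A : ℝ} (hA : 0 ≤ A)
    (h : ∀ q : HPt, ∀ z ∈ 𝕀, |f (q.1, q.2, z)| ≤ A * |E q|) :
    eLpNorm f 2 D.vol ≤ ofReal A * eLpNorm E 2 D.hVol := by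
  have := eLpNorm_volSlab_le D (f := f) (E := fun q => A * E q) (Iio 1) (fun q z hz => by
    rw [abs_mul, abs_of_nonneg hA]; exact h q z hz)
  rw [← vol_eq_volSlab, Set.inter_eq_left.2 (fun z hz => hz.2)] at this
  simp only [Real.volume_Ioo, sub_zero, ENNReal.ofReal_one, one_mul] at this
  have e : eLpNorm (fun q => A * E q) 2 D.hVol = ofReal A * eLpNorm E 2 D.hVol := by
    have := eLpNorm_const_smul A E 2 D.hVol
    rw [← Real.norm_of_nonneg hA, ofReal_norm, ← this, Real.norm_of_nonneg hA]
    rfl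
  rw [← e]
  exact (ENNReal.pow_le_pow_left_iff two_ne_zero).1 this

lemma l2norm_le_sum {E ι : Type*} [MeasurableSpace E] [Fintype ι] (μ : Measure E)
    (f : ι → E → ℝ) : l2norm μ f ≤ ∑ i, eLpNorm (f i) 2 μ := by
  unfold l2norm
  have : ∑ i, eLpNorm (f i) 2 μ ^ 2 ≤ (∑ i, eLpNorm (f i) 2 μ) ^ (2 : ℝ) := by
    rw [ENNReal.rpow_two, sq, Finset.sum_mul]
    refine Finset.sum_le_sum fun i _ => ?_
    rw [sq]
    gcongr
    exact Finset.single_le_sum (f := fun i => eLpNorm (f i) 2 μ) (fun _ _ => zero_le)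
      (Finset.mem_univ i)
  calc _ ≤ ((∑ i, eLpNorm (f i) 2 μ) ^ (2 : ℝ)) ^ (1 / 2 : ℝ) := by gcongr
    _ = _ := by rw [← ENNReal.rpow_mul]; norm_num

/-! ### Traces -/

lemma enorm_add_sq_le (a b : ℝ) : ‖a + b‖ₑ ^ 2 ≤ 2 * (‖a‖ₑ ^ 2 + ‖b‖ₑ ^ 2) := by
  rw [← ofReal_norm, ← ofReal_norm, ← ofReal_norm, ← ofReal_pow (norm_nonneg _),
    ← ofReal_pow (norm_nonneg _), ← ofReal_pow (norm_nonneg _),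
    ← ofReal_add (sq_nonneg _) (sq_nonneg _),
    show (2 : ℝ≥0∞) = ofReal 2 by simp, ← ofReal_mul (by norm_num)]
  refine ofReal_le_ofReal ?_
  simp only [Real.norm_eq_abs, sq_abs]
  nlinarith [sq_nonneg (a - b)]

lemma tendsto_slab_add {D : HDom} {S : ℝ → Set ℝ} {F G : Pt → ℝ}
    (hG : AEStronglyMeasurable G D.vol)
    (h1 : Tendsto (fun h : ℝ => ofReal h⁻¹ * ∫⁻ p, ‖F p‖ₑ ^ 2 ∂D.volSlab (S h))
      (𝓝[>] 0) (𝓝 0))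
    (h2 : Tendsto (fun h : ℝ => ofReal h⁻¹ * ∫⁻ p, ‖G p‖ₑ ^ 2 ∂D.volSlab (S h))
      (𝓝[>] 0) (𝓝 0)) :
    Tendsto (fun h : ℝ => ofReal h⁻¹ * ∫⁻ p, ‖F p + G p‖ₑ ^ 2 ∂D.volSlab (S h))
      (𝓝[>] 0) (𝓝 0) := by
  have h3 := ENNReal.Tendsto.const_mul (a := 2) (h1.add h2) (Or.inr (by simp))
  rw [add_zero, mul_zero] at h3
  refine tendsto_of_tendsto_of_tendsto_of_le_of_le tendsto_const_nhds h3 (fun _ => zero_le)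
    fun h => ?_
  have hm : AEMeasurable (fun p => ‖G p‖ₑ ^ 2) (D.volSlab (S h)) :=
    ((hG.mono_measure (Measure.restrict_mono_set _ fun p hp => hp.1)).enorm).pow_const 2
  simp only
  calc _ ≤ ofReal h⁻¹ * ∫⁻ p, 2 * (‖F p‖ₑ ^ 2 + ‖G p‖ₑ ^ 2) ∂D.volSlab (S h) := by
        gcongr
        exact enorm_add_sq_le _ _
    _ = _ := by
        rw [lintegral_const_mul' _ _ (by simp), lintegral_add_right' _ hm]
        ring

/-- Both traces are limits along slabs that shrink to a level. -/
lemma tendsto_slab_trace (D : HDom) {f : HPt → ℂ} (hfm : Measurable f)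
    (hf : MemLp f 2 D.hVol) {k : ℝ → ℝ → ℂ}
    (hk : Continuous ↿k) {B : ℝ} (hB : ∀ y, ∀ z ∈ Icc (0 : ℝ) 1, ‖k y z‖ ≤ B) {z₀ : ℝ}
    (hz₀ : z₀ ∈ Icc (0 : ℝ) 1) {S : ℝ → Set ℝ} (hS : ∀ h, MeasurableSet (S h))
    (hvol : ∀ h, 0 < h → volume (S h) = ofReal h)
    (hnear : ∀ h, 0 < h → ∀ z ∈ S h, |z - z₀| ≤ h) :
    Tendsto (fun h : ℝ => ofReal h⁻¹ *
      ∫⁻ p, ‖(f (p.1, p.2.1) * k p.2.1 p.2.2).re - (f (p.1, p.2.1) * k p.2.1 z₀).re‖ₑ ^ 2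
        ∂D.volSlab (S h)) (𝓝[>] 0) (𝓝 0) := by
  set m : ℝ → ℝ → ℝ≥0∞ := fun h y =>
    ofReal h⁻¹ * ∫⁻ z in 𝕀 ∩ S h, ‖k y z - k y z₀‖ₑ ^ 2
  have hkm : Measurable fun w : ℝ × ℝ => ‖k w.1 w.2 - k w.1 z₀‖ₑ ^ 2 := by
    have h1 : Continuous fun w : ℝ × ℝ => k w.1 w.2 := hk
    have h2 : Continuous fun w : ℝ × ℝ => k w.1 z₀ :=
      hk.comp (by fun_prop : Continuous fun w : ℝ × ℝ => (w.1, z₀))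
    exact ((h1.sub h2).measurable.enorm).pow_const 2
  have hmm : ∀ h, Measurable (m h) := fun h => by
    have := hkm.lintegral_prod_right' (ν := volume.restrict (𝕀 ∩ S h))
    exact this.const_mul _
  have hmle : ∀ h, 0 < h → ∀ y (c : ℝ≥0∞),
      (∀ z ∈ 𝕀 ∩ S h, ‖k y z - k y z₀‖ₑ ^ 2 ≤ c) → m h y ≤ c := by
    intro h hh y c hc
    calc m h y ≤ ofReal h⁻¹ * ∫⁻ _z in 𝕀 ∩ S h, c := by
          simp only [m]
          gcongr ofReal h⁻¹ * ?_
          exact setLIntegral_mono' (measurableSet_Ioo.inter (hS h)) hc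
      _ ≤ ofReal h⁻¹ * (c * ofReal h) := by
          rw [setLIntegral_const]
          gcongr
          exact (measure_mono Set.inter_subset_right).trans (hvol h hh).le
      _ = c := by
          rw [mul_left_comm, ← ofReal_mul (inv_nonneg.2 hh.le), inv_mul_cancel₀ hh.ne']
          simp
  have hlim : ∀ y, Tendsto (fun h => m h y) (𝓝[>] 0) (𝓝 0) := by
    intro y
    rw [ENNReal.tendsto_nhds_zero]
    intro e he
    have hc : Tendsto (fun z => ‖k y z - k y z₀‖ₑ ^ 2) (𝓝 z₀) (𝓝 0) := by
      have h1 : Continuous fun z => k y z := hk.comp (by fun_prop : Continuous fun z : ℝ => (y, z))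
      have h2 : Continuous fun z => ‖k y z - k y z₀‖ₑ ^ 2 := by
        have := (h1.sub (continuous_const : Continuous fun _ : ℝ => k y z₀)).enorm
        exact ENNReal.continuous_pow 2 |>.comp this
      have := h2.tendsto z₀
      simpa using this
    obtain ⟨η, hη, hball⟩ := Metric.eventually_nhds_iff.1 ((ENNReal.tendsto_nhds_zero.1 hc) e he)
    filter_upwards [Ioo_mem_nhdsGT hη] with h hh
    refine hmle h hh.1 y e fun z hz => hball ?_
    rw [Real.dist_eq]
    exact (hnear h hh.1 z hz.2).trans_lt hh.2
  have hdom := tendsto_lintegral_filter_of_dominated_convergence (μ := D.hVol)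
    (F := fun h q => ‖f q‖ₑ ^ 2 * m h q.2) (f := fun _ => 0) (l := 𝓝[>] (0 : ℝ))
    (fun q => ‖f q‖ₑ ^ 2 * ofReal (2 * B) ^ 2)
    (Eventually.of_forall fun h =>
      (hfm.enorm.pow_const 2).mul ((hmm h).comp measurable_snd))
    (by
      filter_upwards [self_mem_nhdsWithin] with h hh
      refine Eventually.of_forall fun q => ?_
      gcongr
      refine hmle h hh q.2 _ fun z hz => ?_
      gcongr
      rw [← ofReal_norm]
      refine ofReal_le_ofReal ((norm_sub_le _ _).trans ?_)
      linarith [hB q.2 z (Ioo_subset_Icc_self hz.1), hB q.2 z₀ hz₀])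
    (by
      rw [lintegral_mul_const' _ _ (by finiteness), ← eLpNorm_two_sq]
      exact ENNReal.mul_ne_top (ENNReal.pow_ne_top hf.2.ne) (by finiteness))
    (Eventually.of_forall fun q => by
      have := ENNReal.Tendsto.const_mul (a := ‖f q‖ₑ ^ 2) (hlim q.2) (Or.inr (by finiteness))
      rwa [mul_zero] at this)
  rw [lintegral_zero] at hdom
  refine tendsto_of_tendsto_of_tendsto_of_le_of_le tendsto_const_nhds hdom (fun _ => zero_le)
    fun h => ?_
  simp only
  have hle := lintegral_volSlab_le D (S h) fun p =>
    ‖(f (p.1, p.2.1) * k p.2.1 p.2.2).re - (f (p.1, p.2.1) * k p.2.1 z₀).re‖ₑ ^ 2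
  refine (mul_le_mul_right hle _).trans ?_
  rw [← lintegral_const_mul' _ _ ENNReal.ofReal_ne_top]
  refine lintegral_mono fun q => ?_
  simp only [m]
  rw [mul_left_comm, ← lintegral_const_mul' (‖f q‖ₑ ^ 2) _ (by finiteness)]
  refine mul_le_mul_right (lintegral_mono fun z => ?_) _
  rw [← mul_pow, ← enorm_mul, mul_sub, ← Complex.sub_re]
  gcongr
  rw [← ofReal_norm, ← ofReal_norm]
  exact ofReal_le_ofReal (Complex.abs_re_le_norm _)

lemma hasTraceTop_re_mul (D : HDom) {f : HPt → ℂ} (hfm : Measurable f)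
    (hf : MemLp f 2 D.hVol) {k : ℝ → ℝ → ℂ}
    (hk : Continuous ↿k) {B : ℝ} (hB : ∀ y, ∀ z ∈ Icc (0 : ℝ) 1, ‖k y z‖ ≤ B) :
    HasTraceTop D (fun p => (f (p.1, p.2.1) * k p.2.1 p.2.2).re) (fun q => (f q * k q.2 1).re) :=
  tendsto_slab_trace D hfm hf hk hB (by simp) (fun _ => measurableSet_Ioo)
    (fun h _ => by rw [Real.volume_Ioo]; congr 1; ring)
    (fun h _ z hz => abs_le.2 ⟨by linarith [hz.1], by linarith [hz.2]⟩)

lemma hasTraceBottom_re_mul (D : HDom) {f : HPt → ℂ} (hfm : Measurable f)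
    (hf : MemLp f 2 D.hVol) {k : ℝ → ℝ → ℂ}
    (hk : Continuous ↿k) {B : ℝ} (hB : ∀ y, ∀ z ∈ Icc (0 : ℝ) 1, ‖k y z‖ ≤ B) :
    HasTraceBottom D (fun p => (f (p.1, p.2.1) * k p.2.1 p.2.2).re)
      (fun q => (f q * k q.2 0).re) :=
  tendsto_slab_trace D hfm hf hk hB (by simp) (fun _ => measurableSet_Ioo)
    (fun h _ => by rw [Real.volume_Ioo]; congr 1; ring)
    (fun h _ z hz => abs_le.2 ⟨by linarith [hz.1], by linarith [hz.2]⟩)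

lemma HasTraceTop.add {D : HDom} {g g' : Pt → ℝ} {s s' : HPt → ℝ}
    (hm : AEStronglyMeasurable (fun p => g' p - s' (p.1, p.2.1)) D.vol) (h : HasTraceTop D g s)
    (h' : HasTraceTop D g' s') :
    HasTraceTop D (fun p => g p + g' p) (fun q => s q + s' q) := by
  have := tendsto_slab_add hm h h'
  simp only [sub_add_sub_comm] at this
  exact this

lemma HasTraceBottom.add {D : HDom} {g g' : Pt → ℝ} {s s' : HPt → ℝ}
    (hm : AEStronglyMeasurable (fun p => g' p - s' (p.1, p.2.1)) D.vol) (h : HasTraceBottom D g s)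
    (h' : HasTraceBottom D g' s') :
    HasTraceBottom D (fun p => g p + g' p) (fun q => s q + s' q) := by
  have := tendsto_slab_add hm h h'
  simp only [sub_add_sub_comm] at this
  exact this

/-! ### The viscous remainder as a distribution -/

lemma pd_add_smul {E : Type*} [NormedAddCommGroup E] [NormedSpace ℝ E] {f g : E → ℝ}
    (hf : Differentiable ℝ f) (hg : Differentiable ℝ g) (v p : E) (c : ℝ) :
    pd v (f + g) p = pd v f p + pd v g p ∧ pd v (c • f) p = c * pd v f p := by
  unfold pd
  rw [fderiv_add (hf p) (hg p), fderiv_const_smul (hf p)]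
  simp

/-- The distribution `φ ↦ ν ∫ (F ∂ₓφ + G ∂_yφ)`. -/
def gradForm (D : HDom) (ν : ℝ) {F G : Pt → ℝ} (hF : MemLp F 2 D.vol)
    (hG : MemLp G 2 D.vol) : testSpace D →ₗ[ℝ] ℝ where
  toFun φ := ν * (∫ p, F p * pd (dir 0) (φ : Pt → ℝ) p ∂D.vol
    + ∫ p, G p * pd (dir 1) (φ : Pt → ℝ) p ∂D.vol)
  map_add' φ ψ := by
    have e : ∀ k, (fun p => pd (dir k) ((φ + ψ : testSpace D) : Pt → ℝ) p) =
        fun p => pd (dir k) (φ : Pt → ℝ) p + pd (dir k) (ψ : Pt → ℝ) p := fun k => funext fun p =>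
      (pd_add_smul (IsTest.differentiable φ.2) (IsTest.differentiable ψ.2) _ p 0).1
    have i : ∀ (k : Fin 3) (H : Pt → ℝ) (_ : MemLp H 2 D.vol) (χ : testSpace D),
        Integrable (fun p => H p * pd (dir k) (χ : Pt → ℝ) p) D.vol :=
      fun k H hH χ => hH.locInt.integrable_mul (IsTest.pd χ.2 k)
    have k1 := integral_add (i 0 F hF φ) (i 0 F hF ψ)
    have k2 := integral_add (i 1 G hG φ) (i 1 G hG ψ)
    simp only [← mul_add] at k1 k2
    simp only [funext_iff] at e
    simp only [e, k1, k2]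
    ring
  map_smul' c φ := by
    have e : ∀ k p, pd (dir k) ((c • φ : testSpace D) : Pt → ℝ) p = c * pd (dir k) (φ : Pt → ℝ) p :=
      fun k p =>
      (pd_add_smul (IsTest.differentiable φ.2) (IsTest.differentiable φ.2) _ p c).2
    simp only [e, mul_left_comm _ c, integral_const_mul, RingHom.id_apply, smul_eq_mul]
    ring

lemma ofReal_abs_integral_mul_le {E : Type*} [MeasurableSpace E] {μ : Measure E} {f g : E → ℝ}
    (hf : AEStronglyMeasurable f μ) (hg : AEStronglyMeasurable g μ) :
    ofReal |∫ x, f x * g x ∂μ| ≤ eLpNorm f 2 μ * eLpNorm g 2 μ := by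
  rw [← Real.norm_eq_abs, ofReal_norm]
  refine (enorm_integral_le_lintegral_enorm _).trans ?_
  simp only [enorm_mul]
  refine (ENNReal.pow_le_pow_left_iff two_ne_zero).1 ?_
  rw [mul_pow, eLpNorm_two_sq, eLpNorm_two_sq]
  exact lintegral_mul_sq_le hf.enorm hg.enorm

lemma eLpNorm_le_l2norm {E ι : Type*} [MeasurableSpace E] [Fintype ι] (μ : Measure E)
    (f : ι → E → ℝ) (i : ι) : eLpNorm (f i) 2 μ ≤ l2norm μ f := by
  unfold l2norm
  calc eLpNorm (f i) 2 μ = (eLpNorm (f i) 2 μ ^ 2) ^ (1 / 2 : ℝ) := by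
        rw [← ENNReal.rpow_two, ← ENNReal.rpow_mul]; norm_num
    _ ≤ _ := by
        gcongr
        exact Finset.single_le_sum (f := fun i => eLpNorm (f i) 2 μ ^ 2) (fun _ _ => zero_le)
          (Finset.mem_univ i)

lemma normL2HNeg1_gradForm_le (D : HDom) {ν : ℝ} (hν : 0 ≤ ν) {F G : Pt → ℝ}
    (hF : MemLp F 2 D.vol) (hG : MemLp G 2 D.vol) :
    normL2HNeg1 D (gradForm D ν hF hG) ≤
      ofReal ν * (eLpNorm F 2 D.vol + eLpNorm G 2 D.vol) := by
  unfold normL2HNeg1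
  refine iSup_le fun φ => ENNReal.div_le_of_le_mul ?_
  have h0 := ofReal_abs_integral_mul_le hF.1
    (contDiff_pd (IsTest.smooth φ.2) (dir 0)).continuous.aestronglyMeasurable
  have h1 := ofReal_abs_integral_mul_le hG.1
    (contDiff_pd (IsTest.smooth φ.2) (dir 1)).continuous.aestronglyMeasurable
  have n0 := eLpNorm_le_l2norm D.vol ![(φ : Pt → ℝ), pd (dir 0) φ, pd (dir 1) φ] 1
  have n1 := eLpNorm_le_l2norm D.vol ![(φ : Pt → ℝ), pd (dir 0) φ, pd (dir 1) φ] 2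
  change _ ≤ normL2H1 D φ at n0 n1
  simp only [Matrix.cons_val] at n0 n1
  calc ofReal |ν * (∫ p, F p * pd (dir 0) (φ : Pt → ℝ) p ∂D.vol
        + ∫ p, G p * pd (dir 1) (φ : Pt → ℝ) p ∂D.vol)|
      ≤ ofReal ν * (ofReal |∫ p, F p * pd (dir 0) (φ : Pt → ℝ) p ∂D.vol| +
        ofReal |∫ p, G p * pd (dir 1) (φ : Pt → ℝ) p ∂D.vol|) := by
        rw [← ofReal_add (abs_nonneg _) (abs_nonneg _), ← ofReal_mul hν, abs_mul,
          abs_of_nonneg hν]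
        exact ofReal_le_ofReal (mul_le_mul_of_nonneg_left (abs_add_le _ _) hν)
    _ ≤ ofReal ν * (eLpNorm F 2 D.vol * normL2H1 D φ + eLpNorm G 2 D.vol * normL2H1 D φ) := by
        gcongr
        · exact h0.trans (by gcongr)
        · exact h1.trans (by gcongr)
    _ = _ := by rw [← add_mul, mul_assoc]

/-! ### From weak derivatives to the rotating fluid equations -/

/-- Boundary layer and interior fields with their weak derivatives, and the residual of the
rotating fluid equations without horizontal viscosity. -/
structure StatFields (D : HDom) (ε : ℝ) (b : ℝ → ℝ) (uBL uint : UF₁) (p : Pt → ℝ)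
    (gBL gint : UF₂) (gp h r : UF₁) : Prop where
  memBL : ∀ i, MemLp (uBL i) 2 D.vol
  memInt : ∀ i, MemLp (uint i) 2 D.vol
  memP : MemLp p 2 D.vol
  memGBL : ∀ i k, MemLp (gBL i k) 2 D.vol
  memGInt : ∀ i k, MemLp (gint i k) 2 D.vol
  memGP : ∀ k, MemLp (gp k) 2 D.vol
  memR : ∀ i, MemLp (r i) 2 D.vol
  locH : ∀ i, LocInt D (h i)
  weakBL : ∀ i k, IsWeakDeriv D k (uBL i) (gBL i k)
  weakInt : ∀ i k, IsWeakDeriv D k (uint i) (gint i k)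
  weakP : ∀ k, IsWeakDeriv D k p (gp k)
  weakH : ∀ i, IsWeakDeriv D 2 (fun q => gBL i 2 q + gint i 2 q) (h i)
  div : ∀ q ∈ D.box, ∑ k, (gBL k k q + gint k k q) = 0
  eqn : ∀ i, ∀ q ∈ D.box, 1 / ε * b q.2.1 * rot3 (uBL + uint) i q
    + (![1, 1, 1 / ε ^ 2] : Fin 3 → ℝ) i * gp i q - ε * h i q = r i q

namespace StatFields

variable {D : HDom} {ε : ℝ} {b : ℝ → ℝ} {uBL uint : UF₁} {p : Pt → ℝ}
  {gBL gint : UF₂} {gp h r : UF₁}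

lemma memH1 (H : StatFields D ε b uBL uint p gBL gint gp h r) :
    (∀ i, MemH1 D (uBL i)) ∧ (∀ i, MemH1 D (uint i)) ∧ MemH1 D p :=
  ⟨fun i => ⟨H.memBL i, fun k => ⟨_, H.memGBL i k, H.weakBL i k⟩⟩,
    fun i => ⟨H.memInt i, fun k => ⟨_, H.memGInt i k, H.weakInt i k⟩⟩,
    ⟨H.memP, fun k => ⟨_, H.memGP k, H.weakP k⟩⟩⟩

lemma memG (H : StatFields D ε b uBL uint p gBL gint gp h r) (i k : Fin 3) :
    MemLp (fun q => gBL i k q + gint i k q) 2 D.vol := (H.memGBL i k).add (H.memGInt i k)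

lemma weakU (H : StatFields D ε b uBL uint p gBL gint gp h r) (i k : Fin 3) :
    IsWeakDeriv D k (fun q => (uBL + uint) i q) (fun q => gBL i k q + gint i k q) :=
  (H.weakBL i k).add (H.memBL i).locInt (H.memInt i).locInt (H.memGBL i k).locInt
    (H.memGInt i k).locInt (H.weakInt i k)

lemma locU (H : StatFields D ε b uBL uint p gBL gint gp h r) (i : Fin 3) :
    LocInt D ((uBL + uint) i) := (H.memBL i).locInt.add (H.memInt i).locInt

lemma isDivFree (H : StatFields D ε b uBL uint p gBL gint gp h r) : IsDivFree D (uBL + uint) := by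
  intro φ hφ
  rw [integral_finsetSum _ fun k _ => (H.locU k).integrable_mul (IsTest.pd hφ k)]
  have e : ∀ k, ∫ q, (uBL + uint) k q * pd (dir k) φ q ∂D.vol =
      -∫ q, (gBL k k q + gint k k q) * φ q ∂D.vol := fun k => H.weakU k k φ hφ
  rw [Finset.sum_congr rfl fun k _ => e k, Finset.sum_neg_distrib, ← integral_finsetSum _
    fun k _ => (H.memG k k).locInt.integrable_mul hφ, neg_eq_zero]
  refine (setIntegral_congr_fun (measurableSet_box D) fun q hq => ?_).trans (integral_zero _ _)
  rw [← Finset.sum_mul, H.div q hq, zero_mul]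

lemma isStationarySolution (H : StatFields D ε b uBL uint p gBL gint gp h r) (ν : ℝ)
    (hb : Measurable b) (hbl : ∀ R : ℝ, ∃ C : ℝ, ∀ q ∈ D.box, |q.2.1| ≤ R → |b q.2.1| ≤ C) :
    IsStationarySolution D ε ε ν ε b (uBL + uint) p r
      (fun i => gradForm D ν (H.memG i 0) (H.memG i 1)) := by
  intro i φ
  set f : Pt → ℝ := (φ : Pt → ℝ) with hf
  have hφ : IsTest D f := φ.2
  set u := uBL + uint with hu
  have locRot : LocInt D (rot3 u i) := by
    fin_cases i
    · exact (H.locU 1).neg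
    · exact H.locU 0
    · have := (H.locU 0).const_mul 0
      simp only [zero_mul] at this
      exact this
  set c := (![1, 1, 1 / ε ^ 2] : Fin 3 → ℝ) i
  have i1 : Integrable (fun q => 1 / ε * b q.2.1 * rot3 u i q * f q) D.vol := by
    have := ((locRot.bdd_mul (k := fun q => b q.2.1) (by fun_prop) hbl).const_mul
      (1 / ε)).integrable_mul hφ
    simpa only [mul_assoc] using this
  have i2 : Integrable (fun q => c * p q * pd (dir i) f q) D.vol :=
    (H.memP.locInt.const_mul c).integrable_mul (hφ.pd i)
  have i3 : ∀ j k : Fin 3, Integrable (fun q => u i q * pd (dir j) (pd (dir k) f) q) D.vol :=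
    fun j k => (H.locU i).integrable_mul ((hφ.pd k).pd j)
  have w : ∀ k, ∫ q, u i q * pd (dir k) (pd (dir k) f) q ∂D.vol =
      -∫ q, (gBL i k q + gint i k q) * pd (dir k) f q ∂D.vol :=
    fun k => H.weakU i k _ (hφ.pd k)
  have wz : ∫ q, (gBL i 2 q + gint i 2 q) * pd (dir 2) f q ∂D.vol = -∫ q, h i q * f q ∂D.vol :=
    H.weakH i _ hφ
  have wp : ∫ q, p q * pd (dir i) f q ∂D.vol = -∫ q, gp i q * f q ∂D.vol := H.weakP i _ hφ
  have ig : Integrable (fun q => c * gp i q * f q) D.vol :=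
    ((H.memGP i).locInt.const_mul c).integrable_mul hφ
  have ih : Integrable (fun q => ε * h i q * f q) D.vol := ((H.locH i).const_mul ε).integrable_mul hφ
  have er : ∫ q, r i q * f q ∂D.vol = ∫ q, 1 / ε * b q.2.1 * rot3 u i q * f q ∂D.vol
      + c * ∫ q, gp i q * f q ∂D.vol - ε * ∫ q, h i q * f q ∂D.vol := by
    have k1 := integral_add i1 ig
    have k2 := integral_sub (i1.add ig) ih
    simp only [Pi.add_apply, k1] at k2
    simp only [mul_assoc c, mul_assoc ε, integral_const_mul] at k2
    rw [← k2]
    refine setIntegral_congr_fun (measurableSet_box D) fun q hq => ?_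
    rw [← H.eqn i q hq]
    ring
  have i4 : Integrable (fun q => ν * u i q * (pd (dir 0) (pd (dir 0) f) q
      + pd (dir 1) (pd (dir 1) f) q)) D.vol := by
    have := ((i3 0 0).add (i3 1 1)).const_mul ν
    refine this.congr (Eventually.of_forall fun q => ?_)
    simp only [Pi.add_apply]
    ring
  have i5 : Integrable (fun q => ε * u i q * pd (dir 2) (pd (dir 2) f) q) D.vol := by
    simpa only [mul_assoc] using (i3 2 2).const_mul ε
  have e4 : ∫ q, ν * u i q * (pd (dir 0) (pd (dir 0) f) q + pd (dir 1) (pd (dir 1) f) q) ∂D.vol =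
      ν * (∫ q, u i q * pd (dir 0) (pd (dir 0) f) q ∂D.vol +
        ∫ q, u i q * pd (dir 1) (pd (dir 1) f) q ∂D.vol) := by
    rw [← integral_add (i3 0 0) (i3 1 1), ← integral_const_mul]
    refine integral_congr_ae (Eventually.of_forall fun q => ?_)
    simp only
    ring
  have k1 := integral_sub i1 i2
  have k2 := integral_sub (i1.sub i2) i4
  have k3 := integral_sub ((i1.sub i2).sub i4) i5
  simp only [Pi.sub_apply] at k1 k2 k3
  rw [k2, k1, e4] at k3
  simp only [mul_assoc c, mul_assoc ε, integral_const_mul] at k3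
  rw [w, w, w, wz, wp] at k3
  change ∫ q, _ ∂D.vol = _ + ν * (∫ q, (gBL i 0 q + gint i 0 q) * pd (dir 0) f q ∂D.vol
    + ∫ q, (gBL i 1 q + gint i 1 q) * pd (dir 1) f q ∂D.vol)
  rw [er]
  simp only [mul_assoc c, mul_assoc ε]
  refine k3.trans ?_
  ring

end StatFields

/-! ### From the channel to the torus -/

/-- `f` vanishes at latitudes beyond `a`. -/
def LatSupp3 (a : ℝ) (f : Pt → ℝ) : Prop := ∀ p : Pt, a < |p.2.1| → f p = 0

lemma torus_box_subset : HDom.torus.box ⊆ HDom.channel.box :=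
  fun _ hp => ⟨hp.1, trivial, hp.2.2⟩

lemma torus_vol_le : HDom.torus.vol ≤ vΩ :=
  Measure.restrict_mono_set _ torus_box_subset

lemma torus_volSlab_le (S : Set ℝ) : HDom.torus.volSlab S ≤ HDom.channel.volSlab S :=
  Measure.restrict_mono_set _ fun _ hp => ⟨torus_box_subset hp.1, hp.2⟩

lemma integral_torus_eq {f : Pt → ℝ} {a : ℝ} (ha : a < 1 / 2) (hf : LatSupp3 a f) :
    ∫ p, f p ∂vΩ = ∫ p, f p ∂HDom.torus.vol := by
  refine setIntegral_eq_of_subset_of_forall_sdiff_eq_zero (measurableSet_box _) torus_box_subset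
    fun p hp => hf p ?_
  by_contra! h
  have h2 := abs_le.1 h
  exact hp.2 ⟨hp.1.1, ⟨by linarith [h2.1], by linarith [h2.2]⟩, hp.1.2.2⟩

lemma IsWeakDeriv.to_torus {k : Fin 3} {f g : Pt → ℝ} {a : ℝ} (ha : a < 1 / 2)
    (hf : LatSupp3 a f) (hg : LatSupp3 a g) (h : IsWeakDeriv .channel k f g) :
    IsWeakDeriv .torus k f g := by
  intro φ hφ
  obtain ⟨r₁, h1, h1'⟩ := exists_between (max_lt ha (by norm_num) : max a 0 < 1 / 2)
  obtain ⟨r₂, h2, h2'⟩ := exists_between h1'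
  have r1p : 0 < r₁ := (le_max_right _ _).trans_lt h1
  set η : ContDiffBump (0 : ℝ) := ⟨r₁, r₂, r1p, h2⟩
  have hη : ContDiff ℝ ∞ (fun p : Pt => η p.2.1) := η.contDiff.comp (by fun_prop)
  have hone : ∀ p : Pt, |p.2.1| < r₁ → η p.2.1 = 1 := fun p hp =>
    η.one_of_mem_closedBall (by rw [mem_closedBall_zero_iff, Real.norm_eq_abs]; exact hp.le)
  have ht : (fun p => η p.2.1 * φ p) ∈ testSpace .channel := by
    refine ⟨hη.mul (IsTest.smooth hφ), fun x y z => ?_, ⟨r₂, fun x y z hy => ?_⟩, ?_⟩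
    · simp only [IsTest.periodic_x hφ]
    · have : η y = 0 := η.zero_of_le_dist (by rw [Real.dist_eq, sub_zero]; exact hy.le)
      simp only [this, zero_mul]
    · obtain ⟨c, hc, hv⟩ := IsTest.vertical hφ
      exact ⟨c, hc, fun x y z hz => by simp only [hv x y z hz, mul_zero]⟩
  have key := h _ ht
  have lf : LatSupp3 a fun p => f p * pd (dir k) (fun p => η p.2.1 * φ p) p := fun p hp => by
    simp only [hf p hp, zero_mul]
  have lg : LatSupp3 a fun p => g p * (η p.2.1 * φ p) := fun p hp => by
    simp only [hg p hp, zero_mul]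
  rw [integral_torus_eq ha lf, integral_torus_eq ha lg] at key
  have near : ∀ p : Pt, |p.2.1| ≤ a → ∀ᶠ q in 𝓝 p, η q.2.1 * φ q = φ q := by
    intro p hp
    have : ∀ᶠ q : Pt in 𝓝 p, |q.2.1| < r₁ :=
      (by fun_prop : Continuous fun q : Pt => |q.2.1|).continuousAt.eventually_lt
        continuousAt_const ((hp.trans (le_max_left _ _)).trans_lt h1)
    filter_upwards [this] with q hq
    rw [hone q hq, one_mul]
  have e1 : ∀ p, f p * pd (dir k) (fun p => η p.2.1 * φ p) p = f p * pd (dir k) φ p := by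
    intro p
    rcases le_or_gt |p.2.1| a with hp | hp
    · unfold pd
      rw [Filter.EventuallyEq.fderiv_eq (near p hp)]
    · rw [hf p hp, zero_mul, zero_mul]
  have e2 : ∀ p, g p * (η p.2.1 * φ p) = g p * φ p := by
    intro p
    rcases le_or_gt |p.2.1| a with hp | hp
    · rw [(near p hp).self_of_nhds]
    · rw [hg p hp, zero_mul, zero_mul]
  simpa only [e1, e2] using key

lemma LocInt.to_torus {F : Pt → ℝ} (h : LocInt .channel F) : LocInt .torus F := fun R =>
  (h R).mono_set fun _ hp => ⟨torus_box_subset hp.1, hp.2⟩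

lemma StatFields.to_torus {ε : ℝ} {b b' : ℝ → ℝ} {uBL uint : UF₁} {p : Pt → ℝ}
    {gBL gint : UF₂} {gp h r : UF₁}
    (H : StatFields .channel ε b uBL uint p gBL gint gp h r) {a : ℝ} (ha : a < 1 / 2)
    (hb : ∀ y, |y| ≤ a → b' y = b y) (l1 : ∀ i, LatSupp3 a (uBL i)) (l2 : ∀ i, LatSupp3 a (uint i))
    (l3 : LatSupp3 a p) (l4 : ∀ i k, LatSupp3 a (gBL i k)) (l5 : ∀ i k, LatSupp3 a (gint i k))
    (l6 : ∀ k, LatSupp3 a (gp k)) (l7 : ∀ i, LatSupp3 a (h i)) :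
    StatFields .torus ε b' uBL uint p gBL gint gp h r where
  memBL i := (H.memBL i).mono_measure torus_vol_le
  memInt i := (H.memInt i).mono_measure torus_vol_le
  memP := H.memP.mono_measure torus_vol_le
  memGBL i k := (H.memGBL i k).mono_measure torus_vol_le
  memGInt i k := (H.memGInt i k).mono_measure torus_vol_le
  memGP k := (H.memGP k).mono_measure torus_vol_le
  memR i := (H.memR i).mono_measure torus_vol_le
  locH i := (H.locH i).to_torus
  weakBL i k := (H.weakBL i k).to_torus ha (l1 i) (l4 i k)
  weakInt i k := (H.weakInt i k).to_torus ha (l2 i) (l5 i k)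
  weakP k := (H.weakP k).to_torus ha l3 (l6 k)
  weakH i := (H.weakH i).to_torus ha (fun q hq => by simp only [l4 i 2 q hq, l5 i 2 q hq, add_zero])
    (l7 i)
  div q hq := H.div q (torus_box_subset hq)
  eqn i q hq := by
    rw [← H.eqn i q (torus_box_subset hq)]
    rcases le_or_gt |q.2.1| a with hy | hy
    · rw [hb _ hy]
    · have : rot3 (uBL + uint) i q = 0 := by
        fin_cases i <;> simp [rot3, l1 _ q hy, l2 _ q hy]
      simp only [this, mul_zero]

/-! ### Families of approximate solutions -/

/-- Quantitative bounds at a fixed `ε`: `τ` is small, `κ` describes the decay below the surface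
layer, and `N₁`, `N₂` are the norms of the wind stress. -/
structure FieldBounds (D : HDom) (ε ν τ K : ℝ) (κ : ℝ → ℝ) (C : ℝ≥0) (N₁ N₂ : ℝ≥0∞)
    (uBL uint : UF₁) (gBL gint : UF₂) (r : UF₁) : Prop where
  res_h : ∀ i : Fin 2, eLpNorm (r i.castSucc) 2 D.vol ≤ ofReal τ
  res_3 : ofReal ε * eLpNorm (r 2) 2 D.vol ≤ ofReal τ
  grad_h : ∀ i k : Fin 2, ofReal (√ν) *
    eLpNorm (fun q => gBL i.castSucc k.castSucc q + gint i.castSucc k.castSucc q) 2 D.vol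
      ≤ ofReal τ
  grad_3 : ∀ k : Fin 2, ofReal (ε * √ν) *
    eLpNorm (fun q => gBL 2 k.castSucc q + gint 2 k.castSucc q) 2 D.vol ≤ ofReal τ
  layer_h : ∀ M, 0 < M → ∀ i : Fin 2,
    eLpNorm (uBL i.castSucc) 2 (D.volSlab (Iio (1 - M * ε))) ≤ ofReal (κ M / √ε)
  layer_3 : ∀ M, 0 < M →
    eLpNorm (uBL 2) 2 (D.volSlab (Iio (1 - M * ε))) ≤ ofReal (κ M * √ε)
  interior : ∀ M i, eLpNorm (uint i) 2 (D.volSlab (Ioi (1 - M * ε))) ≤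
    ofReal (√(M * ε) * K)
  int : ∀ i, eLpNorm (uint i) 2 D.vol ≤ C * N₂
  bl_h : ∀ i : Fin 2, eLpNorm (uBL i.castSucc) 2 D.vol ≤ ofReal (C / √ε) * N₁
  bl_3 : eLpNorm (uBL 2) 2 D.vol ≤ ofReal τ
  bl_zero : N₁ = 0 → eLpNorm (uBL 2) 2 D.vol = 0

lemma FieldBounds.to_torus {ε ν τ K : ℝ} {κ : ℝ → ℝ} {C C' : ℝ≥0} {N₁ N₂ N₁' N₂' : ℝ≥0∞}
    {uBL uint : UF₁} {gBL gint : UF₂} {r : UF₁}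
    (H : FieldBounds .channel ε ν τ K κ C N₁ N₂ uBL uint gBL gint r)
    (h1 : C * N₁ ≤ C' * N₁') (h2 : C * N₂ ≤ C' * N₂') (h0 : N₁' = 0 → N₁ = 0) :
    FieldBounds .torus ε ν τ K κ C' N₁' N₂' uBL uint gBL gint r where
  res_h i := (eLpNorm_mono_measure _ torus_vol_le).trans (H.res_h i)
  res_3 := (mul_le_mul_right (eLpNorm_mono_measure _ torus_vol_le) _).trans H.res_3
  grad_h i k := (mul_le_mul_right (eLpNorm_mono_measure _ torus_vol_le) _).trans (H.grad_h i k)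
  grad_3 k := (mul_le_mul_right (eLpNorm_mono_measure _ torus_vol_le) _).trans (H.grad_3 k)
  layer_h M hM i := (eLpNorm_mono_measure _ (torus_volSlab_le _)).trans (H.layer_h M hM i)
  layer_3 M hM := (eLpNorm_mono_measure _ (torus_volSlab_le _)).trans (H.layer_3 M hM)
  interior M i := (eLpNorm_mono_measure _ (torus_volSlab_le _)).trans (H.interior M i)
  int i := ((eLpNorm_mono_measure _ torus_vol_le).trans (H.int i)).trans h2
  bl_h i := by
    refine ((eLpNorm_mono_measure _ torus_vol_le).trans (H.bl_h i)).trans ?_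
    rw [div_eq_inv_mul, div_eq_inv_mul, ofReal_mul (by positivity),
      ofReal_mul (by positivity), ENNReal.ofReal_coe_nnreal, ENNReal.ofReal_coe_nnreal,
      mul_assoc, mul_assoc]
    exact mul_le_mul_right h1 _
  bl_3 := (eLpNorm_mono_measure _ torus_vol_le).trans H.bl_3
  bl_zero h := le_antisymm ((eLpNorm_mono_measure _ torus_vol_le).trans (H.bl_zero (h0 h)).le)
    zero_le

lemma tendsto_of_eventually_le_ofReal {f : ℝ → ℝ≥0∞} {τ : ℝ → ℝ}
    (hτ : Tendsto τ (𝓝[>] 0) (𝓝 0)) {m : ℝ} (h : ∀ᶠ ε in 𝓝[>] 0, f ε ≤ ofReal (m * τ ε)) :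
    Tendsto f (𝓝[>] 0) (𝓝 0) := by
  have h1 : Tendsto (fun ε => ofReal (m * τ ε)) (𝓝[>] 0) (𝓝 0) := by
    have := ENNReal.tendsto_ofReal (hτ.const_mul m)
    rwa [mul_zero, ENNReal.ofReal_zero] at this
  exact tendsto_of_tendsto_of_tendsto_of_le_of_le' tendsto_const_nhds h1
    (Eventually.of_forall fun _ => zero_le) h

lemma exists_isApproxStationary {D : HDom} {b : ℝ → ℝ} {σ : VF₁}
    {dσ : VF₂} {ddσ : VF₃} {νh : ℝ → ℝ}
    (hb : Measurable b) (hbl : ∀ R : ℝ, ∃ C : ℝ, ∀ q ∈ D.box, |q.2.1| ≤ R → |b q.2.1| ≤ C)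
    (hν : ∀ ε : ℝ, 0 < ε → 0 < νh ε) {C : ℝ≥0} (hC : 0 < C) {K : ℝ} {τ κ : ℝ → ℝ}
    (hτ : Tendsto τ (𝓝[>] 0) (𝓝 0)) (hκ : Tendsto κ atTop (𝓝 0))
    (H : ∀ᶠ ε in 𝓝[>] 0, ∃ (uBL uint : UF₁) (p : Pt → ℝ)
      (gBL gint : UF₂) (gp h r : UF₁),
      StatFields D ε b uBL uint p gBL gint gp h r ∧
      BoundaryConditions D (1 / ε ^ 2) σ (uBL + uint) ∧
      FieldBounds D ε (νh ε) (τ ε) K κ C (normH1 D σ dσ) (normH2 D σ dσ ddσ) uBL uint gBL gint r) :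
    ∃ (uBL uint : ℝ → UF₁) (p : ℝ → Pt → ℝ) (r₁ : ℝ → UF₁)
      (r₂ : ℝ → Fin 3 → testSpace D →ₗ[ℝ] ℝ),
      IsApproxStationary D b σ dσ ddσ νh (3 * C) uBL uint p r₁ r₂ := by
  classical
  have H' : ∀ ε : ℝ, ∃ (uBL uint : UF₁) (p : Pt → ℝ)
      (gBL gint : UF₂) (gp h r : UF₁),
      (∃ (uBL uint : UF₁) (p : Pt → ℝ)
        (gBL gint : UF₂) (gp h r : UF₁),
        StatFields D ε b uBL uint p gBL gint gp h r ∧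
        BoundaryConditions D (1 / ε ^ 2) σ (uBL + uint) ∧
        FieldBounds D ε (νh ε) (τ ε) K κ C (normH1 D σ dσ) (normH2 D σ dσ ddσ)
          uBL uint gBL gint r) →
      StatFields D ε b uBL uint p gBL gint gp h r ∧
      BoundaryConditions D (1 / ε ^ 2) σ (uBL + uint) ∧
      FieldBounds D ε (νh ε) (τ ε) K κ C (normH1 D σ dσ) (normH2 D σ dσ ddσ)
        uBL uint gBL gint r := by
    intro ε
    by_cases hε : ∃ (uBL uint : UF₁) (p : Pt → ℝ)
        (gBL gint : UF₂) (gp h r : UF₁),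
        StatFields D ε b uBL uint p gBL gint gp h r ∧
        BoundaryConditions D (1 / ε ^ 2) σ (uBL + uint) ∧
        FieldBounds D ε (νh ε) (τ ε) K κ C (normH1 D σ dσ) (normH2 D σ dσ ddσ) uBL uint gBL gint r
    · obtain ⟨a1, a2, a3, a4, a5, a6, a7, a8, a9⟩ := hε
      exact ⟨a1, a2, a3, a4, a5, a6, a7, a8, fun _ => a9⟩
    · exact ⟨0, 0, 0, 0, 0, 0, 0, 0, fun h => absurd h hε⟩
  choose uBL uint p gBL gint gp h r hall using H'
  have S : ∀ᶠ ε in 𝓝[>] 0, StatFields D ε b (uBL ε) (uint ε) (p ε) (gBL ε) (gint ε) (gp ε) (h ε) (r ε) :=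
    H.mono fun ε hε => (hall ε hε).1
  have T : ∀ᶠ ε in 𝓝[>] 0, FieldBounds D ε (νh ε) (τ ε) K κ C (normH1 D σ dσ) (normH2 D σ dσ ddσ)
      (uBL ε) (uint ε) (gBL ε) (gint ε) (r ε) := H.mono fun ε hε => (hall ε hε).2.2
  have P : ∀ᶠ ε : ℝ in 𝓝[>] 0, 0 < ε := self_mem_nhdsWithin
  set r₂ : ℝ → Fin 3 → testSpace D →ₗ[ℝ] ℝ := fun ε i =>
    if hs : StatFields D ε b (uBL ε) (uint ε) (p ε) (gBL ε) (gint ε) (gp ε) (h ε) (r ε) then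
      gradForm D (νh ε) (hs.memG i 0) (hs.memG i 1) else 0 with hr₂
  have er₂ : ∀ ε, ∀ hs : StatFields D ε b (uBL ε) (uint ε) (p ε) (gBL ε) (gint ε) (gp ε) (h ε) (r ε),
      r₂ ε = fun i => gradForm D (νh ε) (hs.memG i 0) (hs.memG i 1) := fun ε hs =>
    funext fun i => dif_pos hs
  have hsqrt : ∀ x : ℝ, 0 < x → 1 / √x * x = √x := fun x hx => by
    rw [one_div_mul_eq_div, div_eq_iff (Real.sqrt_pos.2 hx).ne', Real.mul_self_sqrt hx.le]
  have two : ∀ {x y : ℝ≥0∞} {w : ℝ}, x ≤ ofReal w → y ≤ ofReal w →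
      x + y ≤ ofReal (2 * w) := by
    intro x y w hx hy
    rw [ofReal_mul (by norm_num), ENNReal.ofReal_ofNat, two_mul]
    exact add_le_add hx hy
  have hC1 : ∀ x : ℝ≥0∞, C * x ≤ ((3 * C : ℝ≥0) : ℝ≥0∞) * x := fun x => by
    gcongr
    exact le_mul_of_one_le_left zero_le (by norm_num)
  refine ⟨uBL, uint, p, r, r₂, ⟨?_, ?_, ?_, ?_, ?_, ?_, ?_, ?_, ?_, ?_, ?_, ?_, ?_, ?_⟩⟩
  · exact S.mono fun ε hs => hs.memH1
  · exact S.mono fun ε hs => hs.isDivFree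
  · exact H.mono fun ε hε => (hall ε hε).2.1
  · filter_upwards [S] with ε hs
    rw [er₂ ε hs]
    exact hs.isStationarySolution _ hb hbl
  · exact S.mono fun ε hs => hs.memR
  · refine tendsto_of_eventually_le_ofReal hτ (m := 2) (T.mono fun ε ht => ?_)
    refine (l2norm_le_sum _ _).trans ?_
    rw [Fin.sum_univ_two]
    exact two (ht.res_h 0) (ht.res_h 1)
  · exact tendsto_of_eventually_le_ofReal hτ (m := 1) (T.mono fun ε ht => by
      rw [one_mul]; exact ht.res_3)
  · intro i
    refine tendsto_of_eventually_le_ofReal hτ (m := 2) ?_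
    filter_upwards [S, T, P] with ε hs ht hε
    rw [er₂ ε hs]
    refine (mul_le_mul_right (normL2HNeg1_gradForm_le D (hν ε hε).le _ _) _).trans ?_
    rw [← mul_assoc, ← ofReal_mul (by positivity), hsqrt _ (hν ε hε), mul_add]
    exact two (ht.grad_h i 0) (ht.grad_h i 1)
  · refine tendsto_of_eventually_le_ofReal hτ (m := 2) ?_
    filter_upwards [S, T, P] with ε hs ht hε
    rw [er₂ ε hs]
    refine (mul_le_mul_right (normL2HNeg1_gradForm_le D (hν ε hε).le _ _) _).trans ?_
    rw [← mul_assoc, ← ofReal_mul (by positivity), ← mul_one_div, mul_assoc,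
      hsqrt _ (hν ε hε), mul_add]
    exact two (ht.grad_3 0) (ht.grad_3 1)
  · intro k hk
    have h2 : ∀ᶠ M in atTop, κ M < k / 2 := hκ.eventually_lt_const (by positivity)
    obtain ⟨M, hM, hM0⟩ := (h2.and (eventually_gt_atTop 0)).exists
    refine ⟨M, ?_⟩
    filter_upwards [T, P] with ε ht hε
    have hs : 0 < √ε := Real.sqrt_pos.2 hε
    constructor
    · refine (l2norm_le_sum _ _).trans ?_
      rw [Fin.sum_univ_two]
      refine (two (ht.layer_h M hM0 0) (ht.layer_h M hM0 1)).trans (ofReal_le_ofReal ?_)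
      rw [mul_div_assoc']
      gcongr
      linarith
    · refine (ht.layer_3 M hM0).trans (ofReal_le_ofReal ?_)
      gcongr
      linarith
  · intro M
    have hlim : Tendsto (fun ε => √(M * ε) * K) (𝓝[>] 0) (𝓝 0) := by
      have : Continuous fun ε => √(M * ε) * K := by fun_prop
      have := (this.tendsto 0).mono_left (nhdsWithin_le_nhds (s := Ioi 0))
      simpa using this
    refine tendsto_of_eventually_le_ofReal hlim (m := 3) (T.mono fun ε ht => ?_)
    refine (l2norm_le_sum _ _).trans ?_
    rw [ofReal_mul (by norm_num), ENNReal.ofReal_ofNat]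
    refine (Finset.sum_le_card_nsmul _ _ _ fun i _ => ht.interior M i).trans ?_
    simp
  · filter_upwards [T] with ε ht
    refine (l2norm_le_sum _ _).trans ?_
    refine (Finset.sum_le_card_nsmul _ _ _ fun i _ => ht.int i).trans ?_
    simp [mul_assoc]
  · filter_upwards [T] with ε ht
    refine (l2norm_le_sum _ _).trans ?_
    rw [Fin.sum_univ_two]
    refine (add_le_add (ht.bl_h 0) (ht.bl_h 1)).trans ?_
    rw [← two_mul, ← mul_assoc]
    gcongr
    rw [show (2 : ℝ≥0∞) = ofReal 2 by simp, ← ofReal_mul (by norm_num)]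
    refine ofReal_le_ofReal ?_
    rw [mul_div_assoc']
    push_cast
    gcongr
    norm_num
  · by_cases h0 : normH1 D σ dσ = 0
    · filter_upwards [T] with ε ht
      rw [ht.bl_zero h0]
      exact zero_le
    · have hpos : 0 < ((3 * C : ℝ≥0) : ℝ≥0∞) * normH1 D σ dσ := by
        refine ENNReal.mul_pos ?_ h0
        simp [hC.ne']
      have h1 : Tendsto (fun ε => ofReal (τ ε)) (𝓝[>] 0) (𝓝 0) := by
        have := ENNReal.tendsto_ofReal hτ
        rwa [ENNReal.ofReal_zero] at this
      filter_upwards [T, h1.eventually_lt_const hpos] with ε ht hlt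
      exact ht.bl_3.trans hlt.le

lemma HasTraceTop.congr {D : HDom} {g : Pt → ℝ} {s s' : HPt → ℝ} (h : HasTraceTop D g s)
    (hs : ∀ᵐ q ∂D.hVol, s q = s' q) : HasTraceTop D g s' := by
  refine Tendsto.congr (fun δ => ?_) h
  congr 1
  refine lintegral_congr_ae ?_
  have hq : Measure.QuasiMeasurePreserving (fun p : Pt => (p.1, p.2.1))
      (D.volSlab (Ioo (1 - δ) 1)) D.hVol :=
    Measure.quasiMeasurePreserving_fst.comp
      (MeasurePreserving.symm _ (measurePreserving_volSlab D _)).quasiMeasurePreserving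
  filter_upwards [hq.ae hs] with p hp
  rw [hp]

lemma HasTraceTop.to_torus {g : Pt → ℝ} {s : HPt → ℝ} (h : HasTraceTop .channel g s) :
    HasTraceTop .torus g s :=
  tendsto_of_tendsto_of_tendsto_of_le_of_le tendsto_const_nhds h (fun _ => zero_le) fun _ =>
    mul_le_mul_right (lintegral_mono' (torus_volSlab_le _) le_rfl) _

lemma HasTraceBottom.to_torus {g : Pt → ℝ} {s : HPt → ℝ} (h : HasTraceBottom .channel g s) :
    HasTraceBottom .torus g s :=
  tendsto_of_tendsto_of_tendsto_of_le_of_le tendsto_const_nhds h (fun _ => zero_le) fun _ =>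
    mul_le_mul_right (lintegral_mono' (torus_volSlab_le _) le_rfl) _

/-! ### Wind data on the channel and their majorants -/

/-- A wind stress on the channel with its derivatives, as periodic functions of the unrolled
variables, that vanishes quadratically at the equator. -/
structure WindData (s : VF₁) (ds : VF₂)
    (dds : VF₃) (A : ℝ) : Prop where
  good : ∀ i, HGood (s i)
  good_d : ∀ i k, HGood (ds i k)
  good_dd : ∀ i k l, HGood (dds i k l)
  weak : ∀ i k, IsHWeakDeriv .channel k (s i) (ds i k)
  weak_d : ∀ i k l, IsHWeakDeriv .channel l (ds i k) (dds i k l)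
  near : ∀ i q, |q.2| ≤ 1 → |s i q| ≤ A * q.2 ^ 2
  near_d : ∀ i k q, |q.2| ≤ 1 → |ds i k q| ≤ A * |q.2|
  mean : ∀ᵐ y, ∫ x in 𝕀, s 0 (x, y) = 0

/-- Pointwise size of the wind stress. -/
def size0 (s : VF₁) (q : HPt) : ℝ := ∑ i, |s i q|
/-- Pointwise size of the first derivatives. -/
def size1 (ds : VF₂) (q : HPt) : ℝ := ∑ i, ∑ k, |ds i k q|
/-- Pointwise size of the second derivatives. -/
def size2 (dds : VF₃) (q : HPt) : ℝ :=
  ∑ i, ∑ k, ∑ l, |dds i k l q|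

/-- Majorant controlled by the `H¹` norm. -/
def maj1 (s : VF₁) (q : HPt) : ℝ := size0 s q + size0 s q / |q.2|

/-- The weighted majorant that stays bounded at the equator. -/
def majG (s : VF₁) (ds : VF₂) (q : HPt) : ℝ :=
  size1 ds q / |q.2| + size0 s q / q.2 ^ 2

/-- Majorant controlled by the `H²` norm. -/
def majE (s : VF₁) (ds : VF₂)
    (dds : VF₃) (q : HPt) : ℝ :=
  maj1 s q + majG s ds q + size1 ds q + size2 dds q

section

variable {s : VF₁} {ds : VF₂}
  {dds : VF₃} {A : ℝ}

lemma size0_nonneg (q : HPt) : 0 ≤ size0 s q := Finset.sum_nonneg fun _ _ => abs_nonneg _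
lemma size1_nonneg (q : HPt) : 0 ≤ size1 ds q :=
  Finset.sum_nonneg fun _ _ => Finset.sum_nonneg fun _ _ => abs_nonneg _
lemma size2_nonneg (q : HPt) : 0 ≤ size2 dds q :=
  Finset.sum_nonneg fun _ _ => Finset.sum_nonneg fun _ _ => Finset.sum_nonneg fun _ _ => abs_nonneg _
lemma maj1_nonneg (q : HPt) : 0 ≤ maj1 s q := by
  have := size0_nonneg (s := s) q
  unfold maj1; positivity
lemma majG_nonneg (q : HPt) : 0 ≤ majG s ds q := by
  have := size0_nonneg (s := s) q
  have := size1_nonneg (ds := ds) q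
  unfold majG; positivity
lemma majE_nonneg (q : HPt) : 0 ≤ majE s ds dds q := by
  have := maj1_nonneg (s := s) q
  have := majG_nonneg (s := s) (ds := ds) q
  have := size1_nonneg (ds := ds) q
  have := size2_nonneg (dds := dds) q
  unfold majE; positivity

lemma eLpNorm_abs_le (f : HPt → ℝ) (μ : Measure HPt) :
    eLpNorm (fun q => |f q|) 2 μ = eLpNorm f 2 μ := eLpNorm_norm f

lemma eLpNorm_fun_add_le {f g : HPt → ℝ} {μ : Measure HPt} (hf : AEStronglyMeasurable f μ)
    (hg : AEStronglyMeasurable g μ) :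
    eLpNorm (fun q => f q + g q) 2 μ ≤ eLpNorm f 2 μ + eLpNorm g 2 μ :=
  eLpNorm_add_le hf hg (by norm_num)

lemma eLpNorm_fun_sum_le {ι : Type*} [Fintype ι] {f : ι → HPt → ℝ} {μ : Measure HPt}
    (hf : ∀ i, AEStronglyMeasurable (f i) μ) {B : ℝ≥0∞} (h : ∀ i, eLpNorm (f i) 2 μ ≤ B) :
    eLpNorm (fun q => ∑ i, f i q) 2 μ ≤ Fintype.card ι * B := by
  have := eLpNorm_sum_le (s := Finset.univ) (fun i _ => hf i) (p := 2) (by norm_num)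
  rw [show (∑ i, f i) = fun q => ∑ i, f i q from funext fun q => Finset.sum_apply _ _ _] at this
  refine this.trans ((Finset.sum_le_card_nsmul _ _ _ fun i _ => h i).trans ?_)
  simp

lemma le_rpow_half_of_sq_le {x S : ℝ≥0∞} (h : x ^ 2 ≤ S) : x ≤ S ^ (1 / 2 : ℝ) := by
  calc x = (x ^ 2) ^ (1 / 2 : ℝ) := by rw [← ENNReal.rpow_two, ← ENNReal.rpow_mul]; norm_num
    _ ≤ _ := by gcongr

lemma le_normH1 (D : HDom) (s : VF₁) (ds : VF₂) (i k : Fin 2) :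
    eLpNorm (s i) 2 D.hVol ≤ normH1 D s ds ∧ eLpNorm (ds i k) 2 D.hVol ≤ normH1 D s ds := by
  constructor <;> refine le_rpow_half_of_sq_le ?_
  · exact le_add_right (Finset.single_le_sum (f := fun i => eLpNorm (s i) 2 D.hVol ^ 2)
      (fun _ _ => zero_le) (Finset.mem_univ i))
  · refine le_add_left ?_
    refine le_trans ?_ (Finset.single_le_sum (f := fun i => ∑ k, eLpNorm (ds i k) 2 D.hVol ^ 2)
      (fun _ _ => zero_le) (Finset.mem_univ i))
    exact Finset.single_le_sum (f := fun k => eLpNorm (ds i k) 2 D.hVol ^ 2)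
      (fun _ _ => zero_le) (Finset.mem_univ k)

lemma normH1_le_normH2 (D : HDom) (s : VF₁) (ds : VF₂)
    (dds : VF₃) : normH1 D s ds ≤ normH2 D s ds dds := by
  unfold normH1 normH2
  exact ENNReal.rpow_le_rpow le_self_add (by norm_num)

lemma le_normH2 (D : HDom) (s : VF₁) (ds : VF₂)
    (dds : VF₃) (i k l : Fin 2) :
    eLpNorm (dds i k l) 2 D.hVol ≤ normH2 D s ds dds := by
  refine le_rpow_half_of_sq_le (le_add_left ?_)
  refine le_trans ?_ (Finset.single_le_sum
    (f := fun i => ∑ k, ∑ l, eLpNorm (dds i k l) 2 D.hVol ^ 2) (fun _ _ => zero_le)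
    (Finset.mem_univ i))
  refine le_trans ?_ (Finset.single_le_sum
    (f := fun k => ∑ l, eLpNorm (dds i k l) 2 D.hVol ^ 2) (fun _ _ => zero_le) (Finset.mem_univ k))
  exact Finset.single_le_sum (f := fun l => eLpNorm (dds i k l) 2 D.hVol ^ 2)
    (fun _ _ => zero_le) (Finset.mem_univ l)

namespace WindData

lemma near_lin (h : WindData s ds dds A) (i : Fin 2) (q : HPt) (hq : |q.2| ≤ 1) : |s i q| ≤ |A| * |q.2| := by
  refine (h.near i q hq).trans ?_
  rw [← sq_abs]
  have h1 := abs_nonneg q.2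
  calc A * |q.2| ^ 2 ≤ |A| * (|q.2| * 1) := by
        rw [sq]
        exact mul_le_mul (le_abs_self A) (by gcongr) (by positivity) (abs_nonneg A)
    _ = _ := by ring

lemma size0_eq_zero (h : WindData s ds dds A) (q : HPt) (hq : q.2 = 0) : size0 s q = 0 :=
  Finset.sum_eq_zero fun i _ => le_antisymm (by simpa [hq] using h.near i q (by simp [hq]))
    (abs_nonneg _)

lemma size1_eq_zero (h : WindData s ds dds A) (q : HPt) (hq : q.2 = 0) : size1 ds q = 0 :=
  Finset.sum_eq_zero fun i _ => Finset.sum_eq_zero fun k _ =>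
    le_antisymm (by simpa [hq] using h.near_d i k q (by simp [hq])) (abs_nonneg _)

lemma measurable_size0 (h : WindData s ds dds A) : Measurable (size0 s) :=
  Finset.measurable_fun_sum _ fun i _ => (h.good i).meas.norm

lemma measurable_size1 (h : WindData s ds dds A) : Measurable (size1 ds) :=
  Finset.measurable_fun_sum _ fun i _ => Finset.measurable_fun_sum _ fun k _ =>
    (h.good_d i k).meas.norm

lemma measurable_size2 (h : WindData s ds dds A) : Measurable (size2 dds) :=
  Finset.measurable_fun_sum _ fun i _ => Finset.measurable_fun_sum _ fun k _ =>
    Finset.measurable_fun_sum _ fun l _ => (h.good_dd i k l).meas.norm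

lemma measurable_maj1 (h : WindData s ds dds A) : Measurable (maj1 s) :=
  h.measurable_size0.add (h.measurable_size0.div (by fun_prop))

lemma measurable_majG (h : WindData s ds dds A) : Measurable (majG s ds) :=
  (h.measurable_size1.div (by fun_prop)).add (h.measurable_size0.div (by fun_prop))

lemma measurable_majE (h : WindData s ds dds A) : Measurable (majE s ds dds) :=
  ((h.measurable_maj1.add h.measurable_majG).add h.measurable_size1).add h.measurable_size2

lemma eLpNorm_size0_le (h : WindData s ds dds A) : eLpNorm (size0 s) 2 hΩ ≤ 2 * normH1 .channel s ds := by
  refine (eLpNorm_fun_sum_le (fun i => (h.good i).meas.norm.aestronglyMeasurable)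
    (B := normH1 .channel s ds) fun i => ?_).trans (by simp)
  exact (eLpNorm_abs_le _ _).trans_le (le_normH1 _ s ds i 0).1

lemma eLpNorm_size0_div_le (h : WindData s ds dds A) :
    eLpNorm (fun q => size0 s q / |q.2|) 2 hΩ ≤ 4 * normH1 .channel s ds := by
  have e : (fun q : HPt => size0 s q / |q.2|) = fun q => ∑ i, |s i q / q.2| := funext fun q => by
    unfold size0
    rw [Finset.sum_div]
    simp only [abs_div]
  rw [e]
  refine (eLpNorm_fun_sum_le (fun i => ((h.good i).meas.div measurable_snd).norm.aestronglyMeasurable)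
    (B := 2 * normH1 .channel s ds) fun i => ?_).trans (le_of_eq ?_)
  · refine (eLpNorm_abs_le _ _).trans_le ((hardy (h.good i) (h.good_d i 1) (h.weak i 1)
      (h.near_lin i)).trans ?_)
    gcongr
    exact (le_normH1 _ s ds i 1).2
  · rw [← mul_assoc]; norm_num

lemma eLpNorm_maj1_le (h : WindData s ds dds A) : eLpNorm (maj1 s) 2 hΩ ≤ 6 * normH1 .channel s ds := by
  refine (eLpNorm_fun_add_le h.measurable_size0.aestronglyMeasurable
    (h.measurable_size0.div (by fun_prop)).aestronglyMeasurable).trans ?_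
  refine (add_le_add h.eLpNorm_size0_le h.eLpNorm_size0_div_le).trans (le_of_eq ?_)
  rw [← add_mul]; norm_num

lemma eLpNorm_size0_div_sq_le (h : WindData s ds dds A) :
    eLpNorm (fun q => size0 s q / q.2 ^ 2) 2 hΩ ≤ 8 * normH2 .channel s ds dds := by
  have e : (fun q : HPt => size0 s q / q.2 ^ 2) = fun q => ∑ i, |s i q / q.2 ^ 2| :=
    funext fun q => by
      unfold size0
      rw [Finset.sum_div]
      simp only [abs_div, abs_pow, sq_abs]
  rw [e]
  refine (eLpNorm_fun_sum_le (fun i => ((h.good i).meas.div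
    (measurable_snd.pow_const 2)).norm.aestronglyMeasurable)
    (B := 2 * (2 * normH2 .channel s ds dds)) fun i => ?_).trans (le_of_eq ?_)
  · refine (eLpNorm_abs_le _ _).trans_le ((hardy_sq (h.good i) (h.good_d i 1) (h.weak i 1)
      (h.near_lin i)).trans ?_)
    gcongr
    refine (hardy (h.good_d i 1) (h.good_dd i 1 1) (h.weak_d i 1 1) (h.near_d i 1)).trans ?_
    gcongr
    exact le_normH2 _ s ds dds i 1 1
  · rw [← mul_assoc, ← mul_assoc]; norm_num

lemma eLpNorm_size1_le (h : WindData s ds dds A) : eLpNorm (size1 ds) 2 hΩ ≤ 4 * normH1 .channel s ds := by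
  refine (eLpNorm_fun_sum_le (f := fun i q => ∑ k, |ds i k q|) (fun i =>
    (Finset.measurable_fun_sum _ fun k _ => (h.good_d i k).meas.norm).aestronglyMeasurable)
    (B := 2 * normH1 .channel s ds) fun i => ?_).trans (le_of_eq ?_)
  · refine (eLpNorm_fun_sum_le (fun k => (h.good_d i k).meas.norm.aestronglyMeasurable)
      (B := normH1 .channel s ds) fun k => ?_).trans (by simp)
    exact (eLpNorm_abs_le _ _).trans_le (le_normH1 _ s ds i k).2
  · rw [← mul_assoc]; norm_num

lemma eLpNorm_size1_div_le (h : WindData s ds dds A) :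
    eLpNorm (fun q => size1 ds q / |q.2|) 2 hΩ ≤ 8 * normH2 .channel s ds dds := by
  have e : (fun q : HPt => size1 ds q / |q.2|) = fun q => ∑ i, ∑ k, |ds i k q / q.2| :=
    funext fun q => by
      unfold size1
      simp only [Finset.sum_div, abs_div]
  rw [e]
  refine (eLpNorm_fun_sum_le (f := fun i q => ∑ k, |ds i k q / q.2|) (fun i =>
    (Finset.measurable_fun_sum _ fun k _ =>
      ((h.good_d i k).meas.div measurable_snd).norm).aestronglyMeasurable)
    (B := 2 * (2 * normH2 .channel s ds dds)) fun i => ?_).trans (le_of_eq ?_)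
  · refine (eLpNorm_fun_sum_le (fun k =>
      ((h.good_d i k).meas.div measurable_snd).norm.aestronglyMeasurable)
      (B := 2 * normH2 .channel s ds dds) fun k => ?_).trans (by simp)
    refine (eLpNorm_abs_le _ _).trans_le ((hardy (h.good_d i k) (h.good_dd i k 1)
      (h.weak_d i k 1) (h.near_d i k)).trans ?_)
    gcongr
    exact le_normH2 _ s ds dds i k 1
  · rw [← mul_assoc, ← mul_assoc]; norm_num

lemma eLpNorm_size2_le (h : WindData s ds dds A) :
    eLpNorm (size2 dds) 2 hΩ ≤ 8 * normH2 .channel s ds dds := by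
  refine (eLpNorm_fun_sum_le (f := fun i q => ∑ k, ∑ l, |dds i k l q|) (fun i =>
    (Finset.measurable_fun_sum _ fun k _ => Finset.measurable_fun_sum _ fun l _ =>
      (h.good_dd i k l).meas.norm).aestronglyMeasurable)
    (B := 2 * (2 * normH2 .channel s ds dds)) fun i => ?_).trans (le_of_eq ?_)
  · refine (eLpNorm_fun_sum_le (f := fun k q => ∑ l, |dds i k l q|) (fun k =>
      (Finset.measurable_fun_sum _ fun l _ => (h.good_dd i k l).meas.norm).aestronglyMeasurable)
      (B := 2 * normH2 .channel s ds dds) fun k => ?_).trans (by simp)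
    refine (eLpNorm_fun_sum_le (fun l => (h.good_dd i k l).meas.norm.aestronglyMeasurable)
      (B := normH2 .channel s ds dds) fun l => ?_).trans (by simp)
    exact (eLpNorm_abs_le _ _).trans_le (le_normH2 _ s ds dds i k l)
  · rw [← mul_assoc, ← mul_assoc]; norm_num

lemma eLpNorm_majG_le (h : WindData s ds dds A) :
    eLpNorm (majG s ds) 2 hΩ ≤ 16 * normH2 .channel s ds dds := by
  refine (eLpNorm_fun_add_le (h.measurable_size1.div (by fun_prop)).aestronglyMeasurable
    (h.measurable_size0.div (by fun_prop)).aestronglyMeasurable).trans ?_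
  refine (add_le_add h.eLpNorm_size1_div_le h.eLpNorm_size0_div_sq_le).trans (le_of_eq ?_)
  rw [← add_mul]; norm_num

lemma eLpNorm_majE_le (h : WindData s ds dds A) :
    eLpNorm (majE s ds dds) 2 hΩ ≤ 34 * normH2 .channel s ds dds := by
  have h12 := normH1_le_normH2 .channel s ds dds
  refine (eLpNorm_fun_add_le ((h.measurable_maj1.add h.measurable_majG).add
    h.measurable_size1).aestronglyMeasurable h.measurable_size2.aestronglyMeasurable).trans ?_
  refine (add_le_add_left (eLpNorm_fun_add_le (h.measurable_maj1.add
    h.measurable_majG).aestronglyMeasurable h.measurable_size1.aestronglyMeasurable) _).trans ?_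
  refine (add_le_add_left (add_le_add_left (eLpNorm_fun_add_le h.measurable_maj1.aestronglyMeasurable
    h.measurable_majG.aestronglyMeasurable) _) _).trans ?_
  calc _ ≤ 6 * normH2 .channel s ds dds + 16 * normH2 .channel s ds dds
        + 4 * normH2 .channel s ds dds + 8 * normH2 .channel s ds dds := by
        gcongr
        · exact h.eLpNorm_maj1_le.trans (by gcongr)
        · exact h.eLpNorm_majG_le
        · exact h.eLpNorm_size1_le.trans (by gcongr)
        · exact h.eLpNorm_size2_le
    _ = _ := by rw [← add_mul, ← add_mul, ← add_mul]; norm_num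

lemma normH2_lt_top (h : WindData s ds dds A) : normH2 .channel s ds dds < ⊤ := by
  unfold normH2
  refine ENNReal.rpow_lt_top_of_nonneg (by norm_num) (ENNReal.add_ne_top.2 ⟨ENNReal.add_ne_top.2
    ⟨?_, ?_⟩, ?_⟩)
  · exact ENNReal.sum_ne_top.2 fun i _ => ENNReal.pow_ne_top (h.good i).memLp.2.ne
  · exact ENNReal.sum_ne_top.2 fun i _ => ENNReal.sum_ne_top.2 fun k _ =>
      ENNReal.pow_ne_top (h.good_d i k).memLp.2.ne
  · exact ENNReal.sum_ne_top.2 fun i _ => ENNReal.sum_ne_top.2 fun k _ =>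
      ENNReal.sum_ne_top.2 fun l _ => ENNReal.pow_ne_top (h.good_dd i k l).memLp.2.ne

lemma memLp_majE (h : WindData s ds dds A) : MemLp (majE s ds dds) 2 hΩ :=
  ⟨h.measurable_majE.aestronglyMeasurable,
    h.eLpNorm_majE_le.trans_lt (ENNReal.mul_lt_top (by simp) h.normH2_lt_top)⟩

lemma majG_le (h : WindData s ds dds A) (q : HPt) (hq : |q.2| ≤ 1) : majG s ds q ≤ 6 * |A| := by
  unfold majG
  rcases eq_or_ne q.2 0 with h0 | h0
  · simp [h0]
  have hy : 0 < |q.2| := abs_pos.2 h0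
  have h1 : size1 ds q ≤ 4 * (|A| * |q.2|) := by
    unfold size1
    refine (Finset.sum_le_card_nsmul _ _ (2 * (|A| * |q.2|)) fun i _ =>
      (Finset.sum_le_card_nsmul _ _ (|A| * |q.2|) fun k _ =>
        (h.near_d i k q hq).trans (by gcongr; exact le_abs_self A)).trans (by simp)).trans ?_
    simp only [Finset.card_univ, Fintype.card_fin, nsmul_eq_mul]
    push_cast
    linarith
  have h2 : size0 s q ≤ 2 * (|A| * q.2 ^ 2) := by
    unfold size0
    refine (Finset.sum_le_card_nsmul _ _ (|A| * q.2 ^ 2) fun i _ =>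
        (h.near i q hq).trans (by gcongr; exact le_abs_self A)).trans ?_
    simp
  have h3 : size1 ds q / |q.2| ≤ 4 * |A| := by rw [div_le_iff₀ hy]; linarith
  have h4 : size0 s q / q.2 ^ 2 ≤ 2 * |A| := by rw [div_le_iff₀ (by positivity)]; linarith
  linarith

/-- The majorant with a singular weight at the equator is still square integrable. -/
lemma memLp_majG_weight (h : WindData s ds dds A) :
    MemLp (fun q => majG s ds q * |q.2| ^ (-(3 / 8) : ℝ)) 2 hΩ := by
  have hm : Measurable fun q : HPt => majG s ds q * |q.2| ^ (-(3 / 8) : ℝ) :=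
    h.measurable_majG.mul (by fun_prop)
  refine ⟨hm.aestronglyMeasurable, ?_⟩
  have key : ∫⁻ q, ‖majG s ds q * |q.2| ^ (-(3 / 8) : ℝ)‖ₑ ^ 2 ∂hΩ < ⊤ := by
    have hpt : ∀ q : HPt, ‖majG s ds q * |q.2| ^ (-(3 / 8) : ℝ)‖ₑ ^ 2 ≤
        ‖majG s ds q‖ₑ ^ 2 + (Ioo (-1 : ℝ) 1).indicator
          (fun y => ofReal ((6 * |A|) ^ 2 * |y| ^ (-(3 / 4) : ℝ))) q.2 := by
      intro q
      have e : (|q.2| ^ (-(3 / 8) : ℝ)) ^ 2 = |q.2| ^ (-(3 / 4) : ℝ) := by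
        rw [← Real.rpow_natCast, ← Real.rpow_mul (abs_nonneg _)]; norm_num
      have hG := majG_nonneg (s := s) (ds := ds) q
      rw [← ofReal_norm, ← ofReal_norm, ← ofReal_pow (norm_nonneg _),
        ← ofReal_pow (norm_nonneg _), Real.norm_eq_abs, Real.norm_eq_abs, sq_abs, sq_abs,
        mul_pow, e]
      rcases lt_or_ge |q.2| 1 with hy | hy
      · rw [indicator_of_mem (show q.2 ∈ Ioo (-1 : ℝ) 1 from abs_lt.1 hy)]
        refine le_add_left (ofReal_le_ofReal ?_)
        gcongr
        exact h.majG_le q hy.le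
      · refine le_add_right (ofReal_le_ofReal ?_)
        exact mul_le_of_le_one_right (sq_nonneg _)
          (Real.rpow_le_one_of_one_le_of_nonpos hy (by norm_num))
    have hfin : ∫⁻ q : HPt, (Ioo (-1 : ℝ) 1).indicator
        (fun y => ofReal ((6 * |A|) ^ 2 * |y| ^ (-(3 / 4) : ℝ))) q.2 ∂hΩ < ⊤ := by
      rw [channel_hVol_eq]
      have hm1 : Measurable ((Ioo (-1 : ℝ) 1).indicator
        (fun y => ofReal ((6 * |A|) ^ 2 * |y| ^ (-(3 / 4) : ℝ)))) :=
        Measurable.indicator (by fun_prop) measurableSet_Ioo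
      have hm2 : AEMeasurable (fun q : HPt => (Ioo (-1 : ℝ) 1).indicator
          (fun y => ofReal ((6 * |A|) ^ 2 * |y| ^ (-(3 / 4) : ℝ))) q.2)
          ((volume.restrict 𝕀).prod volume) :=
        (hm1.comp measurable_snd).aemeasurable
      rw [lintegral_prod _ hm2]
      simp only [lintegral_const, Measure.restrict_apply_univ, Real.volume_Ioo]
      rw [lintegral_indicator measurableSet_Ioo]
      refine ENNReal.mul_lt_top ?_ (by simp)
      have hi : IntervalIntegrable (fun y : ℝ => (6 * |A|) ^ 2 * |y| ^ (-(3 / 4) : ℝ)) volume (-1) 1 := by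
        have h01 : IntervalIntegrable (fun y : ℝ => |y| ^ (-(3 / 4) : ℝ)) volume 0 1 := by
          refine (intervalIntegral.intervalIntegrable_rpow' (r := -(3 / 4)) (by norm_num)).congr ?_
          intro y hy
          rw [Set.uIoc_of_le zero_le_one] at hy
          simp only [abs_of_pos hy.1]
        have h10 := (IntervalIntegrable.iff_comp_neg).1 h01
        simp only [abs_neg, neg_zero] at h10
        exact (h10.symm.trans h01).const_mul _
      rw [intervalIntegrable_iff_integrableOn_Ioo_of_le (by norm_num)] at hi
      exact hi.lintegral_lt_top
    refine (lintegral_mono hpt).trans_lt ?_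
    rw [lintegral_add_left (h.measurable_majG.enorm.pow_const 2), ← eLpNorm_two_sq]
    refine ENNReal.add_lt_top.2 ⟨ENNReal.pow_lt_top ?_, hfin⟩
    exact h.eLpNorm_majG_le.trans_lt (ENNReal.mul_lt_top (by simp) h.normH2_lt_top)
  rw [← eLpNorm_two_sq] at key
  exact lt_of_not_ge fun ht => by
    rw [top_le_iff.1 ht] at key
    simp at key

end WindData

end

/-! ### Fields built from a horizontal function and a profile -/

lemma IsHWeakDeriv.linear_comb {k : Fin 2} {f f' g g' : HPt → ℝ}
    (hf : MemLp f 2 hΩ) (hf' : MemLp f' 2 hΩ)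
    (hg : MemLp g 2 hΩ) (hg' : MemLp g' 2 hΩ)
    (h : IsHWeakDeriv .channel k f g) (h' : IsHWeakDeriv .channel k f' g') (a a' : ℝ) :
    IsHWeakDeriv .channel k (fun q => a * f q + a' * f' q) (fun q => a * g q + a' * g' q) := by
  intro φ hφ
  have hp := (hφ.pd k).hGood.memLp
  have hq := hφ.hGood.memLp
  have i1 := ((hf.integrable_mul hp).const_mul a).add ((hf'.integrable_mul hp).const_mul a')
  have k1 := integral_add ((hf.integrable_mul hp).const_mul a) ((hf'.integrable_mul hp).const_mul a')
  have k2 := integral_add ((hg.integrable_mul hq).const_mul a) ((hg'.integrable_mul hq).const_mul a')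
  simp only [Pi.mul_apply, integral_const_mul] at k1 k2
  have e1 : ∫ q, (a * f q + a' * f' q) * pd (hDir k) φ q ∂hΩ =
      ∫ q, (a * (f q * pd (hDir k) φ q) + a' * (f' q * pd (hDir k) φ q)) ∂hΩ :=
    integral_congr_ae (Eventually.of_forall fun q => by simp only; ring)
  have e2 : ∫ q, (a * g q + a' * g' q) * φ q ∂hΩ =
      ∫ q, (a * (g q * φ q) + a' * (g' q * φ q)) ∂hΩ :=
    integral_congr_ae (Eventually.of_forall fun q => by simp only; ring)
  rw [e1, e2, k1, k2, h φ hφ, h' φ hφ]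
  ring

/-- The complex form of a pair of real functions. -/
def cpx (f : VF₁) (q : HPt) : ℂ := f 0 q + f 1 q * I

lemma measurable_cpx {f : VF₁} (hf : ∀ i, Measurable (f i)) : Measurable (cpx f) :=
  (Complex.measurable_ofReal.comp (hf 0)).add
    ((Complex.measurable_ofReal.comp (hf 1)).mul_const _)

lemma norm_cpx_le (f : VF₁) (q : HPt) : ‖cpx f q‖ ≤ |f 0 q| + |f 1 q| :=
  norm_add_mul_I_le _ _

lemma memLp_cpx {f : VF₁} {μ : Measure HPt} (hf : ∀ i, MemLp (f i) 2 μ) :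
    MemLp (cpx f) 2 μ := by
  have h0 : MemLp (fun q => (f 0 q : ℂ)) 2 μ := (hf 0).ofReal
  have h1 : MemLp (fun q => I * (f 1 q : ℂ)) 2 μ := (hf 1).ofReal.const_mul _
  have e : cpx f = fun q => (f 0 q : ℂ) + I * (f 1 q : ℂ) :=
    funext fun q => by rw [mul_comm]; rfl
  rw [e]
  exact h0.add h1

lemma hWeakC_cpx {k : Fin 2} {f g : VF₁} (h : ∀ i, IsHWeakDeriv .channel k (f i) (g i)) :
    HWeakC k (cpx f) (cpx g) := by
  constructor <;> simp [cpx, h]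

lemma HWeakC.linear_comb {k : Fin 2} {f f' g g' : HPt → ℂ}
    (hf : MemLp f 2 hΩ) (hf' : MemLp f' 2 hΩ)
    (hg : MemLp g 2 hΩ) (hg' : MemLp g' 2 hΩ)
    (h : HWeakC k f g) (h' : HWeakC k f' g') (a a' : ℂ) :
    HWeakC k (fun q => a * f q + a' * f' q) (fun q => a * g q + a' * g' q) := by
  constructor
  · have l1 := IsHWeakDeriv.linear_comb hf.re' hf.im' hg.re' hg.im' h.1 h.2 a.re (-a.im)
    have l2 := IsHWeakDeriv.linear_comb hf'.re' hf'.im' hg'.re' hg'.im' h'.1 h'.2 a'.re (-a'.im)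
    have := IsHWeakDeriv.linear_comb ((hf.re'.const_mul _).add (hf.im'.const_mul _))
      ((hf'.re'.const_mul _).add (hf'.im'.const_mul _)) ((hg.re'.const_mul _).add (hg.im'.const_mul _))
      ((hg'.re'.const_mul _).add (hg'.im'.const_mul _)) l1 l2 1 1
    simpa [sub_eq_add_neg] using this
  · have l1 := IsHWeakDeriv.linear_comb hf.re' hf.im' hg.re' hg.im' h.1 h.2 a.im a.re
    have l2 := IsHWeakDeriv.linear_comb hf'.re' hf'.im' hg'.re' hg'.im' h'.1 h'.2 a'.im a'.re
    have := IsHWeakDeriv.linear_comb ((hf.re'.const_mul _).add (hf.im'.const_mul _))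
      ((hf'.re'.const_mul _).add (hf'.im'.const_mul _)) ((hg.re'.const_mul _).add (hg.im'.const_mul _))
      ((hg'.re'.const_mul _).add (hg'.im'.const_mul _)) l1 l2 1 1
    simpa [add_comm] using this

lemma HWeakC.const_mul {k : Fin 2} {f g : HPt → ℂ}
    (hf : MemLp f 2 hΩ) (hg : MemLp g 2 hΩ)
    (h : HWeakC k f g) (a : ℂ) : HWeakC k (fun q => a * f q) (fun q => a * g q) := by
  simpa using HWeakC.linear_comb hf hf hg hg h h a 0

/-- The field `Re (f(x, y) k(y, z))`. -/
def fld (f : HPt → ℂ) (k : ℝ → ℝ → ℂ) (p : Pt) : ℝ :=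
  (f (p.1, p.2.1) * k p.2.1 p.2.2).re

lemma abs_fld_le (f : HPt → ℂ) (k : ℝ → ℝ → ℂ) (q : HPt) (z : ℝ) :
    |fld f k (q.1, q.2, z)| ≤ ‖f q‖ * ‖k q.2 z‖ := by
  rw [← norm_mul]
  exact Complex.abs_re_le_norm _

/-- Profiles that are smooth in `(y, z)` and bounded for `0 ≤ z ≤ 1`. -/
structure Prof (k : ℝ → ℝ → ℂ) : Prop where
  smooth : ContDiff ℝ ∞ (↿k : ℝ × ℝ → ℂ)
  bdd : ∃ B, ∀ y, ∀ z ∈ Icc (0 : ℝ) 1, ‖k y z‖ ≤ B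

lemma locInt_fld {D : HDom} {f : HPt → ℂ} (hf : MemLp f 2 D.hVol) {k : ℝ → ℝ → ℂ}
    (hk : ContDiff ℝ ∞ (↿k : ℝ × ℝ → ℂ)) : LocInt D (fld f k) :=
  locInt_re_mul hf hk.continuous

lemma measurable_fld {f : HPt → ℂ} (hf : Measurable f) {k : ℝ → ℝ → ℂ}
    (hk : ContDiff ℝ ∞ (↿k : ℝ × ℝ → ℂ)) : Measurable (fld f k) := by
  have h1 : Measurable fun p : Pt => f (p.1, p.2.1) := hf.comp (by fun_prop)
  have h2 : Measurable fun p : Pt => k p.2.1 p.2.2 :=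
    hk.continuous.measurable.comp (by fun_prop : Measurable fun p : Pt => (p.2.1, p.2.2))
  exact Complex.measurable_re.comp (h1.mul h2)

lemma memLp_fld {f : HPt → ℂ} (hfm : Measurable f) (hf : MemLp f 2 hΩ)
    {k : ℝ → ℝ → ℂ} (hk : Prof k) : MemLp (fld f k) 2 vΩ := by
  obtain ⟨B, hB⟩ := hk.bdd
  have hB0 : 0 ≤ B := (norm_nonneg _).trans (hB 0 0 (by simp))
  refine ⟨(measurable_fld hfm hk.smooth).aestronglyMeasurable, ?_⟩
  refine (eLpNorm_vol_le .channel (E := fun q => ‖f q‖) hB0 fun q z hz => ?_).trans_lt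
    (ENNReal.mul_lt_top (by simp) ((eLpNorm_norm f).trans_lt hf.2))
  refine (abs_fld_le f k q z).trans ?_
  rw [abs_norm, mul_comm]
  gcongr
  exact hB _ _ (Ioo_subset_Icc_self hz)

lemma weak_fld_zero {f g : HPt → ℂ} (hf : MemLp f 2 hΩ)
    (hg : MemLp g 2 hΩ) {k : ℝ → ℝ → ℂ} (hk : ContDiff ℝ ∞ (↿k : ℝ × ℝ → ℂ))
    (h : HWeakC 0 f g) : IsWeakDeriv .channel 0 (fld f k) (fld g k) :=
  isWeakDeriv_re_mul_zero hf hg h hk.continuous (contDiff_slice hk)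

lemma weak_fld_one {f g : HPt → ℂ} (hf : MemLp f 2 hΩ)
    (hg : MemLp g 2 hΩ) {k : ℝ → ℝ → ℂ} (hk : ContDiff ℝ ∞ (↿k : ℝ × ℝ → ℂ))
    (h : HWeakC 1 f g) :
    IsWeakDeriv .channel 1 (fld f k) (fun p => fld g k p + fld f (dY k) p) :=
  isWeakDeriv_re_mul_one hf hg h hk.continuous (contDiff_slice hk) (contDiff_dY hk).continuous
    (hasDerivAt_dY hk)

lemma weak_fld_two {D : HDom} {f : HPt → ℂ} (hf : MemLp f 2 D.hVol) {k k' : ℝ → ℝ → ℂ}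
    (hk : ContDiff ℝ ∞ (↿k : ℝ × ℝ → ℂ)) (hk' : ContDiff ℝ ∞ (↿k' : ℝ × ℝ → ℂ))
    (hd : ∀ y z, HasDerivAt (fun z => k y z) (k' y z) z) : IsWeakDeriv D 2 (fld f k) (fld f k') :=
  isWeakDeriv_re_mul_two hf hk.continuous hk'.continuous hd

/-! ### The boundary layer and the Ekman transport -/

/-- Data for the construction at a fixed `ε`. -/
structure Setup (b g : ℝ → ℝ) (c L C₀ ε : ℝ) (s : VF₁) (ds : VF₂)
    (dds : VF₃) (A : ℝ) : Prop where
  wind : WindData s ds dds A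
  smoothed : Smoothed b g c L C₀ ε
  two_le : 2 ≤ c
  nonneg : 0 ≤ L
  pos : 0 < ε
  small : ε ≤ 1 / (4 * c)

/-- The divergence-type combination `∂ₓS - i ∂_yS`, applied to two given derivatives. -/
def dvg (f g : VF₁) (q : HPt) : ℂ := 1 * cpx f q + -I * cpx g q

lemma measurable_dvg {f g : VF₁} (hf : ∀ i, Measurable (f i))
    (hg : ∀ i, Measurable (g i)) : Measurable (dvg f g) :=
  ((measurable_cpx hf).const_mul _).add ((measurable_cpx hg).const_mul _)

lemma memLp_dvg {f g : VF₁} {μ : Measure HPt} (hf : ∀ i, MemLp (f i) 2 μ)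
    (hg : ∀ i, MemLp (g i) 2 μ) : MemLp (dvg f g) 2 μ :=
  ((memLp_cpx hf).const_mul _).add ((memLp_cpx hg).const_mul _)

/-- Multiplication of a complex-valued function by a constant. -/
def cm (a : ℂ) (f : HPt → ℂ) (q : HPt) : ℂ := a * f q

/-- A horizontal profile that does not depend on `z`. -/
def atTop1 (k : ℝ → ℝ → ℂ) (y _z : ℝ) : ℂ := k y 1

/-- The linear profile with a given value at `z = 1`. -/
def lin1 (k : ℝ → ℝ → ℂ) (y z : ℝ) : ℂ := z * k y 1

/-- Division of a profile by `ε²`. -/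
def dsq (ε : ℝ) (k : ℝ → ℝ → ℂ) (y z : ℝ) : ℂ := k y z / ε ^ 2

lemma Prof.atTop1 {k : ℝ → ℝ → ℂ} (hk : Prof k) : Prof (atTop1 k) := by
  refine ⟨(contDiff_slice hk.smooth 1).comp contDiff_fst, ?_⟩
  obtain ⟨B, hB⟩ := hk.bdd
  exact ⟨B, fun y z _ => hB y 1 (by simp)⟩

lemma Prof.lin1 {k : ℝ → ℝ → ℂ} (hk : Prof k) : Prof (lin1 k) := by
  refine ⟨(Complex.ofRealCLM.contDiff.comp contDiff_snd).mul
    ((contDiff_slice hk.smooth 1).comp contDiff_fst), ?_⟩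
  obtain ⟨B, hB⟩ := hk.bdd
  refine ⟨B, fun y z hz => ?_⟩
  unfold _root_.lin1
  rw [norm_mul, Complex.norm_real, Real.norm_of_nonneg hz.1]
  have := hB y 1 (by simp)
  exact (mul_le_mul hz.2 this (norm_nonneg _) zero_le_one).trans (by rw [one_mul])

lemma Prof.dsq {k : ℝ → ℝ → ℂ} (hk : Prof k) (ε : ℝ) : Prof (dsq ε k) := by
  refine ⟨hk.smooth.div_const _, ?_⟩
  obtain ⟨B, hB⟩ := hk.bdd
  refine ⟨B / ‖(ε : ℂ) ^ 2‖, fun y z hz => ?_⟩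
  unfold _root_.dsq
  rw [norm_div]
  gcongr
  exact hB y z hz

lemma dY_lin1 {k : ℝ → ℝ → ℂ} (hk : ContDiff ℝ ∞ (↿k : ℝ × ℝ → ℂ)) : dY (lin1 k) = lin1 (dY k) :=
  funext fun y => funext fun z => ((hasDerivAt_dY hk y 1).const_mul (z : ℂ)).deriv

lemma hasDerivAt_lin1 (k : ℝ → ℝ → ℂ) (y z : ℝ) :
    HasDerivAt (fun z => lin1 k y z) (atTop1 k y z) z := by
  have : HasDerivAt (fun z : ℝ => (z : ℂ)) 1 z := Complex.ofRealCLM.hasDerivAt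
  exact (this.mul_const (k y 1)).congr_deriv (one_mul _)

lemma hasDerivAt_atTop1 (k : ℝ → ℝ → ℂ) (y z : ℝ) : HasDerivAt (fun z => atTop1 k y z) 0 z :=
  hasDerivAt_const _ _

lemma Prof.add_sub_lin1 {k : ℝ → ℝ → ℂ} (hk : Prof k) :
    Prof fun y z => k y z - _root_.lin1 k y z := by
  refine ⟨hk.smooth.sub hk.lin1.smooth, ?_⟩
  obtain ⟨B, hB⟩ := hk.bdd
  obtain ⟨B', hB'⟩ := hk.lin1.bdd
  exact ⟨B + B', fun y z hz => (norm_sub_le _ _).trans (add_le_add (hB y z hz) (hB' y z hz))⟩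

namespace Setup

variable {b g : ℝ → ℝ} {c L C₀ ε : ℝ} {s : VF₁} {ds : VF₂}
  {dds : VF₃} {A : ℝ}

lemma norm_pos (h : Setup b g c L C₀ ε s ds dds A) (y : ℝ) : 0 < ‖cor ε g y‖ :=
  h.smoothed.norm_cor_pos h.two_le h.pos y

lemma le_norm (h : Setup b g c L C₀ ε s ds dds A) (y : ℝ) : ε / c ≤ ‖cor ε g y‖ :=
  h.smoothed.eps_le_norm_cor h.two_le h.pos y

lemma kerB_nonneg (h : Setup b g c L C₀ ε s ds dds A) : 0 ≤ kerB c L := by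
  have := h.two_le
  have := h.nonneg
  unfold kerB
  positivity

lemma decay_le (h : Setup b g c L C₀ ε s ds dds A) (y : ℝ) {z : ℝ} (hz : z ∈ Icc (0 : ℝ) 1) :
    decay ε (cor ε g y) z ≤ 1 := by
  have := h.pos
  unfold decay
  rw [Real.exp_le_one_iff, neg_nonpos]
  exact mul_nonneg (by positivity) (by linarith [hz.2])

lemma bounds (h : Setup b g c L C₀ ε s ds dds A) (y : ℝ) {z : ℝ} (hz : z ∈ Icc (0 : ℝ) 1) :
    KerBounds ε g (kerB c L) y z :=
  h.smoothed.kerBounds h.two_le h.nonneg h.pos h.small y hz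

lemma profs (h : Setup b g c L C₀ ε s ds dds A) :
    Prof (kerK ε g) ∧ Prof (dY (kerK ε g)) ∧ Prof (dY (dY (kerK ε g))) ∧ Prof (kerM ε g) ∧
      Prof (dY (kerM ε g)) ∧ Prof (kerQ ε g) ∧ Prof (dY (kerQ ε g)) := by
  obtain ⟨cQ, cK, cM⟩ := h.smoothed.contDiff_ker h.pos
  have hB := h.kerB_nonneg
  have hε := h.pos
  have hc : 0 < c := by linarith [h.two_le]
  have hN : 0 < ε / c := by positivity
  have d0 : ∀ y z, 0 ≤ decay ε (cor ε g y) z := fun y z => (Real.exp_pos _).le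
  refine ⟨⟨cK, kerB c L * 1 / (ε / c), fun y z hz => (h.bounds y hz).K.trans ?_⟩,
    ⟨contDiff_dY cK, kerB c L * 1 / (ε / c) ^ 2, fun y z hz => (h.bounds y hz).dK.trans ?_⟩,
    ⟨contDiff_dY (contDiff_dY cK), kerB c L * 1 / (ε * (ε / c) ^ 2),
      fun y z hz => (h.bounds y hz).ddK.trans ?_⟩,
    ⟨cM, kerB c L * 1 / (ε * √(ε / c)), fun y z hz => (h.bounds y hz).M.trans ?_⟩,
    ⟨contDiff_dY cM, kerB c L * 1 / (ε * (ε / c) * √(ε / c)),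
      fun y z hz => (h.bounds y hz).dM.trans ?_⟩,
    ⟨cQ, kerB c L * 1, fun y z hz => (h.bounds y hz).Q.trans ?_⟩,
    ⟨contDiff_dY cQ, kerB c L * 1 / (ε / c), fun y z hz => (h.bounds y hz).dQ.trans ?_⟩⟩
  all_goals
    have h1 := h.decay_le y hz
    have h2 := h.le_norm y
    have h3 := d0 y z
    gcongr

end Setup

/-! ### Explicit fields -/

section defs

variable (ε : ℝ) (g : ℝ → ℝ) (s : VF₁) (ds : VF₂)
  (dds : VF₃)

/-- First derivatives of the complex wind stress. -/
def cS (k : Fin 2) : HPt → ℂ := cpx fun i => ds i k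

/-- The complex form `∂ₓS - i ∂_yS` of divergence and curl of the wind stress. -/
def cV : HPt → ℂ := dvg (fun i => ds i 0) (fun i => ds i 1)

/-- First derivatives of `cV`. -/
def cV' (k : Fin 2) : HPt → ℂ := dvg (fun i => dds i 0 k) (fun i => dds i 1 k)

/-- The boundary layer field. -/
def blU : UF₁ :=
  ![fld (cpx s) (kerM ε g), fld (cm (-I) (cpx s)) (kerM ε g),
    fun p => fld (cm (-1) (cV ds)) (kerK ε g) p + fld (cm I (cpx s)) (dY (kerK ε g)) p]

/-- The gradient of the boundary layer field. -/
def blG : UF₂ :=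
  ![![fld (cS ds 0) (kerM ε g),
      fun p => fld (cS ds 1) (kerM ε g) p + fld (cpx s) (dY (kerM ε g)) p,
      fld (cpx s) (dsq ε (kerQ ε g))],
    ![fld (cm (-I) (cS ds 0)) (kerM ε g),
      fun p => fld (cm (-I) (cS ds 1)) (kerM ε g) p
        + fld (cm (-I) (cpx s)) (dY (kerM ε g)) p,
      fld (cm (-I) (cpx s)) (dsq ε (kerQ ε g))],
    ![fun p => fld (cm (-1) (cV' dds 0)) (kerK ε g) p + fld (cm I (cS ds 0)) (dY (kerK ε g)) p,
      fun p => (fld (cm (-1) (cV' dds 1)) (kerK ε g) p + fld (cm (-1) (cV ds)) (dY (kerK ε g)) p)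
        + (fld (cm I (cS ds 1)) (dY (kerK ε g)) p
          + fld (cm I (cpx s)) (dY (dY (kerK ε g))) p),
      fun p => fld (cm (-1) (cV ds)) (kerM ε g) p + fld (cm I (cpx s)) (dY (kerM ε g)) p]]

/-- The second vertical derivative of the boundary layer field. -/
def blH : UF₁ :=
  ![fld (cpx s) (dsq ε fun y z => cor ε g y * kerM ε g y z),
    fld (cm (-I) (cpx s)) (dsq ε fun y z => cor ε g y * kerM ε g y z),
    fun p => fld (cm (-1) (cV ds)) (dsq ε (kerQ ε g)) p
      + fld (cm I (cpx s)) (dsq ε (dY (kerQ ε g))) p]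

/-- The interior transport that compensates the boundary layer. -/
def ekU : UF₁ :=
  ![fld (cm (-1) (cpx s)) (atTop1 (kerK ε g)), fld (cm I (cpx s)) (atTop1 (kerK ε g)),
    fun p => fld (cV ds) (lin1 (kerK ε g)) p
      + fld (cm (-I) (cpx s)) (lin1 (dY (kerK ε g))) p]

/-- The gradient of the interior transport. -/
def ekG : UF₂ :=
  ![![fld (cm (-1) (cS ds 0)) (atTop1 (kerK ε g)),
      fun p => fld (cm (-1) (cS ds 1)) (atTop1 (kerK ε g)) p
        + fld (cm (-1) (cpx s)) (atTop1 (dY (kerK ε g))) p,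
      0],
    ![fld (cm I (cS ds 0)) (atTop1 (kerK ε g)),
      fun p => fld (cm I (cS ds 1)) (atTop1 (kerK ε g)) p
        + fld (cm I (cpx s)) (atTop1 (dY (kerK ε g))) p,
      0],
    ![fun p => fld (cV' dds 0) (lin1 (kerK ε g)) p
        + fld (cm (-I) (cS ds 0)) (lin1 (dY (kerK ε g))) p,
      fun p => (fld (cV' dds 1) (lin1 (kerK ε g)) p + fld (cV ds) (lin1 (dY (kerK ε g))) p)
        + (fld (cm (-I) (cS ds 1)) (lin1 (dY (kerK ε g))) p
          + fld (cm (-I) (cpx s)) (lin1 (dY (dY (kerK ε g)))) p),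
      fun p => fld (cV ds) (atTop1 (kerK ε g)) p
        + fld (cm (-I) (cpx s)) (atTop1 (dY (kerK ε g))) p]]

end defs

/-- Measurable square integrable complex functions on the channel. -/
structure CGood (f : HPt → ℂ) : Prop where
  meas : Measurable f
  memLp : MemLp f 2 hΩ

lemma CGood.cm {f : HPt → ℂ} (hf : CGood f) (a : ℂ) : CGood (cm a f) :=
  ⟨hf.meas.const_mul a, hf.memLp.const_mul a⟩

lemma HWeakC.cm {k : Fin 2} {f f' : HPt → ℂ} (h : HWeakC k f f') (hf : CGood f) (hf' : CGood f')
    (a : ℂ) : HWeakC k (cm a f) (cm a f') :=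
  HWeakC.const_mul hf.memLp hf'.memLp h a

lemma CGood.memLp_fld {f : HPt → ℂ} (hf : CGood f) {k : ℝ → ℝ → ℂ} (hk : Prof k) :
    MemLp (fld f k) 2 vΩ := _root_.memLp_fld hf.meas hf.memLp hk

lemma CGood.locInt {f : HPt → ℂ} (hf : CGood f) {k : ℝ → ℝ → ℂ} (hk : Prof k) :
    LocInt .channel (fld f k) := locInt_fld hf.memLp hk.smooth

lemma weak_add_fld_zero {f g f' g' : HPt → ℂ} (hf : CGood f) (hg : CGood g) (hf' : CGood f')
    (hg' : CGood g') {k k' : ℝ → ℝ → ℂ} (hk : Prof k) (hk' : Prof k') (h : HWeakC 0 f g)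
    (h' : HWeakC 0 f' g') :
    IsWeakDeriv .channel 0 (fun p => fld f k p + fld f' k' p)
      (fun p => fld g k p + fld g' k' p) :=
  (weak_fld_zero hf.memLp hg.memLp hk.smooth h).add (hf.locInt hk) (hf'.locInt hk')
    (hg.locInt hk) (hg'.locInt hk') (weak_fld_zero hf'.memLp hg'.memLp hk'.smooth h')

lemma weak_add_fld_one {f g f' g' : HPt → ℂ} (hf : CGood f) (hg : CGood g) (hf' : CGood f')
    (hg' : CGood g') {k k' : ℝ → ℝ → ℂ} (hk : Prof k) (hk' : Prof k') (hd : Prof (dY k))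
    (hd' : Prof (dY k')) (h : HWeakC 1 f g) (h' : HWeakC 1 f' g') :
    IsWeakDeriv .channel 1 (fun p => fld f k p + fld f' k' p)
      (fun p => (fld g k p + fld f (dY k) p) + (fld g' k' p + fld f' (dY k') p)) :=
  (weak_fld_one hf.memLp hg.memLp hk.smooth h).add (hf.locInt hk) (hf'.locInt hk')
    ((hg.locInt hk).add (hf.locInt hd)) ((hg'.locInt hk').add (hf'.locInt hd'))
    (weak_fld_one hf'.memLp hg'.memLp hk'.smooth h')

lemma weak_add_fld_two {f f' : HPt → ℂ} (hf : CGood f) (hf' : CGood f') {k k' l l' : ℝ → ℝ → ℂ}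
    (hk : Prof k) (hk' : Prof k') (hl : Prof l) (hl' : Prof l')
    (hd : ∀ y z, HasDerivAt (fun z => k y z) (l y z) z)
    (hd' : ∀ y z, HasDerivAt (fun z => k' y z) (l' y z) z) :
    IsWeakDeriv .channel 2 (fun p => fld f k p + fld f' k' p)
      (fun p => fld f l p + fld f' l' p) :=
  (weak_fld_two hf.memLp hk.smooth hl.smooth hd).add (hf.locInt hk) (hf'.locInt hk')
    (hf.locInt hl) (hf'.locInt hl') (weak_fld_two hf'.memLp hk'.smooth hl'.smooth hd')

lemma prof_zero : Prof fun _ _ => 0 :=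
  ⟨contDiff_const, 0, fun _ _ _ => by simp⟩

lemma fld_zero (f : HPt → ℂ) : fld f (fun _ _ => 0) = 0 := funext fun p => by simp [fld]

namespace WindData

variable {s : VF₁} {ds : VF₂}
  {dds : VF₃} {A : ℝ}

lemma cGood (h : WindData s ds dds A) : CGood (cpx s) ∧ (∀ k, CGood (cS ds k)) ∧ CGood (cV ds) ∧
    ∀ k, CGood (cV' dds k) :=
  ⟨⟨measurable_cpx fun i => (h.good i).meas, memLp_cpx fun i => (h.good i).memLp⟩,
    fun k => ⟨measurable_cpx fun i => (h.good_d i k).meas, memLp_cpx fun i => (h.good_d i k).memLp⟩,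
    ⟨measurable_dvg (fun i => (h.good_d i 0).meas) (fun i => (h.good_d i 1).meas),
      memLp_dvg (fun i => (h.good_d i 0).memLp) (fun i => (h.good_d i 1).memLp)⟩,
    fun k => ⟨measurable_dvg (fun i => (h.good_dd i 0 k).meas) (fun i => (h.good_dd i 1 k).meas),
      memLp_dvg (fun i => (h.good_dd i 0 k).memLp) (fun i => (h.good_dd i 1 k).memLp)⟩⟩

lemma hWeakC (h : WindData s ds dds A) (k : Fin 2) :
    HWeakC k (cpx s) (cS ds k) ∧ HWeakC k (cV ds) (cV' dds k) :=
  ⟨hWeakC_cpx fun i => h.weak i k, HWeakC.linear_comb (memLp_cpx fun i => (h.good_d i 0).memLp)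
    (memLp_cpx fun i => (h.good_d i 1).memLp) (memLp_cpx fun i => (h.good_dd i 0 k).memLp)
    (memLp_cpx fun i => (h.good_dd i 1 k).memLp) (hWeakC_cpx fun i => h.weak_d i 0 k)
    (hWeakC_cpx fun i => h.weak_d i 1 k) 1 (-I)⟩

end WindData

namespace Setup

variable {b g : ℝ → ℝ} {c L C₀ ε : ℝ} {s : VF₁} {ds : VF₂}
  {dds : VF₃} {A : ℝ}

lemma memLp_bl (h : Setup b g c L C₀ ε s ds dds A) :
    (∀ i, MemLp (blU ε g s ds i) 2 vΩ) ∧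
      ∀ i k, MemLp (blG ε g s ds dds i k) 2 vΩ := by
  obtain ⟨gS, gS', gV, gV'⟩ := h.wind.cGood
  obtain ⟨pK, pdK, pddK, pM, pdM, pQ, -⟩ := h.profs
  constructor
  · intro i
    fin_cases i
    · exact gS.memLp_fld pM
    · exact (gS.cm _).memLp_fld pM
    · exact ((gV.cm _).memLp_fld pK).add ((gS.cm _).memLp_fld pdK)
  · intro i k
    fin_cases i <;> fin_cases k
    · exact (gS' 0).memLp_fld pM
    · exact ((gS' 1).memLp_fld pM).add (gS.memLp_fld pdM)
    · exact gS.memLp_fld (pQ.dsq ε)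
    · exact ((gS' 0).cm _).memLp_fld pM
    · exact (((gS' 1).cm _).memLp_fld pM).add ((gS.cm _).memLp_fld pdM)
    · exact (gS.cm _).memLp_fld (pQ.dsq ε)
    · exact (((gV' 0).cm _).memLp_fld pK).add (((gS' 0).cm _).memLp_fld pdK)
    · exact ((((gV' 1).cm _).memLp_fld pK).add ((gV.cm _).memLp_fld pdK)).add
        ((((gS' 1).cm _).memLp_fld pdK).add ((gS.cm _).memLp_fld pddK))
    · exact ((gV.cm _).memLp_fld pM).add ((gS.cm _).memLp_fld pdM)

lemma memLp_ek (h : Setup b g c L C₀ ε s ds dds A) :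
    (∀ i, MemLp (ekU ε g s ds i) 2 vΩ) ∧
      ∀ i k, MemLp (ekG ε g s ds dds i k) 2 vΩ := by
  obtain ⟨gS, gS', gV, gV'⟩ := h.wind.cGood
  obtain ⟨pK, pdK, pddK, -, -, -, -⟩ := h.profs
  constructor
  · intro i
    fin_cases i
    · exact (gS.cm _).memLp_fld pK.atTop1
    · exact (gS.cm _).memLp_fld pK.atTop1
    · exact (gV.memLp_fld pK.lin1).add ((gS.cm _).memLp_fld pdK.lin1)
  · intro i k
    fin_cases i <;> fin_cases k
    · exact ((gS' 0).cm _).memLp_fld pK.atTop1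
    · exact (((gS' 1).cm _).memLp_fld pK.atTop1).add ((gS.cm _).memLp_fld pdK.atTop1)
    · exact MemLp.zero
    · exact ((gS' 0).cm _).memLp_fld pK.atTop1
    · exact (((gS' 1).cm _).memLp_fld pK.atTop1).add ((gS.cm _).memLp_fld pdK.atTop1)
    · exact MemLp.zero
    · exact ((gV' 0).memLp_fld pK.lin1).add (((gS' 0).cm _).memLp_fld pdK.lin1)
    · exact (((gV' 1).memLp_fld pK.lin1).add (gV.memLp_fld pdK.lin1)).add
        ((((gS' 1).cm _).memLp_fld pdK.lin1).add ((gS.cm _).memLp_fld pddK.lin1))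
    · exact (gV.memLp_fld pK.atTop1).add ((gS.cm _).memLp_fld pdK.atTop1)

lemma contDiff_cor_mul (h : Setup b g c L C₀ ε s ds dds A) :
    ContDiff ℝ ∞ (↿(dsq ε fun y z => cor ε g y * kerM ε g y z) : ℝ × ℝ → ℂ) := by
  obtain ⟨-, -, -, pM, -, -, -⟩ := h.profs
  exact (((h.smoothed.contDiff_cor h.pos).comp contDiff_fst).mul pM.smooth).div_const _

lemma weak_bl (h : Setup b g c L C₀ ε s ds dds A) (i k : Fin 3) :
    IsWeakDeriv .channel k (blU ε g s ds i) (blG ε g s ds dds i k) := by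
  obtain ⟨gS, gS', gV, gV'⟩ := h.wind.cGood
  obtain ⟨pK, pdK, pddK, pM, pdM, pQ, -⟩ := h.profs
  have wS := fun k => (h.wind.hWeakC k).1
  have wV := fun k => (h.wind.hWeakC k).2
  have zM := hasDerivAt_kerM h.pos g
  have zK := hasDerivAt_kerK h.pos g
  have zdK := hasDerivAt_dY_snd pK.smooth zK
  have wSc := fun k a => (wS k).cm gS (gS' k) a
  have wVc := fun k a => (wV k).cm gV (gV' k) a
  fin_cases i <;> fin_cases k
  · exact weak_fld_zero gS.memLp (gS' 0).memLp pM.smooth (wS 0)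
  · exact weak_fld_one gS.memLp (gS' 1).memLp pM.smooth (wS 1)
  · exact weak_fld_two gS.memLp pM.smooth (pQ.dsq ε).smooth zM
  · exact weak_fld_zero (gS.cm _).memLp ((gS' 0).cm _).memLp pM.smooth (wSc 0 _)
  · exact weak_fld_one (gS.cm _).memLp ((gS' 1).cm _).memLp pM.smooth (wSc 1 _)
  · exact weak_fld_two (gS.cm _).memLp pM.smooth (pQ.dsq ε).smooth zM
  · exact weak_add_fld_zero (gV.cm _) ((gV' 0).cm _) (gS.cm _) ((gS' 0).cm _) pK pdK (wVc 0 _)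
      (wSc 0 _)
  · exact weak_add_fld_one (gV.cm _) ((gV' 1).cm _) (gS.cm _) ((gS' 1).cm _) pK pdK pdK pddK
      (wVc 1 _) (wSc 1 _)
  · exact weak_add_fld_two (gV.cm _) (gS.cm _) pK pdK pM pdM zK zdK

lemma weak_blH (h : Setup b g c L C₀ ε s ds dds A) (i : Fin 3) :
    IsWeakDeriv .channel 2 (blG ε g s ds dds i 2) (blH ε g s ds i) ∧
      LocInt .channel (blH ε g s ds i) := by
  obtain ⟨gS, gS', gV, gV'⟩ := h.wind.cGood
  obtain ⟨pK, pdK, pddK, pM, pdM, pQ, pdQ⟩ := h.profs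
  have zM := hasDerivAt_kerM h.pos g
  have zdM : ∀ y z, HasDerivAt (fun z => dY (kerM ε g) y z) (dsq ε (dY (kerQ ε g)) y z) z := by
    intro y z
    refine (hasDerivAt_dY_snd pM.smooth zM y z).congr_deriv ?_
    exact ((hasDerivAt_dY pQ.smooth y z).div_const _).deriv
  have zQ : ∀ y z, HasDerivAt (fun z => dsq ε (kerQ ε g) y z)
      (dsq ε (fun y z => cor ε g y * kerM ε g y z) y z) z := fun y z =>
    (hasDerivAt_kerQ h.pos g y z).div_const _
  fin_cases i
  · exact ⟨weak_fld_two gS.memLp (pQ.dsq ε).smooth h.contDiff_cor_mul zQ,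
      locInt_fld gS.memLp h.contDiff_cor_mul⟩
  · exact ⟨weak_fld_two (gS.cm _).memLp (pQ.dsq ε).smooth h.contDiff_cor_mul zQ,
      locInt_fld (gS.cm _).memLp h.contDiff_cor_mul⟩
  · exact ⟨weak_add_fld_two (gV.cm _) (gS.cm _) pM pdM (pQ.dsq ε) (pdQ.dsq ε) zM zdM,
      ((gV.cm _).locInt (pQ.dsq ε)).add ((gS.cm _).locInt (pdQ.dsq ε))⟩

lemma weak_ek (h : Setup b g c L C₀ ε s ds dds A) (i k : Fin 3) :
    IsWeakDeriv .channel k (ekU ε g s ds i) (ekG ε g s ds dds i k) := by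
  obtain ⟨gS, gS', gV, gV'⟩ := h.wind.cGood
  obtain ⟨pK, pdK, pddK, -, -, -, -⟩ := h.profs
  have wS := fun k => (h.wind.hWeakC k).1
  have wV := fun k => (h.wind.hWeakC k).2
  have wSc := fun k a => (wS k).cm gS (gS' k) a
  have eK := dY_lin1 pK.smooth
  have edK := dY_lin1 pdK.smooth
  have z0 : ∀ f : HPt → ℂ, CGood f →
      IsWeakDeriv .channel 2 (fld f (atTop1 (kerK ε g))) 0 := fun f hf => by
    rw [← fld_zero f]
    exact weak_fld_two hf.memLp pK.atTop1.smooth prof_zero.smooth (hasDerivAt_atTop1 _)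
  fin_cases i <;> fin_cases k
  · exact weak_fld_zero (gS.cm _).memLp ((gS' 0).cm _).memLp pK.atTop1.smooth (wSc 0 _)
  · exact weak_fld_one (gS.cm _).memLp ((gS' 1).cm _).memLp pK.atTop1.smooth (wSc 1 _)
  · exact z0 _ (gS.cm _)
  · exact weak_fld_zero (gS.cm _).memLp ((gS' 0).cm _).memLp pK.atTop1.smooth (wSc 0 _)
  · exact weak_fld_one (gS.cm _).memLp ((gS' 1).cm _).memLp pK.atTop1.smooth (wSc 1 _)
  · exact z0 _ (gS.cm _)
  · exact weak_add_fld_zero gV (gV' 0) (gS.cm _) ((gS' 0).cm _) pK.lin1 pdK.lin1 (wV 0) (wSc 0 _)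
  · have := weak_add_fld_one gV (gV' 1) (gS.cm (-I)) ((gS' 1).cm _) pK.lin1 pdK.lin1
      (by rw [eK]; exact pdK.lin1) (by rw [edK]; exact pddK.lin1) (wV 1) (wSc 1 _)
    rw [eK, edK] at this
    exact this
  · exact weak_add_fld_two gV (gS.cm _) pK.lin1 pdK.lin1 pK.atTop1 pdK.atTop1 (hasDerivAt_lin1 _)
      (hasDerivAt_lin1 _)

lemma weak_ekH (h : Setup b g c L C₀ ε s ds dds A) (i : Fin 3) :
    IsWeakDeriv .channel 2 (ekG ε g s ds dds i 2) 0 := by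
  obtain ⟨gS, gS', gV, gV'⟩ := h.wind.cGood
  obtain ⟨pK, pdK, pddK, -, -, -, -⟩ := h.profs
  have z0 : IsWeakDeriv .channel 2 0 0 := fun φ _ => by simp
  fin_cases i
  · exact z0
  · exact z0
  · have := weak_add_fld_two gV (gS.cm (-I)) pK.atTop1 pdK.atTop1 prof_zero prof_zero
      (hasDerivAt_atTop1 _) (hasDerivAt_atTop1 _)
    simp only [fld_zero, Pi.zero_apply, add_zero] at this
    exact this

lemma div_bl_ek (ε : ℝ) (g : ℝ → ℝ) (s : VF₁) (ds : VF₂)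
    (dds : VF₃) (p : Pt) :
    ∑ k, (blG ε g s ds dds k k p) = 0 ∧ ∑ k, (ekG ε g s ds dds k k p) = 0 := by
  constructor
  all_goals
    rw [Fin.sum_univ_three]
    simp [blG, ekG, fld, cm, cV, dvg, cS, cpx, atTop1]
    ring

end Setup

/-! ### Pointwise and `L²` bounds on the explicit fields -/

lemma norm_cpx_le_size0 (s : VF₁) (q : HPt) : ‖cpx s q‖ ≤ size0 s q := by
  refine (norm_cpx_le s q).trans (le_of_eq ?_)
  simp [size0]

lemma norm_cS_le (ds : VF₂) (k : Fin 2) (q : HPt) :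
    ‖cS ds k q‖ ≤ size1 ds q := by
  refine (norm_cpx_le _ q).trans ?_
  unfold size1
  simp only [Fin.sum_univ_two]
  have := abs_nonneg (ds 0 0 q)
  have := abs_nonneg (ds 0 1 q)
  have := abs_nonneg (ds 1 0 q)
  have := abs_nonneg (ds 1 1 q)
  fin_cases k <;> simp <;> linarith

lemma norm_dvg_le (f g : VF₁) (q : HPt) :
    ‖dvg f g q‖ ≤ (|f 0 q| + |f 1 q|) + (|g 0 q| + |g 1 q|) := by
  refine (norm_add_le _ _).trans (add_le_add ?_ ?_)
  · rw [one_mul]; exact norm_cpx_le f q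
  · rw [norm_mul, norm_neg, norm_I, one_mul]; exact norm_cpx_le g q

lemma norm_cV_le (ds : VF₂) (q : HPt) : ‖cV ds q‖ ≤ size1 ds q := by
  refine (norm_dvg_le _ _ q).trans (le_of_eq ?_)
  simp only [size1, Fin.sum_univ_two]
  ring

lemma norm_cV'_le (dds : VF₃) (k : Fin 2) (q : HPt) :
    ‖cV' dds k q‖ ≤ size2 dds q := by
  refine (norm_dvg_le _ _ q).trans ?_
  simp only [size2, Fin.sum_univ_two]
  have := fun i j k => abs_nonneg (dds i j k q)
  have h1 := this 0 0 0
  have h2 := this 0 0 1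
  have h3 := this 0 1 0
  have h4 := this 0 1 1
  have h5 := this 1 0 0
  have h6 := this 1 0 1
  have h7 := this 1 1 0
  have h8 := this 1 1 1
  fin_cases k <;> simp <;> linarith

lemma norm_cm (a : ℂ) (f : HPt → ℂ) (q : HPt) : ‖cm a f q‖ = ‖a‖ * ‖f q‖ := norm_mul _ _

lemma abs_fld_le_mul {f : HPt → ℂ} {k : ℝ → ℝ → ℂ} {q : HPt} {z F G : ℝ} (hf : ‖f q‖ ≤ F)
    (hk : ‖k q.2 z‖ ≤ G) : |fld f k (q.1, q.2, z)| ≤ F * G :=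
  (abs_fld_le f k q z).trans (mul_le_mul hf hk (norm_nonneg _) ((norm_nonneg _).trans hf))

lemma abs_fld_cm_le_mul {f : HPt → ℂ} {k : ℝ → ℝ → ℂ} {q : HPt} {z F G : ℝ} {a : ℂ}
    (ha : ‖a‖ = 1) (hf : ‖f q‖ ≤ F) (hk : ‖k q.2 z‖ ≤ G) :
    |fld (cm a f) k (q.1, q.2, z)| ≤ F * G :=
  abs_fld_le_mul (by rw [norm_cm, ha, one_mul]; exact hf) hk

lemma div_le_mul_div_abs {x N c y : ℝ} (hx : 0 ≤ x) (hN : 0 < N) (hyN : |y| ≤ c * N)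
    (h0 : y = 0 → x = 0) : x / N ≤ c * (x / |y|) := by
  rcases eq_or_ne y 0 with hy | hy
  · simp [h0 hy]
  · have := abs_pos.2 hy
    rw [mul_div_assoc', div_le_div_iff₀ hN this]
    nlinarith

lemma norm_I_neg : ‖-I‖ = 1 := by simp
lemma norm_neg_one' : ‖(-1 : ℂ)‖ = 1 := by simp

lemma exp_neg_le_inv {x : ℝ} (hx : 0 < x) : Real.exp (-x) ≤ 1 / x := by
  rw [Real.exp_neg, ← one_div]
  exact one_div_le_one_div_of_le hx (by linarith [Real.add_one_le_exp x])

namespace Setup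

variable {b g : ℝ → ℝ} {c L C₀ ε : ℝ} {s : VF₁} {ds : VF₂}
  {dds : VF₃} {A : ℝ}

lemma abs_le_mul_norm (h : Setup b g c L C₀ ε s ds dds A) (y : ℝ) : |y| ≤ c * ‖cor ε g y‖ := by
  have := h.smoothed.lat_le_norm_cor (ε := ε) h.two_le y
  rwa [div_le_iff₀ (by linarith [h.two_le]), mul_comm] at this

lemma inv_norm_le (h : Setup b g c L C₀ ε s ds dds A) (y : ℝ) : 1 / ‖cor ε g y‖ ≤ c / ε := by
  have hc : 0 < c := by linarith [h.two_le]
  have := h.le_norm y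
  rw [div_le_iff₀ hc] at this
  rw [div_le_div_iff₀ (h.norm_pos y) h.pos]
  linarith

/-- The weights of the profiles are absorbed by the majorants. -/
lemma weights (h : Setup b g c L C₀ ε s ds dds A) (q : HPt) :
    size0 s q / ‖cor ε g q.2‖ ≤ c * (size0 s q / |q.2|) ∧
      size1 ds q / ‖cor ε g q.2‖ ≤ c * (size1 ds q / |q.2|) ∧
      size0 s q / ‖cor ε g q.2‖ ^ 2 ≤ c ^ 2 * (size0 s q / q.2 ^ 2) := by
  have hN := h.norm_pos q.2
  have hy := h.abs_le_mul_norm q.2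
  have hc : 0 < c := by linarith [h.two_le]
  refine ⟨div_le_mul_div_abs (size0_nonneg q) hN hy (h.wind.size0_eq_zero q),
    div_le_mul_div_abs (size1_nonneg q) hN hy (h.wind.size1_eq_zero q), ?_⟩
  have h1 := div_le_mul_div_abs (size0_nonneg (s := s) q) (pow_pos hN 2) (c := c ^ 2) (y := q.2 ^ 2)
    (by rw [← mul_pow, abs_pow]; gcongr)
    (fun h0 => h.wind.size0_eq_zero q (by simpa using h0))
  rwa [abs_pow, sq_abs] at h1

lemma weight_G (h : Setup b g c L C₀ ε s ds dds A) (q : HPt) :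
    (size1 ds q + size0 s q / ‖cor ε g q.2‖) / ‖cor ε g q.2‖ ≤ c ^ 2 * majG s ds q := by
  obtain ⟨-, w1, w2⟩ := h.weights q
  have hc := h.two_le
  have h1 : 0 ≤ size1 ds q / |q.2| := div_nonneg (size1_nonneg q) (abs_nonneg _)
  have h2 : c * (size1 ds q / |q.2|) ≤ c ^ 2 * (size1 ds q / |q.2|) :=
    mul_le_mul_of_nonneg_right (by nlinarith) h1
  have h3 : 0 ≤ c ^ 2 * size1 ds q := mul_nonneg (sq_nonneg c) (size1_nonneg q)
  rw [add_div, div_div, ← sq]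
  unfold majG
  linarith [mul_add (c ^ 2) (size1 ds q / |q.2|) (size0 s q / q.2 ^ 2)]

lemma weight_A (h : Setup b g c L C₀ ε s ds dds A) (q : HPt) :
    size1 ds q + size0 s q / ‖cor ε g q.2‖ ≤ c * majE s ds dds q := by
  obtain ⟨w0, -, -⟩ := h.weights q
  have hc := h.two_le
  have h0 := size0_nonneg (s := s) q
  have h1 := size1_nonneg (ds := ds) q
  have h2 := size2_nonneg (dds := dds) q
  have hG := majG_nonneg (s := s) (ds := ds) q
  have : 0 ≤ size0 s q / |q.2| := by positivity
  unfold majE maj1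
  nlinarith

lemma _root_.majG_le_majE (s : VF₁) (ds : VF₂)
    (dds : VF₃) (q : HPt) : majG s ds q ≤ majE s ds dds q := by
  have := maj1_nonneg (s := s) q
  have h1 := size1_nonneg (ds := ds) q
  have h2 := size2_nonneg (dds := dds) q
  unfold majE; linarith

lemma _root_.maj1_le_majE (s : VF₁) (ds : VF₂)
    (dds : VF₃) (q : HPt) : maj1 s q ≤ majE s ds dds q := by
  have := majG_nonneg (s := s) (ds := ds) q
  have h1 := size1_nonneg (ds := ds) q
  have h2 := size2_nonneg (dds := dds) q
  unfold majE; linarith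

lemma weight_size2 (h : Setup b g c L C₀ ε s ds dds A) (q : HPt) :
    size2 dds q / ‖cor ε g q.2‖ + 2 * (size1 ds q / ‖cor ε g q.2‖ ^ 2)
      + size0 s q / (ε * ‖cor ε g q.2‖ ^ 2) ≤ 4 * c ^ 2 / ε * majE s ds dds q := by
  obtain ⟨-, w1, w2⟩ := h.weights q
  have hc := h.two_le
  have hε := h.pos
  have hi := h.inv_norm_le q.2
  have hN := h.norm_pos q.2
  have h0 := size0_nonneg (s := s) q
  have h1 := size1_nonneg (ds := ds) q
  have h2 := size2_nonneg (dds := dds) q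
  have a1 : 0 ≤ size0 s q / q.2 ^ 2 := by positivity
  have a2 : 0 ≤ size1 ds q / |q.2| := by positivity
  have k1 : size2 dds q / ‖cor ε g q.2‖ ≤ c ^ 2 / ε * size2 dds q := by
    calc _ = size2 dds q * (1 / ‖cor ε g q.2‖) := by ring
      _ ≤ size2 dds q * (c / ε) := by gcongr
      _ ≤ size2 dds q * (c ^ 2 / ε) := by gcongr; nlinarith
      _ = _ := by ring
  have k2 : size1 ds q / ‖cor ε g q.2‖ ^ 2 ≤ c ^ 2 / ε * (size1 ds q / |q.2|) := by
    calc _ = size1 ds q / ‖cor ε g q.2‖ * (1 / ‖cor ε g q.2‖) := by field_simp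
      _ ≤ c * (size1 ds q / |q.2|) * (c / ε) := by gcongr
      _ = _ := by ring
  have k3 : size0 s q / (ε * ‖cor ε g q.2‖ ^ 2) ≤ c ^ 2 / ε * (size0 s q / q.2 ^ 2) := by
    calc _ = size0 s q / ‖cor ε g q.2‖ ^ 2 / ε := by field_simp
      _ ≤ c ^ 2 * (size0 s q / q.2 ^ 2) / ε := by gcongr
      _ = _ := by ring
  have hp : 0 ≤ c ^ 2 / ε := by positivity
  have key : size2 dds q + 2 * (size1 ds q / |q.2|) + size0 s q / q.2 ^ 2 ≤
      4 * majE s ds dds q := by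
    have := maj1_nonneg (s := s) q
    unfold majE majG
    linarith
  calc _ ≤ c ^ 2 / ε * size2 dds q + 2 * (c ^ 2 / ε * (size1 ds q / |q.2|))
        + c ^ 2 / ε * (size0 s q / q.2 ^ 2) := by gcongr
    _ = c ^ 2 / ε * (size2 dds q + 2 * (size1 ds q / |q.2|) + size0 s q / q.2 ^ 2) := by ring
    _ ≤ c ^ 2 / ε * (4 * majE s ds dds q) := by gcongr
    _ = _ := by ring

/-! Pointwise bounds on the boundary layer. -/

lemma abs_blU_h_le (h : Setup b g c L C₀ ε s ds dds A) (i : Fin 2) (q : HPt) {z : ℝ}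
    (hz : z ∈ 𝕀) :
    |blU ε g s ds i.castSucc (q.1, q.2, z)| ≤
      kerB c L * size0 s q / (ε * √‖cor ε g q.2‖) * decay ε (cor ε g q.2) z := by
  have hb := h.bounds q.2 (Ioo_subset_Icc_self hz)
  fin_cases i
  · exact (abs_fld_le_mul (norm_cpx_le_size0 s q) hb.M).trans (le_of_eq (by ring))
  · exact (abs_fld_cm_le_mul norm_I_neg (norm_cpx_le_size0 s q) hb.M).trans (le_of_eq (by ring))

lemma abs_blU_two_le (h : Setup b g c L C₀ ε s ds dds A) (q : HPt) {z : ℝ}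
    (hz : z ∈ 𝕀) :
    |blU ε g s ds 2 (q.1, q.2, z)| ≤
      kerB c L * ((size1 ds q + size0 s q / ‖cor ε g q.2‖) / ‖cor ε g q.2‖)
        * decay ε (cor ε g q.2) z := by
  have hb := h.bounds q.2 (Ioo_subset_Icc_self hz)
  have hN := h.norm_pos q.2
  refine (abs_add_le _ _).trans ((add_le_add
    (abs_fld_cm_le_mul norm_neg_one' (norm_cV_le ds q) hb.K)
    (abs_fld_cm_le_mul norm_I (norm_cpx_le_size0 s q) hb.dK)).trans (le_of_eq ?_))
  field_simp

lemma abs_blG_h_le (h : Setup b g c L C₀ ε s ds dds A) (i k : Fin 2) (q : HPt) {z : ℝ}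
    (hz : z ∈ 𝕀) :
    |blG ε g s ds dds i.castSucc k.castSucc (q.1, q.2, z)| ≤
      kerB c L * (size1 ds q + size0 s q / ‖cor ε g q.2‖) / (ε * √‖cor ε g q.2‖)
        * decay ε (cor ε g q.2) z := by
  have hb := h.bounds q.2 (Ioo_subset_Icc_self hz)
  have hN := h.norm_pos q.2
  have hs := Real.sqrt_pos.2 hN
  have hε := h.pos
  have hB := h.kerB_nonneg
  have hd : 0 < decay ε (cor ε g q.2) z := Real.exp_pos _
  have h0 := size0_nonneg (s := s) q
  have e1 : kerB c L * (size1 ds q + size0 s q / ‖cor ε g q.2‖) / (ε * √‖cor ε g q.2‖)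
        * decay ε (cor ε g q.2) z =
      size1 ds q * (kerB c L * decay ε (cor ε g q.2) z / (ε * √‖cor ε g q.2‖)) +
      size0 s q * (kerB c L * decay ε (cor ε g q.2) z /
        (ε * ‖cor ε g q.2‖ * √‖cor ε g q.2‖)) := by
    field_simp
  have e2 : 0 ≤ size0 s q * (kerB c L * decay ε (cor ε g q.2) z /
        (ε * ‖cor ε g q.2‖ * √‖cor ε g q.2‖)) := by positivity
  rw [e1]
  fin_cases i <;> fin_cases k
  · exact (abs_fld_le_mul (norm_cS_le ds 0 q) hb.M).trans (le_add_of_nonneg_right e2)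
  · exact (abs_add_le _ _).trans (add_le_add (abs_fld_le_mul (norm_cS_le ds 1 q) hb.M)
      (abs_fld_le_mul (norm_cpx_le_size0 s q) hb.dM))
  · exact (abs_fld_cm_le_mul norm_I_neg (norm_cS_le ds 0 q) hb.M).trans (le_add_of_nonneg_right e2)
  · exact (abs_add_le _ _).trans (add_le_add
      (abs_fld_cm_le_mul norm_I_neg (norm_cS_le ds 1 q) hb.M)
      (abs_fld_cm_le_mul norm_I_neg (norm_cpx_le_size0 s q) hb.dM))

lemma abs_vert_le (h : Setup b g c L C₀ ε s ds dds A) (q : HPt) {B N x₁ x₂ x₃ x₄ d : ℝ}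
    (hN : N = ‖cor ε g q.2‖) (hB : 0 ≤ B) (hd : 0 ≤ d) (hd1 : d ≤ 1)
    (h1 : x₁ ≤ size2 dds q * (B * d / N)) (h2 : x₂ ≤ size1 ds q * (B * d / N ^ 2))
    (h3 : x₃ ≤ size1 ds q * (B * d / N ^ 2)) (h4 : x₄ ≤ size0 s q * (B * d / (ε * N ^ 2))) :
    x₁ + x₂ + (x₃ + x₄) ≤ B * (4 * c ^ 2 / ε) * majE s ds dds q := by
  have hw := h.weight_size2 q
  have hE := majE_nonneg (s := s) (ds := ds) (dds := dds) q
  have hc := h.two_le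
  have hε := h.pos
  rw [← hN] at hw
  have hNp : 0 < N := hN ▸ h.norm_pos q.2
  calc _ ≤ B * d * (size2 dds q / N + 2 * (size1 ds q / N ^ 2) + size0 s q / (ε * N ^ 2)) := by
        refine (add_le_add (add_le_add h1 h2) (add_le_add h3 h4)).trans (le_of_eq ?_)
        ring
    _ ≤ B * d * (4 * c ^ 2 / ε * majE s ds dds q) := by gcongr
    _ ≤ B * 1 * (4 * c ^ 2 / ε * majE s ds dds q) := by gcongr
    _ = _ := by ring

lemma abs_blG_two_le (h : Setup b g c L C₀ ε s ds dds A) (k : Fin 2) (q : HPt) {z : ℝ}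
    (hz : z ∈ 𝕀) :
    |blG ε g s ds dds 2 k.castSucc (q.1, q.2, z)| ≤
      kerB c L * (4 * c ^ 2 / ε) * majE s ds dds q := by
  have hb := h.bounds q.2 (Ioo_subset_Icc_self hz)
  have hB := h.kerB_nonneg
  have hN := h.norm_pos q.2
  have hε := h.pos
  have hd : 0 < decay ε (cor ε g q.2) z := Real.exp_pos _
  have hd1 := h.decay_le q.2 (Ioo_subset_Icc_self hz)
  have a0 := size0_nonneg (s := s) q
  have a1 := size1_nonneg (ds := ds) q
  have key := h.abs_vert_le q rfl hB hd.le hd1 (x₁ := size2 dds q * (kerB c L * decay ε (cor ε g q.2) z / ‖cor ε g q.2‖)) le_rfl (x₂ := size1 ds q * (kerB c L * decay ε (cor ε g q.2) z / ‖cor ε g q.2‖ ^ 2)) le_rfl le_rfl le_rfl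
  refine le_trans ?_ key
  fin_cases k
  · refine (abs_add_le _ _).trans ((add_le_add
      (abs_fld_cm_le_mul norm_neg_one' (norm_cV'_le dds 0 q) hb.K)
      (abs_fld_cm_le_mul norm_I (norm_cS_le ds 0 q) hb.dK)).trans ?_)
    refine le_add_of_nonneg_right ?_
    positivity
  · exact (abs_add_le _ _).trans (add_le_add ((abs_add_le _ _).trans (add_le_add
      (abs_fld_cm_le_mul norm_neg_one' (norm_cV'_le dds 1 q) hb.K)
      (abs_fld_cm_le_mul norm_neg_one' (norm_cV_le ds q) hb.dK)))
      ((abs_add_le _ _).trans (add_le_add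
      (abs_fld_cm_le_mul norm_I (norm_cS_le ds 1 q) hb.dK)
      (abs_fld_cm_le_mul norm_I (norm_cpx_le_size0 s q) hb.ddK))))

lemma abs_blH_two_le (h : Setup b g c L C₀ ε s ds dds A) (q : HPt) {z : ℝ}
    (hz : z ∈ 𝕀) :
    |-(ε * blH ε g s ds 2 (q.1, q.2, z))| ≤
      kerB c L * (size1 ds q + size0 s q / ‖cor ε g q.2‖) / ε * decay ε (cor ε g q.2) z := by
  have hb := h.bounds q.2 (Ioo_subset_Icc_self hz)
  have hN := h.norm_pos q.2
  have hε := h.pos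
  have nsq : ‖(ε : ℂ) ^ 2‖ = ε ^ 2 := by
    rw [norm_pow, Complex.norm_real, Real.norm_of_nonneg hε.le]
  have hQ : ‖dsq ε (kerQ ε g) q.2 z‖ ≤ kerB c L * decay ε (cor ε g q.2) z / ε ^ 2 := by
    unfold dsq
    rw [norm_div, nsq]
    gcongr
    exact hb.Q
  have hdQ : ‖dsq ε (dY (kerQ ε g)) q.2 z‖ ≤
      kerB c L * decay ε (cor ε g q.2) z / ‖cor ε g q.2‖ / ε ^ 2 := by
    unfold dsq
    rw [norm_div, nsq]
    gcongr
    exact hb.dQ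
  rw [abs_neg, abs_mul, abs_of_pos hε]
  have := (abs_add_le _ _).trans (add_le_add
    (abs_fld_cm_le_mul norm_neg_one' (norm_cV_le ds q) hQ)
    (abs_fld_cm_le_mul norm_I (norm_cpx_le_size0 s q) hdQ))
  refine (mul_le_mul_of_nonneg_left this hε.le).trans (le_of_eq ?_)
  field_simp

/-! Pointwise bounds on the interior transport. -/

lemma norm_lin1_le {k : ℝ → ℝ → ℂ} {y z G : ℝ} (hz : z ∈ 𝕀) (hk : ‖k y 1‖ ≤ G) :
    ‖lin1 k y z‖ ≤ G := by
  unfold lin1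
  rw [norm_mul, Complex.norm_real, Real.norm_of_nonneg hz.1.le]
  exact (mul_le_of_le_one_left (norm_nonneg _) hz.2.le).trans hk

lemma abs_ekU_h_le (h : Setup b g c L C₀ ε s ds dds A) (i : Fin 2) (q : HPt) {z : ℝ} :
    |ekU ε g s ds i.castSucc (q.1, q.2, z)| ≤ kerB c L * c * maj1 s q := by
  have hb := (h.bounds q.2 (z := 1) (by simp)).K
  rw [decay_one, mul_one] at hb
  have hB := h.kerB_nonneg
  have hc := h.two_le
  obtain ⟨w0, -, -⟩ := h.weights q
  have key : size0 s q * (kerB c L / ‖cor ε g q.2‖) ≤ kerB c L * c * maj1 s q := by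
    have h0 := size0_nonneg (s := s) q
    calc _ = kerB c L * (size0 s q / ‖cor ε g q.2‖) := by ring
      _ ≤ kerB c L * (c * (size0 s q / |q.2|)) := by gcongr
      _ ≤ kerB c L * (c * maj1 s q) := by
          unfold maj1
          gcongr
          linarith
      _ = _ := by ring
  fin_cases i
  · exact (abs_fld_cm_le_mul norm_neg_one' (norm_cpx_le_size0 s q) hb).trans key
  · exact (abs_fld_cm_le_mul norm_I (norm_cpx_le_size0 s q) hb).trans key

lemma ek_key (h : Setup b g c L C₀ ε s ds dds A) (q : HPt) :
    size1 ds q * (kerB c L / ‖cor ε g q.2‖) + size0 s q * (kerB c L / ‖cor ε g q.2‖ ^ 2) ≤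
      kerB c L * c ^ 2 * majG s ds q := by
  have hN := h.norm_pos q.2
  have hB := h.kerB_nonneg
  calc _ = kerB c L * ((size1 ds q + size0 s q / ‖cor ε g q.2‖) / ‖cor ε g q.2‖) := by
        field_simp
    _ ≤ kerB c L * (c ^ 2 * majG s ds q) := by
        gcongr
        exact h.weight_G q
    _ = _ := by ring

lemma abs_ekU_two_le (h : Setup b g c L C₀ ε s ds dds A) (q : HPt) {z : ℝ}
    (hz : z ∈ 𝕀) :
    |ekU ε g s ds 2 (q.1, q.2, z)| ≤ kerB c L * c ^ 2 * majG s ds q := by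
  have hb := h.bounds q.2 (z := 1) (by simp)
  have hK := hb.K
  have hdK := hb.dK
  rw [decay_one, mul_one] at hK hdK
  exact ((abs_add_le _ _).trans (add_le_add (abs_fld_le_mul (norm_cV_le ds q) (norm_lin1_le hz hK))
    (abs_fld_cm_le_mul norm_I_neg (norm_cpx_le_size0 s q) (norm_lin1_le hz hdK)))).trans
    (h.ek_key q)

lemma abs_ekG_h_le (h : Setup b g c L C₀ ε s ds dds A) (i k : Fin 2) (q : HPt) {z : ℝ} :
    |ekG ε g s ds dds i.castSucc k.castSucc (q.1, q.2, z)| ≤ kerB c L * c ^ 2 * majG s ds q := by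
  have hb := h.bounds q.2 (z := 1) (by simp)
  have hK := hb.K
  have hdK := hb.dK
  rw [decay_one, mul_one] at hK hdK
  have hB := h.kerB_nonneg
  have h0 := size0_nonneg (s := s) q
  refine le_trans ?_ (h.ek_key q)
  have e2 : 0 ≤ size0 s q * (kerB c L / ‖cor ε g q.2‖ ^ 2) := by positivity
  fin_cases i <;> fin_cases k
  · exact (abs_fld_cm_le_mul norm_neg_one' (norm_cS_le ds 0 q) hK).trans (le_add_of_nonneg_right e2)
  · exact (abs_add_le _ _).trans (add_le_add
      (abs_fld_cm_le_mul norm_neg_one' (norm_cS_le ds 1 q) hK)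
      (abs_fld_cm_le_mul norm_neg_one' (norm_cpx_le_size0 s q) hdK))
  · exact (abs_fld_cm_le_mul norm_I (norm_cS_le ds 0 q) hK).trans (le_add_of_nonneg_right e2)
  · exact (abs_add_le _ _).trans (add_le_add
      (abs_fld_cm_le_mul norm_I (norm_cS_le ds 1 q) hK)
      (abs_fld_cm_le_mul norm_I (norm_cpx_le_size0 s q) hdK))

lemma abs_ekG_two_le (h : Setup b g c L C₀ ε s ds dds A) (k : Fin 2) (q : HPt) {z : ℝ}
    (hz : z ∈ 𝕀) :
    |ekG ε g s ds dds 2 k.castSucc (q.1, q.2, z)| ≤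
      kerB c L * (4 * c ^ 2 / ε) * majE s ds dds q := by
  have hb := h.bounds q.2 (z := 1) (by simp)
  have hK := hb.K
  have hdK := hb.dK
  have hddK := hb.ddK
  rw [decay_one] at hK hdK hddK
  have hB := h.kerB_nonneg
  have hN := h.norm_pos q.2
  have hε := h.pos
  have a0 := size0_nonneg (s := s) q
  have a1 := size1_nonneg (ds := ds) q
  have key := h.abs_vert_le q rfl hB zero_le_one le_rfl (x₁ := size2 dds q * (kerB c L * 1 / ‖cor ε g q.2‖)) le_rfl (x₂ := size1 ds q * (kerB c L * 1 / ‖cor ε g q.2‖ ^ 2)) le_rfl le_rfl le_rfl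
  refine le_trans ?_ key
  fin_cases k
  · refine (abs_add_le _ _).trans ((add_le_add
      (abs_fld_le_mul (norm_cV'_le dds 0 q) (norm_lin1_le hz hK))
      (abs_fld_cm_le_mul norm_I_neg (norm_cS_le ds 0 q) (norm_lin1_le hz hdK))).trans ?_)
    refine le_add_of_nonneg_right ?_
    positivity
  · exact (abs_add_le _ _).trans (add_le_add ((abs_add_le _ _).trans (add_le_add
      (abs_fld_le_mul (norm_cV'_le dds 1 q) (norm_lin1_le hz hK))
      (abs_fld_le_mul (norm_cV_le ds q) (norm_lin1_le hz hdK))))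
      ((abs_add_le _ _).trans (add_le_add
      (abs_fld_cm_le_mul norm_I_neg (norm_cS_le ds 1 q) (norm_lin1_le hz hdK))
      (abs_fld_cm_le_mul norm_I_neg (norm_cpx_le_size0 s q) (norm_lin1_le hz hddK)))))

end Setup

/-! ### `L²` bounds on the explicit fields -/

lemma sq_div_cube_le {x t m : ℝ} (hx : 0 ≤ x) (ht : 0 < t) (h1 : x ≤ m) (h2 : x / t ^ 2 ≤ m) :
    x ^ 2 / t ^ 3 ≤ m ^ 2 := by
  rcases le_total 1 t with h | h
  · calc x ^ 2 / t ^ 3 ≤ x ^ 2 / 1 := by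
          gcongr
          exact one_le_pow₀ h
      _ ≤ m ^ 2 := by rw [div_one]; gcongr
  · calc x ^ 2 / t ^ 3 ≤ x ^ 2 / t ^ 4 := by
          gcongr x ^ 2 / ?_
          exact pow_le_pow_of_le_one ht.le h (by norm_num)
      _ = (x / t ^ 2) ^ 2 := by rw [div_pow]; ring
      _ ≤ m ^ 2 := by gcongr

lemma exp_neg_le_inv_sqrt {x : ℝ} (hx : 0 < x) : Real.exp (-x) ≤ 1 / √x := by
  rw [Real.exp_neg, ← one_div]
  refine one_div_le_one_div_of_le (Real.sqrt_pos.2 hx) (Real.sqrt_le_iff.2 ⟨(Real.exp_pos _).le, ?_⟩)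
  have := Real.add_one_le_exp x
  nlinarith [Real.exp_pos x]

/-- The difference between the exact and the regularised Coriolis factors. -/
def corErr (ε : ℝ) (b g : ℝ → ℝ) (y : ℝ) : ℂ := b y * I - cor ε g y

/-- The profile of the residual of the boundary layer. -/
def resM (ε : ℝ) (b g : ℝ → ℝ) (y z : ℝ) : ℂ := kerM ε g y z * (corErr ε b g y / ε)

/-- The profile of the residual of the interior transport. -/
def resK (ε : ℝ) (b g : ℝ → ℝ) (y _z : ℝ) : ℂ :=
  -(corErr ε b g y / (ε * cor ε g y))

namespace Setup

variable {b g : ℝ → ℝ} {c L C₀ ε : ℝ} {s : VF₁} {ds : VF₂}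
  {dds : VF₃} {A : ℝ}

lemma eps_le_one (h : Setup b g c L C₀ ε s ds dds A) : ε ≤ 1 := by
  refine h.small.trans ?_
  have := h.two_le
  rw [div_le_one (by linarith)]
  linarith

lemma sqrt_pos (h : Setup b g c L C₀ ε s ds dds A) (y : ℝ) : 0 < √‖cor ε g y‖ :=
  Real.sqrt_pos.2 (h.norm_pos y)

lemma sq_sqrt (h : Setup b g c L C₀ ε s ds dds A) (y : ℝ) : √‖cor ε g y‖ ^ 2 = ‖cor ε g y‖ :=
  Real.sq_sqrt (h.norm_pos y).le

lemma eps_div_sqrt_le (h : Setup b g c L C₀ ε s ds dds A) (y : ℝ) :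
    ε / √‖cor ε g y‖ ≤ √(c * ε) := by
  have hε := h.pos
  have hc := h.two_le
  have := h.sqrt_pos y
  have hi := h.inv_norm_le y
  rw [div_le_div_iff₀ (h.norm_pos y) hε] at hi
  rw [div_le_iff₀ this, ← Real.sqrt_mul (by positivity)]
  refine Real.le_sqrt_of_sq_le ?_
  nlinarith

lemma size0_div_le (h : Setup b g c L C₀ ε s ds dds A) (q : HPt) :
    size0 s q ≤ c * maj1 s q ∧ size0 s q / ‖cor ε g q.2‖ ≤ c * maj1 s q := by
  obtain ⟨w0, -, -⟩ := h.weights q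
  have hc := h.two_le
  have h0 := size0_nonneg (s := s) q
  have h1 : 0 ≤ size0 s q / |q.2| := by positivity
  unfold maj1
  exact ⟨by nlinarith, by nlinarith⟩

lemma eLpNorm_blU_h_le (h : Setup b g c L C₀ ε s ds dds A) (i : Fin 2) :
    eLpNorm (blU ε g s ds i.castSucc) 2 vΩ ≤
      ofReal (√((kerB c L * c) ^ 2 / ε)) * eLpNorm (maj1 s) 2 hΩ := by
  have hε := h.pos
  refine eLpNorm_vol_le_of_decay _ hε h.norm_pos (fun q z hz => h.abs_blU_h_le i q hz)
    (by positivity) fun q => ?_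
  have ht := h.sqrt_pos q.2
  have h2 := h.size0_div_le q
  rw [← h.sq_sqrt q.2] at h2
  have := sq_div_cube_le (size0_nonneg q) ht h2.1 h2.2
  calc _ = kerB c L ^ 2 / ε * (size0 s q ^ 2 / √‖cor ε g q.2‖ ^ 3) := by field_simp
    _ ≤ kerB c L ^ 2 / ε * (c * maj1 s q) ^ 2 := by gcongr
    _ = _ := by ring

lemma eLpNorm_blU_h_slab_le (h : Setup b g c L C₀ ε s ds dds A) (i : Fin 2) {M : ℝ} (hM : 0 < M) :
    eLpNorm (blU ε g s ds i.castSucc) 2 (HDom.channel.volSlab (Iio (1 - M * ε))) ≤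
      ofReal (√((kerB c L * c) ^ 2 / (ε * M))) *
        eLpNorm (majE s ds dds) 2 hΩ := by
  have hε := h.pos
  refine eLpNorm_slab_le_of_decay _ hε h.norm_pos (fun q z hz => h.abs_blU_h_le i q hz)
    (by positivity) fun q => ?_
  have ht := h.sqrt_pos q.2
  have h2 := (h.size0_div_le q).2
  rw [← h.sq_sqrt q.2] at h2
  have he := exp_neg_le_inv (mul_pos hM ht)
  have h0 := size0_nonneg (s := s) q
  have hc := h.two_le
  set t := √‖cor ε g q.2‖
  calc _ = kerB c L ^ 2 / ε * ((size0 s q / t ^ 2) ^ 2 * (t * Real.exp (-(M * t)))) := by field_simp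
    _ ≤ kerB c L ^ 2 / ε * ((c * majE s ds dds q) ^ 2 * (t * (1 / (M * t)))) := by
        gcongr
        exact h2.trans (by gcongr; exact maj1_le_majE ..)
    _ = _ := by field_simp

lemma eLpNorm_blU_two_le (h : Setup b g c L C₀ ε s ds dds A) :
    eLpNorm (blU ε g s ds 2) 2 vΩ ≤
      ofReal (√((kerB c L * c ^ 2) ^ 2 * √(c * ε))) *
        eLpNorm (majE s ds dds) 2 hΩ := by
  have hε := h.pos
  have hB := h.kerB_nonneg
  refine eLpNorm_vol_le_of_decay _ hε h.norm_pos (fun q z hz => h.abs_blU_two_le q hz)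
    (by positivity) fun q => ?_
  have h0 := size0_nonneg (s := s) q
  have h1 := size1_nonneg (ds := ds) q
  have hG := majG_nonneg (s := s) (ds := ds) q
  calc _ ≤ (kerB c L * (c ^ 2 * majE s ds dds q)) ^ 2 * √(c * ε) := by
        gcongr
        · exact (h.weight_G q).trans (by gcongr; exact majG_le_majE ..)
        · exact h.eps_div_sqrt_le _
    _ = _ := by ring

lemma inv_sqrt_mul_exp_le (h : Setup b g c L C₀ ε s ds dds A) {M : ℝ} (hM : 0 < M) {y : ℝ}
    (hy : y ≠ 0) : 1 / √‖cor ε g y‖ * Real.exp (-(M * √‖cor ε g y‖)) ≤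
      c / √M * (|y| ^ (-(3 / 8) : ℝ)) ^ 2 := by
  have hN := h.norm_pos y
  have hc := h.two_le
  have ht := h.sqrt_pos y
  have hy0 := abs_pos.2 hy
  have e1 : √‖cor ε g y‖ * √(√‖cor ε g y‖) = ‖cor ε g y‖ ^ (3 / 4 : ℝ) := by
    rw [Real.sqrt_eq_rpow, Real.sqrt_eq_rpow, ← Real.rpow_mul hN.le, ← Real.rpow_add hN]
    norm_num
  have e2 : (|y| ^ (-(3 / 8) : ℝ)) ^ 2 = 1 / |y| ^ (3 / 4 : ℝ) := by
    rw [← Real.rpow_mul_natCast hy0.le, one_div, ← Real.rpow_neg hy0.le]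
    norm_num
  have e3 : |y| ^ (3 / 4 : ℝ) ≤ c * ‖cor ε g y‖ ^ (3 / 4 : ℝ) := by
    calc _ ≤ (c * ‖cor ε g y‖) ^ (3 / 4 : ℝ) := by
          gcongr
          exact h.abs_le_mul_norm y
      _ = c ^ (3 / 4 : ℝ) * ‖cor ε g y‖ ^ (3 / 4 : ℝ) := Real.mul_rpow (by linarith) hN.le
      _ ≤ c ^ (1 : ℝ) * ‖cor ε g y‖ ^ (3 / 4 : ℝ) := by
          gcongr
          · linarith
          · norm_num
      _ = _ := by rw [Real.rpow_one]
  calc _ ≤ 1 / √‖cor ε g y‖ * (1 / √(M * √‖cor ε g y‖)) := by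
        gcongr
        exact exp_neg_le_inv_sqrt (by positivity)
    _ = 1 / √M * (1 / ‖cor ε g y‖ ^ (3 / 4 : ℝ)) := by
        rw [← e1, Real.sqrt_mul hM.le]
        field_simp
    _ ≤ 1 / √M * (c * (1 / |y| ^ (3 / 4 : ℝ))) := by
        gcongr
        rw [mul_one_div, div_le_div_iff₀ (by positivity) (by positivity), one_mul]
        exact e3
    _ = _ := by rw [e2]; ring

lemma eLpNorm_blU_two_slab_le (h : Setup b g c L C₀ ε s ds dds A) {M : ℝ} (hM : 0 < M) :
    eLpNorm (blU ε g s ds 2) 2 (HDom.channel.volSlab (Iio (1 - M * ε))) ≤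
      ofReal (√((kerB c L * c ^ 2) ^ 2 * ε * (c / √M))) *
        eLpNorm (fun q => majG s ds q * |q.2| ^ (-(3 / 8) : ℝ)) 2 hΩ := by
  have hε := h.pos
  have hB := h.kerB_nonneg
  have hc := h.two_le
  refine eLpNorm_slab_le_of_decay _ hε h.norm_pos (fun q z hz => h.abs_blU_two_le q hz)
    (by positivity) fun q => ?_
  have h0 := size0_nonneg (s := s) q
  have h1 := size1_nonneg (ds := ds) q
  rcases eq_or_ne q.2 0 with hy | hy
  · rw [h.wind.size0_eq_zero q hy, h.wind.size1_eq_zero q hy]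
    simp only [zero_div, add_zero, mul_zero, zero_pow two_ne_zero, zero_mul]
    positivity
  calc _ = (kerB c L * ((size1 ds q + size0 s q / ‖cor ε g q.2‖) / ‖cor ε g q.2‖)) ^ 2 * ε *
        (1 / √‖cor ε g q.2‖ * Real.exp (-(M * √‖cor ε g q.2‖))) := by ring
    _ ≤ (kerB c L * (c ^ 2 * majG s ds q)) ^ 2 * ε * (c / √M * (|q.2| ^ (-(3 / 8) : ℝ)) ^ 2) := by
        have := h.inv_sqrt_mul_exp_le hM hy
        have := h.weight_G q
        have : 0 ≤ 1 / √‖cor ε g q.2‖ * Real.exp (-(M * √‖cor ε g q.2‖)) := by positivity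
        generalize 1 / √‖cor ε g q.2‖ * Real.exp (-(M * √‖cor ε g q.2‖)) = X at *
        generalize c / √M * (|q.2| ^ (-(3 / 8) : ℝ)) ^ 2 = Y at *
        gcongr
    _ = _ := by ring

lemma eLpNorm_blG_h_le (h : Setup b g c L C₀ ε s ds dds A) (i k : Fin 2) :
    eLpNorm (blG ε g s ds dds i.castSucc k.castSucc) 2 vΩ ≤
      ofReal (√((kerB c L * c ^ 2) ^ 2 / ε)) *
        eLpNorm (majE s ds dds) 2 hΩ := by
  have hε := h.pos
  refine eLpNorm_vol_le_of_decay _ hε h.norm_pos (fun q z hz => h.abs_blG_h_le i k q hz)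
    (by positivity) fun q => ?_
  have ht := h.sqrt_pos q.2
  have hN := h.norm_pos q.2
  have hc := h.two_le
  have h0 := size0_nonneg (s := s) q
  have h1 := size1_nonneg (ds := ds) q
  have hE := majE_nonneg (s := s) (ds := ds) (dds := dds) q
  have k1 : size1 ds q + size0 s q / ‖cor ε g q.2‖ ≤ c ^ 2 * majE s ds dds q :=
    (h.weight_A q).trans (mul_le_mul_of_nonneg_right (by nlinarith) hE)
  have k2 : (size1 ds q + size0 s q / ‖cor ε g q.2‖) / √‖cor ε g q.2‖ ^ 2 ≤
      c ^ 2 * majE s ds dds q := by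
    rw [h.sq_sqrt]
    exact (h.weight_G q).trans (by gcongr; exact majG_le_majE ..)
  have := sq_div_cube_le (by positivity) ht k1 k2
  calc _ = kerB c L ^ 2 / ε * ((size1 ds q + size0 s q / ‖cor ε g q.2‖) ^ 2 /
        √‖cor ε g q.2‖ ^ 3) := by field_simp
    _ ≤ kerB c L ^ 2 / ε * (c ^ 2 * majE s ds dds q) ^ 2 := by gcongr
    _ = _ := by ring

lemma eLpNorm_le_majE (_h : Setup b g c L C₀ ε s ds dds A) {f : Pt → ℝ} {B : ℝ} (hB : 0 ≤ B)
    (hf : ∀ q : HPt, ∀ z ∈ 𝕀, |f (q.1, q.2, z)| ≤ B * majE s ds dds q) :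
    eLpNorm f 2 vΩ ≤
      ofReal B * eLpNorm (majE s ds dds) 2 hΩ :=
  eLpNorm_vol_le _ hB fun q z hz => by
    rw [abs_of_nonneg (majE_nonneg q)]
    exact hf q z hz

lemma eLpNorm_blG_two_le (h : Setup b g c L C₀ ε s ds dds A) (k : Fin 2) :
    eLpNorm (blG ε g s ds dds 2 k.castSucc) 2 vΩ ≤
      ofReal (kerB c L * (4 * c ^ 2 / ε)) *
        eLpNorm (majE s ds dds) 2 hΩ := by
  have := h.pos
  have := h.kerB_nonneg
  exact h.eLpNorm_le_majE (by positivity) fun q z hz => h.abs_blG_two_le k q hz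

lemma eLpNorm_blH_two_le (h : Setup b g c L C₀ ε s ds dds A) :
    eLpNorm (fun p => -(ε * blH ε g s ds 2 p)) 2 vΩ ≤
      ofReal (√((kerB c L * c) ^ 2 * √(c * ε) / ε ^ 2)) *
        eLpNorm (majE s ds dds) 2 hΩ := by
  have hε := h.pos
  have hB := h.kerB_nonneg
  refine eLpNorm_vol_le_of_decay _ hε h.norm_pos (fun q z hz => h.abs_blH_two_le q hz)
    (by positivity) fun q => ?_
  have h0 := size0_nonneg (s := s) q
  have h1 := size1_nonneg (ds := ds) q
  calc _ ≤ (kerB c L * (c * majE s ds dds q) / ε) ^ 2 * √(c * ε) := by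
        gcongr
        · exact h.weight_A q
        · exact h.eps_div_sqrt_le _
    _ = _ := by ring

/-! Residuals. -/

lemma norm_corErr_le (h : Setup b g c L C₀ ε s ds dds A) (y : ℝ) :
    ‖corErr ε b g y‖ ≤ 2 * L * ε ^ 2 + fric ε y := by
  have e : corErr ε b g y = ((-fric ε y : ℝ) : ℂ) + ((-(g y - b y) : ℝ) : ℂ) * I := by
    unfold corErr cor
    push_cast
    ring
  rw [e]
  refine (norm_add_mul_I_le _ _).trans ?_
  rw [abs_neg, abs_neg, abs_of_pos (fric_pos h.pos y), add_comm]
  gcongr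
  exact h.smoothed.close y

lemma size0_corErr_le (h : Setup b g c L C₀ ε s ds dds A) (q : HPt) :
    size0 s q * (2 * L * ε ^ 2 + fric ε q.2) ≤ (2 * L + 1) * c * ε ^ 2 * majE s ds dds q ∧
    size0 s q * (2 * L * ε ^ 2 + fric ε q.2) / ‖cor ε g q.2‖ ≤
      (2 * L + 1) * c * ε ^ 2 * majE s ds dds q := by
  have hε := h.pos
  have hε1 := h.eps_le_one
  have hL := h.nonneg
  have hc := h.two_le
  have hN := h.norm_pos q.2
  have hE := majE_nonneg (s := s) (ds := ds) (dds := dds) q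
  have h0 := size0_nonneg (s := s) q
  obtain ⟨w1, w2⟩ := h.size0_div_le q
  have hmE := maj1_le_majE s ds dds q
  have hsE : size0 s q ≤ majE s ds dds q := by
    refine le_trans ?_ hmE
    have : 0 ≤ size0 s q / |q.2| := by positivity
    unfold maj1
    linarith
  have f0 := fric_pos hε q.2
  have hf : size0 s q * fric ε q.2 ≤ ε ^ 3 * majE s ds dds q := by
    rcases eq_or_ne q.2 0 with hy | hy
    · rw [h.wind.size0_eq_zero q hy, zero_mul]; positivity
    have hy2 : 0 < q.2 ^ 2 := by positivity
    have : size0 s q / q.2 ^ 2 ≤ majE s ds dds q := by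
      refine le_trans ?_ (majG_le_majE s ds dds q)
      have : 0 ≤ size1 ds q / |q.2| := div_nonneg (size1_nonneg q) (abs_nonneg _)
      unfold majG
      linarith
    calc _ = size0 s q / q.2 ^ 2 * (fric ε q.2 * q.2 ^ 2) := by field_simp
      _ ≤ majE s ds dds q * ε ^ 3 := by
          gcongr
          exact fric_mul_sq_le hε _
      _ = _ := by ring
  constructor
  · calc _ = 2 * L * ε ^ 2 * size0 s q + size0 s q * fric ε q.2 := by ring
      _ ≤ 2 * L * ε ^ 2 * majE s ds dds q + ε ^ 3 * majE s ds dds q := by gcongr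
      _ = (2 * L + ε) * 1 * ε ^ 2 * majE s ds dds q := by ring
      _ ≤ _ := by
        gcongr
        linarith
  · calc _ = 2 * L * ε ^ 2 * (size0 s q / ‖cor ε g q.2‖) +
          size0 s q * fric ε q.2 * (1 / ‖cor ε g q.2‖) := by ring
      _ ≤ 2 * L * ε ^ 2 * (c * majE s ds dds q) + ε ^ 3 * majE s ds dds q * (c / ε) := by
          have k1 := w2.trans (mul_le_mul_of_nonneg_left hmE (by linarith : (0 : ℝ) ≤ c))
          have k2 := h.inv_norm_le q.2
          exact add_le_add (mul_le_mul_of_nonneg_left k1 (by positivity))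
            (mul_le_mul hf k2 (by positivity) (by positivity))
      _ = _ := by field_simp

lemma abs_resM_le (h : Setup b g c L C₀ ε s ds dds A) {f : HPt → ℂ}
    (hf : ∀ q, ‖f q‖ ≤ size0 s q) (q : HPt) {z : ℝ} (hz : z ∈ 𝕀) :
    |fld f (resM ε b g) (q.1, q.2, z)| ≤
      kerB c L * (size0 s q * (2 * L * ε ^ 2 + fric ε q.2)) / (ε ^ 2 * √‖cor ε g q.2‖)
        * decay ε (cor ε g q.2) z := by
  have hb := (h.bounds q.2 (Ioo_subset_Icc_self hz)).M
  have hε := h.pos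
  have ht := h.sqrt_pos q.2
  refine (abs_fld_le_mul (hf q) (G := kerB c L * decay ε (cor ε g q.2) z /
    (ε * √‖cor ε g q.2‖) * ((2 * L * ε ^ 2 + fric ε q.2) / ε)) ?_).trans (le_of_eq ?_)
  · unfold resM
    rw [norm_mul, norm_div, Complex.norm_real, Real.norm_of_nonneg hε.le]
    exact mul_le_mul hb (div_le_div_of_nonneg_right (h.norm_corErr_le _) hε.le) (by positivity)
      ((norm_nonneg _).trans hb)
  · field_simp

lemma eLpNorm_resM_le (h : Setup b g c L C₀ ε s ds dds A) {f : HPt → ℂ}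
    (hf : ∀ q, ‖f q‖ ≤ size0 s q) :
    eLpNorm (fld f (resM ε b g)) 2 vΩ ≤
      ofReal (√((kerB c L * ((2 * L + 1) * c)) ^ 2 * ε)) *
        eLpNorm (majE s ds dds) 2 hΩ := by
  have hε := h.pos
  refine eLpNorm_vol_le_of_decay _ hε h.norm_pos (fun q z hz => h.abs_resM_le hf q hz)
    (by positivity) fun q => ?_
  have ht := h.sqrt_pos q.2
  obtain ⟨k1, k2⟩ := h.size0_corErr_le q
  rw [← h.sq_sqrt] at k2
  have hL := h.nonneg
  have := sq_div_cube_le (mul_nonneg (size0_nonneg q)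
    (add_nonneg (by positivity) (fric_pos hε q.2).le)) ht k1 k2
  calc _ = kerB c L ^ 2 / ε ^ 3 * ((size0 s q * (2 * L * ε ^ 2 + fric ε q.2)) ^ 2 /
        √‖cor ε g q.2‖ ^ 3) := by field_simp
    _ ≤ kerB c L ^ 2 / ε ^ 3 * ((2 * L + 1) * c * ε ^ 2 * majE s ds dds q) ^ 2 := by gcongr
    _ = _ := by field_simp

lemma abs_resK_le (h : Setup b g c L C₀ ε s ds dds A) {f : HPt → ℂ}
    (hf : ∀ q, ‖f q‖ ≤ size0 s q) (q : HPt) (z : ℝ) :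
    |fld f (resK ε b g) (q.1, q.2, z)| ≤ (2 * L + 1) * c * ε * majE s ds dds q := by
  have hε := h.pos
  have hN := h.norm_pos q.2
  refine (abs_fld_le_mul (hf q) (G := (2 * L * ε ^ 2 + fric ε q.2) / (ε * ‖cor ε g q.2‖)) ?_).trans ?_
  · unfold resK
    rw [norm_neg, norm_div, norm_mul, Complex.norm_real, Real.norm_of_nonneg hε.le]
    gcongr
    exact h.norm_corErr_le _
  · calc _ = size0 s q * (2 * L * ε ^ 2 + fric ε q.2) / ‖cor ε g q.2‖ / ε := by field_simp
      _ ≤ (2 * L + 1) * c * ε ^ 2 * majE s ds dds q / ε := by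
          gcongr
          exact (h.size0_corErr_le q).2
      _ = _ := by field_simp

lemma eLpNorm_resK_le (h : Setup b g c L C₀ ε s ds dds A) {f : HPt → ℂ}
    (hf : ∀ q, ‖f q‖ ≤ size0 s q) :
    eLpNorm (fld f (resK ε b g)) 2 vΩ ≤
      ofReal ((2 * L + 1) * c * ε) * eLpNorm (majE s ds dds) 2 hΩ := by
  have := h.pos
  have := h.nonneg
  have := h.two_le
  exact h.eLpNorm_le_majE (by positivity) fun q z _ => h.abs_resK_le hf q z

/-! The surface layer vanishes with the wind stress. -/

lemma eLpNorm_blU_two_eq_zero (h : Setup b g c L C₀ ε s ds dds A)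
    (h0 : normH1 .channel s ds = 0) : eLpNorm (blU ε g s ds 2) 2 vΩ = 0 := by
  have hε := h.pos
  have hm : Measurable fun q => size0 s q + size1 ds q :=
    h.wind.measurable_size0.add h.wind.measurable_size1
  have z : eLpNorm (fun q => size0 s q + size1 ds q) 2 hΩ = 0 := by
    refine le_antisymm ((eLpNorm_fun_add_le h.wind.measurable_size0.aestronglyMeasurable
      h.wind.measurable_size1.aestronglyMeasurable).trans ?_) zero_le
    refine (add_le_add h.wind.eLpNorm_size0_le h.wind.eLpNorm_size1_le).trans ?_
    simp [h0]
  have hb := h.kerB_nonneg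
  have hc := h.two_le
  refine le_antisymm ((eLpNorm_vol_le _ (E := fun q => size0 s q + size1 ds q)
    (A := kerB c L * (c / ε + (c / ε) ^ 2)) (by positivity) fun q x hx => ?_).trans
    (by rw [z, mul_zero])) zero_le
  have a0 := size0_nonneg (s := s) q
  have a1 := size1_nonneg (ds := ds) q
  have hi := h.inv_norm_le q.2
  have hN := h.norm_pos q.2
  rw [abs_of_nonneg (add_nonneg a0 a1)]
  have hd := h.decay_le q.2 (Ioo_subset_Icc_self hx)
  have hd0 : 0 < decay ε (cor ε g q.2) x := Real.exp_pos _
  refine (h.abs_blU_two_le q hx).trans ?_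
  calc _ ≤ kerB c L * ((size1 ds q + size0 s q / ‖cor ε g q.2‖) / ‖cor ε g q.2‖) * 1 := by gcongr
    _ = kerB c L * (size1 ds q * (1 / ‖cor ε g q.2‖) + size0 s q * (1 / ‖cor ε g q.2‖) ^ 2) := by
        field_simp
    _ ≤ kerB c L * (size1 ds q * (c / ε) + size0 s q * (c / ε) ^ 2) := by gcongr
    _ ≤ kerB c L * (size1 ds q * (c / ε + (c / ε) ^ 2) + size0 s q * (c / ε + (c / ε) ^ 2)) := by
        gcongr
        · exact le_add_of_nonneg_right (by positivity)
        · exact le_add_of_nonneg_left (by positivity)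
    _ = _ := by ring

end Setup

/-! ### Periodic functions of class `H²` on the channel -/

lemma pd_lat_mul {a : ℝ → ℝ} (ha : ContDiff ℝ ∞ a) {φ : HPt → ℝ} (hφ : IsHTest .channel φ)
    (q : HPt) : pd (hDir 1) (fun q : HPt => a q.2 * φ q) q =
      deriv a q.2 * φ q + a q.2 * pd (hDir 1) φ q ∧
    pd (hDir 0) (fun q : HPt => a q.2 * φ q) q = a q.2 * pd (hDir 0) φ q := by
  have hd := (hφ.mul_lat ha).differentiable
  constructor
  · have := ((ha.differentiable (by simp) q.2).hasDerivAt).mul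
      (hasDerivAt_hpd_one hφ.differentiable q.1 q.2)
    exact (hasDerivAt_hpd_one hd q.1 q.2).unique this
  · have := (hasDerivAt_hpd_zero hφ.differentiable q.1 q.2).const_mul (a q.2)
    exact (hasDerivAt_hpd_zero hd q.1 q.2).unique this

lemma IsHWeakDeriv.lat_mul_zero {f g : HPt → ℝ} (h : IsHWeakDeriv .channel 0 f g) {a : ℝ → ℝ}
    (ha : ContDiff ℝ ∞ a) :
    IsHWeakDeriv .channel 0 (fun q => a q.2 * f q) (fun q => a q.2 * g q) := by
  intro φ hφ
  have h1 := h _ (hφ.mul_lat ha)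
  simp only [(pd_lat_mul ha hφ _).2] at h1
  refine Eq.trans (integral_congr_ae (Eventually.of_forall fun q => ?_)) (h1.trans
    (congrArg Neg.neg (integral_congr_ae (Eventually.of_forall fun q => ?_))))
  · simp only; ring
  · simp only; ring

lemma IsHWeakDeriv.lat_mul_one {f g : HPt → ℝ} (hf : HGood f) (hg : HGood g)
    (h : IsHWeakDeriv .channel 1 f g) {a : ℝ → ℝ} (ha : ContDiff ℝ ∞ a) :
    IsHWeakDeriv .channel 1 (fun q => a q.2 * f q) (fun q => a q.2 * g q + deriv a q.2 * f q) := by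
  intro φ hφ
  have ha' : ContDiff ℝ ∞ (deriv a) := (contDiff_infty_iff_deriv.1 ha).2
  have h1 := h _ (hφ.mul_lat ha)
  simp only [(pd_lat_mul ha hφ _).1] at h1
  have i1 := hf.integrable_mul (hφ.mul_lat ha').hGood
  have i2 := hf.integrable_mul ((hφ.pd 1).mul_lat ha).hGood
  have i3 := hg.integrable_mul (hφ.mul_lat ha).hGood
  simp only [mul_add, integral_add i1 i2] at h1
  have e1 : ∫ q, a q.2 * f q * pd (hDir 1) φ q ∂hΩ =
      ∫ q, f q * (a q.2 * pd (hDir 1) φ q) ∂hΩ :=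
    integral_congr_ae (Eventually.of_forall fun q => by simp only; ring)
  have e2 : ∫ q, (a q.2 * g q + deriv a q.2 * f q) * φ q ∂hΩ =
      ∫ q, (g q * (a q.2 * φ q) + f q * (deriv a q.2 * φ q)) ∂hΩ :=
    integral_congr_ae (Eventually.of_forall fun q => by simp only; ring)
  rw [e1, e2, integral_add i3 i1]
  linarith

/-- Weak derivatives commute. -/
lemma IsHWeakDeriv.comm {D : HDom} {k l : Fin 2} {f g h m : HPt → ℝ} (hg : IsHWeakDeriv D k f g)
    (hh : IsHWeakDeriv D l f h) (hm : IsHWeakDeriv D l g m) : IsHWeakDeriv D k h m := by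
  intro φ hφ
  have h1 := hh _ (hφ.pd k)
  have h2 := hg _ (hφ.pd l)
  have h3 := hm _ hφ
  rw [pd_comm hφ.smooth] at h1
  linarith

lemma IsHWeakDeriv.sub' {k : Fin 2} {f f' g g' : HPt → ℝ} (hf : HGood f) (hf' : HGood f')
    (hg : HGood g) (hg' : HGood g') (h : IsHWeakDeriv .channel k f g)
    (h' : IsHWeakDeriv .channel k f' g') :
    IsHWeakDeriv .channel k (fun q => f q - f' q) (fun q => g q - g' q) := by
  simpa [sub_eq_add_neg] using
    IsHWeakDeriv.linear_comb hf.memLp hf'.memLp hg.memLp hg'.memLp h h' 1 (-1)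

lemma IsHWeakDeriv.add' {k : Fin 2} {f f' g g' : HPt → ℝ} (hf : HGood f) (hf' : HGood f')
    (hg : HGood g) (hg' : HGood g') (h : IsHWeakDeriv .channel k f g)
    (h' : IsHWeakDeriv .channel k f' g') :
    IsHWeakDeriv .channel k (fun q => f q + f' q) (fun q => g q + g' q) := by
  simpa using IsHWeakDeriv.linear_comb hf.memLp hf'.memLp hg.memLp hg'.memLp h h' 1 1

/-- A periodic function of class `H²`, with its weak derivatives. -/
structure H2Fun (f : HPt → ℝ) (df : VF₁) (ddf : VF₂) : Prop where
  good : HGood f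
  good_d : ∀ k, HGood (df k)
  good_dd : ∀ k l, HGood (ddf k l)
  weak : ∀ k, IsHWeakDeriv .channel k f (df k)
  weak_d : ∀ k l, IsHWeakDeriv .channel l (df k) (ddf k l)

/-- First derivatives of `a(y) f`. -/
def mulD (a : ℝ → ℝ) (f : HPt → ℝ) (df : VF₁) : VF₁ :=
  ![fun q => a q.2 * df 0 q, fun q => a q.2 * df 1 q + deriv a q.2 * f q]

/-- Second derivatives of `a(y) f`. -/
def mulDD (a : ℝ → ℝ) (f : HPt → ℝ) (df : VF₁)
    (ddf : VF₂) : VF₂ :=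
  ![![fun q => a q.2 * ddf 0 0 q, fun q => a q.2 * ddf 0 1 q + deriv a q.2 * df 0 q],
    ![fun q => a q.2 * ddf 1 0 q + deriv a q.2 * df 0 q,
      fun q => (a q.2 * ddf 1 1 q + deriv a q.2 * df 1 q)
        + (deriv a q.2 * df 1 q + deriv (deriv a) q.2 * f q)]]

lemma H2Fun.mul_lat {f : HPt → ℝ} {df : VF₁} {ddf : VF₂}
    (h : H2Fun f df ddf) {a : ℝ → ℝ} (ha : ContDiff ℝ ∞ a) {A₀ A₁ A₂ : ℝ} (h0 : ∀ y, |a y| ≤ A₀)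
    (h1 : ∀ y, |deriv a y| ≤ A₁) (h2 : ∀ y, |deriv (deriv a) y| ≤ A₂) :
    H2Fun (fun q => a q.2 * f q) (mulD a f df) (mulDD a f df ddf) := by
  have ha1 : ContDiff ℝ ∞ (deriv a) := (contDiff_infty_iff_deriv.1 ha).2
  have ha2 : ContDiff ℝ ∞ (deriv (deriv a)) := (contDiff_infty_iff_deriv.1 ha1).2
  have g0 : ∀ {u : HPt → ℝ}, HGood u → HGood fun q => a q.2 * u q :=
    fun hu => hu.lat_mul ha.continuous.measurable h0
  have g1 : ∀ {u : HPt → ℝ}, HGood u → HGood fun q => deriv a q.2 * u q :=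
    fun hu => hu.lat_mul ha1.continuous.measurable h1
  have g2 : ∀ {u : HPt → ℝ}, HGood u → HGood fun q => deriv (deriv a) q.2 * u q :=
    fun hu => hu.lat_mul ha2.continuous.measurable h2
  refine ⟨g0 h.good, fun k => ?_, fun k l => ?_, fun k => ?_, fun k l => ?_⟩
  · fin_cases k
    · exact g0 (h.good_d 0)
    · exact (g0 (h.good_d 1)).add (g1 h.good)
  · fin_cases k <;> fin_cases l
    · exact g0 (h.good_dd 0 0)
    · exact (g0 (h.good_dd 0 1)).add (g1 (h.good_d 0))
    · exact (g0 (h.good_dd 1 0)).add (g1 (h.good_d 0))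
    · exact ((g0 (h.good_dd 1 1)).add (g1 (h.good_d 1))).add ((g1 (h.good_d 1)).add (g2 h.good))
  · fin_cases k
    · exact (h.weak 0).lat_mul_zero ha
    · exact (h.weak 1).lat_mul_one h.good (h.good_d 1) ha
  · fin_cases k <;> fin_cases l
    · exact (h.weak_d 0 0).lat_mul_zero ha
    · exact (h.weak_d 0 1).lat_mul_one (h.good_d 0) (h.good_dd 0 1) ha
    · exact IsHWeakDeriv.add' (g0 (h.good_d 1)) (g1 h.good) (g0 (h.good_dd 1 0)) (g1 (h.good_d 0))
        ((h.weak_d 1 0).lat_mul_zero ha) ((h.weak 0).lat_mul_zero ha1)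
    · exact IsHWeakDeriv.add' (g0 (h.good_d 1)) (g1 h.good)
        ((g0 (h.good_dd 1 1)).add (g1 (h.good_d 1))) ((g1 (h.good_d 1)).add (g2 h.good))
        ((h.weak_d 1 1).lat_mul_one (h.good_d 1) (h.good_dd 1 1) ha)
        ((h.weak 1).lat_mul_one h.good (h.good_d 1) ha1)

lemma eLpNorm_lat_mul_le {D : HDom} {f : HPt → ℝ} {a : ℝ → ℝ} {A : ℝ} (hA : ∀ y, |a y| ≤ A) :
    eLpNorm (fun q => a q.2 * f q) 2 D.hVol ≤ ofReal A * eLpNorm f 2 D.hVol := by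
  have hA0 : 0 ≤ A := (abs_nonneg _).trans (hA 0)
  refine eLpNorm_le_of_sq_le ?_
  rw [← lintegral_const_mul' _ _ (by finiteness)]
  refine lintegral_mono fun q => ?_
  simp only
  rw [enorm_mul, mul_pow]
  gcongr
  rw [← ofReal_norm]
  exact ofReal_le_ofReal (hA _)

lemma H2Fun.eLpNorm_mul_lat_le {f : HPt → ℝ} {df : VF₁}
    {ddf : VF₂} (h : H2Fun f df ddf) {a : ℝ → ℝ} (ha : ContDiff ℝ ∞ a)
    {A₀ A₁ A₂ : ℝ} (h0 : ∀ y, |a y| ≤ A₀) (h1 : ∀ y, |deriv a y| ≤ A₁)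
    (h2 : ∀ y, |deriv (deriv a) y| ≤ A₂) {T T' : ℝ≥0∞}
    (n0 : eLpNorm f 2 hΩ ≤ T) (n1 : ∀ k, eLpNorm (df k) 2 hΩ ≤ T)
    (n2 : ∀ k l, eLpNorm (ddf k l) 2 hΩ ≤ T') :
    eLpNorm (fun q => a q.2 * f q) 2 hΩ ≤ ofReal A₀ * T ∧
    (∀ k, eLpNorm (mulD a f df k) 2 hΩ ≤ ofReal (A₀ + A₁) * T) ∧
    ∀ k l, eLpNorm (mulDD a f df ddf k l) 2 hΩ ≤
      ofReal A₀ * T' + ofReal (2 * A₁ + A₂) * T := by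
  have ha1 : ContDiff ℝ ∞ (deriv a) := (contDiff_infty_iff_deriv.1 ha).2
  have ha2 : ContDiff ℝ ∞ (deriv (deriv a)) := (contDiff_infty_iff_deriv.1 ha1).2
  have p0 : 0 ≤ A₀ := (abs_nonneg _).trans (h0 0)
  have p1 : 0 ≤ A₁ := (abs_nonneg _).trans (h1 0)
  have p2 : 0 ≤ A₂ := (abs_nonneg _).trans (h2 0)
  have g0 : ∀ {u : HPt → ℝ}, HGood u → HGood fun q => a q.2 * u q :=
    fun hu => hu.lat_mul ha.continuous.measurable h0
  have g1 : ∀ {u : HPt → ℝ}, HGood u → HGood fun q => deriv a q.2 * u q :=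
    fun hu => hu.lat_mul ha1.continuous.measurable h1
  have g2 : ∀ {u : HPt → ℝ}, HGood u → HGood fun q => deriv (deriv a) q.2 * u q :=
    fun hu => hu.lat_mul ha2.continuous.measurable h2
  have e0 : ∀ {u : HPt → ℝ} {N : ℝ≥0∞}, eLpNorm u 2 hΩ ≤ N →
      eLpNorm (fun q => a q.2 * u q) 2 hΩ ≤ ofReal A₀ * N :=
    fun hu => (eLpNorm_lat_mul_le h0).trans (mul_le_mul_right hu _)
  have e1 : ∀ {u : HPt → ℝ} {N : ℝ≥0∞}, eLpNorm u 2 hΩ ≤ N →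
      eLpNorm (fun q => deriv a q.2 * u q) 2 hΩ ≤ ofReal A₁ * N :=
    fun hu => (eLpNorm_lat_mul_le h1).trans (mul_le_mul_right hu _)
  have e2 : ∀ {u : HPt → ℝ} {N : ℝ≥0∞}, eLpNorm u 2 hΩ ≤ N →
      eLpNorm (fun q => deriv (deriv a) q.2 * u q) 2 hΩ ≤ ofReal A₂ * N :=
    fun hu => (eLpNorm_lat_mul_le h2).trans (mul_le_mul_right hu _)
  have ad : ∀ {u v : HPt → ℝ} {N M : ℝ≥0∞}, HGood u → HGood v →
      eLpNorm u 2 hΩ ≤ N → eLpNorm v 2 hΩ ≤ M →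
      eLpNorm (fun q => u q + v q) 2 hΩ ≤ N + M := fun hu hv h h' =>
    (eLpNorm_fun_add_le hu.meas.aestronglyMeasurable hv.meas.aestronglyMeasurable).trans
      (add_le_add h h')
  refine ⟨e0 n0, fun k => ?_, fun k l => ?_⟩
  · fin_cases k
    · exact (e0 (n1 0)).trans (by gcongr; linarith)
    · refine (ad (g0 (h.good_d 1)) (g1 h.good) (e0 (n1 1)) (e1 n0)).trans (le_of_eq ?_)
      rw [ofReal_add p0 p1, add_mul]
  · have k1 : ofReal A₁ * T ≤ ofReal (2 * A₁ + A₂) * T := by gcongr; linarith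
    fin_cases k <;> fin_cases l
    · exact (e0 (n2 0 0)).trans le_self_add
    · exact (ad (g0 (h.good_dd 0 1)) (g1 (h.good_d 0)) (e0 (n2 0 1)) (e1 (n1 0))).trans
        (by gcongr)
    · exact (ad (g0 (h.good_dd 1 0)) (g1 (h.good_d 0)) (e0 (n2 1 0)) (e1 (n1 0))).trans
        (by gcongr)
    · refine (ad ((g0 (h.good_dd 1 1)).add (g1 (h.good_d 1))) ((g1 (h.good_d 1)).add (g2 h.good))
        (ad (g0 (h.good_dd 1 1)) (g1 (h.good_d 1)) (e0 (n2 1 1)) (e1 (n1 1)))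
        (ad (g1 (h.good_d 1)) (g2 h.good) (e1 (n1 1)) (e2 n0))).trans (le_of_eq ?_)
      rw [ofReal_add (by positivity) p2, two_mul, ofReal_add p1 p1]
      ring

lemma LatSupp.lat_mul {f : HPt → ℝ} {r : ℝ} (h : LatSupp r f) (a : ℝ → ℝ) :
    LatSupp r fun q => a q.2 * f q := fun q hq => by simp [h q hq]

lemma LatSupp.add {f g : HPt → ℝ} {r : ℝ} (hf : LatSupp r f) (hg : LatSupp r g) :
    LatSupp r fun q => f q + g q := fun q hq => by simp [hf q hq, hg q hq]

lemma LatSupp.sub {f g : HPt → ℝ} {r : ℝ} (hf : LatSupp r f) (hg : LatSupp r g) :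
    LatSupp r fun q => f q - g q := fun q hq => by simp [hf q hq, hg q hq]

lemma LatSupp.mono {f : HPt → ℝ} {r r' : ℝ} (hf : LatSupp r f) (h : r ≤ r') : LatSupp r' f :=
  fun q hq => hf q (h.trans_lt hq)

/-- A function and its derivatives vanish for `|y| > r`. -/
structure H2Supp (r : ℝ) (f : HPt → ℝ) (df : VF₁) (ddf : VF₂) :
    Prop where
  supp : LatSupp r f
  supp_d : ∀ k, LatSupp r (df k)
  supp_dd : ∀ k l, LatSupp r (ddf k l)

lemma H2Supp.mul_lat {f : HPt → ℝ} {df : VF₁} {ddf : VF₂} {r : ℝ}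
    (h : H2Supp r f df ddf) (a : ℝ → ℝ) :
    H2Supp r (fun q => a q.2 * f q) (mulD a f df) (mulDD a f df ddf) := by
  refine ⟨h.supp.lat_mul a, fun k => ?_, fun k l => ?_⟩
  · fin_cases k
    · exact (h.supp_d 0).lat_mul a
    · exact ((h.supp_d 1).lat_mul a).add (h.supp.lat_mul _)
  · fin_cases k <;> fin_cases l
    · exact (h.supp_dd 0 0).lat_mul a
    · exact ((h.supp_dd 0 1).lat_mul a).add ((h.supp_d 0).lat_mul _)
    · exact ((h.supp_dd 1 0).lat_mul a).add ((h.supp_d 0).lat_mul _)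
    · exact (((h.supp_dd 1 1).lat_mul a).add ((h.supp_d 1).lat_mul _)).add
        (((h.supp_d 1).lat_mul _).add (h.supp.lat_mul _))

/-- A multiplier that vanishes outside `[-r, r]` with its derivatives localises a function. -/
lemma h2Supp_mul_lat (f : HPt → ℝ) (df : VF₁) (ddf : VF₂)
    {a : ℝ → ℝ} {r : ℝ} (ha : ∀ y, r < |y| → a y = 0) :
    H2Supp r (fun q => a q.2 * f q) (mulD a f df) (mulDD a f df ddf) := by
  have dz : ∀ {u : ℝ → ℝ}, (∀ y, r < |y| → u y = 0) → ∀ y, r < |y| → deriv u y = 0 := by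
    intro u hu y hy
    have : u =ᶠ[𝓝 y] fun _ => 0 := by
      filter_upwards [(isOpen_lt continuous_const continuous_abs).mem_nhds hy] with w hw
      exact hu w hw
    rw [this.deriv_eq, deriv_const]
  have l0 : ∀ u : HPt → ℝ, LatSupp r fun q => a q.2 * u q := fun u q hq => by simp [ha _ hq]
  have l1 : ∀ u : HPt → ℝ, LatSupp r fun q => deriv a q.2 * u q :=
    fun u q hq => by simp [dz ha _ hq]
  have l2 : ∀ u : HPt → ℝ, LatSupp r fun q => deriv (deriv a) q.2 * u q :=
    fun u q hq => by simp [dz (dz ha) _ hq]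
  refine ⟨l0 _, fun k => ?_, fun k l => ?_⟩
  · fin_cases k
    · exact l0 _
    · exact (l0 _).add (l1 _)
  · fin_cases k <;> fin_cases l
    · exact l0 _
    · exact (l0 _).add (l1 _)
    · exact (l0 _).add (l1 _)
    · exact ((l0 _).add (l1 _)).add ((l1 _).add (l2 _))

/-! ### The rotational part of the interior flow -/

lemma HGood.lat_mul_of_latSupp {f : HPt → ℝ} (hf : HGood f) {r : ℝ} (hs : LatSupp r f)
    {a : ℝ → ℝ} (ha : Continuous a) : HGood (fun q => a q.2 * f q) := by
  obtain ⟨C, hC⟩ := (isCompact_Icc (a := -r) (b := r)).exists_bound_of_continuousOn ha.continuousOn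
  have e : (fun q => a q.2 * f q) =
      fun q : HPt => (Icc (-r) r).indicator a q.2 * f q := by
    funext q
    by_cases hq : q.2 ∈ Icc (-r) r
    · rw [indicator_of_mem hq]
    · rw [hs q (by by_contra! h; exact hq (abs_le.1 h)), mul_zero, mul_zero]
  rw [e]
  refine hf.lat_mul (ha.measurable.indicator measurableSet_Icc) (C := |C|) fun y => ?_
  by_cases hy : y ∈ Icc (-r) r
  · rw [indicator_of_mem hy]
    exact (hC y hy).trans (le_abs_self C)
  · rw [indicator_of_notMem hy, abs_zero]
    exact abs_nonneg C

section multiplier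

variable {b g : ℝ → ℝ} {c L C₀ δ : ℝ}

lemma Smoothed.deriv_pos (hg : Smoothed b g c L C₀ δ) (hc : 2 ≤ c) (y : ℝ) : 0 < deriv g y :=
  (inv_pos.2 (by linarith)).trans_le (hg.le_deriv y)

lemma Smoothed.contDiff_inv_deriv (hg : Smoothed b g c L C₀ δ) (hc : 2 ≤ c) :
    ContDiff ℝ ∞ fun y => (deriv g y)⁻¹ :=
  hg.contDiff_deriv.inv fun y => (hg.deriv_pos hc y).ne'

lemma Smoothed.inv_deriv_le (hg : Smoothed b g c L C₀ δ) (hc : 2 ≤ c) (y : ℝ) :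
    (deriv g y)⁻¹ ≤ c :=
  inv_le_of_inv_le₀ (by linarith) (hg.le_deriv y)

lemma Smoothed.deriv_inv_deriv (hg : Smoothed b g c L C₀ δ) (hc : 2 ≤ c) :
    deriv (fun y => (deriv g y)⁻¹) = fun y => -(deriv (deriv g) y * ((deriv g y)⁻¹ * (deriv g y)⁻¹)) :=
  funext fun y => by
    have := ((hg.contDiff_deriv.differentiable (by simp) y).hasDerivAt.inv (hg.deriv_pos hc y).ne').deriv
    refine this.trans ?_
    rw [← mul_inv, ← sq, neg_div, div_eq_mul_inv]

lemma Smoothed.multiplier_bounds (hg : Smoothed b g c L C₀ δ) (hc : 2 ≤ c) (y : ℝ) :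
    |(deriv g y)⁻¹| ≤ c ∧ |deriv (fun y => (deriv g y)⁻¹) y| ≤ L * c ^ 2 ∧
      |deriv (deriv fun y => (deriv g y)⁻¹) y| ≤ C₀ * L / δ * c ^ 2 + 2 * L ^ 2 * c ^ 3 := by
  have hp := hg.deriv_pos hc y
  have hi := hg.inv_deriv_le hc y
  have hip : 0 < (deriv g y)⁻¹ := inv_pos.2 hp
  have h2 := hg.deriv2 y
  have h3 := hg.deriv3 y
  have hL : 0 ≤ L := (abs_nonneg _).trans h2
  have d1 : deriv (fun y => (deriv g y)⁻¹) y =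
      -(deriv (deriv g) y * ((deriv g y)⁻¹ * (deriv g y)⁻¹)) := congrFun (hg.deriv_inv_deriv hc) y
  have k1 : |deriv (fun y => (deriv g y)⁻¹) y| ≤ L * c ^ 2 := by
    rw [d1, abs_neg, abs_mul, abs_of_pos (mul_pos hip hip), sq]
    gcongr
  refine ⟨by rwa [abs_of_pos hip], k1, ?_⟩
  have hd := ((hg.contDiff_inv_deriv hc).differentiable (by simp) y).hasDerivAt
  have h := ((hg.contDiff_deriv2.differentiable (by simp) y).hasDerivAt.mul (hd.mul hd)).neg
  rw [hg.deriv_inv_deriv hc]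
  have e : deriv (fun y => -(deriv (deriv g) y * ((deriv g y)⁻¹ * (deriv g y)⁻¹))) y =
      -(deriv (deriv (deriv g)) y * ((deriv g y)⁻¹ * (deriv g y)⁻¹) + deriv (deriv g) y *
        (deriv (fun y => (deriv g y)⁻¹) y * (deriv g y)⁻¹ +
          (deriv g y)⁻¹ * deriv (fun y => (deriv g y)⁻¹) y)) := h.deriv
  rw [e, abs_neg]
  refine (abs_add_le _ _).trans (add_le_add ?_ ?_)
  · rw [abs_mul, abs_of_pos (mul_pos hip hip), sq]
    gcongr
    exact (abs_nonneg _).trans h3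
  · rw [abs_mul]
    calc _ ≤ L * (L * c ^ 2 * c + c * (L * c ^ 2)) := by
          refine mul_le_mul h2 ((abs_add_le _ _).trans ?_) (abs_nonneg _) hL
          rw [abs_mul, abs_mul, abs_of_pos hip]
          gcongr
      _ = _ := by ring

end multiplier

section stream

variable (δ : ℝ) (t : VF₁) (dt : VF₂)
  (ddt : VF₃)

/-- The meridional transport before division by the Coriolis gradient. -/
def svW (q : HPt) : ℝ := t 1 q - yAvg δ (xPrim (dt 0 1)) q

/-- First derivatives of `svW`. -/
def svWd : VF₁ :=
  ![fun q => dt 1 0 q - yAvg δ (dt 0 1) q, fun q => dt 1 1 q - yAvg δ (xPrim (ddt 0 1 1)) q]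

/-- Second derivatives of `svW`. -/
def svWdd : VF₂ :=
  ![![fun q => ddt 1 0 0 q - yAvg δ (ddt 0 1 0) q, fun q => ddt 1 0 1 q - yAvg δ (ddt 0 1 1) q],
    ![fun q => ddt 1 1 0 q - yAvg δ (ddt 0 1 1) q,
      fun q => ddt 1 1 1 q - yQuot δ (xPrim (ddt 0 1 1)) q]]

variable {δ t dt ddt}

lemma h2Fun_svW (h : ∀ i, H2Fun (t i) (dt i) (ddt i))
    (h0 : ∀ᵐ y, ∫ x in 𝕀, t 0 (x, y) = 0) (hδ : 0 < δ) :
    H2Fun (svW δ t dt) (svWd δ dt ddt) (svWdd δ ddt) := by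
  have gP := (h 0).good.xPrim
  have gPy := ((h 0).good_d 1).xPrim
  have gPyy := ((h 0).good_dd 1 1).xPrim
  have wPx := isHWeakDeriv_xPrim (h 0).good h0
  have wPy : IsHWeakDeriv .channel 1 (xPrim (t 0)) (xPrim (dt 0 1)) :=
    ((h 0).weak 1).avg (h 0).good ((h 0).good_d 1) (by fun_prop) (by fun_prop)
  have wPyy : IsHWeakDeriv .channel 1 (xPrim (dt 0 1)) (xPrim (ddt 0 1 1)) :=
    ((h 0).weak_d 1 1).avg ((h 0).good_d 1) ((h 0).good_dd 1 1) (by fun_prop) (by fun_prop)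
  have wPyx : IsHWeakDeriv .channel 0 (xPrim (dt 0 1)) (dt 0 1) := wPx.comm wPy ((h 0).weak 1)
  have wPyyx : IsHWeakDeriv .channel 0 (xPrim (ddt 0 1 1)) (ddt 0 1 1) :=
    wPyx.comm wPyy ((h 0).weak_d 1 1)
  have av : ∀ {k : Fin 2} {f g : HPt → ℝ}, HGood f → HGood g → IsHWeakDeriv .channel k f g →
      IsHWeakDeriv .channel k (yAvg δ f) (yAvg δ g) :=
    fun hf hg h => h.avg hf hg (by fun_prop) (by fun_prop)
  refine ⟨(h 1).good.sub (gPy.yAvg δ), fun k => ?_, fun k l => ?_, fun k => ?_, fun k l => ?_⟩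
  · fin_cases k
    · exact ((h 1).good_d 0).sub (((h 0).good_d 1).yAvg δ)
    · exact ((h 1).good_d 1).sub (gPyy.yAvg δ)
  · fin_cases k <;> fin_cases l
    · exact ((h 1).good_dd 0 0).sub (((h 0).good_dd 1 0).yAvg δ)
    · exact ((h 1).good_dd 0 1).sub (((h 0).good_dd 1 1).yAvg δ)
    · exact ((h 1).good_dd 1 0).sub (((h 0).good_dd 1 1).yAvg δ)
    · exact ((h 1).good_dd 1 1).sub (gPyy.yQuot δ)
  · fin_cases k
    · exact ((h 1).weak 0).sub' (h 1).good (gPy.yAvg δ) ((h 1).good_d 0) (((h 0).good_d 1).yAvg δ)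
        (av gPy ((h 0).good_d 1) wPyx)
    · exact ((h 1).weak 1).sub' (h 1).good (gPy.yAvg δ) ((h 1).good_d 1) (gPyy.yAvg δ)
        (av gPy gPyy wPyy)
  · fin_cases k <;> fin_cases l
    · exact ((h 1).weak_d 0 0).sub' ((h 1).good_d 0) (((h 0).good_d 1).yAvg δ) ((h 1).good_dd 0 0)
        (((h 0).good_dd 1 0).yAvg δ) (av ((h 0).good_d 1) ((h 0).good_dd 1 0) ((h 0).weak_d 1 0))
    · exact ((h 1).weak_d 0 1).sub' ((h 1).good_d 0) (((h 0).good_d 1).yAvg δ) ((h 1).good_dd 0 1)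
        (((h 0).good_dd 1 1).yAvg δ) (av ((h 0).good_d 1) ((h 0).good_dd 1 1) ((h 0).weak_d 1 1))
    · exact ((h 1).weak_d 1 0).sub' ((h 1).good_d 1) (gPyy.yAvg δ) ((h 1).good_dd 1 0)
        (((h 0).good_dd 1 1).yAvg δ) (av gPyy ((h 0).good_dd 1 1) wPyyx)
    · exact ((h 1).weak_d 1 1).sub' ((h 1).good_d 1) (gPyy.yAvg δ) ((h 1).good_dd 1 1)
        (gPyy.yQuot δ) (isHWeakDeriv_yAvg gPyy hδ)

lemma HGood.eLpNorm_sub_le {f g : HPt → ℝ} (hf : HGood f) (hg : HGood g) {N M : ℝ≥0∞}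
    (h1 : eLpNorm f 2 hΩ ≤ N) (h2 : eLpNorm g 2 hΩ ≤ M) :
    eLpNorm (fun q => f q - g q) 2 hΩ ≤ N + M :=
  (MeasureTheory.eLpNorm_sub_le hf.meas.aestronglyMeasurable hg.meas.aestronglyMeasurable
    (by norm_num)).trans (add_le_add h1 h2)

lemma eLpNorm_svW_le (h : ∀ i, H2Fun (t i) (dt i) (ddt i)) (hδ : 0 < δ) (hδ1 : δ ≤ 1) {T : ℝ≥0∞}
    (n0 : ∀ i, eLpNorm (t i) 2 hΩ ≤ T)
    (n1 : ∀ i k, eLpNorm (dt i k) 2 hΩ ≤ T)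
    (n2 : ∀ i k l, eLpNorm (ddt i k l) 2 hΩ ≤ T) :
    eLpNorm (svW δ t dt) 2 hΩ ≤ 2 * T ∧
    (∀ k, eLpNorm (svWd δ dt ddt k) 2 hΩ ≤ 2 * T) ∧
    ∀ k l, eLpNorm (svWdd δ ddt k l) 2 hΩ ≤ ofReal (2 / δ) * T := by
  have gPy := ((h 0).good_d 1).xPrim
  have gPyy := ((h 0).good_dd 1 1).xPrim
  have bPy := (eLpNorm_xPrim_le ((h 0).good_d 1)).trans (n1 0 1)
  have bPyy := (eLpNorm_xPrim_le ((h 0).good_dd 1 1)).trans (n2 0 1 1)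
  have av : ∀ {f : HPt → ℝ} {N : ℝ≥0∞}, HGood f → eLpNorm f 2 hΩ ≤ N →
      eLpNorm (yAvg δ f) 2 hΩ ≤ N := fun hf hN => (eLpNorm_yAvg_le hf δ).trans hN
  have two : (2 : ℝ≥0∞) * T ≤ ofReal (2 / δ) * T := by
    gcongr
    rw [show (2 : ℝ≥0∞) = ofReal 2 by simp]
    refine ofReal_le_ofReal ?_
    rw [le_div_iff₀ hδ]
    linarith
  have hT : T ≤ ofReal δ⁻¹ * T := by
    refine le_mul_of_one_le_left zero_le ?_
    rw [show (1 : ℝ≥0∞) = ofReal 1 by simp]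
    exact ofReal_le_ofReal (one_le_inv_iff₀.2 ⟨hδ, hδ1⟩)
  refine ⟨?_, fun k => ?_, fun k l => ?_⟩
  · rw [two_mul]
    exact (h 1).good.eLpNorm_sub_le (gPy.yAvg δ) (n0 1) (av gPy bPy)
  · rw [two_mul]
    fin_cases k
    · exact ((h 1).good_d 0).eLpNorm_sub_le (((h 0).good_d 1).yAvg δ) (n1 1 0)
        (av ((h 0).good_d 1) (n1 0 1))
    · exact ((h 1).good_d 1).eLpNorm_sub_le (gPyy.yAvg δ) (n1 1 1) (av gPyy bPyy)
  · have fst : ∀ k l m, eLpNorm (fun q => ddt 1 k l q - yAvg δ (ddt 0 1 m) q) 2 hΩ ≤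
        ofReal (2 / δ) * T := fun k l m => by
      refine le_trans ?_ two
      rw [two_mul]
      exact ((h 1).good_dd k l).eLpNorm_sub_le (((h 0).good_dd 1 m).yAvg δ) (n2 1 k l)
        (av ((h 0).good_dd 1 m) (n2 0 1 m))
    fin_cases k <;> fin_cases l
    · exact fst 0 0 0
    · exact fst 0 1 1
    · exact fst 1 0 1
    · refine (((h 1).good_dd 1 1).eLpNorm_sub_le (gPyy.yQuot δ) ((n2 1 1 1).trans hT)
        ((eLpNorm_yQuot_le gPyy hδ).trans (mul_le_mul_right bPyy _))).trans (le_of_eq ?_)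
      rw [← two_mul, ← mul_assoc, div_eq_mul_inv, ofReal_mul (by norm_num)]
      simp

lemma h2Supp_svW {r : ℝ} (h : ∀ i, H2Supp r (t i) (dt i) (ddt i)) (hδ : 0 ≤ δ) :
    H2Supp (r + δ) (svW δ t dt) (svWd δ dt ddt) (svWdd δ ddt) := by
  have hr : r ≤ r + δ := by linarith
  have lPy := ((h 0).supp_d 1).xPrim
  have lPyy := ((h 0).supp_dd 1 1).xPrim
  refine ⟨((h 1).supp.mono hr).sub (lPy.yAvg hδ), fun k => ?_, fun k l => ?_⟩
  · fin_cases k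
    · exact (((h 1).supp_d 0).mono hr).sub (((h 0).supp_d 1).yAvg hδ)
    · exact (((h 1).supp_d 1).mono hr).sub (lPyy.yAvg hδ)
  · fin_cases k <;> fin_cases l
    · exact (((h 1).supp_dd 0 0).mono hr).sub (((h 0).supp_dd 1 0).yAvg hδ)
    · exact (((h 1).supp_dd 0 1).mono hr).sub (((h 0).supp_dd 1 1).yAvg hδ)
    · exact (((h 1).supp_dd 1 0).mono hr).sub (((h 0).supp_dd 1 1).yAvg hδ)
    · exact (((h 1).supp_dd 1 1).mono hr).sub (lPyy.yQuot hδ)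

end stream

/-- A stream function `ψ` and a pressure `P` in Sverdrup balance with the forcing `t` up to the
error `δ² e`. -/
structure Sverdrup (g : ℝ → ℝ) (δ r : ℝ) (t : VF₁) (T : ℝ≥0∞) (C : ℝ)
    (ψ : HPt → ℝ) (dψ : VF₁) (ddψ : VF₂) (P e : HPt → ℝ) : Prop where
  h2 : H2Fun ψ dψ ddψ
  supp : H2Supp r ψ dψ ddψ
  good_p : HGood P
  supp_p : LatSupp r P
  good_e : HGood e
  supp_e : LatSupp r e
  good_gd : ∀ k, HGood fun q => g q.2 * dψ k q
  weak_x : IsHWeakDeriv .channel 0 P (fun q => g q.2 * dψ 0 q + (t 0 q + δ ^ 2 * e q))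
  weak_y : IsHWeakDeriv .channel 1 P (fun q => g q.2 * dψ 1 q + t 1 q)
  norm_d : ∀ k, eLpNorm (dψ k) 2 hΩ ≤ ofReal C * T
  norm_dd : ∀ k l, eLpNorm (ddψ k l) 2 hΩ ≤ ofReal (C / δ) * T
  norm_e : eLpNorm e 2 hΩ ≤ 2 * T

/-- The constant in `Sverdrup`. -/
def sverdrupConst (c L C₀ : ℝ) : ℝ :=
  2 * (c + L * c ^ 2) + 2 * (2 * (L * c ^ 2) + (C₀ * L * c ^ 2 + 2 * L ^ 2 * c ^ 3))

lemma exists_sverdrup {b g : ℝ → ℝ} {c L C₀ δ r : ℝ} (hg : Smoothed b g c L C₀ δ) (hc : 2 ≤ c)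
    (hC₀ : 0 ≤ C₀) (hδ : 0 < δ) (hδ1 : δ ≤ 1) {t : VF₁} {dt : VF₂}
    {ddt : VF₃} (h : ∀ i, H2Fun (t i) (dt i) (ddt i))
    (hs : ∀ i, H2Supp r (t i) (dt i) (ddt i))
    (h0 : ∀ᵐ y, ∫ x in 𝕀, t 0 (x, y) = 0) {T : ℝ≥0∞}
    (n0 : ∀ i, eLpNorm (t i) 2 hΩ ≤ T)
    (n1 : ∀ i k, eLpNorm (dt i k) 2 hΩ ≤ T)
    (n2 : ∀ i k l, eLpNorm (ddt i k l) 2 hΩ ≤ T) :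
    ∃ ψ dψ ddψ P e, Sverdrup g δ (r + δ) t T (sverdrupConst c L C₀) ψ dψ ddψ P e := by
  set a : ℝ → ℝ := fun y => (deriv g y)⁻¹ with ha
  have ca : ContDiff ℝ ∞ a := hg.contDiff_inv_deriv hc
  have b0 := fun y => (hg.multiplier_bounds hc y).1
  have b1 := fun y => (hg.multiplier_bounds hc y).2.1
  have b2 := fun y => (hg.multiplier_bounds hc y).2.2
  have hW := h2Fun_svW h h0 hδ
  have sW := h2Supp_svW hs hδ.le
  have hψ := hW.mul_lat ca b0 b1 b2
  have sψ := sW.mul_lat a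
  obtain ⟨m0, m1, m2⟩ := eLpNorm_svW_le h hδ hδ1 n0 n1 n2
  obtain ⟨-, k1, k2⟩ := hW.eLpNorm_mul_lat_le ca b0 b1 b2 m0 m1 m2
  have hL : 0 ≤ L := (abs_nonneg _).trans (hg.deriv2 0)
  have gc := hg.contDiff.continuous
  have gPi := (h 0).good.xPrim.yAvg δ
  have ggψ := hψ.good.lat_mul_of_latSupp sψ.supp gc
  have ggd := fun k => (hψ.good_d k).lat_mul_of_latSupp (sψ.supp_d k) gc
  have gg'ψ := hψ.good.lat_mul_of_latSupp sψ.supp hg.contDiff_deriv.continuous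
  have gPy := ((h 0).good_d 1).xPrim.yAvg δ
  have ge := ((h 0).good_dd 1 1).yRem δ
  have wPx : IsHWeakDeriv .channel 0 (yAvg δ (xPrim (t 0)))
      (fun q => t 0 q + δ ^ 2 * yRem δ (ddt 0 1 1) q) := by
    intro φ hφ
    rw [← integral_yAvg_mul (h 0).good ((h 0).good_d 1) ((h 0).good_dd 1 1) ((h 0).weak 1)
      ((h 0).weak_d 1 1) δ hφ]
    exact (isHWeakDeriv_xPrim (h 0).good h0).avg (h 0).good.xPrim (h 0).good (by fun_prop)
      (by fun_prop) φ hφ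
  have wPy : IsHWeakDeriv .channel 1 (yAvg δ (xPrim (t 0))) (yAvg δ (xPrim (dt 0 1))) :=
    (((h 0).weak 1).avg (h 0).good ((h 0).good_d 1) (by fun_prop) (by fun_prop)).avg
      (h 0).good.xPrim ((h 0).good_d 1).xPrim (by fun_prop) (by fun_prop)
  refine ⟨_, _, _, fun q => g q.2 * (a q.2 * svW δ t dt q) + yAvg δ (xPrim (t 0)) q,
    yRem δ (ddt 0 1 1), hψ, sψ, ggψ.add gPi,
    (sψ.supp.lat_mul g).add (((hs 0).supp.xPrim).yAvg hδ.le), ge,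
    ((hs 0).supp_dd 1 1).yRem hδ.le, ggd, ?_, ?_, fun k => ?_, fun k l => ?_, ?_⟩
  · exact ((hψ.weak 0).lat_mul_zero hg.contDiff).add' ggψ gPi (ggd 0)
      ((h 0).good.add (ge.const_mul _)) wPx
  · have := ((hψ.weak 1).lat_mul_one hψ.good (hψ.good_d 1) hg.contDiff).add' ggψ gPi
      ((ggd 1).add gg'ψ) gPy wPy
    refine (congrArg (IsHWeakDeriv .channel 1 _) (funext fun q => ?_)).mp this
    have hp := (hg.deriv_pos hc q.2).ne'
    simp only [ha, svW]
    field_simp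
    ring
  · refine (k1 k).trans ?_
    rw [show (2 : ℝ≥0∞) = ofReal 2 by simp, ← mul_assoc, ← ofReal_mul (by positivity)]
    gcongr
    unfold sverdrupConst
    have : 0 ≤ 2 * (2 * (L * c ^ 2) + (C₀ * L * c ^ 2 + 2 * L ^ 2 * c ^ 3)) := by positivity
    linarith
  · refine (k2 k l).trans ?_
    rw [show (2 : ℝ≥0∞) = ofReal 2 by simp, ← mul_assoc, ← mul_assoc,
      ← ofReal_mul (by positivity), ← ofReal_mul (by positivity), ← add_mul,
      ← ofReal_add (by positivity) (by positivity)]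
    gcongr
    rw [le_div_iff₀ hδ]
    unfold sverdrupConst
    have e : (c * (2 / δ) + (2 * (L * c ^ 2) + (C₀ * L / δ * c ^ 2 + 2 * L ^ 2 * c ^ 3)) * 2) * δ =
      2 * c + 2 * (2 * (L * c ^ 2) * δ + (C₀ * L * c ^ 2 + 2 * L ^ 2 * c ^ 3 * δ)) := by
      field_simp
    rw [e]
    have : 0 ≤ L * c ^ 2 := by positivity
    have : 2 * (L * c ^ 2) * δ ≤ 2 * (L * c ^ 2) := mul_le_of_le_one_right (by positivity) hδ1
    have : 2 * L ^ 2 * c ^ 3 * δ ≤ 2 * L ^ 2 * c ^ 3 := mul_le_of_le_one_right (by positivity) hδ1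
    linarith
  · exact (eLpNorm_yRem_le ((h 0).good_dd 1 1) δ).trans (mul_le_mul_right (n2 0 1 1) _)

/-! ### Fields that do not depend on `z` -/

/-- A horizontal function, seen as a function on `ω`. -/
def lift (f : HPt → ℝ) (p : Pt) : ℝ := f (p.1, p.2.1)

lemma HGood.memLp_lift {f : HPt → ℝ} (hf : HGood f) : MemLp (lift f) 2 vΩ := by
  have hm : Measurable (lift f) := hf.meas.comp (by fun_prop)
  refine ⟨hm.aestronglyMeasurable, ?_⟩
  refine (eLpNorm_vol_le .channel (E := f) zero_le_one fun q z _ => by rw [one_mul]; rfl).trans_lt ?_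
  simpa using hf.memLp.2

lemma eLpNorm_lift_le (D : HDom) (f : HPt → ℝ) : eLpNorm (lift f) 2 D.vol ≤ eLpNorm f 2 D.hVol := by
  simpa using eLpNorm_vol_le D (f := lift f) (E := f) zero_le_one fun q z _ => by rw [one_mul]; rfl

lemma weak_lift {f g : HPt → ℝ} (hf : HGood f) (hg : HGood g) {k : Fin 2}
    (h : IsHWeakDeriv .channel k f g) : IsWeakDeriv .channel k.castSucc (lift f) (lift g) := by
  fin_cases k
  · have := isWeakDeriv_mul_zero hf.memLp hg.memLp h (k := fun _ _ => 1) continuous_const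
      (fun _ => contDiff_const)
    simp only [mul_one] at this
    exact this
  · have := isWeakDeriv_mul_one hf.memLp hg.memLp h (k := fun _ _ => 1) (k' := fun _ _ => 0)
      continuous_const (fun _ => contDiff_const) continuous_const fun _ _ => hasDerivAt_const _ _
    simp only [mul_one, mul_zero, add_zero] at this
    exact this

lemma weak_lift_two {f : HPt → ℝ} (hf : HGood f) : IsWeakDeriv .channel 2 (lift f) 0 := by
  have := isWeakDeriv_mul_two hf.memLp (k := fun _ _ => 1) (k' := fun _ _ => 0)
    continuous_const continuous_const fun _ _ => hasDerivAt_const _ _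
  simp only [mul_one, mul_zero] at this
  exact this

lemma measurable_fld' {f : HPt → ℂ} (hf : Measurable f) {k : ℝ → ℝ → ℂ}
    (hk : Measurable fun w : ℝ × ℝ => k w.1 w.2) : Measurable (fld f k) := by
  have h1 : Measurable fun p : Pt => f (p.1, p.2.1) := hf.comp (by fun_prop)
  have h2 : Measurable fun p : Pt => k p.2.1 p.2.2 :=
    hk.comp (by fun_prop : Measurable fun p : Pt => (p.2.1, p.2.2))
  exact Complex.measurable_re.comp (h1.mul h2)

/-! ### The approximate solution -/

section defs

variable (ε δ : ℝ) (b g g₂ : ℝ → ℝ) (s : VF₁) (ds : VF₂)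
  (dds : VF₃) (t : VF₁)
  (dψ : VF₁) (ddψ : VF₂) (P e : HPt → ℝ)

/-- The velocity with stream function `ψ`. -/
def rotU : UF₁ := ![lift fun q => (-1) * dψ 1 q, lift (dψ 0), 0]

/-- The gradient of the velocity with stream function `ψ`. -/
def rotG : UF₂ :=
  ![![lift fun q => (-1) * ddψ 0 1 q, lift fun q => (-1) * ddψ 1 1 q, 0],
    ![lift (ddψ 0 0), lift (ddψ 0 1), 0], ![0, 0, 0]]

/-- The interior flow. -/
def intU (i : Fin 3) (p : Pt) : ℝ := ekU ε g s ds i p + rotU dψ i p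

/-- The gradient of the interior flow. -/
def intG (i k : Fin 3) (p : Pt) : ℝ := ekG ε g s ds dds i k p + rotG ddψ i k p

/-- The pressure. -/
def presP (p : Pt) : ℝ := 1 / ε * lift P p

/-- The pressure gradient. -/
def presG : UF₁ :=
  ![fun p => 1 / ε * lift (fun q => g₂ q.2 * dψ 0 q + (t 0 q + δ ^ 2 * e q)) p,
    fun p => 1 / ε * lift (fun q => g₂ q.2 * dψ 1 q + t 1 q) p, 0]

/-- The residual of the interior flow. -/
def resI : VF₁ :=
  ![fun q => 1 / ε * ((g₂ q.2 - b q.2) * dψ 0 q + ((t 0 q - s 0 q) + δ ^ 2 * e q)),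
    fun q => 1 / ε * ((g₂ q.2 - b q.2) * dψ 1 q + (t 1 q - s 1 q))]

/-- The residual of the approximate solution. -/
def resR : UF₁ :=
  ![fun p => (fld (cpx s) (resM ε b g) p + fld (cpx s) (resK ε b g) p)
      + lift (resI ε δ b g₂ s t dψ e 0) p,
    fun p => (fld (cm (-I) (cpx s)) (resM ε b g) p
      + fld (cm (-I) (cpx s)) (resK ε b g) p) + lift (resI ε δ b g₂ s t dψ e 1) p,
    fun p => -(ε * blH ε g s ds 2 p)]

end defs

variable {b g g₂ : ℝ → ℝ} {c L C₀ C₁ ε δ r : ℝ} {s t : VF₁}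
  {ds : VF₂} {dds : VF₃} {A : ℝ} {T : ℝ≥0∞}
  {ψ : HPt → ℝ} {dψ : VF₁} {ddψ : VF₂} {P e : HPt → ℝ}

lemma Sverdrup.memLp_rot (v : Sverdrup g₂ δ r t T C₁ ψ dψ ddψ P e) :
    (∀ i, MemLp (rotU dψ i) 2 vΩ) ∧
      ∀ i k, MemLp (rotG ddψ i k) 2 vΩ := by
  constructor
  · intro i
    fin_cases i
    · exact ((v.h2.good_d 1).const_mul (-1)).memLp_lift
    · exact (v.h2.good_d 0).memLp_lift
    · exact MemLp.zero
  · intro i k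
    fin_cases i <;> fin_cases k
    · exact ((v.h2.good_dd 0 1).const_mul (-1)).memLp_lift
    · exact ((v.h2.good_dd 1 1).const_mul (-1)).memLp_lift
    · exact MemLp.zero
    · exact (v.h2.good_dd 0 0).memLp_lift
    · exact (v.h2.good_dd 0 1).memLp_lift
    · exact MemLp.zero
    · exact MemLp.zero
    · exact MemLp.zero
    · exact MemLp.zero

lemma isWeakDeriv_zero (D : HDom) (k : Fin 3) : IsWeakDeriv D k 0 0 := fun φ _ => by simp

lemma IsHWeakDeriv.const_mul' {k : Fin 2} {f f' : HPt → ℝ} (hf : HGood f) (hf' : HGood f')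
    (h : IsHWeakDeriv .channel k f f') (a : ℝ) :
    IsHWeakDeriv .channel k (fun q => a * f q) (fun q => a * f' q) := by
  simpa using IsHWeakDeriv.linear_comb hf.memLp hf.memLp hf'.memLp hf'.memLp h h a 0

lemma Sverdrup.weak_rot (v : Sverdrup g₂ δ r t T C₁ ψ dψ ddψ P e) (i k : Fin 3) :
    IsWeakDeriv .channel k (rotU dψ i) (rotG ddψ i k) := by
  have wyx : IsHWeakDeriv .channel 0 (dψ 1) (ddψ 0 1) :=
    (v.h2.weak 0).comm (v.h2.weak 1) (v.h2.weak_d 0 1)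
  have g0 := v.h2.good_d 0
  have g1 := (v.h2.good_d 1).const_mul (-1)
  fin_cases i <;> fin_cases k
  · exact weak_lift g1 ((v.h2.good_dd 0 1).const_mul (-1))
      (wyx.const_mul' (v.h2.good_d 1) (v.h2.good_dd 0 1) (-1))
  · exact weak_lift g1 ((v.h2.good_dd 1 1).const_mul (-1))
      ((v.h2.weak_d 1 1).const_mul' (v.h2.good_d 1) (v.h2.good_dd 1 1) (-1))
  · exact weak_lift_two g1
  · exact weak_lift g0 (v.h2.good_dd 0 0) (v.h2.weak_d 0 0)
  · exact weak_lift g0 (v.h2.good_dd 0 1) (v.h2.weak_d 0 1)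
  · exact weak_lift_two g0
  · exact isWeakDeriv_zero _ _
  · exact isWeakDeriv_zero _ _
  · exact isWeakDeriv_zero _ _

lemma rotG_two (ddψ : VF₂) (i : Fin 3) : rotG ddψ i 2 = 0 := by
  fin_cases i <;> rfl

lemma Setup.continuous_cor (h : Setup b g c L C₀ ε s ds dds A) : Continuous (cor ε g) :=
  (h.smoothed.contDiff_cor h.pos).continuous

lemma Setup.measurable_res (h : Setup b g c L C₀ ε s ds dds A) (hb : Measurable b) :
    (Measurable fun w : ℝ × ℝ => resM ε b g w.1 w.2) ∧
      Measurable fun w : ℝ × ℝ => resK ε b g w.1 w.2 := by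
  obtain ⟨-, -, -, pM, -, -, -⟩ := h.profs
  have hbc : Measurable fun w : ℝ × ℝ => corErr ε b g w.1 := by
    have h1 : Measurable fun w : ℝ × ℝ => ((b w.1 : ℝ) : ℂ) :=
      Complex.measurable_ofReal.comp (hb.comp measurable_fst)
    exact (h1.mul_const _).sub (h.continuous_cor.measurable.comp measurable_fst)
  have hM : Measurable fun w : ℝ × ℝ => kerM ε g w.1 w.2 := pM.smooth.continuous.measurable
  have hc : Measurable fun w : ℝ × ℝ => cor ε g w.1 := h.continuous_cor.measurable.comp measurable_fst
  exact ⟨hM.mul (hbc.div_const _), (hbc.div (hc.const_mul _)).neg⟩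

lemma norm_cm_neg_I_le (s : VF₁) (q : HPt) :
    ‖cm (-I) (cpx s) q‖ ≤ size0 s q := by
  rw [norm_cm, norm_I_neg, one_mul]
  exact norm_cpx_le_size0 s q

lemma Setup.memLp_res (h : Setup b g c L C₀ ε s ds dds A) (hb : Measurable b) {f : HPt → ℂ}
    (hf : CGood f) (hfs : ∀ q, ‖f q‖ ≤ size0 s q) :
    MemLp (fld f (resM ε b g)) 2 vΩ ∧
      MemLp (fld f (resK ε b g)) 2 vΩ := by
  obtain ⟨mM, mK⟩ := h.measurable_res hb
  exact ⟨⟨(measurable_fld' hf.meas mM).aestronglyMeasurable, (h.eLpNorm_resM_le hfs).trans_lt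
    (ENNReal.mul_lt_top (by simp) h.wind.memLp_majE.2)⟩,
    ⟨(measurable_fld' hf.meas mK).aestronglyMeasurable, (h.eLpNorm_resK_le hfs).trans_lt
    (ENNReal.mul_lt_top (by simp) h.wind.memLp_majE.2)⟩⟩

lemma Sverdrup.hGood_resI (v : Sverdrup g₂ δ r t T C₁ ψ dψ ddψ P e) (hg : Smoothed b g₂ c L C₀ δ)
    (hb : Measurable b) (hs : ∀ i, HGood (s i)) (ht : ∀ i, HGood (t i)) (i : Fin 2) :
    HGood (resI ε δ b g₂ s t dψ e i) := by
  have hm : Measurable fun y => g₂ y - b y := hg.contDiff.continuous.measurable.sub hb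
  fin_cases i
  · exact (((v.h2.good_d 0).lat_mul hm hg.close).add (((ht 0).sub (hs 0)).add
      (v.good_e.const_mul _))).const_mul _
  · exact (((v.h2.good_d 1).lat_mul hm hg.close).add ((ht 1).sub (hs 1))).const_mul _

lemma statFields_channel (h : Setup b g c L C₀ ε s ds dds A) (hb : Measurable b)
    (hg : Smoothed b g₂ c L C₀ δ) (v : Sverdrup g₂ δ r t T C₁ ψ dψ ddψ P e) (ht : ∀ i, HGood (t i)) :
    StatFields .channel ε b (blU ε g s ds) (intU ε g s ds dψ) (presP ε P) (blG ε g s ds dds)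
      (intG ε g s ds dds ddψ) (presG ε δ g₂ t dψ e) (blH ε g s ds)
      (resR ε δ b g g₂ s ds t dψ e) := by
  have hS := h.wind.cGood.1
  have hε := h.pos.ne'
  have gx : HGood fun q => g₂ q.2 * dψ 0 q + (t 0 q + δ ^ 2 * e q) :=
    (v.good_gd 0).add ((ht 0).add (v.good_e.const_mul _))
  have gy : HGood fun q => g₂ q.2 * dψ 1 q + t 1 q := (v.good_gd 1).add (ht 1)
  refine ⟨h.memLp_bl.1, fun i => (h.memLp_ek.1 i).add (v.memLp_rot.1 i),
    v.good_p.memLp_lift.const_mul _, h.memLp_bl.2, fun i k => (h.memLp_ek.2 i k).add (v.memLp_rot.2 i k),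
    fun k => ?_, fun i => ?_, fun i => (h.weak_blH i).2, h.weak_bl, fun i k => ?_, fun k => ?_,
    fun i => ?_, fun q _ => ?_, fun i q _ => ?_⟩
  · fin_cases k
    · exact gx.memLp_lift.const_mul _
    · exact gy.memLp_lift.const_mul _
    · exact MemLp.zero
  · obtain ⟨m1, m2⟩ := h.memLp_res hb hS (norm_cpx_le_size0 s)
    obtain ⟨m3, m4⟩ := h.memLp_res hb (hS.cm (-I)) (norm_cm_neg_I_le s)
    fin_cases i
    · exact (m1.add m2).add (v.hGood_resI hg hb h.wind.good ht 0).memLp_lift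
    · exact (m3.add m4).add (v.hGood_resI hg hb h.wind.good ht 1).memLp_lift
    · have hm : Measurable (blH ε g s ds 2) := by
        obtain ⟨-, -, -, -, -, pQ, pdQ⟩ := h.profs
        have hV := h.wind.cGood.2.2.1
        exact (measurable_fld (hV.cm _).meas (pQ.dsq ε).smooth).add
          (measurable_fld (hS.cm _).meas (pdQ.dsq ε).smooth)
      exact ⟨(hm.const_mul ε).neg.aestronglyMeasurable, h.eLpNorm_blH_two_le.trans_lt
        (ENNReal.mul_lt_top (by simp) h.wind.memLp_majE.2)⟩
  · exact (h.weak_ek i k).add (h.memLp_ek.1 i).locInt (v.memLp_rot.1 i).locInt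
      (h.memLp_ek.2 i k).locInt (v.memLp_rot.2 i k).locInt (v.weak_rot i k)
  · fin_cases k
    · exact (weak_lift v.good_p gx v.weak_x).const_mul _
    · exact (weak_lift v.good_p gy v.weak_y).const_mul _
    · have := (weak_lift_two v.good_p).const_mul (1 / ε)
      simp only [Pi.zero_apply, mul_zero] at this
      exact this
  · have h1 := (h.weak_blH i).1
    have h2 := h.weak_ekH i
    have z : LocInt .channel (0 : Pt → ℝ) := MemLp.zero.locInt
    have := h1.add (h.memLp_bl.2 i 2).locInt (h.memLp_ek.2 i 2).locInt (h.weak_blH i).2 z h2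
    simpa [intG, rotG_two] using this
  · obtain ⟨d1, d2⟩ := Setup.div_bl_ek ε g s ds dds q
    have d3 : ∑ k, rotG ddψ k k q = 0 := by
      rw [Fin.sum_univ_three]
      simp [rotG, lift]
    unfold intG
    rw [Finset.sum_add_distrib, Finset.sum_add_distrib, d1, d2, d3]
    ring
  · have hcor : cor ε g q.2.1 ≠ 0 := norm_pos_iff.1 (h.norm_pos q.2.1)
    have hεc : (ε : ℂ) ≠ 0 := by exact_mod_cast hε
    have hK := kerK_one h.pos g q.2.1
    have eM : ∀ f : ℂ, (f * resM ε b g q.2.1 q.2.2).re =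
        1 / ε * b q.2.1 * (f * I * kerM ε g q.2.1 q.2.2).re -
          ε * (f * (cor ε g q.2.1 * kerM ε g q.2.1 q.2.2 / ε ^ 2)).re := by
      intro f
      rw [← Complex.re_ofReal_mul, ← Complex.re_ofReal_mul, ← Complex.sub_re]
      congr 1
      unfold resM corErr
      push_cast
      field_simp
    have eK : ∀ f : ℂ, (f * resK ε b g q.2.1 q.2.2).re =
        1 / ε * b q.2.1 * (-(f * I * kerK ε g q.2.1 1)).re + 1 / ε * f.re := by
      intro f
      rw [← Complex.re_ofReal_mul, ← Complex.re_ofReal_mul, ← Complex.add_re, hK]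
      congr 1
      unfold resK corErr
      push_cast
      field_simp
      ring
    fin_cases i
    · have e1 := eM (cpx s (q.1, q.2.1))
      have e2 := eK (cpx s (q.1, q.2.1))
      simp [rot3, intU, blU, ekU, rotU, presG, blH, resR, resI, fld, lift, cm, dsq, atTop1] at *
      rw [e1, e2]
      simp [cpx]
      field_simp
      ring
    · have e1 := eM (-I * cpx s (q.1, q.2.1))
      have e2 := eK (-I * cpx s (q.1, q.2.1))
      simp [rot3, intU, blU, ekU, rotU, presG, blH, resR, resI, fld, lift, cm, dsq, atTop1] at *
      rw [e1, e2]
      simp [cpx]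
      field_simp
      ring
    · simp [rot3, presG, resR]

/-! ### Boundary conditions and supports -/

/-- The boundary conditions, where `G` is the vertical derivative of the horizontal velocity. -/
structure Traces (D : HDom) (γ : ℝ) (s : VF₁) (u : UF₁) (G : Fin 2 → Pt → ℝ) :
    Prop where
  horizontal : ∀ i, HasTraceBottom D (G i) 0 ∧ HasTraceTop D (G i) fun q => γ * s i q
  vertical_bottom : HasTraceBottom D (u 2) 0
  vertical_top : HasTraceTop D (u 2) 0

lemma Traces.congr {D : HDom} {γ : ℝ} {s s' : VF₁} {u : UF₁}
    {G : Fin 2 → Pt → ℝ} (h : Traces D γ s u G) (hs : ∀ i, ∀ᵐ q ∂D.hVol, s i q = s' i q) :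
    Traces D γ s' u G :=
  ⟨fun i => ⟨(h.horizontal i).1, (h.horizontal i).2.congr (by filter_upwards [hs i] with q hq; rw [hq])⟩,
    h.vertical_bottom, h.vertical_top⟩

lemma Traces.to_torus {γ : ℝ} {s : VF₁} {u : UF₁}
    {G : Fin 2 → Pt → ℝ} (h : Traces .channel γ s u G) : Traces .torus γ s u G :=
  ⟨fun i => ⟨(h.horizontal i).1.to_torus, (h.horizontal i).2.to_torus⟩, h.vertical_bottom.to_torus,
    h.vertical_top.to_torus⟩

lemma StatFields.boundaryConditions {D : HDom} {ε γ : ℝ} {b : ℝ → ℝ} {uBL uint : UF₁}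
    {p : Pt → ℝ} {gBL gint : UF₂} {gp h r : UF₁} {s : VF₁}
    (H : StatFields D ε b uBL uint p gBL gint gp h r)
    (T : Traces D γ s (uBL + uint) fun i q => gBL i.castSucc 2 q + gint i.castSucc 2 q) :
    BoundaryConditions D γ s (uBL + uint) :=
  ⟨fun i => ⟨_, H.memG i.castSucc 2, H.weakU i.castSucc 2, T.horizontal i⟩, T.vertical_bottom,
    T.vertical_top⟩

section

variable {b g g₂ : ℝ → ℝ} {c L C₀ C₁ ε δ r : ℝ} {s t : VF₁}
  {ds : VF₂} {dds : VF₃} {A : ℝ} {T : ℝ≥0∞}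
  {ψ : HPt → ℝ} {dψ : VF₁} {ddψ : VF₂} {P e : HPt → ℝ}

lemma CGood.traceTop {f : HPt → ℂ} (hf : CGood f) {k : ℝ → ℝ → ℂ} (hk : Prof k) {s : HPt → ℝ}
    (hs : ∀ q, (f q * k q.2 1).re = s q) : HasTraceTop .channel (fld f k) s := by
  obtain ⟨B, hB⟩ := hk.bdd
  have := hasTraceTop_re_mul .channel hf.meas hf.memLp hk.smooth.continuous hB
  rwa [show (fun q => (f q * k q.2 1).re) = s from funext hs] at this

lemma CGood.traceBottom {f : HPt → ℂ} (hf : CGood f) {k : ℝ → ℝ → ℂ} (hk : Prof k)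
    (h0 : ∀ y, k y 0 = 0) : HasTraceBottom .channel (fld f k) 0 := by
  obtain ⟨B, hB⟩ := hk.bdd
  have := hasTraceBottom_re_mul .channel hf.meas hf.memLp hk.smooth.continuous hB
  rwa [show (fun q : HPt => (f q * k q.2 0).re) = 0 from funext fun q => by simp [h0]] at this

lemma traces_channel (h : Setup b g c L C₀ ε s ds dds A)
    (ddψ : VF₂) : Traces .channel (1 / ε ^ 2) s (blU ε g s ds + intU ε g s ds dψ)
      fun i p => blG ε g s ds dds i.castSucc 2 p + intG ε g s ds dds ddψ i.castSucc 2 p := by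
  obtain ⟨gS, -, gV, -⟩ := h.wind.cGood
  obtain ⟨pK, pdK, -, -, -, pQ, -⟩ := h.profs
  have hε := h.pos
  have Q1 := kerQ_one hε g
  have Q0 := kerQ_zero ε g
  have vert : (blU ε g s ds + intU ε g s ds dψ) 2 = fun p =>
      fld (cm (-1) (cV ds)) (fun y z => kerK ε g y z - lin1 (kerK ε g) y z) p +
      fld (cm I (cpx s)) (fun y z => dY (kerK ε g) y z - lin1 (dY (kerK ε g)) y z) p := by
    funext p
    simp [blU, intU, ekU, rotU, fld, cm]
    ring
  have m2 : AEStronglyMeasurable (fun p : Pt => fld (cm I (cpx s))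
      (fun y z => dY (kerK ε g) y z - lin1 (dY (kerK ε g)) y z) p - (0 : HPt → ℝ) (p.1, p.2.1))
      vΩ := by
    simp only [Pi.zero_apply, sub_zero]
    exact ((gS.cm _).memLp_fld pdK.add_sub_lin1).1
  have zero_add_fn : (fun q => (0 : HPt → ℝ) q + (0 : HPt → ℝ) q) = 0 := by funext q; simp
  refine ⟨fun i => ⟨?_, ?_⟩, ?_, ?_⟩
  · fin_cases i
    · have := gS.traceBottom (pQ.dsq ε) fun y => by simp [dsq, Q0]
      simpa [intG, rotG_two, ekG, blG] using this
    · have := (gS.cm (-I)).traceBottom (pQ.dsq ε) fun y => by simp [dsq, Q0]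
      simpa [intG, rotG_two, ekG, blG] using this
  · have nsq : ∀ w : ℂ, (w * (1 / (ε : ℂ) ^ 2)).re = 1 / ε ^ 2 * w.re := fun w => by
      rw [← Complex.re_ofReal_mul]
      congr 1
      push_cast
      ring
    fin_cases i
    · have := gS.traceTop (pQ.dsq ε) (s := fun q => 1 / ε ^ 2 * s 0 q) fun q => by
        unfold dsq
        rw [Q1, nsq]
        simp [cpx]
      simpa [intG, rotG_two, ekG, blG] using this
    · have := (gS.cm (-I)).traceTop (pQ.dsq ε) (s := fun q => 1 / ε ^ 2 * s 1 q) fun q => by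
        unfold dsq
        rw [Q1, nsq]
        simp [cpx, cm]
      simpa [intG, rotG_two, ekG, blG] using this
  · rw [vert]
    have := ((gV.cm (-1)).traceBottom pK.add_sub_lin1 fun y => by simp [lin1, kerK_zero]).add m2
      ((gS.cm I).traceBottom pdK.add_sub_lin1 fun y => by simp [lin1, dY_kerK_zero])
    rwa [zero_add_fn] at this
  · rw [vert]
    have := ((gV.cm (-1)).traceTop pK.add_sub_lin1 (s := 0) fun q => by simp [lin1]).add m2
      ((gS.cm I).traceTop pdK.add_sub_lin1 (s := 0) fun q => by simp [lin1])
    rwa [zero_add_fn] at this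

lemma latSupp_blU (hs : ∀ i, H2Supp r (s i) (ds i) (dds i)) :
    (∀ i, LatSupp3 r (blU ε g s ds i)) ∧ (∀ i k, LatSupp3 r (blG ε g s ds dds i k)) ∧
      (∀ i, LatSupp3 r (blH ε g s ds i)) ∧ (∀ i, LatSupp3 r (ekU ε g s ds i)) ∧
      ∀ i k, LatSupp3 r (ekG ε g s ds dds i k) := by
  have z0 : ∀ p : Pt, r < |p.2.1| → cpx s (p.1, p.2.1) = 0 := fun p hp => by
    simp [cpx, fun i => (hs i).supp (p.1, p.2.1) hp]
  have z1 : ∀ k, ∀ p : Pt, r < |p.2.1| → cS ds k (p.1, p.2.1) = 0 := fun k p hp => by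
    simp [cS, cpx, fun i => (hs i).supp_d k (p.1, p.2.1) hp]
  have z2 : ∀ p : Pt, r < |p.2.1| → cV ds (p.1, p.2.1) = 0 := fun p hp => by
    simp [cV, dvg, cpx, fun i k => (hs i).supp_d k (p.1, p.2.1) hp]
  have z3 : ∀ k, ∀ p : Pt, r < |p.2.1| → cV' dds k (p.1, p.2.1) = 0 := fun k p hp => by
    simp [cV', dvg, cpx, fun i k l => (hs i).supp_dd k l (p.1, p.2.1) hp]
  refine ⟨fun i p hp => ?_, fun i k p hp => ?_, fun i p hp => ?_, fun i p hp => ?_,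
    fun i k p hp => ?_⟩
  · fin_cases i <;> simp [blU, fld, cm, z0 p hp, z2 p hp]
  · fin_cases i <;> fin_cases k <;>
      simp [blG, fld, cm, z0 p hp, z1 _ p hp, z2 p hp, z3 _ p hp]
  · fin_cases i <;> simp [blH, fld, cm, z0 p hp, z2 p hp]
  · fin_cases i <;> simp [ekU, fld, cm, z0 p hp, z2 p hp]
  · fin_cases i <;> fin_cases k <;>
      simp [ekG, fld, cm, z0 p hp, z1 _ p hp, z2 p hp, z3 _ p hp]

lemma Sverdrup.latSupp (v : Sverdrup g₂ δ r t T C₁ ψ dψ ddψ P e)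
    (hs : ∀ i, H2Supp r (s i) (ds i) (dds i)) (ht : ∀ i, LatSupp r (t i)) :
    (∀ i, LatSupp3 r (intU ε g s ds dψ i)) ∧ (∀ i k, LatSupp3 r (intG ε g s ds dds ddψ i k)) ∧
      LatSupp3 r (presP ε P) ∧ ∀ k, LatSupp3 r (presG ε δ g₂ t dψ e k) := by
  obtain ⟨-, -, -, l1, l2⟩ := latSupp_blU (ε := ε) (g := g) hs
  have d := fun (k : Fin 2) (p : Pt) (hp : r < |p.2.1|) => v.supp.supp_d k (p.1, p.2.1) hp
  have dd := fun (k l : Fin 2) (p : Pt) (hp : r < |p.2.1|) => v.supp.supp_dd k l (p.1, p.2.1) hp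
  refine ⟨fun i p hp => ?_, fun i k p hp => ?_, fun p hp => ?_, fun k p hp => ?_⟩
  · unfold intU
    rw [l1 i p hp]
    fin_cases i <;> simp [rotU, _root_.lift, d _ p hp]
  · unfold intG
    rw [l2 i k p hp]
    fin_cases i <;> fin_cases k <;> simp [rotG, _root_.lift, dd _ _ p hp]
  · have := v.supp_p (p.1, p.2.1) hp
    simp [presP, _root_.lift, this]
  · have h1 := fun i => ht i (p.1, p.2.1) hp
    have h2 := v.supp_e (p.1, p.2.1) hp
    fin_cases k <;> simp [presG, _root_.lift, d _ p hp, h1, h2]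

end

/-! ### Estimates on the approximate solution -/

lemma ofReal_mul_eLpNorm_le {X : ℝ≥0∞} {x y a : ℝ} (hx : 0 ≤ x) (h : X ≤ ofReal y)
    (hxy : x * y ≤ a) : ofReal x * X ≤ ofReal a := by
  refine (mul_le_mul_right h _).trans ?_
  rw [← ofReal_mul hx]
  exact ofReal_le_ofReal hxy

lemma eLpNorm_add_le_ofReal {f g : Pt → ℝ} {μ : Measure Pt} (hf : MemLp f 2 μ) (hg : MemLp g 2 μ)
    {x y : ℝ} (hx : 0 ≤ x) (hy : 0 ≤ y) (h1 : eLpNorm f 2 μ ≤ ofReal x)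
    (h2 : eLpNorm g 2 μ ≤ ofReal y) :
    eLpNorm (fun p => f p + g p) 2 μ ≤ ofReal (x + y) := by
  rw [ofReal_add hx hy]
  exact (eLpNorm_add_le hf.1 hg.1 (by norm_num)).trans (add_le_add h1 h2)

lemma eLpNorm_slab_le_sqrt (D : HDom) {f : Pt → ℝ} {E : HPt → ℝ} {M ε y : ℝ}
    (h : ∀ q : HPt, ∀ z ∈ 𝕀, |f (q.1, q.2, z)| ≤ |E q|)
    (hE : eLpNorm E 2 D.hVol ≤ ofReal y) :
    eLpNorm f 2 (D.volSlab (Ioi (1 - M * ε))) ≤ ofReal (√(M * ε) * y) := by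
  rw [ofReal_mul (sqrt_nonneg _)]
  refine le_trans (eLpNorm_le_of_sq_le_mul (A := M * ε) ?_) (mul_le_mul_right hE _)
  refine (eLpNorm_volSlab_le D _ h).trans ?_
  gcongr
  calc volume (𝕀 ∩ Ioi (1 - M * ε)) ≤ volume (Ioo (1 - M * ε) 1) :=
        measure_mono fun z hz => ⟨hz.2, hz.1.2⟩
    _ = _ := by rw [Real.volume_Ioo]; congr 1; ring

section

variable {b g g₂ : ℝ → ℝ} {c L C₀ C₁ ε δ r : ℝ} {s t : VF₁}
  {ds : VF₂} {dds : VF₃} {A : ℝ} {T : ℝ}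
  {ψ : HPt → ℝ} {dψ : VF₁} {ddψ : VF₂} {P e : HPt → ℝ}

lemma eLpNorm_neg_one_mul (f : HPt → ℝ) :
    eLpNorm (fun q => (-1) * f q) 2 hΩ = eLpNorm f 2 hΩ := by
  have : (fun q => (-1) * f q) = -f := by funext q; simp
  rw [this, eLpNorm_neg]

/-- The velocity with stream function `ψ` is the lift of a horizontal field. -/
lemma rotU_eq_lift (v : Sverdrup g₂ δ r t (ofReal T) C₁ ψ dψ ddψ P e) (hC : 0 ≤ C₁)
    (i : Fin 3) : ∃ f : HPt → ℝ, rotU dψ i = lift f ∧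
      eLpNorm f 2 hΩ ≤ ofReal (C₁ * T) := by
  rw [ofReal_mul hC]
  fin_cases i
  · exact ⟨_, rfl, (eLpNorm_neg_one_mul _).trans_le (v.norm_d 1)⟩
  · exact ⟨_, rfl, v.norm_d 0⟩
  · exact ⟨0, rfl, by simp⟩

lemma Sverdrup.eLpNorm_rotG_le (v : Sverdrup g₂ δ r t (ofReal T) C₁ ψ dψ ddψ P e)
    (hC : 0 ≤ C₁) (hδ : 0 < δ) (i k : Fin 2) :
    eLpNorm (rotG ddψ i.castSucc k.castSucc) 2 vΩ ≤ ofReal (C₁ / δ * T) := by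
  rw [ofReal_mul (by positivity)]
  have neg : ∀ f : HPt → ℝ, eLpNorm f 2 hΩ ≤
      ofReal (C₁ / δ) * ofReal T →
      eLpNorm (lift fun q => (-1) * f q) 2 vΩ ≤
      ofReal (C₁ / δ) * ofReal T := fun f hf =>
    (eLpNorm_lift_le _ _).trans ((eLpNorm_neg_one_mul f).trans_le hf)
  fin_cases i <;> fin_cases k
  · exact neg _ (v.norm_dd 0 1)
  · exact neg _ (v.norm_dd 1 1)
  · exact (eLpNorm_lift_le _ _).trans (v.norm_dd 0 0)
  · exact (eLpNorm_lift_le _ _).trans (v.norm_dd 0 1)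

lemma Sverdrup.eLpNorm_resI_le (v : Sverdrup g₂ δ r t (ofReal T) C₁ ψ dψ ddψ P e)
    (hg : Smoothed b g₂ c L C₀ δ) (hb : Measurable b) (hs : ∀ i, HGood (s i))
    (ht : ∀ i, HGood (t i)) (hC : 0 ≤ C₁) (hL : 0 ≤ L) (hT : 0 ≤ T) (hε : 0 < ε) {μ : ℝ}
    (hμ : 0 ≤ μ) (hδ : δ ^ 2 ≤ μ * ε)
    (htail : ∀ i, eLpNorm (fun q => t i q - s i q) 2 hΩ ≤ ofReal (μ * ε))
    (i : Fin 2) : eLpNorm (resI ε δ b g₂ s t dψ e i) 2 hΩ ≤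
      ofReal (μ * (2 * L * (C₁ * T) + (1 + 2 * T))) := by
  have hm : Measurable fun y => g₂ y - b y := hg.contDiff.continuous.measurable.sub hb
  have a1 : ∀ k, eLpNorm (fun q => (g₂ q.2 - b q.2) * dψ k q) 2 hΩ ≤
      ofReal (μ * ε * (2 * L * (C₁ * T))) := fun k => by
    refine (eLpNorm_lat_mul_le (a := fun y => g₂ y - b y) hg.close).trans ?_
    refine ofReal_mul_eLpNorm_le (by positivity) ((v.norm_d k).trans_eq
      (ofReal_mul hC).symm) ?_
    calc 2 * L * δ ^ 2 * (C₁ * T) ≤ 2 * L * (μ * ε) * (C₁ * T) := by gcongr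
      _ = _ := by ring
  have a2 : eLpNorm (fun q => δ ^ 2 * e q) 2 hΩ ≤
      ofReal (μ * ε * (2 * T)) := by
    refine (eLpNorm_lat_mul_le (a := fun _ => δ ^ 2) fun y => le_of_eq (abs_of_nonneg (sq_nonneg δ))).trans ?_
    have ne : eLpNorm e 2 hΩ ≤ ofReal (2 * T) :=
      v.norm_e.trans_eq (by rw [ofReal_mul (by norm_num)]; simp)
    exact ofReal_mul_eLpNorm_le (sq_nonneg _) ne (by gcongr)
  have hgd : ∀ k, HGood fun q => (g₂ q.2 - b q.2) * dψ k q := fun k =>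
    (v.h2.good_d k).lat_mul hm hg.close
  have add_le : ∀ {f f' : HPt → ℝ} {x y : ℝ}, HGood f → HGood f' → 0 ≤ x → 0 ≤ y →
      eLpNorm f 2 hΩ ≤ ofReal x →
      eLpNorm f' 2 hΩ ≤ ofReal y →
      eLpNorm (fun q => f q + f' q) 2 hΩ ≤ ofReal (x + y) :=
    fun hf hf' hx hy h h' => by
      rw [ofReal_add hx hy]
      exact (eLpNorm_fun_add_le hf.meas.aestronglyMeasurable hf'.meas.aestronglyMeasurable).trans
        (add_le_add h h')
  have fin : ∀ {f : HPt → ℝ}, eLpNorm f 2 hΩ ≤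
      ofReal (μ * ε * (2 * L * (C₁ * T)) + (μ * ε + μ * ε * (2 * T))) →
      eLpNorm (fun q => 1 / ε * f q) 2 hΩ ≤
        ofReal (μ * (2 * L * (C₁ * T) + (1 + 2 * T))) := fun hf => by
    refine (eLpNorm_lat_mul_le (a := fun _ => 1 / ε) fun y =>
      le_of_eq (abs_of_nonneg (by positivity))).trans ?_
    refine ofReal_mul_eLpNorm_le (by positivity) hf (le_of_eq ?_)
    field_simp
  fin_cases i
  · exact fin (add_le (hgd 0) (((ht 0).sub (hs 0)).add (v.good_e.const_mul _)) (by positivity)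
      (by positivity) (a1 0) (add_le ((ht 0).sub (hs 0)) (v.good_e.const_mul _) (by positivity)
      (by positivity) (htail 0) a2))
  · refine fin ((add_le (hgd 1) ((ht 1).sub (hs 1)) (by positivity) (by positivity) (a1 1)
      (htail 1)).trans ?_)
    refine ofReal_le_ofReal ?_
    have : 0 ≤ μ * ε * (2 * T) := by positivity
    linarith

/-- The constant in front of the `L²` bounds of the velocities. -/
def velConst (c L C₁ K : ℝ) : ℝ := 34 * (kerB c L * c ^ 2) + C₁ * K

/-- The constant in front of the small errors. -/
def errConst (c L C₁ n T : ℝ) : ℝ :=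
  kerB c L * ((2 * L + 1) * c) * (34 * n) + (2 * L + 1) * c * (34 * n)
    + (2 * L * (C₁ * T) + (1 + 2 * T)) + kerB c L * c * (34 * n)
    + (2 * (kerB c L * c ^ 2) * (34 * n) + C₁ * T) + 8 * (kerB c L * c ^ 2) * (34 * n)

lemma fieldBounds_channel (h : Setup b g c L C₀ ε s ds dds A) (hb : Measurable b)
    (hg : Smoothed b g₂ c L C₀ δ) {K n W ν μ : ℝ}
    (v : Sverdrup g₂ δ r t (ofReal (K * n)) C₁ ψ dψ ddψ P e)
    (ht : ∀ i, HGood (t i)) (hC : 0 ≤ C₁) (hK : 0 ≤ K) (hn : 0 ≤ n)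
    (hN : normH2 .channel s ds dds = ofReal n) (hW0 : 0 ≤ W)
    (hW : eLpNorm (fun q => majG s ds q * |q.2| ^ (-(3 / 8) : ℝ)) 2 hΩ =
      ofReal W) (hδ0 : 0 < δ) (hμ : 0 ≤ μ) (hμ1 : μ ≤ 1)
    (h1 : √(c * ε) ≤ μ ^ 2) (h2 : δ ^ 2 ≤ μ * ε) (h3 : √ν ≤ μ * δ) (h4 : √ν ≤ μ * √ε)
    (htail : ∀ i, eLpNorm (fun q => t i q - s i q) 2 hΩ ≤ ofReal (μ * ε)) :
    FieldBounds .channel ε ν (μ * errConst c L C₁ n (K * n))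
      (kerB c L * c ^ 2 * (34 * n) + C₁ * (K * n))
      (fun M => kerB c L * c * (34 * n) * √(1 / M) + kerB c L * c ^ 2 * W * √(c / √M))
      (velConst c L C₁ K).toNNReal (normH1 .channel s ds) (normH2 .channel s ds dds)
      (blU ε g s ds) (intU ε g s ds dψ) (blG ε g s ds dds) (intG ε g s ds dds ddψ)
      (resR ε δ b g g₂ s ds t dψ e) := by
  have hε := h.pos
  have hε1 := h.eps_le_one
  have hc := h.two_le
  have hL := h.nonneg
  have hB := h.kerB_nonneg
  have hE : eLpNorm (majE s ds dds) 2 hΩ ≤ ofReal (34 * n) := by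
    refine h.wind.eLpNorm_majE_le.trans (le_of_eq ?_)
    rw [hN, ofReal_mul (by norm_num)]
    simp
  have hS := h.wind.cGood.1
  have hT : 0 ≤ K * n := by positivity
  have hcB : kerB c L * c ≤ kerB c L * c ^ 2 := by gcongr; nlinarith
  have sε : √ε ≤ μ := by
    refine (Real.sqrt_le_sqrt (by nlinarith : ε ≤ c * ε)).trans (h1.trans ?_)
    nlinarith
  have eεμ : ε ≤ μ := by
    have : ε = √ε * √ε := (Real.mul_self_sqrt hε.le).symm
    nlinarith [sqrt_nonneg ε]
  have ssμ : √(√(c * ε)) ≤ μ := Real.sqrt_le_iff.2 ⟨hμ, h1⟩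
  have sνμ : √ν ≤ μ := h4.trans (by nlinarith [sqrt_nonneg ε])
  have sqB : ∀ x y : ℝ, 0 ≤ x → √(x ^ 2 * y) = x * √y := fun x y hx => by
    rw [Real.sqrt_mul (sq_nonneg x), Real.sqrt_sq hx]
  have n0 : 0 ≤ 34 * n := by positivity
  have e1 : 0 ≤ kerB c L * ((2 * L + 1) * c) * (34 * n) := by positivity
  have e2 : 0 ≤ (2 * L + 1) * c * (34 * n) := by positivity
  have e3 : 0 ≤ 2 * L * (C₁ * (K * n)) + (1 + 2 * (K * n)) := by positivity
  have e4 : 0 ≤ kerB c L * c * (34 * n) := by positivity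
  have e5 : 0 ≤ 2 * (kerB c L * c ^ 2) * (34 * n) + C₁ * (K * n) := by positivity
  have e6 : 0 ≤ 8 * (kerB c L * c ^ 2) * (34 * n) := by positivity
  have hτ : ∀ x : ℝ, x ≤ errConst c L C₁ n (K * n) →
      ofReal (μ * x) ≤ ofReal (μ * errConst c L C₁ n (K * n)) := fun x hx =>
    ofReal_le_ofReal (mul_le_mul_of_nonneg_left hx hμ)
  have ekH : ∀ i : Fin 2, eLpNorm (ekU ε g s ds i.castSucc) 2 vΩ ≤
      ofReal (kerB c L * c ^ 2) * eLpNorm (majE s ds dds) 2 hΩ := fun i =>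
    h.eLpNorm_le_majE (by positivity) fun q z _ => (h.abs_ekU_h_le i q).trans
      (mul_le_mul hcB (maj1_le_majE ..) (maj1_nonneg q) (by positivity))
  have ek3 : eLpNorm (ekU ε g s ds 2) 2 vΩ ≤
      ofReal (kerB c L * c ^ 2) * eLpNorm (majE s ds dds) 2 hΩ :=
    h.eLpNorm_le_majE (by positivity) fun q z hz => (h.abs_ekU_two_le q hz).trans
      (mul_le_mul_of_nonneg_left (majG_le_majE ..) (by positivity))
  have ekAll : ∀ i : Fin 3, eLpNorm (ekU ε g s ds i) 2 vΩ ≤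
      ofReal (kerB c L * c ^ 2) * eLpNorm (majE s ds dds) 2 hΩ := fun i => by
    fin_cases i
    · exact ekH 0
    · exact ekH 1
    · exact ek3
  have ekSlab : ∀ M, ∀ i : Fin 3, eLpNorm (ekU ε g s ds i) 2
      (HDom.channel.volSlab (Ioi (1 - M * ε))) ≤
      ofReal (√(M * ε) * (kerB c L * c ^ 2 * (34 * n))) := fun M i => by
    refine eLpNorm_slab_le_sqrt _ (E := fun q => kerB c L * c ^ 2 * majE s ds dds q)
      (fun q z hz => ?_) ?_
    · rw [abs_of_nonneg (mul_nonneg (by positivity) (majE_nonneg q))]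
      fin_cases i
      · exact (h.abs_ekU_h_le 0 q).trans (mul_le_mul hcB (maj1_le_majE ..) (maj1_nonneg q)
          (by positivity))
      · exact (h.abs_ekU_h_le 1 q).trans (mul_le_mul hcB (maj1_le_majE ..) (maj1_nonneg q)
          (by positivity))
      · exact (h.abs_ekU_two_le q hz).trans
          (mul_le_mul_of_nonneg_left (majG_le_majE ..) (by positivity))
    · refine (eLpNorm_lat_mul_le (a := fun _ => kerB c L * c ^ 2) fun y =>
        le_of_eq (abs_of_nonneg (by positivity))).trans ?_
      exact ofReal_mul_eLpNorm_le (by positivity) hE le_rfl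
  refine ⟨fun i => ?_, ?_, fun i k => ?_, fun k => ?_, fun M hM i => ?_, fun M hM => ?_,
    fun M i => ?_, fun i => ?_, fun i => ?_, ?_, fun h0 => h.eLpNorm_blU_two_eq_zero h0⟩
  · have rM : ∀ {f : HPt → ℂ}, (∀ q, ‖f q‖ ≤ size0 s q) → eLpNorm (fld f (resM ε b g)) 2
        vΩ ≤ ofReal (μ * (kerB c L * ((2 * L + 1) * c) * (34 * n))) :=
      fun hf => by
        refine (h.eLpNorm_resM_le hf).trans (ofReal_mul_eLpNorm_le (sqrt_nonneg _) hE ?_)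
        rw [sqB _ _ (by positivity)]
        calc _ = kerB c L * ((2 * L + 1) * c) * (34 * n) * √ε := by ring
          _ ≤ kerB c L * ((2 * L + 1) * c) * (34 * n) * μ := by gcongr
          _ = _ := by ring
    have rK : ∀ {f : HPt → ℂ}, (∀ q, ‖f q‖ ≤ size0 s q) → eLpNorm (fld f (resK ε b g)) 2
        vΩ ≤ ofReal (μ * ((2 * L + 1) * c * (34 * n))) := fun hf => by
      refine (h.eLpNorm_resK_le hf).trans (ofReal_mul_eLpNorm_le (by positivity) hE ?_)
      calc _ = (2 * L + 1) * c * (34 * n) * ε := by ring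
        _ ≤ (2 * L + 1) * c * (34 * n) * μ := by gcongr
        _ = _ := by ring
    have rI := fun i => (eLpNorm_lift_le .channel _).trans (v.eLpNorm_resI_le hg hb h.wind.good ht hC
      hL hT hε hμ h2 htail i)
    have mI := fun i => (v.hGood_resI (ε := ε) hg hb h.wind.good ht i).memLp_lift
    have tot : ∀ {f : HPt → ℂ}, CGood f → (∀ q, ‖f q‖ ≤ size0 s q) → ∀ i,
        eLpNorm (fun p => (fld f (resM ε b g) p + fld f (resK ε b g) p)
          + lift (resI ε δ b g₂ s t dψ e i) p) 2 vΩ ≤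
        ofReal (μ * errConst c L C₁ n (K * n)) := fun hf hfs i => by
      obtain ⟨m1, m2⟩ := h.memLp_res hb hf hfs
      refine (eLpNorm_add_le_ofReal (m1.add m2) (mI i) (by positivity) (by positivity)
        (eLpNorm_add_le_ofReal m1 m2 (by positivity) (by positivity) (rM hfs) (rK hfs)) (rI i)).trans ?_
      rw [← mul_add, ← mul_add]
      refine hτ _ ?_
      unfold errConst
      linarith
    fin_cases i
    · exact tot hS (norm_cpx_le_size0 s) 0
    · exact tot (hS.cm _) (norm_cm_neg_I_le s) 1
  · refine (ofReal_mul_eLpNorm_le hε.le (h.eLpNorm_blH_two_le.trans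
      (ofReal_mul_eLpNorm_le (sqrt_nonneg _) hE le_rfl)) (a := μ * (kerB c L * c * (34 * n))) ?_).trans
      (hτ _ (by unfold errConst; linarith))
    rw [mul_div_assoc, sqB _ _ (by positivity), Real.sqrt_div (sqrt_nonneg _), Real.sqrt_sq hε.le]
    calc _ = kerB c L * c * (34 * n) * √(√(c * ε)) := by field_simp
      _ ≤ kerB c L * c * (34 * n) * μ := by gcongr
      _ = _ := by ring
  · have g1 : eLpNorm (blG ε g s ds dds i.castSucc k.castSucc) 2 vΩ ≤
        ofReal (kerB c L * c ^ 2 / √ε * (34 * n)) := by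
      refine (h.eLpNorm_blG_h_le i k).trans (ofReal_mul_eLpNorm_le (sqrt_nonneg _) hE ?_)
      rw [Real.sqrt_div (sq_nonneg _), Real.sqrt_sq (by positivity)]
    have g2 : eLpNorm (ekG ε g s ds dds i.castSucc k.castSucc) 2 vΩ ≤
        ofReal (kerB c L * c ^ 2 * (34 * n)) := by
      refine (h.eLpNorm_le_majE (B := kerB c L * c ^ 2) (by positivity) fun q z _ =>
        (h.abs_ekG_h_le i k q).trans (mul_le_mul_of_nonneg_left (majG_le_majE ..)
          (by positivity))).trans (ofReal_mul_eLpNorm_le (by positivity) hE le_rfl)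
    have g3 := v.eLpNorm_rotG_le hC hδ0 i k
    refine ofReal_mul_eLpNorm_le (y := kerB c L * c ^ 2 / √ε * (34 * n) +
      (kerB c L * c ^ 2 * (34 * n) + C₁ / δ * (K * n))) (sqrt_nonneg _)
      (eLpNorm_add_le_ofReal (h.memLp_bl.2 _ _) ((h.memLp_ek.2 _ _).add (v.memLp_rot.2 _ _))
        (by positivity) (by positivity) g1 (eLpNorm_add_le_ofReal (h.memLp_ek.2 _ _)
        (v.memLp_rot.2 _ _) (by positivity) (by positivity) g2 g3)) ?_
    have hs : 0 < √ε := Real.sqrt_pos.2 hε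
    calc _ = √ν * (kerB c L * c ^ 2 / √ε * (34 * n)) + (√ν * (kerB c L * c ^ 2 * (34 * n))
          + √ν * (C₁ / δ * (K * n))) := by ring
      _ ≤ μ * √ε * (kerB c L * c ^ 2 / √ε * (34 * n)) + (μ * (kerB c L * c ^ 2 * (34 * n))
          + μ * δ * (C₁ / δ * (K * n))) := by gcongr
      _ = μ * (2 * (kerB c L * c ^ 2) * (34 * n) + C₁ * (K * n)) := by field_simp; ring
      _ ≤ _ := mul_le_mul_of_nonneg_left (by unfold errConst; linarith) hμ
  · have g1 := (h.eLpNorm_blG_two_le k).trans (ofReal_mul_eLpNorm_le (by positivity) hE le_rfl)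
    have g2 := (h.eLpNorm_le_majE (f := ekG ε g s ds dds 2 k.castSucc)
      (B := kerB c L * (4 * c ^ 2 / ε)) (by positivity)
      fun q z hz => h.abs_ekG_two_le k q hz).trans
        (ofReal_mul_eLpNorm_le (by positivity) hE le_rfl)
    have e : (fun p => blG ε g s ds dds 2 k.castSucc p + intG ε g s ds dds ddψ 2 k.castSucc p) =
        fun p => blG ε g s ds dds 2 k.castSucc p + ekG ε g s ds dds 2 k.castSucc p := by
      funext p
      fin_cases k <;> simp [intG, rotG]
    rw [e]
    refine ofReal_mul_eLpNorm_le (by positivity)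
      (eLpNorm_add_le_ofReal (h.memLp_bl.2 _ _) (h.memLp_ek.2 _ _) (by positivity) (by positivity)
        g1 g2) ?_
    calc _ = √ν * (8 * (kerB c L * c ^ 2) * (34 * n)) := by field_simp; ring
      _ ≤ μ * (8 * (kerB c L * c ^ 2) * (34 * n)) := by gcongr
      _ ≤ _ := mul_le_mul_of_nonneg_left (by unfold errConst; linarith) hμ
  · refine (h.eLpNorm_blU_h_slab_le i hM).trans (ofReal_mul_eLpNorm_le (sqrt_nonneg _) hE ?_)
    have hs : 0 < √ε := Real.sqrt_pos.2 hε
    have : √((kerB c L * c) ^ 2 / (ε * M)) = kerB c L * c * √(1 / M) / √ε := by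
      rw [show (kerB c L * c) ^ 2 / (ε * M) = (kerB c L * c) ^ 2 * (1 / M) / ε by field_simp,
        Real.sqrt_div (by positivity), sqB _ _ (by positivity)]
    rw [this, add_div]
    have : 0 ≤ kerB c L * c ^ 2 * W * √(c / √M) / √ε := by positivity
    refine le_add_of_le_of_nonneg (le_of_eq ?_) this
    ring
  · refine (h.eLpNorm_blU_two_slab_le hM).trans (ofReal_mul_eLpNorm_le (sqrt_nonneg _) hW.le ?_)
    rw [mul_assoc, sqB _ _ (by positivity), Real.sqrt_mul hε.le]
    have : 0 ≤ kerB c L * c * (34 * n) * √(1 / M) * √ε := by positivity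
    rw [add_mul]
    refine le_add_of_nonneg_of_le this (le_of_eq ?_)
    ring
  · obtain ⟨f, hf, hfn⟩ := rotU_eq_lift v hC i
    have hrot : eLpNorm (rotU dψ i) 2 (HDom.channel.volSlab (Ioi (1 - M * ε))) ≤
        ofReal (√(M * ε) * (C₁ * (K * n))) := by
      rw [hf]
      exact eLpNorm_slab_le_sqrt _ (fun q z _ => le_rfl) hfn
    have sub : HDom.channel.volSlab (Ioi (1 - M * ε)) ≤ vΩ :=
      Measure.restrict_mono_set _ fun p hp => hp.1
    have := eLpNorm_add_le_ofReal ((h.memLp_ek.1 i).mono_measure sub)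
      ((v.memLp_rot.1 i).mono_measure sub) (by positivity) (by positivity) (ekSlab M i) hrot
    rw [← mul_add] at this
    exact this
  · obtain ⟨f, hf, hfn⟩ := rotU_eq_lift v hC i
    have hrot : eLpNorm (rotU dψ i) 2 vΩ ≤ ofReal (C₁ * (K * n)) := by
      rw [hf]
      exact (eLpNorm_lift_le _ _).trans hfn
    refine (eLpNorm_add_le_ofReal (h.memLp_ek.1 i) (v.memLp_rot.1 i) (by positivity) (by positivity)
      ((ekAll i).trans (ofReal_mul_eLpNorm_le (by positivity) hE le_rfl)) hrot).trans (le_of_eq ?_)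
    rw [hN, show ((velConst c L C₁ K).toNNReal : ℝ≥0∞) = ofReal (velConst c L C₁ K) from rfl,
      ← ofReal_mul (by unfold velConst; positivity)]
    congr 1
    unfold velConst
    ring
  · refine (h.eLpNorm_blU_h_le i).trans ?_
    refine (mul_le_mul_right h.wind.eLpNorm_maj1_le _).trans ?_
    rw [← mul_assoc, show (6 : ℝ≥0∞) = ofReal 6 by simp,
      ← ofReal_mul (sqrt_nonneg _), Real.sqrt_div (sq_nonneg _),
      Real.sqrt_sq (by positivity), Real.coe_toNNReal _ (by unfold velConst; positivity)]
    gcongr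
    rw [div_mul_eq_mul_div]
    gcongr
    unfold velConst
    have : 0 ≤ C₁ * K := by positivity
    have : 0 ≤ kerB c L * c ^ 2 := by positivity
    linarith
  · refine h.eLpNorm_blU_two_le.trans (ofReal_mul_eLpNorm_le (sqrt_nonneg _) hE
      (a := μ * (kerB c L * c ^ 2 * (34 * n))) ?_) |>.trans (hτ _ ?_)
    · rw [sqB _ _ (by positivity)]
      calc _ = kerB c L * c ^ 2 * (34 * n) * √(√(c * ε)) := by ring
        _ ≤ kerB c L * c ^ 2 * (34 * n) * μ := by gcongr
        _ = _ := by ring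
    · unfold errConst
      have : 0 ≤ kerB c L * c ^ 2 * (34 * n) := by positivity
      linarith

end

/-! ### The approximate solution on the channel -/

lemma exists_cutoff {r R : ℝ} (hr : 0 < r) (hR : r < R) : ∃ a : ℝ → ℝ, ContDiff ℝ ∞ a ∧
    (∀ y, |a y| ≤ 1) ∧ (∀ y, |1 - a y| ≤ 1) ∧ (∀ y, |y| ≤ r → a y = 1) ∧ (∀ y, R < |y| → a y = 0) ∧
    ∃ A, (∀ y, |deriv a y| ≤ A) ∧ ∀ y, |deriv (deriv a) y| ≤ A := by
  let a : ContDiffBump (0 : ℝ) := ⟨r, R, hr, hR⟩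
  have c0 : ContDiff ℝ ∞ a := a.contDiff
  have c1 := (contDiff_infty_iff_deriv.1 c0).2
  have c2 := (contDiff_infty_iff_deriv.1 c1).2
  obtain ⟨A, hA⟩ := c1.continuous.bounded_above_of_compact_support a.hasCompactSupport.deriv
  obtain ⟨B, hB⟩ := c2.continuous.bounded_above_of_compact_support a.hasCompactSupport.deriv.deriv
  refine ⟨a, c0, fun y => abs_le.2 ⟨by linarith [a.nonneg (x := y)], a.le_one⟩,
    fun y => abs_le.2 ⟨by linarith [a.le_one (x := y)], by linarith [a.nonneg (x := y)]⟩,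
    fun y hy => a.one_of_mem_closedBall (by simpa using hy),
    fun y hy => a.zero_of_le_dist (by simpa using hy.le), max A B,
    fun y => (hA y).trans (le_max_left _ _), fun y => (hB y).trans (le_max_right _ _)⟩

/-- Approximation of the wind stress by a compactly supported one. -/
structure Truncation (s : VF₁) (r T η : ℝ) (t : VF₁) (dt : VF₂)
    (ddt : VF₃) : Prop where
  h2 : ∀ i, H2Fun (t i) (dt i) (ddt i)
  supp : ∀ i, H2Supp r (t i) (dt i) (ddt i)
  mean : ∀ᵐ y, ∫ x in 𝕀, t 0 (x, y) = 0
  n0 : ∀ i, eLpNorm (t i) 2 hΩ ≤ ofReal T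
  n1 : ∀ i k, eLpNorm (dt i k) 2 hΩ ≤ ofReal T
  n2 : ∀ i k l, eLpNorm (ddt i k l) 2 hΩ ≤ ofReal T
  tail : ∀ i, eLpNorm (fun q => t i q - s i q) 2 hΩ ≤ ofReal η

lemma HGood.exists_tail {f : HPt → ℝ} (hf : HGood f) {η : ℝ} (hη : 0 < η) :
    ∃ R₀ : ℝ, ∀ a : ℝ → ℝ, (∀ y, |1 - a y| ≤ 1) → (∀ y, |y| ≤ R₀ → a y = 1) →
      eLpNorm (fun q => a q.2 * f q - f q) 2 hΩ ≤ ofReal η := by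
  have : IsLocallyFiniteMeasure hΩ := by unfold HDom.hVol; infer_instance
  obtain ⟨g, hg, hfg, -, -⟩ := hf.memLp.exists_hasCompactSupport_eLpNorm_sub_le
    (ENNReal.ofNat_ne_top) (ENNReal.ofReal_pos.2 hη).ne'
  obtain ⟨R, hR⟩ := hg.isCompact.isBounded.subset_closedBall 0
  refine ⟨R, fun a ha ha1 => (eLpNorm_mono fun q => ?_).trans hfg⟩
  by_cases hq : |q.2| ≤ R
  · simp [ha1 _ hq]
  · have : g q = 0 := by
      by_contra hne
      have := hR (subset_tsupport g hne)
      rw [mem_closedBall_zero_iff] at this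
      exact hq ((norm_snd_le q).trans this)
    rw [Pi.sub_apply, this, sub_zero, show a q.2 * f q - f q = -((1 - a q.2) * f q) by ring, norm_neg,
      norm_mul]
    exact mul_le_of_le_one_left (norm_nonneg _) (ha _)

lemma WindData.h2Fun {s : VF₁} {ds : VF₂}
    {dds : VF₃} {A : ℝ} (h : WindData s ds dds A) (i : Fin 2) :
    H2Fun (s i) (ds i) (dds i) :=
  ⟨h.good i, h.good_d i, h.good_dd i, h.weak i, h.weak_d i⟩

lemma exists_trunc : ∃ K : ℝ, 1 ≤ K ∧ ∀ (s : VF₁) (ds : VF₂)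
    (dds : VF₃) (A n : ℝ), WindData s ds dds A → 0 ≤ n →
    normH2 .channel s ds dds = ofReal n →
    ∀ η > 0, ∃ r t dt ddt, Truncation s r (K * n) η t dt ddt := by
  obtain ⟨θ, cθ, θ0, θ1, θi, θo, B, hB1, hB2⟩ := exists_cutoff one_pos one_lt_two
  have B0 : 0 ≤ B := (abs_nonneg _).trans (hB1 0)
  refine ⟨1 + (2 * B + B), by linarith, fun s ds dds A n w hn0 hn η hη => ?_⟩
  choose R₀ hR₀ using fun i : Fin 2 => (w.good i).exists_tail (η := η) hη
  set R : ℝ := max 1 (max (R₀ 0) (R₀ 1))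
  have hR : 1 ≤ R := le_max_left _ _
  have hRp : 0 < R := one_pos.trans_le hR
  have hRi : |R⁻¹| ≤ 1 := by rw [abs_of_pos (inv_pos.2 hRp)]; exact inv_le_one_of_one_le₀ hR
  set a : ℝ → ℝ := fun y => θ (R⁻¹ * y) with ha
  have ca : ContDiff ℝ ∞ a := cθ.comp (contDiff_const.mul contDiff_id)
  have e1 : deriv a = fun y => R⁻¹ * deriv θ (R⁻¹ * y) := by
    funext y
    simpa using deriv_comp_mul_left R⁻¹ θ y
  have e2 : deriv (deriv a) = fun y => R⁻¹ * (R⁻¹ * deriv (deriv θ) (R⁻¹ * y)) := by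
    rw [e1]
    funext y
    rw [deriv_const_mul_field]
    congr 1
    simpa using deriv_comp_mul_left R⁻¹ (deriv θ) y
  have a0 : ∀ y, |a y| ≤ 1 := fun y => θ0 _
  have a1 : ∀ y, |deriv a y| ≤ B := fun y => by
    rw [e1, abs_mul]
    exact (mul_le_of_le_one_left (abs_nonneg _) hRi).trans (hB1 _)
  have a2 : ∀ y, |deriv (deriv a) y| ≤ B := fun y => by
    rw [e2, abs_mul, abs_mul]
    exact (mul_le_of_le_one_left (by positivity) hRi).trans
      ((mul_le_of_le_one_left (abs_nonneg _) hRi).trans (hB2 _))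
  have ain : ∀ y, |y| ≤ R → a y = 1 := fun y hy => θi _ <| by
    rw [abs_mul, abs_of_pos (inv_pos.2 hRp), inv_mul_le_iff₀ hRp]
    linarith
  have aout : ∀ y, 2 * R < |y| → a y = 0 := fun y hy => θo _ <| by
    rw [abs_mul, abs_of_pos (inv_pos.2 hRp), lt_inv_mul_iff₀ hRp]
    linarith
  have n1 := hn ▸ normH1_le_normH2 .channel s ds dds
  have N := fun i => (w.h2Fun i).eLpNorm_mul_lat_le ca a0 a1 a2 (T := ofReal n)
    (T' := ofReal n) ((le_normH1 _ s ds i 0).1.trans n1)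
    (fun k => (le_normH1 _ s ds i k).2.trans n1) (fun k l => hn ▸ le_normH2 _ s ds dds i k l)
  refine ⟨2 * R, fun i q => a q.2 * s i q, fun i => mulD a (s i) (ds i),
    fun i => mulDD a (s i) (ds i) (dds i), fun i => (w.h2Fun i).mul_lat ca a0 a1 a2,
    fun i => h2Supp_mul_lat _ _ _ aout, ?_, fun i => (N i).1.trans ?_, fun i k => ((N i).2.1 k).trans ?_,
    fun i k l => ((N i).2.2 k l).trans ?_, fun i => hR₀ i a (fun y => θ1 _) fun y hy => ain y (hy.trans ?_)⟩
  · filter_upwards [w.mean] with y hy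
    rw [integral_const_mul, hy, mul_zero]
  · exact ofReal_mul_eLpNorm_le zero_le_one le_rfl (by nlinarith)
  · exact ofReal_mul_eLpNorm_le (by positivity) le_rfl (by nlinarith)
  · rw [← add_mul, ← ofReal_add (by positivity) (by positivity)]
    exact ofReal_mul_eLpNorm_le (by positivity) le_rfl le_rfl
  · fin_cases i
    · exact (le_max_left _ _).trans (le_max_right _ _)
    · exact (le_max_right _ _).trans (le_max_right _ _)

/-- The constant of the final estimates on the channel. -/
def mainConst (c L K : ℝ) : ℝ≥0 :=
  (velConst c L (sverdrupConst c L (∫ t, |deriv bumpFn t|)) K).toNNReal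

lemma CoreB.sverdrupConst_nonneg {b : ℝ → ℝ} {c L : ℝ} (hb : CoreB b c L) {C₀ : ℝ} (hC₀ : 0 ≤ C₀) :
    0 ≤ sverdrupConst c L C₀ := by
  have := hb.two_le
  have := hb.nonneg
  unfold sverdrupConst
  positivity

lemma CoreB.mainConst_pos {b : ℝ → ℝ} {c L K : ℝ} (hb : CoreB b c L) (hK : 0 ≤ K) :
    0 < mainConst c L K := by
  have h1 := hb.sverdrupConst_nonneg (C₀ := ∫ t, |deriv bumpFn t|) (by positivity)
  have := hb.two_le
  have := hb.nonneg
  refine Real.toNNReal_pos.2 ?_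
  unfold velConst kerB
  positivity

lemma eventually_fields {b : ℝ → ℝ} {c L K A n : ℝ} (hb : CoreB b c L) {s : VF₁}
    {ds : VF₂} {dds : VF₃} (w : WindData s ds dds A)
    (hn : 0 ≤ n) (hN : normH2 .channel s ds dds = ofReal n) (hK : 0 ≤ K) {ν : ℝ → ℝ}
    (hν : ∀ ε : ℝ, 0 < ε → 0 < ν ε) (ho : ν =o[𝓝[>] 0] fun ε : ℝ => ε) {S : ℝ → Prop}
    (htr : ∀ η > 0, ∃ r t dt ddt, S r ∧ Truncation s r (K * n) η t dt ddt) :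
    ∃ (τ κ : ℝ → ℝ) (K' : ℝ), Tendsto τ (𝓝[>] 0) (𝓝 0) ∧ Tendsto κ atTop (𝓝 0) ∧
      ∀ᶠ ε in 𝓝[>] 0, ∃ (uBL uint : UF₁) (p : Pt → ℝ)
        (gBL gint : UF₂) (gp h r : UF₁),
        StatFields .channel ε b uBL uint p gBL gint gp h r ∧
        Traces .channel (1 / ε ^ 2) s (uBL + uint) (fun i q => gBL i.castSucc 2 q + gint i.castSucc 2 q) ∧
        FieldBounds .channel ε (ν ε) (τ ε) K' κ (mainConst c L K) (normH1 .channel s ds)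
          (normH2 .channel s ds dds) uBL uint gBL gint r ∧
        ∃ R δ, S R ∧ 0 < δ ∧ δ ≤ √ε ∧ ((∀ i, H2Supp (R + δ) (s i) (ds i) (dds i)) →
          (∀ i, LatSupp3 (R + δ) (uBL i)) ∧ (∀ i, LatSupp3 (R + δ) (uint i)) ∧ LatSupp3 (R + δ) p ∧
          (∀ i k, LatSupp3 (R + δ) (gBL i k)) ∧ (∀ i k, LatSupp3 (R + δ) (gint i k)) ∧
          (∀ k, LatSupp3 (R + δ) (gp k)) ∧ ∀ i, LatSupp3 (R + δ) (h i)) := by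
  have hc := hb.two_le
  have hbm := hb.diff.continuous.measurable
  set C₀ := ∫ t, |deriv bumpFn t|
  have hC₀ : 0 ≤ C₀ := integral_nonneg fun _ => abs_nonneg _
  set C₁ := sverdrupConst c L C₀
  have hC₁ : 0 ≤ C₁ := hb.sverdrupConst_nonneg hC₀
  set x : ℝ → ℝ := fun ε => √√(ν ε / ε) with hx
  set μ : ℝ → ℝ := fun ε => √√(c * ε) + x ε with hμ
  set W := (eLpNorm (fun q => majG s ds q * |q.2| ^ (-(3 / 8) : ℝ)) 2 hΩ).toReal with hW
  have s0 : ∀ {l : Filter ℝ} {f : ℝ → ℝ}, Tendsto f l (𝓝 0) → Tendsto (fun ε => √(f ε)) l (𝓝 0) :=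
    fun h => by simpa using h.sqrt
  have id0 : Tendsto (fun ε : ℝ => ε) (𝓝[>] 0) (𝓝 0) := tendsto_nhdsWithin_of_tendsto_nhds tendsto_id
  have x0 : Tendsto x (𝓝[>] 0) (𝓝 0) := s0 (s0 ho.tendsto_div_nhds_zero)
  have μ0 : Tendsto μ (𝓝[>] 0) (𝓝 0) := by
    have : Tendsto (fun ε => √√(c * ε)) (𝓝[>] 0) (𝓝 0) := s0 (s0 (by simpa using id0.const_mul c))
    simpa using this.add x0
  have inv0 : ∀ C : ℝ, Tendsto (fun M => √(C / M)) atTop (𝓝 0) := fun C =>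
    s0 (tendsto_const_nhds.div_atTop tendsto_id)
  have inv1 : Tendsto (fun M => √(c / √M)) atTop (𝓝 0) :=
    s0 (tendsto_const_nhds.div_atTop Real.tendsto_sqrt_atTop)
  refine ⟨fun ε => μ ε * errConst c L C₁ n (K * n), fun M => kerB c L * c * (34 * n) * √(1 / M) +
    kerB c L * c ^ 2 * W * √(c / √M), kerB c L * c ^ 2 * (34 * n) + C₁ * (K * n), ?_, ?_, ?_⟩
  · simpa using μ0.mul_const (errConst c L C₁ n (K * n))
  · simpa using ((inv0 1).const_mul (kerB c L * c * (34 * n))).add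
      (inv1.const_mul (kerB c L * c ^ 2 * W))
  · filter_upwards [self_mem_nhdsWithin, id0.eventually (ge_mem_nhds (show (0:ℝ) < 1 / (4 * c) by positivity)),
      μ0.eventually (ge_mem_nhds one_pos)] with ε hε hε4 hμ1
    have hε : 0 < ε := hε
    have hνε : 0 < ν ε / ε := div_pos (hν ε hε) hε
    have xp : 0 < x ε := Real.sqrt_pos.2 (Real.sqrt_pos.2 hνε)
    have sp : 0 < √ε := Real.sqrt_pos.2 hε
    have s1 : √ε ≤ 1 := Real.sqrt_le_one.2 (hε4.trans (by rw [div_le_one (by positivity)]; linarith))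
    have xμ : x ε ≤ μ ε := le_add_of_nonneg_left (sqrt_nonneg _)
    have x1 : x ε ≤ 1 := xμ.trans hμ1
    have μp : 0 < μ ε := xp.trans_le xμ
    have x2 : x ε ^ 2 ≤ μ ε := (pow_le_of_le_one xp.le x1 two_ne_zero).trans xμ
    have hνx : √(ν ε) = √ε * x ε ^ 2 := by
      rw [hx]
      simp only
      rw [Real.sq_sqrt (sqrt_nonneg _), ← Real.sqrt_mul hε.le, mul_div_cancel₀ _ hε.ne']
    have δp : 0 < √ε * x ε := mul_pos sp xp
    have δs : √ε * x ε ≤ √ε := mul_le_of_le_one_right sp.le x1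
    obtain ⟨g, hg⟩ := hb.exists_smoothed hε
    obtain ⟨g₂, hg₂⟩ := hb.exists_smoothed δp
    obtain ⟨r, t, dt, ddt, hS, ht⟩ := htr (μ ε * ε) (mul_pos μp hε)
    have hset : Setup b g c L C₀ ε s ds dds A := ⟨w, hg, hc, hb.nonneg, hε, hε4⟩
    obtain ⟨ψ, dψ, ddψ, P, e, v⟩ := exists_sverdrup hg₂ hc hC₀ δp (δs.trans s1) ht.h2 ht.supp ht.mean
      ht.n0 ht.n1 ht.n2
    have tg := fun i => (ht.h2 i).good
    have st := statFields_channel hset hbm hg₂ v tg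
    refine ⟨_, _, _, _, _, _, _, _, st, traces_channel hset ddψ,
      fieldBounds_channel hset hbm hg₂ v tg hC₁ hK hn hN ENNReal.toReal_nonneg
        (ENNReal.ofReal_toReal w.memLp_majG_weight.eLpNorm_ne_top).symm δp μp.le hμ1 ?_ ?_ ?_ ?_ ht.tail,
      r, _, hS, δp, δs, fun hs => ?_⟩
    · calc √(c * ε) = √√(c * ε) ^ 2 := (Real.sq_sqrt (sqrt_nonneg _)).symm
        _ ≤ μ ε ^ 2 := by
          gcongr
          exact le_add_of_nonneg_right xp.le
    · rw [mul_pow, Real.sq_sqrt hε.le, mul_comm]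
      exact mul_le_mul_of_nonneg_right x2 hε.le
    · rw [hνx]
      nlinarith [mul_nonneg δp.le (sub_nonneg.2 xμ)]
    · rw [hνx, mul_comm]
      exact mul_le_mul_of_nonneg_right x2 sp.le
    · obtain ⟨l1, l2, l3, -, -⟩ := latSupp_blU (ε := ε) (g := g) hs
      obtain ⟨m1, m2, m3, m4⟩ := v.latSupp (ε := ε) (g := g) hs
        fun i => (ht.supp i).supp.mono (by linarith)
      exact ⟨l1, m1, m3, l2, m2, m4, l3⟩

/-! ### Passage from the torus to the channel -/

/-- Periodisation in latitude of a function supported in `|y| < 1 / 2`. -/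
def perLat (G : HPt → ℝ) (q : HPt) : ℝ := G (q.1, Int.fract (q.2 + 1 / 2) - 1 / 2)

lemma perLat_eq (G : HPt → ℝ) {q : HPt} (hq : q ∈ HDom.torus.hBox) : perLat G q = G q := by
  have h : -(1 / 2) < q.2 ∧ q.2 < 1 / 2 := hq.2
  unfold perLat
  rw [Int.fract_eq_self.2 ⟨by linarith, by linarith⟩, add_sub_cancel_right]

lemma pd_perLat_eq (G : HPt → ℝ) (v : HPt) {q : HPt} (hq : q ∈ HDom.torus.hBox) :
    pd v (perLat G) q = pd v G q := by
  unfold pd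
  rw [Filter.EventuallyEq.fderiv_eq]
  filter_upwards [(isOpen_hBox .torus).mem_nhds hq] with r hr using perLat_eq G hr

lemma IsHTest.perLat {G : HPt → ℝ} (hG : IsHTest .channel G) {a : ℝ} (ha : a < 1 / 2)
    (h0 : LatSupp a G) : IsHTest .torus (perLat G) := by
  refine ⟨?_, fun x y => hG.periodic_x _ _, fun x y => ?_⟩
  · have := contDiff_comp_fract (φ := fun r : HPt => G (r.2, r.1 - 1 / 2)) (κ := 1 / 2 - a)
      (hG.smooth.comp (by fun_prop)) (by linarith) fun x y hx => h0 _ ?_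
    · exact this.comp (by fun_prop : ContDiff ℝ ∞ fun q : HPt => ((q.2 + 1 / 2, q.1) : HPt))
    · rcases hx with hx | hx
      · exact lt_abs.2 (Or.inr (by simp only; linarith))
      · exact lt_abs.2 (Or.inl (by simp only; linarith))
  · unfold _root_.perLat
    rw [show y + 1 + 1 / 2 = y + 1 / 2 + 1 by ring, Int.fract_add_one]

lemma pd_eq_zero_of_abs_lt {G : HPt → ℝ} {a : ℝ} (h : ∀ q : HPt, |q.2| < a → G q = 0) (v : HPt)
    {q : HPt} (hq : |q.2| < a) : pd v G q = 0 := by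
  have : G =ᶠ[𝓝 q] fun _ => 0 := by
    filter_upwards [(isOpen_lt (by fun_prop) continuous_const : IsOpen {r : HPt | |r.2| < a}).mem_nhds
      hq] with r hr using h r hr
  unfold pd
  rw [this.fderiv_eq]
  simp

/-- A weak derivative vanishes where the function does. -/
lemma IsHWeakDeriv.ae_eq_zero {k : Fin 2} {f g : HPt → ℝ} {a : ℝ}
    (hg : MemLp g 2 HDom.torus.hVol) (h : IsHWeakDeriv .torus k f g)
    (hf : ∀ᵐ q ∂HDom.torus.hVol, a < |q.2| → f q = 0) :
    ∀ᵐ q ∂HDom.torus.hVol, a < |q.2| → g q = 0 := by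
  have hmeas : MeasurableSet {q : HPt | a < |q.2|} := measurableSet_lt (by fun_prop) (by fun_prop)
  set U : Set HPt := {q | a < |q.2|} ∩ HDom.torus.hBox with hUdef
  have hU : IsOpen U := (isOpen_lt continuous_const (by fun_prop)).inter (isOpen_hBox _)
  have hUr : volume.restrict U = HDom.torus.hVol.restrict {q : HPt | a < |q.2|} :=
    (Measure.restrict_restrict hmeas).symm
  refine (ae_restrict_iff' hmeas).1 ?_
  rw [← hUr]
  refine ae_eq_zero_of_forall_integral_comp_fract hU (fun q hq => ⟨hq.2.1, trivial⟩)
    (hUr ▸ hg.restrict _) fun φ hc hs ht => ?_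
  obtain ⟨κ, hκ, hm⟩ := (hc.isCompact.image (by fun_prop : Continuous fun q : HPt => |q.2|)).exists_margin
    (u := a) (v := 1 / 2) (by
      rintro _ ⟨q, hq, rfl⟩
      exact ⟨(hs hq).1, abs_lt.2 (hs hq).2.2⟩)
  have hm' : ∀ q : HPt, φ (Int.fract q.1, q.2) ≠ 0 → a + κ < |q.2| ∧ |q.2| < 1 / 2 - κ :=
    fun q hq => hm _ ⟨_, subset_tsupport _ hq, rfl⟩
  set ψ : HPt → ℝ := fun q => φ (Int.fract q.1, q.2)
  have key := h _ (ht.perLat (a := 1 / 2 - κ) (by linarith) fun q hq => by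
    by_contra hne
    exact absurd (hm' q hne).2 (not_lt.2 hq.le))
  have e1 : ∫ q, f q * pd (hDir k) (perLat ψ) q ∂HDom.torus.hVol = 0 := by
    refine integral_eq_zero_of_ae ?_
    filter_upwards [hf, ae_restrict_mem (measurableSet_hBox _)] with q hq hb
    rw [pd_perLat_eq _ _ hb, Pi.zero_apply]
    rcases lt_or_ge a |q.2| with h1 | h1
    · rw [hq h1, zero_mul]
    · rw [pd_eq_zero_of_abs_lt (a := a + κ) (fun r hr => ?_) _ (by linarith), mul_zero]
      by_contra hne
      exact absurd (hm' r hne).1 (not_lt.2 hr.le)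
  have e2 : ∫ q, g q * perLat ψ q ∂HDom.torus.hVol = ∫ q in HDom.torus.hBox, g q * ψ q :=
    setIntegral_congr_fun (measurableSet_hBox _) fun q hq => by simp only [perLat_eq ψ hq]
  rw [e1, e2] at key
  rw [setIntegral_eq_of_subset_of_forall_sdiff_eq_zero (measurableSet_hBox .torus)
    (Set.inter_subset_right : U ⊆ _) fun q hq => ?_] at key
  · linarith
  · by_contra hne
    have := (hm' q (right_ne_zero_of_mul hne)).1
    exact hq.2 ⟨show a < |q.2| by linarith, hq.1⟩

lemma LatSupp.integral_torus {f : HPt → ℝ} {a : ℝ} (ha : a < 1 / 2) (hf : LatSupp a f) :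
    ∫ q, f q ∂hΩ = ∫ q, f q ∂HDom.torus.hVol := by
  refine setIntegral_eq_of_subset_of_forall_sdiff_eq_zero (measurableSet_hBox _)
    (fun q hq => ⟨hq.1, trivial⟩) fun q hq => hf q ?_
  by_contra! h
  have h2 := abs_le.1 h
  exact hq.2 ⟨hq.1.1, ⟨by linarith [h2.1], by linarith [h2.2]⟩⟩

lemma IsHWeakDeriv.to_channel {k : Fin 2} {f g : HPt → ℝ} {a : ℝ} (ha : a < 1 / 2)
    (hf : LatSupp a f) (hg : LatSupp a g) (h : IsHWeakDeriv .torus k f g) :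
    IsHWeakDeriv .channel k f g := by
  intro φ hφ
  obtain ⟨r₁, h1, h1'⟩ := exists_between (max_lt ha (by norm_num) : max a 0 < 1 / 2)
  obtain ⟨r₂, h2, h2'⟩ := exists_between h1'
  obtain ⟨η, cη, -, -, ηi, ηo, -⟩ := exists_cutoff ((le_max_right _ _).trans_lt h1) h2
  have near : ∀ q : HPt, |q.2| ≤ a → ∀ᶠ r in 𝓝 q, η r.2 * φ r = φ r := fun q hq => by
    filter_upwards [(isOpen_lt (by fun_prop) continuous_const : IsOpen {r : HPt | |r.2| < r₁}).mem_nhds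
      ((hq.trans (le_max_left _ _)).trans_lt h1)] with r hr
    rw [ηi _ (le_of_lt hr), one_mul]
  have key := h _ ((hφ.mul_lat cη).perLat h2' fun q hq => by simp [ηo _ hq])
  rw [LatSupp.integral_torus ha fun q hq => by rw [hf q hq, zero_mul],
    LatSupp.integral_torus ha fun q hq => by rw [hg q hq, zero_mul]]
  refine Eq.trans (setIntegral_congr_fun (measurableSet_hBox _) fun q hq => ?_) (key.trans
    (congrArg Neg.neg (setIntegral_congr_fun (measurableSet_hBox _) fun q hq => ?_)))
  · simp only [pd_perLat_eq _ _ hq]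
    rcases le_or_gt |q.2| a with h3 | h3
    · unfold pd
      rw [Filter.EventuallyEq.fderiv_eq (near q h3)]
    · rw [hf q h3, zero_mul, zero_mul]
  · simp only [perLat_eq _ hq]
    rcases le_or_gt |q.2| a with h3 | h3
    · rw [(near q h3).self_of_nhds]
    · rw [hg q h3, zero_mul, zero_mul]

/-! ### Regular representatives of the wind stress -/

lemma measurableSet_yRange (D : HDom) : MeasurableSet D.yRange := by
  cases D
  · exact MeasurableSet.univ
  · exact measurableSet_Ioo

lemma exists_hGood_rep {D : HDom} {f : HPt → ℝ} (hf : MemLp f 2 D.hVol) {Y : Set ℝ}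
    (hY : MeasurableSet Y) (hYD : Y ⊆ D.yRange) (hz : ∀ᵐ q ∂D.hVol, q.2 ∉ Y → f q = 0)
    {M : Set (ℝ × ℝ)} (hM : MeasurableSet M) (h0 : ∀ y, (y, (0 : ℝ)) ∈ M)
    (h : ∀ᵐ q ∂D.hVol, (q.2, f q) ∈ M) :
    ∃ F, HGood F ∧ (∀ᵐ q ∂D.hVol, F q = f q) ∧ (∀ q : HPt, (q.2, F q) ∈ M) ∧
      (∀ q : HPt, q.2 ∉ Y → F q = 0) ∧ eLpNorm F 2 hΩ = eLpNorm f 2 D.hVol := by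
  set G : HPt → ℝ := fun q => hf.1.mk f (Int.fract q.1, q.2) with hG
  have mG : Measurable G := hf.1.stronglyMeasurable_mk.measurable.comp (by fun_prop)
  set S : Set HPt := {q | q.2 ∈ Y ∧ (q.2, G q) ∈ M} with hS
  have mS : MeasurableSet S :=
    (measurable_snd hY).inter ((measurable_snd.prodMk mG) hM)
  have mF : Measurable (S.indicator G) := mG.indicator mS
  have ae : ∀ᵐ q ∂D.hVol, S.indicator G q = f q := by
    filter_upwards [hf.1.ae_eq_mk, hz, h, ae_restrict_mem (measurableSet_hBox _)] with q h1 h2 h3 hb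
    have hGq : G q = f q := by
      rw [hG, h1]
      simp only [Int.fract_eq_self.2 ⟨hb.1.1.le, hb.1.2⟩]
    by_cases hq : q.2 ∈ Y
    · rw [indicator_of_mem (show q ∈ S from ⟨hq, by rwa [hGq]⟩), hGq]
    · rw [indicator_of_notMem fun hm => hq hm.1, h2 hq]
  have z : ∀ q : HPt, q.2 ∉ Y → S.indicator G q = 0 := fun q hq =>
    indicator_of_notMem (fun hm => hq hm.1) _
  have norm : eLpNorm (S.indicator G) 2 hΩ = eLpNorm f 2 D.hVol := by
    rw [← eLpNorm_congr_ae ae]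
    have e : D.hVol = HDom.channel.hVol.restrict {q : HPt | q.2 ∈ D.yRange} := by
      unfold HDom.hVol
      rw [Measure.restrict_restrict (show MeasurableSet {q : HPt | q.2 ∈ D.yRange} from
        measurable_snd (measurableSet_yRange D))]
      congr 1
      ext q
      exact ⟨fun hq => ⟨hq.2, hq.1, trivial⟩, fun hq => ⟨hq.2.1, hq.1⟩⟩
    rw [e]
    refine (eLpNorm_restrict_eq_of_support_subset fun q hq => ?_).symm
    by_contra hn
    exact hq (z q fun hm => hn (hYD hm))
  refine ⟨S.indicator G, ⟨mF, fun x y => ?_, mF.aestronglyMeasurable, norm ▸ hf.2⟩, ae, fun q => ?_, z,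
    norm⟩
  · have e : G (x + 1, y) = G (x, y) := by simp [hG]
    have : (x + 1, y) ∈ S ↔ (x, y) ∈ S := by
      change _ ∧ (_, G (x + 1, y)) ∈ M ↔ _ ∧ (_, G (x, y)) ∈ M
      rw [e]
    by_cases hm : (x, y) ∈ S
    · rw [indicator_of_mem (this.2 hm), indicator_of_mem hm, e]
    · rw [indicator_of_notMem (mt this.1 hm), indicator_of_notMem hm]
  · by_cases hq : q ∈ S
    · rw [indicator_of_mem hq]
      exact hq.2
    · rw [indicator_of_notMem hq]
      exact h0 _

lemma IsHWeakDeriv.congr_ae {D : HDom} {k : Fin 2} {f f' g g' : HPt → ℝ} (h : IsHWeakDeriv D k f g)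
    (hf : ∀ᵐ q ∂D.hVol, f' q = f q) (hg : ∀ᵐ q ∂D.hVol, g' q = g q) : IsHWeakDeriv D k f' g' := by
  intro φ hφ
  have e1 : ∫ q, f' q * pd (hDir k) φ q ∂D.hVol = ∫ q, f q * pd (hDir k) φ q ∂D.hVol :=
    integral_congr_ae (by filter_upwards [hf] with q hq; rw [hq])
  have e2 : ∫ q, g' q * φ q ∂D.hVol = ∫ q, g q * φ q ∂D.hVol :=
    integral_congr_ae (by filter_upwards [hg] with q hq; rw [hq])
  rw [e1, e2, h φ hφ]

lemma zonal_mean_congr {D : HDom} {f f' : HPt → ℝ} (h : ∀ᵐ q ∂D.hVol, f q = f' q)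
    (h0 : ∀ᵐ y ∂volume.restrict D.yRange, ∫ x in 𝕀, f' (x, y) = 0)
    (hf : ∀ q : HPt, q.2 ∉ D.yRange → f q = 0) :
    ∀ᵐ y, ∫ x in 𝕀, f (x, y) = 0 := by
  have e : D.hVol = (volume.restrict 𝕀).prod (volume.restrict D.yRange) :=
    (Measure.prod_restrict _ _).symm
  rw [e] at h
  have h1 := Measure.ae_ae_of_ae_prod (Measure.measurePreserving_swap.quasiMeasurePreserving.ae h)
  have : ∀ᵐ y ∂volume.restrict D.yRange, ∫ x in 𝕀, f (x, y) = 0 := by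
    filter_upwards [h0, h1] with y hy hy1
    exact (integral_congr_ae hy1).trans hy
  filter_upwards [(ae_restrict_iff' (measurableSet_yRange D)).1 this] with y hy
  by_cases hm : y ∈ D.yRange
  · exact hy hm
  · simp [hf (_, y) hm]

lemma exists_windData {D : HDom} {σ : VF₁} {dσ : VF₂}
    {ddσ : VF₃} (H : IsWindStress D σ dσ ddσ) {Y : Set ℝ}
    (hY : MeasurableSet Y) (hYD : Y ⊆ D.yRange) (z0 : ∀ i, ∀ᵐ q ∂D.hVol, q.2 ∉ Y → σ i q = 0)
    (z1 : ∀ i k, ∀ᵐ q ∂D.hVol, q.2 ∉ Y → dσ i k q = 0)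
    (z2 : ∀ i k l, ∀ᵐ q ∂D.hVol, q.2 ∉ Y → ddσ i k l q = 0)
    (tr : ∀ (k : Fin 2) (f g : HPt → ℝ), (∀ q : HPt, q.2 ∉ Y → f q = 0) →
      (∀ q : HPt, q.2 ∉ Y → g q = 0) → IsHWeakDeriv D k f g → IsHWeakDeriv .channel k f g) :
    ∃ s ds dds A, WindData s ds dds A ∧ (∀ i, ∀ᵐ q ∂D.hVol, s i q = σ i q) ∧
      normH1 .channel s ds = normH1 D σ dσ ∧ normH2 .channel s ds dds = normH2 D σ dσ ddσ ∧
      (∀ i, ∀ q : HPt, q.2 ∉ Y → s i q = 0) ∧ (∀ i k, ∀ q : HPt, q.2 ∉ Y → ds i k q = 0) ∧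
      ∀ i k l, ∀ q : HPt, q.2 ∉ Y → dds i k l q = 0 := by
  obtain ⟨C, hC⟩ := H.quadratic
  choose s gs es ms zs ns using fun i => exists_hGood_rep (H.isH2 i).memLp hY hYD (z0 i)
    (M := {p | |p.2| ≤ |C| * p.1 ^ 2}) (measurableSet_le (by fun_prop) (by fun_prop))
    (fun y => by simp; positivity) (by
      filter_upwards [hC i] with q hq
      exact hq.1.trans (mul_le_mul_of_nonneg_right (le_abs_self C) (sq_nonneg _)))
  choose ds gd ed md zd nd using fun i k => exists_hGood_rep ((H.isH2 i).memLp_d k) hY hYD (z1 i k)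
    (M := {p | 1 < |p.1|} ∪ {p | |p.2| ≤ |C| * |p.1|}) ((measurableSet_lt (by fun_prop)
      (by fun_prop)).union (measurableSet_le (by fun_prop) (by fun_prop))) (fun y => Or.inr (by simp; positivity)) (by
      filter_upwards [hC i] with q hq
      refine or_iff_not_imp_left.2 fun h1 => ?_
      have h1 : |q.2| ≤ 1 := not_lt.1 h1
      have h2 : C * |q.2| ≤ |C| * |q.2| := mul_le_mul_of_nonneg_right (le_abs_self C) (abs_nonneg _)
      fin_cases k
      · refine hq.2.1.trans ((mul_le_mul_of_nonneg_right (le_abs_self C) (sq_nonneg _)).trans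
          (mul_le_mul_of_nonneg_left ?_ (abs_nonneg C)))
        rw [← sq_abs]
        nlinarith [abs_nonneg q.2]
      · exact hq.2.2.trans h2)
  choose dds gdd edd _ zdd ndd using fun i k l => exists_hGood_rep ((H.isH2 i).memLp_dd k l) hY hYD
    (z2 i k l) (M := univ) MeasurableSet.univ (fun _ => trivial) (by simp)
  refine ⟨s, ds, dds, |C|, ⟨gs, gd, gdd, fun i k => tr _ _ _ (zs i) (zd i k)
    (((H.isH2 i).weak_d k).congr_ae (es i) (ed i k)), fun i k l => tr _ _ _ (zd i k) (zdd i k l)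
    (((H.isH2 i).weak_dd k l).congr_ae (ed i k) (edd i k l)), fun i q _ => ms i q,
    fun i k q hq => (md i k q).resolve_left (not_lt.2 hq), zonal_mean_congr (es 0) H.zonal_mean
    fun q hq => zs 0 q fun hm => hq (hYD hm)⟩, es, ?_, ?_, zs, zd, zdd⟩
  · simp only [normH1, ns, nd]
  · simp only [normH2, ns, nd, ndd]

/-! ### Coriolis factors -/

lemma eq_zero_of_isEquivalent {b : ℝ → ℝ} {β : ℝ} (hc : ContinuousAt b 0)
    (h : b ~[𝓝 0] fun y => β * y) : b 0 = 0 := by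
  have : Tendsto (fun y : ℝ => β * y) (𝓝 0) (𝓝 0) := by
    simpa using (continuous_const_mul β).tendsto (0 : ℝ)
  exact tendsto_nhds_unique hc.tendsto (h.symm.tendsto_nhds this)

lemma IsCoriolisChannel.exists_coreB {b : ℝ → ℝ} (h : IsCoriolisChannel b) :
    ∃ c L, CoreB b c L := by
  obtain ⟨L, hL⟩ := h.lipschitz_deriv
  obtain ⟨c, hc, hb⟩ := h.deriv_bounds
  obtain ⟨β, -, he⟩ := h.equivalent
  exact ⟨max c 2, L, le_max_right _ _, L.2, h.differentiable,
    eq_zero_of_isEquivalent h.differentiable.continuous.continuousAt he,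
    fun y => (inv_anti₀ hc (le_max_left _ _)).trans (hb y).1, fun y => (hb y).2.trans (le_max_left _ _),
    fun y y' => by simpa [Real.dist_eq] using hL.dist_le_mul y y'⟩

lemma IsCoriolisTorus.exists_coreB {b : ℝ → ℝ} (h : IsCoriolisTorus b) {a : ℝ}
    (ha : a ∈ Ioo (0 : ℝ) (1 / 2)) : ∃ b' c L, CoreB b' c L ∧ ∀ y, |y| ≤ a → b y = b' y := by
  obtain ⟨L, hL⟩ := h.lipschitz_deriv a ha
  obtain ⟨c, hc, hb⟩ := h.deriv_bounds a ha
  obtain ⟨β, -, he⟩ := h.equivalent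
  have hd : ∀ y, |y| ≤ a → DifferentiableAt ℝ b y := fun y hy =>
    (h.differentiable y ⟨by linarith [ha.2, (abs_le.1 hy).1], by linarith [ha.2, (abs_le.1 hy).2]⟩).differentiableAt
      (isOpen_Ioo.mem_nhds ⟨by linarith [ha.2, (abs_le.1 hy).1], by linarith [ha.2, (abs_le.1 hy).2]⟩)
  have hb0 : b 0 = 0 := eq_zero_of_isEquivalent (hd 0 (by simpa using ha.1.le)).continuousAt he
  have hle : -a ≤ a := by linarith [ha.1]
  set D : ℝ → ℝ := fun y => deriv b (Set.projIcc (-a) a hle y)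
  have hD : ∀ y y', |D y - D y'| ≤ L * |y - y'| := fun y y' => by
    have := hL.dist_le_mul _ (Set.projIcc (-a) a hle y).2 _ (Set.projIcc (-a) a hle y').2
    rw [Real.dist_eq, Real.dist_eq] at this
    exact this.trans (mul_le_mul_of_nonneg_left (Set.abs_projIcc_sub_projIcc hle) L.2)
  have cD : Continuous D := (LipschitzWith.of_dist_le_mul (K := L) fun y y' => hD y y').continuous
  have dB : ∀ y, HasDerivAt (fun y => ∫ t in (0 : ℝ)..y, D t) (D y) y := fun y =>
    intervalIntegral.integral_hasDerivAt_right (cD.intervalIntegrable _ _)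
      (cD.stronglyMeasurableAtFilter _ _) cD.continuousAt
  have eD := fun y => (dB y).deriv
  refine ⟨fun y => ∫ t in (0 : ℝ)..y, D t, max c 2, L, ⟨le_max_right _ _, L.2,
    fun y => (dB y).differentiableAt, by simp, fun y => ?_, fun y => ?_, fun y y' => ?_⟩, fun y hy => ?_⟩
  · rw [eD]
    exact (inv_anti₀ hc (le_max_left _ _)).trans (hb _ (Set.projIcc (-a) a hle y).2).1
  · rw [eD]
    exact (hb _ (Set.projIcc (-a) a hle y).2).2.trans (le_max_left _ _)
  · rw [eD, eD]
    exact hD y y'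
  · have := intervalIntegral.integral_eq_sub_of_hasDerivAt (f := b) (f' := D) (a := 0) (b := y)
      (fun t ht => ?_) (cD.intervalIntegrable _ _)
    · simp only [this, hb0, sub_zero]
    · have h1 : |t| ≤ |y| := by simpa using Set.abs_sub_left_of_mem_uIcc ht
      have h2 := h1.trans hy
      have : D t = deriv b t := by
        simp only [D, Set.projIcc_of_mem hle (abs_le.1 h2)]
      rw [this]
      exact (hd t h2).hasDerivAt

/-! ### The approximate stationary solutions -/

lemma exists_channel {b : ℝ → ℝ} (hb : IsCoriolisChannel b) : ∃ C : ℝ≥0,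
    ∀ (σ : VF₁) (dσ : VF₂) (ddσ : VF₃)
      (νh : ℝ → ℝ), IsWindStress .channel σ dσ ddσ → (∀ ε : ℝ, 0 < ε → 0 < νh ε) →
      νh =o[𝓝[>] 0] (fun ε : ℝ => ε) →
      ∃ (uBL uint : ℝ → UF₁) (p : ℝ → Pt → ℝ) (r₁ : ℝ → UF₁)
        (r₂ : ℝ → Fin 3 → testSpace .channel →ₗ[ℝ] ℝ),
        IsApproxStationary .channel b σ dσ ddσ νh C uBL uint p r₁ r₂ := by
  obtain ⟨c, L, core⟩ := hb.exists_coreB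
  obtain ⟨K, hK, trunc⟩ := exists_trunc
  have hK0 : 0 ≤ K := zero_le_one.trans hK
  refine ⟨3 * mainConst c L K, fun σ dσ ddσ νh H hν ho => ?_⟩
  obtain ⟨s, ds, dds, A, w, es, n1, n2, -⟩ := exists_windData H MeasurableSet.univ subset_rfl
    (fun _ => by simp) (fun _ _ => by simp) (fun _ _ _ => by simp) fun _ _ _ _ _ h => h
  have hN := (ENNReal.ofReal_toReal w.normH2_lt_top.ne).symm
  obtain ⟨τ, κ, K', hτ, hκ, ev⟩ := eventually_fields core w ENNReal.toReal_nonneg hN hK0 hν ho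
    (S := fun _ => True) fun η hη => by
      obtain ⟨r, t, dt, ddt, ht⟩ := trunc s ds dds A _ w ENNReal.toReal_nonneg hN η hη
      exact ⟨r, t, dt, ddt, trivial, ht⟩
  refine exists_isApproxStationary hb.differentiable.continuous.measurable (fun R => ?_) hν
    (core.mainConst_pos hK0) hτ hκ (K := K') ?_
  · obtain ⟨C, hC⟩ := (isCompact_Icc (a := -R) (b := R)).exists_bound_of_continuousOn
      hb.differentiable.continuous.continuousOn
    exact ⟨C, fun q _ hq => hC _ (abs_le.1 hq)⟩
  · filter_upwards [ev] with ε hε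
    obtain ⟨uBL, uint, p, gBL, gint, gp, h, r, st, bc, fb, -⟩ := hε
    exact ⟨uBL, uint, p, gBL, gint, gp, h, r, st, st.boundaryConditions (bc.congr es), n1 ▸ n2 ▸ fb⟩

lemma exists_torus {b : ℝ → ℝ} (hb : IsCoriolisTorus b) {d : ℝ} (hd : 0 < d) : ∃ C : ℝ≥0,
    ∀ (σ : VF₁) (dσ : VF₂) (ddσ : VF₃)
      (νh : ℝ → ℝ), IsWindStress .torus σ dσ ddσ →
      (∀ i, ∀ᵐ q ∂HDom.torus.hVol, 1 / 2 - d < |q.2| → σ i q = 0) →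
      (∀ ε : ℝ, 0 < ε → 0 < νh ε) → νh =o[𝓝[>] 0] (fun ε : ℝ => ε) →
      ∃ (uBL uint : ℝ → UF₁) (p : ℝ → Pt → ℝ) (r₁ : ℝ → UF₁)
        (r₂ : ℝ → Fin 3 → testSpace .torus →ₗ[ℝ] ℝ),
        IsApproxStationary .torus b σ dσ ddσ νh C uBL uint p r₁ r₂ := by
  set a : ℝ := max (1 / 2 - d) (1 / 4) with ha
  have a1 : 1 / 2 - d ≤ a := le_max_left _ _
  have a0 : 1 / 4 ≤ a := le_max_right _ _
  have a2 : a < 1 / 2 := max_lt (by linarith) (by norm_num)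
  obtain ⟨b', c, L, core, hbb⟩ := hb.exists_coreB (a := (a + 1 / 2) / 2) ⟨by linarith, by linarith⟩
  refine ⟨3 * mainConst c L 1, fun σ dσ ddσ νh H hz hν ho => ?_⟩
  have out : ∀ {y : ℝ}, y ∉ Icc (-a) a ↔ a < |y| := fun {y} => by
    rw [Set.mem_Icc, ← abs_le, not_le]
  have z0 : ∀ i, ∀ᵐ q ∂HDom.torus.hVol, a < |q.2| → σ i q = 0 := fun i => by
    filter_upwards [hz i] with q hq h using hq (a1.trans_lt h)
  have z1 := fun i k => ((H.isH2 i).weak_d k).ae_eq_zero ((H.isH2 i).memLp_d k) (z0 i)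
  have z2 := fun i k l => ((H.isH2 i).weak_dd k l).ae_eq_zero ((H.isH2 i).memLp_dd k l) (z1 i k)
  simp only [← out] at z0 z1 z2
  obtain ⟨s, ds, dds, A, w, es, n1, n2, y0, y1, y2⟩ := exists_windData H (Y := Icc (-a) a)
    measurableSet_Icc (fun y hy => ⟨by linarith [hy.1], by linarith [hy.2]⟩) z0 z1 z2
    fun k f g hf hg h => h.to_channel a2 (fun q hq => hf q (out.2 hq)) fun q hq => hg q (out.2 hq)
  simp only [out] at y0 y1 y2
  have hs : ∀ r, a ≤ r → ∀ i, H2Supp r (s i) (ds i) (dds i) := fun r hr i =>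
    ⟨fun q hq => y0 i q (hr.trans_lt hq), fun k q hq => y1 i k q (hr.trans_lt hq),
      fun k l q hq => y2 i k l q (hr.trans_lt hq)⟩
  have hN := (ENNReal.ofReal_toReal w.normH2_lt_top.ne).symm
  have m1 := hN ▸ normH1_le_normH2 .channel s ds dds
  obtain ⟨τ, κ, K', hτ, hκ, ev⟩ := eventually_fields core w ENNReal.toReal_nonneg hN zero_le_one hν ho
    (S := fun r => r = a) fun η hη => ⟨a, s, ds, dds, rfl, w.h2Fun, hs a le_rfl, w.mean,
      by simpa only [one_mul] using fun i => (le_normH1 _ s ds i 0).1.trans m1,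
      by simpa only [one_mul] using fun i k => (le_normH1 _ s ds i k).2.trans m1,
      by simpa only [one_mul] using fun i k l => hN ▸ le_normH2 _ s ds dds i k l, fun i => by simp⟩
  refine exists_isApproxStationary hb.measurable (fun R => ?_) hν (core.mainConst_pos zero_le_one) hτ hκ
    (K := K') ?_
  · obtain ⟨B, hB⟩ := hb.bounded
    exact ⟨B, fun q hq _ => hB _ hq.2.1⟩
  · have e0 : ∀ᶠ ε : ℝ in 𝓝[>] 0, √ε ≤ (1 / 2 - a) / 2 := by
      have : Tendsto (fun ε : ℝ => √ε) (𝓝[>] 0) (𝓝 0) := by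
        simpa using (Real.continuous_sqrt.tendsto 0).mono_left nhdsWithin_le_nhds
      exact this.eventually (ge_mem_nhds (by linarith))
    filter_upwards [ev, e0] with ε hε hε2
    obtain ⟨uBL, uint, p, gBL, gint, gp, h, r, st, bc, fb, R, δ, rfl, δ0, δ1, hsupp⟩ := hε
    obtain ⟨l1, l2, l3, l4, l5, l6, l7⟩ := hsupp (hs _ (by linarith))
    have st' := st.to_torus (a := a + δ) (b' := b) (by linarith) (fun y hy => hbb y (by linarith))
      l1 l2 l3 l4 l5 l6 l7
    exact ⟨uBL, uint, p, gBL, gint, gp, h, r, st', st'.boundaryConditions (bc.to_torus.congr es),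
      fb.to_torus (by rw [n1]) (by rw [n2]) (by rw [n1]; exact id)⟩

end

theorem theorem1 :
    (∀ b : ℝ → ℝ, IsCoriolisChannel b →
      ∃ C : ℝ≥0, ∀ (σ : Fin 2 → HPt → ℝ) (dσ : Fin 2 → Fin 2 → HPt → ℝ)
        (ddσ : Fin 2 → Fin 2 → Fin 2 → HPt → ℝ) (νh : ℝ → ℝ),
        IsWindStress .channel σ dσ ddσ → IsW2Infty .channel σ dσ ddσ →
        (∀ ε : ℝ, 0 < ε → 0 < νh ε) → νh =o[𝓝[>] 0] (fun ε : ℝ => ε) →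
        ∃ (uBL uint : ℝ → Fin 3 → Pt → ℝ) (p : ℝ → Pt → ℝ) (r₁ : ℝ → Fin 3 → Pt → ℝ)
          (r₂ : ℝ → Fin 3 → testSpace .channel →ₗ[ℝ] ℝ),
          IsApproxStationary .channel b σ dσ ddσ νh C uBL uint p r₁ r₂) ∧
    (∀ b : ℝ → ℝ, IsCoriolisTorus b → ∀ d : ℝ, 0 < d →
      ∃ C : ℝ≥0, ∀ (σ : Fin 2 → HPt → ℝ) (dσ : Fin 2 → Fin 2 → HPt → ℝ)
        (ddσ : Fin 2 → Fin 2 → Fin 2 → HPt → ℝ) (νh : ℝ → ℝ),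
        IsWindStress .torus σ dσ ddσ →
        (∀ i, ∀ᵐ q ∂HDom.torus.hVol, 1 / 2 - d < |q.2| → σ i q = 0) →
        (∀ ε : ℝ, 0 < ε → 0 < νh ε) → νh =o[𝓝[>] 0] (fun ε : ℝ => ε) →
        ∃ (uBL uint : ℝ → Fin 3 → Pt → ℝ) (p : ℝ → Pt → ℝ) (r₁ : ℝ → Fin 3 → Pt → ℝ)
          (r₂ : ℝ → Fin 3 → testSpace .torus →ₗ[ℝ] ℝ),
          IsApproxStationary .torus b σ dσ ddσ νh C uBL uint p r₁ r₂) := by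
  exact ⟨fun b hb => (exists_channel hb).imp fun C h σ dσ ddσ νh H _ => h σ dσ ddσ νh H,
    fun b hb d hd => exists_torus hb hd⟩
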